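/- **Setting.** A private quantum coin scheme $\mathsf{Pr\text{-}QC}$ consists, for each security parameter $\lambda$, of a probability distribution $\mathsf{key\text{-}gen}(1^\lambda)$ on keys, a pure state $|\psi_{sk}\rangle$ (the private coin) on $\ell(\lambda)$ qubits returned by every call of $\mathsf{mint}(sk)$, and a verification $\mathsf{Verify}(sk,\cdot)$ that accepts or rejects without returning the measured state. It need not be efficient. It has perfect completeness if, for every $\lambda$, a minted coin is accepted with probability $1$. Verification is a rank-1 projective measurement if it is a measurement $\{V_{sk},I-V_{sk}\}$ with $V_{sk}$ an orthogonal projection of rank 1, where $V_{sk}$ is the accepting outcome. **The scheme $\mathsf{Pk\text{-}QC}$.** Let $\kappa:\mathbb N\to\mathbb N$ satisfy $\kappa(\lambda)=\Theta(\log(\lambda)^c)$ for a constant $c>1$. $\mathsf{Pk\text{-}QC}$ has the same $\mathsf{key\text{-}gen}$; its coin is $|\psi_{sk}\rangle^{\otimes\kappa}$. Public counting $\mathsf{Count}(\rho_1,\dots,\rho_m)$: a wallet is initialized with one fresh public coin; for $t=1,\dots,m$ the coin $\rho_t$ is added to the wallet and the wallet, now consisting of $(t+1)\kappa$ registers, is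 measured with $\{\Pi_{\mathrm{Sym}},I-\Pi_{\mathrm{Sym}}\}$, where $\Pi_{\mathrm{Sym}}$ is the orthogonal projection onto the symmetric subspace of these registers; the post-measurement state is the new wallet, $\rho_t$ is accepted on outcome $\Pi_{\mathrm{Sym}}$, and the number of accepted coins is output. Private verification $\mathsf{Verify}_{bank}(sk,\rho)$: $\mathsf{Pr\text{-}QC}.\mathsf{Verify}(sk,\cdot)$ is applied to each of the $\kappa$ registers, the registers are destroyed, and if $j$ of them were accepted then $\rho$ is accepted with probability $j/\kappa$. **The game.** For a scheme $\mathcal M$, a key $sk\leftarrow\mathsf{key\text{-}gen}(1^\lambda)$ is drawn, and the adversary $\mathcal A$, given $\lambda$ and the size of a money state, has oracle access to $\mathsf{mint}(sk)$ and to the private verification $\mathsf{Verify}_{sk}$ (which returns only the decision; for $\mathcal M=\mathsf{Pr\text{-}QC}$ there is no such oracle). It submits, one after another, to $k$ verifiers: to the $i$-th verifier it submits $m_i$ possibly entangled alleged money states and learns the number $m_i'$ of accepted ones, as determined by the counting procedure, which for $\mathsf{Pk\text{-}QC}$ is the public one, with a new wallet for each verifier, and for $\mathsf{Pr\text{-}QC}$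 applies $\mathsf{Verify}(sk,\cdot)$ to each submitted coin. $\mathcal A$ may be adaptive. Let $n$ be the number of calls of $\mathsf{mint}(sk)$ and $n'$ the number of acceptances by $\mathsf{Verify}_{sk}$ ($n'=0$ for $\mathsf{Pr\text{-}QC}$). Put $$U_{\mathrm{flex}}=\sum_{i=1}^k m_i'+n'-n,\qquad U_{\mathrm{aon}}=\sum_{i=1}^k U_i+n'-n,\quad U_i=m_i\text{ if }m_i=m_i',\ U_i=0\text{ otherwise}.$$ $\mathcal M$ is *multiverifier-nonadaptive-unforgeable* if for every quantum polynomial-time $\mathcal A$ there is a negligible function $\varepsilon$ with $\Pr[U_{\mathrm{flex}}>0]\le\varepsilon(\lambda)$ for all $\lambda$, and *multiverifier-nonadaptive-rationally-unforgeable* if for every quantum polynomial-time $\mathcal A$ there is a negligible $\varepsilon$ with $\mathbb E[U_{\mathrm{aon}}]\le\varepsilon(\lambda)$ for all $\lambda$. The *unconditional* versions quantify instead over all adversaries with unlimited computational power whose numbers of oracle calls, of verifiers and of submitted money states are bounded by a polynomial in $\lambda$. (A quantum polynomial-time adversary is a uniform one: a single program of a quantum random access machine that runs, with probability one, in time polynomial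 in $\lambda$. The machine has classical variables holding natural numbers with addition and subtraction, branching and loops, the gates $X,H,T$, CNOT and Toffoli, the real one-qubit rotations taking $|0\rangle$ to $\sqrt{p/(p+q)}\,|0\rangle+\sqrt{q/(p+q)}\,|1\rangle$ where $p,q$ are values of classical variables, and computational-basis measurements; every instruction costs one step, and handing over or receiving money states costs at least one step per qubit.) **Proposition.** Let $\mathsf{Pr\text{-}QC}$ be a private quantum coin scheme with perfect completeness whose verification is a rank-1 projective measurement, and let $\mathsf{Pk\text{-}QC}$ be built from it as above. 1. If $\kappa$ is computable from $\lambda$ in time polynomial in $\lambda$ and $\mathsf{Pr\text{-}QC}$ is multiverifier-nonadaptive-unforgeable, then $\mathsf{Pk\text{-}QC}$ is multiverifier-nonadaptive-rationally-unforgeable. 2. If $\mathsf{Pr\text{-}QC}$ is unconditionally multiverifier-nonadaptive-unforgeable, then $\mathsf{Pk\text{-}QC}$ is unconditionally multiverifier-nonadaptive-rationally-unforgeable. -/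

import Mathlib

open MeasureTheory Filter Asymptotics

noncomputable section

namespace QMoney

/-! ### Qubits, configurations and state vectors

A qubit location is either a cell `(bank, address)` of the adversary's memory, or a cell
`(call, coin, register, qubit)` that was handed over to the environment (banks, verifiers,
discarded qubits) in the oracle call with number `call`. -/

abbrev Loc := (ℕ × ℕ) ⊕ (ℕ × ℕ × ℕ × ℕ)

/-- A computational basis state of the countably many qubits: the finite set of the qubits that
are in state `1`. -/
abbrev Config := Finset Loc

/-- A (possibly unnormalised) pure state of the memory: a finite superposition of basis states. -/
abbrev Vec := Config →₀ ℂ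

/-- The squared norm; for the unnormalised state of a branch it is the probability of the branch. -/
def normSq (v : Vec) : ℝ := v.sum fun _ z => ‖z‖ ^ 2

def readBits {ι : Type} (L : ι → Loc) (s : Config) : ι → Bool := fun i => decide (L i ∈ s)

def writeBits {ι : Type} [Fintype ι] (L : ι → Loc) (b : ι → Bool) (s : Config) : Config :=
  (s \ Finset.univ.image L) ∪ (Finset.univ.filter fun i => b i = true).image L

/-- Apply the operator `K`, which takes the qubits at `Lin` as input and leaves its output at the
locations `Lout`; input locations that are not output locations are left in state `0`. -/
def applyOp {ι ι' : Type} [Fintype ι] [Fintype ι'] [DecidableEq ι']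
    (Lin : ι → Loc) (Lout : ι' → Loc) (K : Matrix (ι' → Bool) (ι → Bool) ℂ) (v : Vec) : Vec :=
  v.sum fun s z => ∑ b : ι' → Bool,
    Finsupp.single (writeBits Lout b (writeBits Lin (fun _ => false) s)) (K b (readBits Lin s) * z)

/-! ### Registers

`Slots m r ℓ` indexes the qubits of `m` money states, each of which consists of `r` registers of
`ℓ` qubits. -/

abbrev Slots (m r ℓ : ℕ) := (Fin m × Fin r) × Fin ℓ

/-- One branch of a measurement of `m` money states: the classical outcome, and the Kraus operator
from the measured qubits to the qubits of the `kept` money states that are kept afterwards. -/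
structure KrausOp (m r ℓ : ℕ) where
  outcome : ℕ
  kept : ℕ
  op : Matrix (Slots kept r ℓ → Bool) (Slots m r ℓ → Bool) ℂ

/-- The oracles of a money scheme for a fixed key: the minted state, the counting procedure of a
verifier on `m` submitted money states (outcome: the number of accepted ones), and the private
verification of one money state (outcome `1` is acceptance). -/
structure Oracles (r ℓ : ℕ) where
  coin : (Slots 1 r ℓ → Bool) → ℂ
  count : (m : ℕ) → Multiset (KrausOp m r ℓ)
  verifySk : Multiset (KrausOp 1 r ℓ)

/-! ### Adversaries: programs of a quantum random access machine -/

inductive Gate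
  | x | h | t

def Gate.matrix : Gate → Matrix (Fin 1 → Bool) (Fin 1 → Bool) ℂ
  | .x => fun a b => if a 0 = !(b 0) then 1 else 0
  | .h => fun a b => ((1 / Real.sqrt 2 : ℝ) : ℂ) * (if a 0 && b 0 then -1 else 1)
  | .t => fun a b => if a 0 = b 0 then
      (if b 0 then Complex.exp (Complex.I * (Real.pi / 4 : ℝ)) else 1) else 0

def cnotMatrix : Matrix (Fin 2 → Bool) (Fin 2 → Bool) ℂ := fun a b =>
  if a = ![b 0, xor (b 1) (b 0)] then 1 else 0

def toffoliMatrix : Matrix (Fin 3 → Bool) (Fin 3 → Bool) ℂ := fun a b =>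
  if a = ![b 0, b 1, xor (b 2) (b 0 && b 1)] then 1 else 0

/-- The real rotation of a qubit that maps `|0⟩` to `√(p/(p+q)) |0⟩ + √(q/(p+q)) |1⟩`. -/
def rotMatrix (p q : ℕ) : Matrix (Fin 1 → Bool) (Fin 1 → Bool) ℂ := fun a b =>
  let θ : ℝ := Real.arccos (Real.sqrt ((p : ℝ) / ((p : ℝ) + (q : ℝ))))
  match a 0, b 0 with
  | false, false => (Real.cos θ : ℂ)
  | false, true => (-Real.sin θ : ℂ)
  | true, false => (Real.sin θ : ℂ)
  | true, true => (Real.cos θ : ℂ)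

/-- A reference to a qubit: a memory bank, and the classical variable that holds the address. -/
abbrev QRef := ℕ × ℕ

/-- Programs. Classical variables are numbered by `ℕ` and hold natural numbers. -/
inductive Prog
  | skip
  /-- `x := c` -/
  | const (x c : ℕ)
  /-- `x := y + z` -/
  | add (x y z : ℕ)
  /-- `x := y - z` (truncated) -/
  | sub (x y z : ℕ)
  /-- a gate on a single qubit -/
  | gate (g : Gate) (q : QRef)
  /-- controlled not (without effect if the operands are not distinct qubits) -/
  | cnot (q₁ q₂ : QRef)
  /-- doubly controlled not (without effect if the operands are not distinct qubits) -/
  | toffoli (q₁ q₂ q₃ : QRef)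
  /-- the rotation `rotMatrix` whose parameters are the values of the variables `y` and `z` -/
  | rot (q : QRef) (y z : ℕ)
  /-- measure a qubit in the computational basis and store the outcome in `x` -/
  | measure (x : ℕ) (q : QRef)
  /-- request a money state, delivered to consecutive cells starting at `q` -/
  | mint (q : QRef)
  /-- hand over one money state, starting at `q`, for private verification; answer stored in `x` -/
  | verify (x : ℕ) (q : QRef)
  /-- submit to a new verifier as many alleged money states as the variable `y` says, starting at
  `q`; the number of accepted ones is stored in `x` -/
  | submit (x : ℕ) (q : QRef) (y : ℕ)
  | seq (P Q : Prog)
  /-- `if x = 0 then P else Q` -/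
  | ite (x : ℕ) (P Q : Prog)
  /-- execute `P` as many times as the value of `x` at the beginning says -/
  | loop (x : ℕ) (P : Prog)
  /-- not elementary: `x := f`, for an arbitrary function of all the classical variables -/
  | compute (x : ℕ) (f : (ℕ → ℕ) → ℕ)
  /-- not elementary: an arbitrary unitary on any finite number of cells of the memory, which may
  depend on the classical variables -/
  | unitary (k : ℕ) (L : Fin k ↪ ℕ × ℕ) (U : (ℕ → ℕ) → Matrix.unitaryGroup (Fin k → Bool) ℂ)

/-- Programs of an efficient machine: elementary instructions only. -/
def Prog.Elementary : Prog → Prop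
  | .seq P Q => P.Elementary ∧ Q.Elementary
  | .ite _ P Q => P.Elementary ∧ Q.Elementary
  | .loop _ P => P.Elementary
  | .compute _ _ => False
  | .unitary _ _ _ => False
  | _ => True

/-- Elementary programs without quantum instructions and without oracle calls. -/
def Prog.Classical : Prog → Prop
  | .skip => True
  | .const _ _ => True
  | .add _ _ _ => True
  | .sub _ _ _ => True
  | .seq P Q => P.Classical ∧ Q.Classical
  | .ite _ P Q => P.Classical ∧ Q.Classical
  | .loop _ P => P.Classical
  | _ => False

/-- The state of one branch of a run. -/
structure State where
  /-- the classical variables -/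
  store : ℕ → ℕ
  /-- the unnormalised quantum state -/
  vec : Vec
  /-- the number of elementary steps so far -/
  time : ℕ
  /-- the number of money states requested, sent to the private verification or submitted to
  verifiers, plus the number of verifiers addressed -/
  queries : ℕ
  /-- the number of oracle calls so far, used to name fresh environment qubits -/
  calls : ℕ
  /-- the number `n` of calls of the minting oracle -/
  minted : ℕ
  /-- the number `n'` of acceptances by the private verification oracle -/
  accepted : ℕ
  /-- the pairs `(mᵢ, m'ᵢ)`, for the verifiers addressed: numbers of submitted and of accepted
  money states -/
  submitted : List (ℕ × ℕ)

def State.tick (s : State) (c : ℕ) : State := { s with time := s.time + c }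

def State.assign (s : State) (x c : ℕ) : State := { s with store := Function.update s.store x c }

/-- The probability of the branch. -/
def State.prob (s : State) : ℝ := normSq s.vec

/-- The memory cell a qubit reference points to. -/
def State.loc (s : State) (q : QRef) : Loc := Sum.inl (q.1, s.store q.2)

/-- The consecutive memory cells, starting at `q`, of `m` money states. -/
def State.block (s : State) (q : QRef) (m r ℓ : ℕ) : Slots m r ℓ → Loc := fun i =>
  Sum.inl (q.1, s.store q.2 + ((i.1.1 * r + i.1.2) * ℓ + i.2))

/-- Environment qubits, fresh for the current oracle call. -/
def State.fresh (s : State) (m r ℓ : ℕ) : Slots m r ℓ → Loc := fun i =>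
  Sum.inr (s.calls, i.1.1, i.1.2, i.2)

open Classical in
/-- Apply an operator to the qubits at the given places, if these are distinct. -/
def State.act (s : State) {k : ℕ} (L : Fin k → Loc)
    (U : Matrix (Fin k → Bool) (Fin k → Bool) ℂ) : State :=
  { s with vec := if Function.Injective L then applyOp L L U s.vec else s.vec }

/-- The branch of outcome `b` of a measurement in the computational basis. -/
def State.project (s : State) (l : Loc) (b : Bool) : State :=
  { s with vec := s.vec.filter fun c => decide (l ∈ c) = b }

section Exec

variable {r ℓ : ℕ} (O : Oracles r ℓ)

/-- The former contents of the target cells are discarded, and a fresh money state is put there. -/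
def State.doMint (s : State) (q : QRef) : State :=
  { s with
    vec := applyOp (Fin.elim0 : Fin 0 → Loc) (s.block q 1 r ℓ) (fun b _ => O.coin b)
      (applyOp (s.block q 1 r ℓ) (s.fresh 1 r ℓ) 1 s.vec)
    time := s.time + (r * ℓ + 1)
    queries := s.queries + 1
    calls := s.calls + 1
    minted := s.minted + 1 }

def State.doVerify (s : State) (x : ℕ) (q : QRef) (K : KrausOp 1 r ℓ) : State :=
  { s with
    store := Function.update s.store x K.outcome
    vec := applyOp (s.block q 1 r ℓ) (s.fresh K.kept r ℓ) K.op s.vec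
    time := s.time + (r * ℓ + 1)
    queries := s.queries + 1
    calls := s.calls + 1
    accepted := if K.outcome = 1 then s.accepted + 1 else s.accepted }

def State.doSubmit (s : State) (x : ℕ) (q : QRef) (m : ℕ) (K : KrausOp m r ℓ) : State :=
  { s with
    store := Function.update s.store x K.outcome
    vec := applyOp (s.block q m r ℓ) (s.fresh K.kept r ℓ) K.op s.vec
    time := s.time + (m * (r * ℓ + 1) + 1)
    queries := s.queries + (m + 1)
    calls := s.calls + 1
    submitted := s.submitted ++ [(m, K.outcome)] }

/-- The branches at the end of a run of a program. -/
def exec : Prog → State → Multiset State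
  | .skip, s => {s.tick 1}
  | .const x c, s => {(s.assign x c).tick 1}
  | .add x y z, s => {(s.assign x (s.store y + s.store z)).tick 1}
  | .sub x y z, s => {(s.assign x (s.store y - s.store z)).tick 1}
  | .gate g q, s => {(s.act ![s.loc q] g.matrix).tick 1}
  | .cnot q₁ q₂, s => {(s.act ![s.loc q₁, s.loc q₂] cnotMatrix).tick 1}
  | .toffoli q₁ q₂ q₃, s => {(s.act ![s.loc q₁, s.loc q₂, s.loc q₃] toffoliMatrix).tick 1}
  | .rot q y z, s => {(s.act ![s.loc q] (rotMatrix (s.store y) (s.store z))).tick 1}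
  | .measure x q, s => (Finset.univ : Finset Bool).val.map fun b =>
      ((s.project (s.loc q) b).assign x b.toNat).tick 1
  | .mint q, s => {s.doMint O q}
  | .verify x q, s => O.verifySk.map fun K => s.doVerify x q K
  | .submit x q y, s => (O.count (s.store y)).map fun K => s.doSubmit x q (s.store y) K
  | .seq P Q, s => (exec P s).bind fun s' => exec Q s'
  | .ite x P Q, s => if s.store x = 0 then exec P (s.tick 1) else exec Q (s.tick 1)
  | .loop x P, s => (fun M : Multiset State => M.bind fun s' => exec P s')^[s.store x] {s.tick 1}
  | .compute x f, s => {(s.assign x (f s.store)).tick 1}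
  | .unitary _ L U, s =>
      {(s.act (fun i => Sum.inl (L i)) (U s.store : Matrix _ _ ℂ)).tick 1}

end Exec

/-- The beginning of a run: the variables hold the given inputs, all qubits are in state `0`. -/
def State.start (store : ℕ → ℕ) : State where
  store := store
  vec := Finsupp.single ∅ 1
  time := 0
  queries := 0
  calls := 0
  minted := 0
  accepted := 0
  submitted := []

/-- A function that is computed, from the value of its argument in variable `0`, by a classical
program in time polynomial in its argument. (The oracles `O` are not used by such a program.) -/
def PolyTimeComputable (f : ℕ → ℕ) : Prop :=
  ∃ P : Prog, P.Classical ∧ ∃ p : Polynomial ℕ, ∀ (r ℓ : ℕ) (O : Oracles r ℓ) (n : ℕ),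
    ∀ s ∈ exec O P (State.start (Function.update 0 0 n)), s.store 0 = f n ∧ s.time ≤ p.eval n

/-! ### Money schemes and the multiverifier nonadaptive unforgeability game -/

/-- A quantum coin scheme, as seen by the players of the game. The first argument of each field is
the security parameter. A money state consists of `regs n` registers of `qubits n` qubits. -/
structure MoneyScheme where
  Key : ℕ → Type
  mKey : (n : ℕ) → MeasurableSpace (Key n)
  keyGen : (n : ℕ) → @Measure (Key n) (mKey n)
  regs : ℕ → ℕ
  qubits : ℕ → ℕ
  oracles : (n : ℕ) → Key n → Oracles (regs n) (qubits n)

namespace MoneyScheme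

variable (M : MoneyScheme)

instance (n : ℕ) : MeasurableSpace (M.Key n) := M.mKey n

/-- The inputs of an adversary: the security parameter and the size of a money state. -/
def input (n : ℕ) : ℕ → ℕ
  | 0 => n
  | 1 => M.regs n
  | 2 => M.qubits n
  | _ => 0

/-- The branches at the end of the game, for a given security parameter and a given key. -/
def outcomes (A : ℕ → Prog) (n : ℕ) (sk : M.Key n) : Multiset State :=
  exec (M.oracles n sk) (A n) (State.start (M.input n))

/-- Quantum polynomial-time adversaries: a single program of elementary instructions that, almost
surely, halts after a polynomial number of steps. -/
def IsQPA (A : ℕ → Prog) : Prop :=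
  (∃ P : Prog, P.Elementary ∧ ∀ n, A n = P) ∧
  ∃ p : Polynomial ℕ, ∀ n, ∀ᵐ sk ∂M.keyGen n,
    ∀ s ∈ M.outcomes A n sk, s.vec ≠ 0 → s.time ≤ p.eval n

/-- Unbounded adversaries: arbitrary computations, but a polynomial number of queries (and of
verifiers, and of submitted money states). -/
def IsUnbounded (A : ℕ → Prog) : Prop :=
  ∃ p : Polynomial ℕ, ∀ n, ∀ᵐ sk ∂M.keyGen n,
    ∀ s ∈ M.outcomes A n sk, s.vec ≠ 0 → s.queries ≤ p.eval n

/-- The expectation, at the end of the game, of a function of the state. -/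
def expect (A : ℕ → Prog) (n : ℕ) (f : State → ℝ) : ℝ :=
  ∫ sk, ((M.outcomes A n sk).map fun s => s.prob * f s).sum ∂M.keyGen n

end MoneyScheme

/-- The all-or-nothing utility `∑ᵢ Uᵢ + n' - n`, where `Uᵢ = mᵢ` if `mᵢ = m'ᵢ`, and `Uᵢ = 0`
otherwise. -/
def State.allOrNothing (s : State) : ℝ :=
  (s.submitted.map fun q => if q.1 = q.2 then (q.1 : ℝ) else 0).sum + s.accepted - s.minted

/-- The flexible utility `∑ᵢ m'ᵢ + n' - n`. -/
def State.flexible (s : State) : ℝ :=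
  (s.submitted.map fun q => (q.2 : ℝ)).sum + s.accepted - s.minted

def Negligible (ε : ℕ → ℝ) : Prop := SuperpolynomialDecay atTop (fun n : ℕ => (n : ℝ)) ε

namespace MoneyScheme

variable (M : MoneyScheme)

open Classical in
/-- Standard unforgeability against a class of adversaries, with respect to the flexible utility:
a positive utility has negligible probability. -/
def StandardUnforgeable (adv : (ℕ → Prog) → Prop) : Prop :=
  ∀ A, adv A → ∃ ε, Negligible ε ∧
    ∀ n, M.expect A n (fun s => if 0 < s.flexible then 1 else 0) ≤ ε n

/-- Rational unforgeability against a class of adversaries, with respect to the all-or-nothing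
utility: the expected utility is at most negligible. -/
def RationallyUnforgeable (adv : (ℕ → Prog) → Prop) : Prop :=
  ∀ A, adv A → ∃ ε, Negligible ε ∧ ∀ n, M.expect A n State.allOrNothing ≤ ε n

def MultiverifierNonadaptiveUnforgeable : Prop := M.StandardUnforgeable M.IsQPA

def UnconditionallyMultiverifierNonadaptiveUnforgeable : Prop :=
  M.StandardUnforgeable M.IsUnbounded

def MultiverifierNonadaptiveRationallyUnforgeable : Prop := M.RationallyUnforgeable M.IsQPA

def UnconditionallyMultiverifierNonadaptiveRationallyUnforgeable : Prop :=
  M.RationallyUnforgeable M.IsUnbounded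

end MoneyScheme

/-! ### Private quantum coin schemes -/

/-- A private quantum coin scheme (efficient or not) whose verification is a projective
measurement: for the security parameter `n`, a coin has `qubits n` qubits, all coins minted with
the key `sk` are in the pure state `coin n sk`, and verification accepts on the outcome
`verify n sk` of the measurement with the projections `verify n sk` and `1 - verify n sk`. -/
structure PrivateCoinScheme where
  Key : ℕ → Type
  mKey : (n : ℕ) → MeasurableSpace (Key n)
  keyGen : (n : ℕ) → @Measure (Key n) (mKey n)
  isProbabilityMeasure_keyGen : ∀ n, IsProbabilityMeasure (keyGen n)
  qubits : ℕ → ℕ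
  coin : (n : ℕ) → Key n → (Fin (qubits n) → Bool) → ℂ
  coin_normalized : ∀ n sk, ∑ b, ‖coin n sk b‖ ^ 2 = 1
  measurable_coin : ∀ n b, Measurable fun sk => coin n sk b
  verify : (n : ℕ) → Key n → Matrix (Fin (qubits n) → Bool) (Fin (qubits n) → Bool) ℂ
  verify_projection : ∀ n sk, IsStarProjection (verify n sk)
  measurable_verify : ∀ n a b, Measurable fun sk => verify n sk a b

/-- The state of copies of the same coin in the registers indexed by `R`. -/
def copies {R : Type} [Fintype R] {ℓ : ℕ} (φ : (Fin ℓ → Bool) → ℂ) : (R × Fin ℓ → Bool) → ℂ :=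
  fun b => ∏ ρ : R, φ fun i => b (ρ, i)

/-- The registers indexed by `R` are each measured with the projections `V` and `1 - V`; this is
the projection for the outcomes `a` (`true` for `V`). -/
def measureEach {R : Type} [Fintype R] {ℓ : ℕ} (V : Matrix (Fin ℓ → Bool) (Fin ℓ → Bool) ℂ)
    (a : R → Bool) : Matrix (R × Fin ℓ → Bool) (R × Fin ℓ → Bool) ℂ :=
  fun b c => ∏ ρ : R, (if a ρ then V else 1 - V) (fun i => b (ρ, i)) (fun i => c (ρ, i))

/-- The number of accepting outcomes. -/
def numTrue {R : Type} [Fintype R] (a : R → Bool) : ℕ :=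
  (Finset.univ.filter fun ρ => a ρ = true).card

namespace PrivateCoinScheme

variable (S : PrivateCoinScheme)

instance (n : ℕ) : MeasurableSpace (S.Key n) := S.mKey n

/-- Perfect completeness: a minted coin is accepted with probability one. -/
def PerfectlyComplete : Prop :=
  ∀ n, ∀ᵐ sk ∂S.keyGen n, ∑ b, ‖(S.verify n sk).mulVec (S.coin n sk) b‖ ^ 2 = 1

def RankOneVerification : Prop := ∀ n sk, (S.verify n sk).rank = 1

/-- In the game for a private scheme, the verifiers are bank branches that count with the key, and
there is no separate private verification oracle (it only answers `⊥`, represented by `0`). -/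
def toMoneyScheme : MoneyScheme where
  Key := S.Key
  mKey := S.mKey
  keyGen := S.keyGen
  regs := fun _ => 1
  qubits := S.qubits
  oracles := fun n sk =>
    { coin := copies (S.coin n sk)
      count := fun m => (Finset.univ : Finset (Fin m × Fin 1 → Bool)).val.map fun a =>
        { outcome := numTrue a, kept := m, op := measureEach (S.verify n sk) a }
      verifySk := {{ outcome := 0, kept := 1, op := 1 }} }

end PrivateCoinScheme

/-! ### The public coin scheme -/

/-- The states that are symmetric under all permutations of the registers in `T`. -/
def symSubspace {R : Type} (ℓ : ℕ) [Fintype R] [DecidableEq R] (T : Set R) :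
    Submodule ℂ (EuclideanSpace ℂ (R × Fin ℓ → Bool)) where
  carrier := {ψ | ∀ π : Equiv.Perm R, (∀ ρ, ρ ∉ T → π ρ = ρ) →
    ∀ b : R × Fin ℓ → Bool, ψ (fun q => b (π q.1, q.2)) = ψ b}
  add_mem' := by
    intro ψ φ hψ hφ π hπ b
    simp [hψ π hπ b, hφ π hπ b]
  zero_mem' := by
    intro π _ b
    simp
  smul_mem' := by
    intro c ψ hψ π hπ b
    simp [hψ π hπ b]

/-- The orthogonal projection onto the symmetric subspace, as a matrix. -/
def symProj {R : Type} (ℓ : ℕ) [Fintype R] [DecidableEq R] (T : Set R) :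
    Matrix (R × Fin ℓ → Bool) (R × Fin ℓ → Bool) ℂ :=
  fun a b => (symSubspace ℓ T).starProjection (EuclideanSpace.single b 1) a

/-- Put the state `ω` of one public coin in front of `m` submitted ones. -/
def addWallet {r ℓ : ℕ} (m : ℕ) (ω : (Slots 1 r ℓ → Bool) → ℂ) :
    Matrix (Slots (m + 1) r ℓ → Bool) (Slots m r ℓ → Bool) ℂ :=
  fun b a => ω (fun i => b ((0, i.1.2), i.2)) *
    if (fun i : Slots m r ℓ => b ((i.1.1.succ, i.1.2), i.2)) = a then 1 else 0

/-- Verification of the `t`-th submitted coin (`t` starts from `0`; the wallet starts with one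
coin): the measurement of whether the registers of the wallet and of this coin are in the symmetric
subspace. The result is the projection for acceptance (`true`) or rejection (`false`). -/
def walletTest {r ℓ m : ℕ} (t : Fin m) (acc : Bool) :
    Matrix (Slots (m + 1) r ℓ → Bool) (Slots (m + 1) r ℓ → Bool) ℂ :=
  let Sym := symProj ℓ {ρ : Fin (m + 1) × Fin r | (ρ.1 : ℕ) ≤ t + 1}
  if acc then Sym else 1 - Sym

/-- The public counting procedure with the outcomes `a` of the successive verifications: the wallet
is initialised with a fresh coin, and the submitted coins are verified one by one. -/
def publicCountOp {r ℓ m : ℕ} (ω : (Slots 1 r ℓ → Bool) → ℂ) (a : Fin m → Bool) :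
    Matrix (Slots (m + 1) r ℓ → Bool) (Slots m r ℓ → Bool) ℂ :=
  (List.finRange m).foldl (fun K t => walletTest t (a t) * K) (addWallet m ω)

/-- The public coin scheme with private verification built from a private coin scheme: a public
coin is `κ n` private coins; public verification is by comparison with a fresh coin; the private
verification runs the verification of the private scheme on the `κ n` registers and, if `j` of them
are accepted, accepts with probability `j / κ n`. -/
def PkQC (S : PrivateCoinScheme) (κ : ℕ → ℕ) : MoneyScheme where
  Key := S.Key
  mKey := S.mKey
  keyGen := S.keyGen
  regs := κ
  qubits := S.qubits
  oracles := fun n sk =>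
    { coin := copies (S.coin n sk)
      count := fun m => (Finset.univ : Finset (Fin m → Bool)).val.map fun a =>
        { outcome := numTrue a, kept := m + 1, op := publicCountOp (copies (S.coin n sk)) a }
      verifySk := (Finset.univ : Finset ((Fin 1 × Fin (κ n) → Bool) × Bool)).val.map fun q =>
        let pAcc : ℝ := (numTrue q.1 : ℝ) / (κ n : ℝ)
        { outcome := q.2.toNat
          kept := 1
          op := ((Real.sqrt (if q.2 then pAcc else 1 - pAcc) : ℝ) : ℂ) •
            measureEach (S.verify n sk) q.1 } }

end QMoney

end

/-! An adversary A against the public scheme is turned into an adversary B against the private one,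
which plays the public bank and the public verifiers itself. For a public coin, B mints κ private
coins. A private verification is answered by submitting the κ registers to a private verifier and
accepting with probability j/κ if j of them were accepted. When A submits m coins, B mints κ private
coins as the wallet, carries out the public counting on its own machine, reports the result to A,
and then submits all (m+1)κ registers of the wallet to a private verifier. These registers have left
the memory of A for good, so the additional measurement cannot be noticed and A plays its original
game.

The flexible utility of B is compared with κ times the all-or-nothing utility of A. Minting costs
both sides κ. A private verification with j accepted registers brings B exactly j, and κ times the
expected gain of A is κ·(j/κ) = j. In a submission B gains the number of accepted registers minus κ,
while κ times the gain of A is κm if all coins are accepted and 0 otherwise. The projections onto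
symmetric subspaces commute with the number of accepted registers, which is invariant under
permutations, so the expectation of this number is the same before and after the counting. Moreover
the successive projections are nested, so acceptance of all coins means passing the last test, on
all (m+1)κ registers. What has to be shown is therefore that the probability of passing this test is
at most the expected fraction of accepted registers among the mκ submitted ones, plus 2^(-κ).

To see this, fix the number κ+j of accepted registers and put M = mκ. A symmetric vector gives the
same weight to each set of κ+j accepted positions, whereas in the vector that is tested the κ
positions of the wallet coin are accepted with certainty. By the Cauchy-Schwarz inequality the test
is passed with probability at most C(M,j)/C(κ+M,κ+j) = C(κ+j,κ)/C(κ+M,κ). The numerator is convex in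
j, so comparison with its chord on [0,M], together with C(κ+M,κ) ≥ 2^κ, gives the bound j/M +
2^(-κ). This is `nsq_symProj_le`; its consequence for a whole submission is `countOp_gain`.

Summing up, κ·E[U_aon(A)] ≤ E[U_flex(B)] + κ·2^(-κ)·q, where q bounds the queries of A. Since
U_flex(B) is at most 3(κ+1)q, its expectation is at most 3(κ+1)q times the probability that it is
positive (`allOrNothing_le_reduction`). This probability is negligible by assumption, and 2^(-κ) is
negligible because κ grows faster than the logarithm.

For efficient adversaries B has to be a uniform elementary program, so the symmetric subspace test
needs an exact circuit. The projection is written as a product of lazy transpositions d/(d+1) +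
(1/(d+1))·(x y) (`symProj_eq_lazyAll`). Each factor is the success branch of a controlled exchange
whose control qubit is rotated before and after; a chain of ancillas records whether all factors
succeeded, the last one is measured, and everything is undone (`testMap_eq`). The runs of A and B
differ in their environments and in their numbers of branches, so they are compared through the
reduced density matrix of the memory of A: a branch of A is represented by several branches of B
whose reduced matrices add up to its own (`sim_compile`). -/

noncomputable section

namespace QMoney

set_option linter.unusedSectionVars false
set_option linter.unusedSimpArgs false

/-! ### Reading and writing bits -/

section Bits

variable {α ι ι' : Type} [DecidableEq α]

/-- The bits of a finite set at the given places. -/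
def getBits (L : ι → α) (s : Finset α) : ι → Bool := fun i => decide (L i ∈ s)

@[simp] theorem getBits_apply (L : ι → α) (s : Finset α) (i : ι) :
    getBits L s i = decide (L i ∈ s) := rfl

variable [Fintype ι] [Fintype ι']

/-- Overwrite the bits of a finite set at the given places. -/
def setBits (L : ι → α) (b : ι → Bool) (s : Finset α) : Finset α :=
  (s \ Finset.univ.image L) ∪ (Finset.univ.filter fun i => b i = true).image L

theorem mem_setBits {L : ι → α} {b : ι → Bool} {s : Finset α} {l : α} :
    l ∈ setBits L b s ↔ (l ∈ s ∧ ∀ i, L i ≠ l) ∨ ∃ i, b i = true ∧ L i = l := by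
  simp [setBits]

theorem apply_mem_setBits {L : ι → α} (hL : Function.Injective L) {b : ι → Bool} {s : Finset α}
    {i : ι} : L i ∈ setBits L b s ↔ b i = true := by
  rw [mem_setBits]
  constructor
  · rintro (⟨_, h⟩ | ⟨j, hj, h⟩)
    · exact absurd rfl (h i)
    · rw [← hL h]; exact hj
  · intro h; exact Or.inr ⟨i, h, rfl⟩

theorem mem_setBits_of_ne {L : ι → α} {b : ι → Bool} {s : Finset α} {l : α} (h : ∀ i, L i ≠ l) :
    l ∈ setBits L b s ↔ l ∈ s := by
  rw [mem_setBits]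
  constructor
  · rintro (⟨h1, _⟩ | ⟨i, _, hi⟩)
    · exact h1
    · exact absurd hi (h i)
  · intro h1; exact Or.inl ⟨h1, h⟩

theorem mem_setBits_false {L : ι → α} {s : Finset α} {l : α} :
    l ∈ setBits L (fun _ => false) s ↔ l ∈ s ∧ ∀ i, L i ≠ l := by
  simp [mem_setBits]

theorem getBits_setBits {L : ι → α} (hL : Function.Injective L) (b : ι → Bool) (s : Finset α) :
    getBits L (setBits L b s) = b := by
  funext i
  rw [getBits_apply]
  simp [apply_mem_setBits hL]

theorem setBits_getBits (L : ι → α) (s : Finset α) : setBits L (getBits L s) s = s := by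
  ext l
  rw [mem_setBits]
  simp only [getBits_apply, decide_eq_true_eq]
  constructor
  · rintro (⟨h, _⟩ | ⟨i, h, rfl⟩) <;> exact h
  · intro h
    by_cases hl : ∃ i, L i = l
    · obtain ⟨i, rfl⟩ := hl
      exact Or.inr ⟨i, h, rfl⟩
    · push Not at hl
      exact Or.inl ⟨h, hl⟩

theorem setBits_setBits (L : ι → α) (b b' : ι → Bool) (s : Finset α) :
    setBits L b (setBits L b' s) = setBits L b s := by
  ext l
  by_cases hl : ∃ i, L i = l
  · simp only [mem_setBits]
    obtain ⟨i, hi⟩ := hl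
    constructor
    · rintro (⟨_, h⟩ | h)
      · exact absurd hi (h i)
      · exact Or.inr h
    · rintro (⟨_, h⟩ | h)
      · exact absurd hi (h i)
      · exact Or.inr h
  · push Not at hl
    simp only [mem_setBits_of_ne hl]

theorem setBits_eq_self {L : ι → α} {s : Finset α} (h : ∀ i, L i ∉ s) :
    setBits L (fun _ => false) s = s := by
  ext l
  rw [mem_setBits_false]
  constructor
  · exact fun h => h.1
  · intro hl
    exact ⟨hl, fun i hi => h i (hi ▸ hl)⟩

/-- A finite set amounts to a pair: its bits at the places `L`, and what is left when these places
are blanked. Injectivity of `L` makes every bit pattern realizable, so an equation with a written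
set can be solved for both components separately. -/
theorem eq_setBits_iff {L : ι → α} (hL : Function.Injective L) {b : ι → Bool} {s t : Finset α} :
    t = setBits L b s ↔ getBits L t = b ∧
      setBits L (fun _ => false) t = setBits L (fun _ => false) s := by
  constructor
  · rintro rfl
    exact ⟨getBits_setBits hL _ _, setBits_setBits _ _ _ _⟩
  · rintro ⟨rfl, h⟩
    rw [← setBits_setBits L _ (fun _ => false) s, ← h, setBits_setBits, setBits_getBits]

theorem setBits_comm {L : ι → α} {L' : ι' → α} (h : ∀ i j, L i ≠ L' j) (b : ι → Bool)
    (b' : ι' → Bool) (s : Finset α) :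
    setBits L b (setBits L' b' s) = setBits L' b' (setBits L b s) := by
  ext l
  simp only [mem_setBits]
  constructor
  · rintro (⟨⟨h1, h2⟩ | ⟨j, hj, rfl⟩, h3⟩ | ⟨i, hi, rfl⟩)
    · exact Or.inl ⟨Or.inl ⟨h1, h3⟩, h2⟩
    · exact Or.inr ⟨j, hj, rfl⟩
    · exact Or.inl ⟨Or.inr ⟨i, hi, rfl⟩, fun j => (h i j).symm⟩
  · rintro (⟨⟨h1, h2⟩ | ⟨i, hi, rfl⟩, h3⟩ | ⟨j, hj, rfl⟩)
    · exact Or.inl ⟨Or.inl ⟨h1, h3⟩, h2⟩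
    · exact Or.inr ⟨i, hi, rfl⟩
    · exact Or.inl ⟨Or.inr ⟨j, hj, rfl⟩, fun i => h i j⟩

end Bits

/-! ### `applyOp` as a linear map -/

section ApplyOp

variable {ι ι' ι'' : Type} [Fintype ι] [Fintype ι'] [Fintype ι''] [DecidableEq ι']
  [DecidableEq ι'']

theorem applyOp_single (Lin : ι → Loc) (Lout : ι' → Loc) (K : Matrix (ι' → Bool) (ι → Bool) ℂ)
    (s : Config) (z : ℂ) : applyOp Lin Lout K (Finsupp.single s z) =
      ∑ b : ι' → Bool, Finsupp.single (setBits Lout b (setBits Lin (fun _ => false) s))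
        (K b (getBits Lin s) * z) := by
  rw [applyOp, Finsupp.sum_single_index]
  · rfl
  · simp

theorem applyOp_add (Lin : ι → Loc) (Lout : ι' → Loc) (K : Matrix (ι' → Bool) (ι → Bool) ℂ)
    (v w : Vec) : applyOp Lin Lout K (v + w) = applyOp Lin Lout K v + applyOp Lin Lout K w := by
  rw [applyOp, Finsupp.sum_add_index']
  · rfl
  · simp
  · intro s z z'
    rw [← Finset.sum_add_distrib]
    simp [mul_add]

theorem applyOp_zero (Lin : ι → Loc) (Lout : ι' → Loc) (K : Matrix (ι' → Bool) (ι → Bool) ℂ) :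
    applyOp Lin Lout K 0 = 0 := by
  simp [applyOp]

theorem applyOp_smul (Lin : ι → Loc) (Lout : ι' → Loc) (K : Matrix (ι' → Bool) (ι → Bool) ℂ)
    (z : ℂ) (v : Vec) : applyOp Lin Lout K (z • v) = z • applyOp Lin Lout K v := by
  induction v using Finsupp.induction_linear with
  | zero => simp [applyOp_zero]
  | add v w hv hw => simp only [smul_add, applyOp_add, hv, hw]
  | single s y =>
    rw [Finsupp.smul_single, applyOp_single, applyOp_single, Finset.smul_sum]
    refine Finset.sum_congr rfl fun b _ => ?_
    rw [Finsupp.smul_single, smul_eq_mul, smul_eq_mul]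
    ring_nf

/-- `applyOp`, bundled as a linear map. -/
def opMap (Lin : ι → Loc) (Lout : ι' → Loc) (K : Matrix (ι' → Bool) (ι → Bool) ℂ) :
    Vec →ₗ[ℂ] Vec where
  toFun := applyOp Lin Lout K
  map_add' := applyOp_add Lin Lout K
  map_smul' := applyOp_smul Lin Lout K

theorem applyOp_add_op (Lin : ι → Loc) (Lout : ι' → Loc)
    (K K' : Matrix (ι' → Bool) (ι → Bool) ℂ) (v : Vec) :
    applyOp Lin Lout (K + K') v = applyOp Lin Lout K v + applyOp Lin Lout K' v := by
  induction v using Finsupp.induction_linear with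
  | zero => simp [applyOp_zero]
  | add v w hv hw => simp only [applyOp_add, hv, hw]; abel
  | single s y =>
    simp only [applyOp_single, ← Finset.sum_add_distrib, Matrix.add_apply, add_mul,
      Finsupp.single_add]

theorem applyOp_smul_op (Lin : ι → Loc) (Lout : ι' → Loc)
    (z : ℂ) (K : Matrix (ι' → Bool) (ι → Bool) ℂ) (v : Vec) :
    applyOp Lin Lout (z • K) v = z • applyOp Lin Lout K v := by
  induction v using Finsupp.induction_linear with
  | zero => simp [applyOp_zero]
  | add v w hv hw => simp only [applyOp_add, smul_add, hv, hw]
  | single s y =>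
    simp only [applyOp_single, Finset.smul_sum, Matrix.smul_apply, Finsupp.smul_single,
      smul_eq_mul, mul_assoc]

theorem applyOp_sub_op (Lin : ι → Loc) (Lout : ι' → Loc)
    (K K' : Matrix (ι' → Bool) (ι → Bool) ℂ) (v : Vec) :
    applyOp Lin Lout (K - K') v = applyOp Lin Lout K v - applyOp Lin Lout K' v := by
  rw [sub_eq_add_neg, applyOp_add_op, ← neg_one_smul ℂ K', applyOp_smul_op, neg_one_smul,
    sub_eq_add_neg]

theorem applyOp_one [DecidableEq ι] {L : ι → Loc} (v : Vec) :
    applyOp L L (1 : Matrix (ι → Bool) (ι → Bool) ℂ) v = v := by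
  induction v using Finsupp.induction_linear with
  | zero => simp [applyOp_zero]
  | add v w hv hw => simp only [applyOp_add, hv, hw]
  | single s y =>
    rw [applyOp_single, Finset.sum_eq_single (getBits L s)]
    · rw [Matrix.one_apply_eq, one_mul, setBits_setBits, setBits_getBits]
    · intro b _ hb
      rw [Matrix.one_apply_ne hb]; simp
    · simp

/-- Vectors all of whose basis states satisfy a predicate. -/
def Supp (p : Config → Prop) (v : Vec) : Prop := ∀ c ∈ v.support, p c

theorem Supp.zero {p : Config → Prop} : Supp p 0 := by simp [Supp]

theorem Supp.add {p : Config → Prop} {v w : Vec} (hv : Supp p v) (hw : Supp p w) :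
    Supp p (v + w) := by
  intro c hc
  rcases Finset.mem_union.1 (Finsupp.support_add hc) with h | h
  · exact hv c h
  · exact hw c h

theorem Supp.smul {p : Config → Prop} {v : Vec} (hv : Supp p v) (z : ℂ) : Supp p (z • v) :=
  fun c hc => hv c (Finsupp.support_smul hc)

theorem Supp.neg {p : Config → Prop} {v : Vec} (hv : Supp p v) : Supp p (-v) := by
  rw [← neg_one_smul ℂ]; exact hv.smul _

theorem Supp.sub {p : Config → Prop} {v w : Vec} (hv : Supp p v) (hw : Supp p w) :
    Supp p (v - w) := by
  rw [sub_eq_add_neg]; exact hv.add hw.neg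

theorem Supp.sum {p : Config → Prop} {κ : Type} {s : Finset κ} {f : κ → Vec}
    (h : ∀ i ∈ s, Supp p (f i)) : Supp p (∑ i ∈ s, f i) := by
  classical
  induction s using Finset.induction_on with
  | empty => simpa using Supp.zero
  | insert a s ha ih =>
    rw [Finset.sum_insert ha]
    exact (h a (by simp)).add (ih fun i hi => h i (by simp [hi]))

theorem Supp.single {p : Config → Prop} {c : Config} (h : p c) (z : ℂ) :
    Supp p (Finsupp.single c z) := by
  intro c' hc'
  have := Finsupp.support_single_subset hc'
  rw [Finset.mem_singleton] at this
  rwa [this]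

theorem Supp.mono {p q : Config → Prop} {v : Vec} (hv : Supp p v) (h : ∀ c, p c → q c) :
    Supp q v := fun c hc => h c (hv c hc)

theorem Supp.and {p q : Config → Prop} {v : Vec} (hp : Supp p v) (hq : Supp q v) :
    Supp (fun c => p c ∧ q c) v := fun c hc => ⟨hp c hc, hq c hc⟩

/-- Induction for vectors whose support is restricted. -/
theorem Supp.induction {p : Config → Prop} {motive : Vec → Prop} {v : Vec} (hv : Supp p v)
    (zero : motive 0) (add : ∀ v w, motive v → motive w → motive (v + w))
    (single : ∀ c z, p c → motive (Finsupp.single c z)) : motive v := by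
  classical
  rw [← Finsupp.sum_single v, Finsupp.sum]
  have : ∀ s : Finset Config, (∀ c ∈ s, p c) →
      motive (∑ c ∈ s, Finsupp.single c (v c)) := by
    intro s
    induction s using Finset.induction_on with
    | empty => intro _; simpa using zero
    | insert a s ha ih =>
      intro h
      rw [Finset.sum_insert ha]
      exact add _ _ (single _ _ (h a (by simp))) (ih fun c hc => h c (by simp [hc]))
  exact this _ hv

theorem Supp.applyOp {p q : Config → Prop} {v : Vec} (hv : Supp p v) {Lin : ι → Loc}
    {Lout : ι' → Loc} {K : Matrix (ι' → Bool) (ι → Bool) ℂ}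
    (h : ∀ c b, p c → q (setBits Lout b (setBits Lin (fun _ => false) c))) :
    Supp q (applyOp Lin Lout K v) := by
  refine hv.induction (motive := fun v => Supp q (QMoney.applyOp Lin Lout K v)) ?_ ?_ ?_
  · rw [applyOp_zero]; exact Supp.zero
  · intro v w hv hw
    rw [applyOp_add]; exact hv.add hw
  · intro c z hc
    rw [applyOp_single]
    exact Supp.sum fun b _ => Supp.single (h c b hc) _

/-- Composition of two operators when the intermediate places are blank before. -/
theorem applyOp_applyOp {Lin : ι → Loc} {Lmid : ι' → Loc} {Lout : ι'' → Loc}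
    (hmid : Function.Injective Lmid) (K : Matrix (ι' → Bool) (ι → Bool) ℂ)
    (K' : Matrix (ι'' → Bool) (ι' → Bool) ℂ) {v : Vec}
    (hv : Supp (fun c => ∀ i, Lmid i ∈ c → ∃ j, Lin j = Lmid i) v) :
    applyOp Lmid Lout K' (applyOp Lin Lmid K v) = applyOp Lin Lout (K' * K) v := by
  refine hv.induction (motive := fun v =>
    applyOp Lmid Lout K' (applyOp Lin Lmid K v) = applyOp Lin Lout (K' * K) v) ?_ ?_ ?_
  · simp [applyOp_zero]
  · intro v w hv hw
    simp only [applyOp_add, hv, hw]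
  · intro c z hc
    rw [applyOp_single, applyOp_single]
    have : ∀ s : Finset (ι' → Bool), applyOp Lmid Lout K' (∑ b ∈ s, Finsupp.single
        (setBits Lmid b (setBits Lin (fun _ => false) c)) (K b (getBits Lin c) * z)) =
        ∑ b ∈ s, applyOp Lmid Lout K' (Finsupp.single
        (setBits Lmid b (setBits Lin (fun _ => false) c)) (K b (getBits Lin c) * z)) :=
      fun s => map_sum (opMap Lmid Lout K') _ _
    rw [this]
    simp only [applyOp_single]
    rw [Finset.sum_comm]
    refine Finset.sum_congr rfl fun b _ => ?_
    rw [Matrix.mul_apply, Finset.sum_mul, Finsupp.single_finsetSum]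
    refine Finset.sum_congr rfl fun d _ => ?_
    -- Blanking the intermediate places again has no effect: by hypothesis they contained nothing
    -- beyond the inputs, which are already blanked.
    rw [getBits_setBits hmid, setBits_setBits, setBits_eq_self (s := setBits Lin _ c), mul_assoc]
    intro i hi
    rw [mem_setBits_false] at hi
    obtain ⟨j, hj⟩ := hc i hi.1
    exact hi.2 j hj

theorem applyOp_applyOp_same [DecidableEq ι] {L : ι → Loc} (hL : Function.Injective L)
    (K K' : Matrix (ι → Bool) (ι → Bool) ℂ) (v : Vec) :
    applyOp L L K' (applyOp L L K v) = applyOp L L (K' * K) v :=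
  applyOp_applyOp hL K K' fun _ _ i _ => ⟨i, rfl⟩

theorem applyOp_reindex {κ κ' : Type} [Fintype κ] [Fintype κ'] [DecidableEq κ'] (Lin : ι → Loc)
    (Lout : ι' → Loc) (e : κ ≃ ι) (e' : κ' ≃ ι')
    (K : Matrix (ι' → Bool) (ι → Bool) ℂ) (v : Vec) :
    applyOp (Lin ∘ e) (Lout ∘ e')
      (K.submatrix (fun b i => b (e'.symm i)) (fun d i => d (e.symm i))) v = applyOp Lin Lout K v := by
  have key : ∀ {κ ι : Type} [Fintype κ] [Fintype ι] (L : ι → Loc) (e : κ ≃ ι) (b : κ → Bool)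
      (c : Config), setBits (L ∘ e) b c = setBits L (fun i => b (e.symm i)) c := by
    intro κ ι _ _ L e b c
    ext l
    simp only [mem_setBits, Function.comp_apply]
    constructor
    · rintro (⟨h, h'⟩ | ⟨i, hi, h⟩)
      · exact Or.inl ⟨h, fun i => by simpa using h' (e.symm i)⟩
      · exact Or.inr ⟨e i, by simpa using hi, h⟩
    · rintro (⟨h, h'⟩ | ⟨i, hi, h⟩)
      · exact Or.inl ⟨h, fun i => h' (e i)⟩
      · exact Or.inr ⟨e.symm i, hi, by simpa using h⟩
  induction v using Finsupp.induction_linear with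
  | zero => simp [applyOp_zero]
  | add v w hv hw => simp only [applyOp_add, hv, hw]
  | single s y =>
    rw [applyOp_single, applyOp_single]
    refine Fintype.sum_equiv (Equiv.arrowCongr e' (Equiv.refl Bool)) _ _ fun b => ?_
    rw [key, key]
    rw [Matrix.submatrix_apply]
    congr 3
    funext i
    simp

end ApplyOp

/-! ### Sesquilinear forms, and the reduced density matrix of the memory -/

section Sesq

open scoped ComplexConjugate

open Classical in
/-- The sesquilinear form on vectors with a `0`-`1`-kernel. -/
def sesq (p : Config → Config → Prop) (v w : Vec) : ℂ :=
  v.sum fun c z => w.sum fun c' z' => if p c c' then z * conj z' else 0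

variable {p : Config → Config → Prop}

theorem sesq_zero_left (w : Vec) : sesq p 0 w = 0 := by simp [sesq]

theorem sesq_zero_right (v : Vec) : sesq p v 0 = 0 := by simp [sesq]

theorem sesq_add_left (v v' w : Vec) : sesq p (v + v') w = sesq p v w + sesq p v' w := by
  classical
  rw [sesq, Finsupp.sum_add_index']
  · rfl
  · intro c
    simp
  · intro c z z'
    rw [← Finsupp.sum_add]
    refine Finsupp.sum_congr fun c' _ => ?_
    split_ifs <;> ring

theorem sesq_add_right (v w w' : Vec) : sesq p v (w + w') = sesq p v w + sesq p v w' := by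
  classical
  rw [sesq, sesq, sesq, ← Finsupp.sum_add]
  refine Finsupp.sum_congr fun c _ => ?_
  rw [Finsupp.sum_add_index']
  · intro c'
    simp
  · intro c' z z'
    split_ifs <;> simp [mul_add]

theorem sesq_single (c c' : Config) (z z' : ℂ) [Decidable (p c c')] :
    sesq p (Finsupp.single c z) (Finsupp.single c' z') = if p c c' then z * conj z' else 0 := by
  classical
  rw [sesq, Finsupp.sum_single_index, Finsupp.sum_single_index]
  · congr
  · simp
  · simp

theorem sesq_smul_left (a : ℂ) (v w : Vec) : sesq p (a • v) w = a * sesq p v w := by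
  classical
  induction v using Finsupp.induction_linear with
  | zero => simp [sesq_zero_left]
  | add v v' hv hv' => rw [smul_add, sesq_add_left, hv, hv', sesq_add_left, mul_add]
  | single c z =>
    induction w using Finsupp.induction_linear with
    | zero => simp [sesq_zero_right]
    | add w w' hw hw' => rw [sesq_add_right, sesq_add_right, hw, hw', mul_add]
    | single c' z' =>
      rw [Finsupp.smul_single, sesq_single, sesq_single]
      split_ifs <;> simp [mul_assoc]

theorem sesq_smul_right (a : ℂ) (v w : Vec) : sesq p v (a • w) = conj a * sesq p v w := by
  classical
  induction v using Finsupp.induction_linear with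
  | zero => simp [sesq_zero_left]
  | add v v' hv hv' => rw [sesq_add_left, hv, hv', sesq_add_left, mul_add]
  | single c z =>
    induction w using Finsupp.induction_linear with
    | zero => simp [sesq_zero_right]
    | add w w' hw hw' => rw [smul_add, sesq_add_right, sesq_add_right, hw, hw', mul_add]
    | single c' z' =>
      rw [Finsupp.smul_single, sesq_single, sesq_single]
      split_ifs
      · simp only [smul_eq_mul, map_mul]; ring
      · simp

theorem sesq_sum_left {κ : Type} (s : Finset κ) (f : κ → Vec) (w : Vec) :
    sesq p (∑ i ∈ s, f i) w = ∑ i ∈ s, sesq p (f i) w :=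
  map_sum (AddMonoidHom.mk' (fun v => sesq p v w) fun v v' => sesq_add_left v v' w) f s

theorem sesq_sum_right {κ : Type} (s : Finset κ) (f : κ → Vec) (v : Vec) :
    sesq p v (∑ i ∈ s, f i) = ∑ i ∈ s, sesq p v (f i) :=
  map_sum (AddMonoidHom.mk' (fun w => sesq p v w) fun w w' => sesq_add_right v w w') f s

/-- A pair of additive maps pulls a form back to a form with another kernel. -/
theorem sesq_congr {q : Config → Config → Prop} {P : Config → Prop} {v w : Vec} (hv : Supp P v)
    (hw : Supp P w) (X Y : Vec →+ Vec)
    (h : ∀ c c' z z', P c → P c' → sesq p (X (Finsupp.single c z)) (Y (Finsupp.single c' z')) =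
      sesq q (Finsupp.single c z) (Finsupp.single c' z')) :
    sesq p (X v) (Y w) = sesq q v w := by
  refine hv.induction (motive := fun v => sesq p (X v) (Y w) = sesq q v w) ?_ ?_ ?_
  · simp [sesq_zero_left]
  · intro v v' h1 h2
    rw [map_add, sesq_add_left, sesq_add_left, h1, h2]
  · intro c z hc
    refine hw.induction (motive := fun w => sesq p (X (Finsupp.single c z)) (Y w) =
      sesq q (Finsupp.single c z) w) ?_ ?_ ?_
    · simp [sesq_zero_right]
    · intro v v' h1 h2
      rw [map_add, sesq_add_right, sesq_add_right, h1, h2]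
    · intro c' z' hc'
      exact h c c' z z' hc hc'

theorem sesq_mapDomain {q : Config → Config → Prop} {P : Config → Prop} {v w : Vec}
    (hv : Supp P v) (hw : Supp P w) (f g : Config → Config)
    (h : ∀ c c', P c → P c' → (p (f c) (g c') ↔ q c c')) :
    sesq p (v.mapDomain f) (w.mapDomain g) = sesq q v w := by
  classical
  refine sesq_congr hv hw (Finsupp.mapDomain.addMonoidHom f) (Finsupp.mapDomain.addMonoidHom g)
    fun c c' z z' hc hc' => ?_
  simp only [Finsupp.mapDomain.addMonoidHom, AddMonoidHom.coe_mk, ZeroHom.coe_mk,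
    Finsupp.mapDomain_single]
  rw [sesq_single, sesq_single]
  simp only [h c c' hc hc']

theorem sesq_kernel_congr {q : Config → Config → Prop} {P : Config → Prop} {v w : Vec}
    (hv : Supp P v) (hw : Supp P w) (h : ∀ c c', P c → P c' → (p c c' ↔ q c c')) :
    sesq p v w = sesq q v w := by
  classical
  refine sesq_congr hv hw (AddMonoidHom.id _) (AddMonoidHom.id _) fun c c' z z' hc hc' => ?_
  simp only [AddMonoidHom.id_apply]
  rw [sesq_single, sesq_single]
  simp only [h c c' hc hc']

theorem sesq_of_forall_not {P : Config → Prop} {v w : Vec} (hv : Supp P v) (hw : Supp P w)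
    (h : ∀ c c', P c → P c' → ¬ p c c') : sesq p v w = 0 := by
  classical
  rw [sesq_kernel_congr (q := fun _ _ => False) hv hw fun c c' hc hc' => by simp [h c c' hc hc']]
  simp [sesq]

theorem sesq_eq (v : Vec) : sesq (fun c c' => c = c') v v = (normSq v : ℂ) := by
  classical
  rw [sesq, normSq, Finsupp.sum, Finsupp.sum, Complex.ofReal_sum]
  refine Finset.sum_congr rfl fun c hc => ?_
  rw [Finsupp.sum, Finset.sum_eq_single c]
  · rw [if_pos rfl, Complex.mul_conj, Complex.normSq_eq_norm_sq]
  · intro c' _ hc'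
    rw [if_neg hc'.symm]
  · intro h; exact absurd hc h

theorem normSq_nonneg (v : Vec) : 0 ≤ normSq v :=
  Finset.sum_nonneg fun _ _ => by positivity

theorem normSq_eq_sum {v : Vec} {s : Finset Config} (h : v.support ⊆ s) :
    normSq v = ∑ c ∈ s, ‖v c‖ ^ 2 := by
  rw [normSq, Finsupp.sum_of_support_subset _ h]
  simp

theorem normSq_pos {v : Vec} (h : v ≠ 0) : 0 < normSq v := by
  obtain ⟨c, hc⟩ := Finsupp.support_nonempty_iff.2 h
  refine Finset.sum_pos' (fun _ _ => by positivity) ⟨c, hc, ?_⟩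
  have := Finsupp.mem_support_iff.1 hc
  positivity

theorem normSq_zero : normSq 0 = 0 := by simp [normSq]

theorem normSq_smul (a : ℂ) (v : Vec) : normSq (a • v) = ‖a‖ ^ 2 * normSq v := by
  have := sesq_eq (a • v)
  rw [sesq_smul_left, sesq_smul_right, sesq_eq, ← mul_assoc, Complex.mul_conj,
    Complex.normSq_eq_norm_sq] at this
  exact_mod_cast this.symm

variable {ι ι' : Type} [Fintype ι] [Fintype ι'] [DecidableEq ι']

/-- The part of a vector with the bits `d` at the places `L`, with these places blanked. -/
def slice (L : ι → Loc) (d : ι → Bool) (v : Vec) : Vec :=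
  (v.filter fun c => getBits L c = d).mapDomain (setBits L fun _ => false)

theorem filter_single_eq (q : Config → Prop) [DecidablePred q] (c : Config) (z : ℂ) :
    (Finsupp.single c z).filter q = if q c then Finsupp.single c z else 0 := by
  split_ifs with h
  · exact Finsupp.filter_single_of_pos _ h
  · exact Finsupp.filter_single_of_neg _ h

theorem slice_zero (L : ι → Loc) (d : ι → Bool) : slice L d 0 = 0 := by
  rw [slice, Finsupp.filter_zero, Finsupp.mapDomain_zero]

theorem slice_add (L : ι → Loc) (d : ι → Bool) (v w : Vec) :
    slice L d (v + w) = slice L d v + slice L d w := by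
  rw [slice, Finsupp.filter_add, Finsupp.mapDomain_add]
  rfl

theorem slice_single (L : ι → Loc) (d : ι → Bool) (c : Config) (z : ℂ) :
    slice L d (Finsupp.single c z) = if getBits L c = d then
      Finsupp.single (setBits L (fun _ => false) c) z else 0 := by
  rw [slice, filter_single_eq]
  split_ifs
  · rw [Finsupp.mapDomain_single]
  · rw [Finsupp.mapDomain_zero]

theorem Supp.slice {P Q : Config → Prop} {v : Vec} (hv : Supp P v) {L : ι → Loc} {d : ι → Bool}
    (h : ∀ c, P c → Q (setBits L (fun _ => false) c)) : Supp Q (slice L d v) := by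
  refine hv.induction (motive := fun v => Supp Q (QMoney.slice L d v)) ?_ ?_ ?_
  · rw [slice_zero]; exact Supp.zero
  · intro v w hv hw
    rw [slice_add]; exact hv.add hw
  · intro c z hc
    rw [slice_single]
    split_ifs
    · exact Supp.single (h c hc) _
    · exact Supp.zero

variable [DecidableEq ι]

/-- The slices are the components of `v` with respect to the bits at `Lin`. The matrix mixes them as
if they were scalar coordinates and then writes the output bits, so questions about operators become
questions about linear combinations of slices. -/
theorem applyOp_eq_sum_slice (Lin : ι → Loc) (Lout : ι' → Loc)
    (K : Matrix (ι' → Bool) (ι → Bool) ℂ) (v : Vec) :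
    applyOp Lin Lout K v = ∑ b, (∑ d, K b d • slice Lin d v).mapDomain (setBits Lout b) := by
  classical
  induction v using Finsupp.induction_linear with
  | zero => simp [applyOp_zero, slice_zero]
  | add v w hv hw =>
    simp only [applyOp_add, hv, hw, slice_add, smul_add, Finset.sum_add_distrib,
      Finsupp.mapDomain_add]
  | single c z =>
    rw [applyOp_single]
    refine Finset.sum_congr rfl fun b _ => ?_
    rw [Finset.sum_eq_single (getBits Lin c)]
    · rw [slice_single, if_pos rfl, Finsupp.smul_single, Finsupp.mapDomain_single, smul_eq_mul]
    · intro d _ hd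
      rw [slice_single, if_neg hd.symm, smul_zero]
    · simp

/-- The blank places condition for `applyOp`. -/
def Blank (Lin : ι → Loc) (Lout : ι' → Loc) (v : Vec) : Prop :=
  Supp (fun c => ∀ i, Lout i ∈ c → ∃ j, Lin j = Lout i) v

theorem Blank.slice {Lin : ι → Loc} {Lout : ι' → Loc} {v : Vec} (h : Blank Lin Lout v)
    (d : ι → Bool) : Supp (fun c => ∀ i, Lout i ∉ c) (slice Lin d v) := by
  refine Supp.slice h fun c hc i hi => ?_
  rw [mem_setBits_false] at hi
  obtain ⟨j, hj⟩ := hc i hi.1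
  exact hi.2 j hj

theorem setBits_inj_of_blank {α : Type} [DecidableEq α] {L : ι → α} (hL : Function.Injective L)
    {b b' : ι → Bool} {c c' : Finset α} (hc : ∀ i, L i ∉ c) (hc' : ∀ i, L i ∉ c') :
    setBits L b c = setBits L b' c' ↔ b = b' ∧ c = c' := by
  rw [eq_setBits_iff hL, getBits_setBits hL, setBits_setBits, setBits_eq_self hc,
    setBits_eq_self hc']

/-- The combinations of slices are blank at the output places, hence writing different output bits
produces orthogonal vectors and writing fixed bits is an isometry. -/
theorem normSq_applyOp {Lin : ι → Loc} {Lout : ι' → Loc} (hout : Function.Injective Lout)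
    (K : Matrix (ι' → Bool) (ι → Bool) ℂ) {v : Vec} (hv : Blank Lin Lout v) :
    normSq (applyOp Lin Lout K v) = ∑ b, normSq (∑ d, K b d • slice Lin d v) := by
  classical
  have h := sesq_eq (applyOp Lin Lout K v)
  rw [applyOp_eq_sum_slice, sesq_sum_left] at h
  have hs : ∀ b, Supp (fun c => ∀ i, Lout i ∉ c) (∑ d, K b d • slice Lin d v) := fun b =>
    Supp.sum fun d _ => (hv.slice d).smul _
  have key : ∀ b, sesq (fun c c' => c = c') ((∑ d, K b d • slice Lin d v).mapDomain (setBits Lout b))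
      (∑ b, (∑ d, K b d • slice Lin d v).mapDomain (setBits Lout b)) =
      (normSq (∑ d, K b d • slice Lin d v) : ℂ) := by
    intro b
    rw [sesq_sum_right, Finset.sum_eq_single b]
    · rw [sesq_mapDomain (q := fun c c' => c = c') (hs b) (hs b), sesq_eq]
      intro c c' hc hc'
      rw [setBits_inj_of_blank hout hc hc']
      simp
    · intro b' _ hb'
      rw [sesq_mapDomain (q := fun _ _ => False) (hs b) (hs b')]
      · simp [sesq]
      · intro c c' hc hc'
        rw [setBits_inj_of_blank hout hc hc']
        simp [hb'.symm]
    · simp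
  simp only [key] at h
  rw [applyOp_eq_sum_slice]
  exact_mod_cast h.symm

/-- The squared norm of a vector after an operator, by the fibres over the untouched places. -/
theorem normSq_applyOp_eq_sum {Lin : ι → Loc} (v : Vec) :
    ∃ R : Finset Config, ∀ {ι' : Type} [Fintype ι'] [DecidableEq ι'] (Lout : ι' → Loc)
      (_ : Function.Injective Lout) (K : Matrix (ι' → Bool) (ι → Bool) ℂ) (_ : Blank Lin Lout v),
      normSq (applyOp Lin Lout K v) =
        ∑ r ∈ R, ∑ b, ‖K.mulVec (fun d => slice Lin d v r) b‖ ^ 2 := by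
  classical
  -- The set of fibres depends on `v` and `Lin` only, not on the operator. The same decomposition
  -- thus serves for all operators, in particular for the identity, and norms can be compared fibre
  -- by fibre.
  refine ⟨Finset.univ.biUnion fun d : ι → Bool => (slice Lin d v).support, ?_⟩
  intro ι' _ _ Lout hout K hv
  rw [normSq_applyOp hout K hv, Finset.sum_comm]
  refine Finset.sum_congr rfl fun b _ => ?_
  rw [normSq_eq_sum (s := Finset.univ.biUnion fun d : ι → Bool => (slice Lin d v).support)]
  · refine Finset.sum_congr rfl fun r _ => ?_
    rw [Finsupp.finsetSum_apply]
    rfl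
  · intro c hc
    have := Finsupp.support_finsetSum hc
    obtain ⟨d, hd⟩ := by simpa using this
    simp only [Finset.mem_biUnion, Finset.mem_univ, true_and, Finsupp.mem_support_iff]
    exact ⟨d, fun h0 => hd.2 h0⟩

/-! ### The reduced density matrix of the memory -/

/-- The matrix entries of the state of the memory, the environment being traced out. -/
def gram (v : Vec) (a b : Finset (ℕ × ℕ)) : ℂ :=
  sesq (fun c c' => c.toLeft = a ∧ c'.toLeft = b ∧ c.toRight = c'.toRight) v v

theorem toLeft_setBits_inl (L : ι → ℕ × ℕ) (b : ι → Bool) (c : Config) :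
    (setBits (fun i => (Sum.inl (L i) : Loc)) b c).toLeft = setBits L b c.toLeft := by
  ext l
  simp [mem_setBits]

theorem toRight_setBits_inl (L : ι → ℕ × ℕ) (b : ι → Bool) (c : Config) :
    (setBits (fun i => (Sum.inl (L i) : Loc)) b c).toRight = c.toRight := by
  ext l
  simp [mem_setBits]

theorem toLeft_setBits_inr (L : ι → ℕ × ℕ × ℕ × ℕ) (b : ι → Bool) (c : Config) :
    (setBits (fun i => (Sum.inr (L i) : Loc)) b c).toLeft = c.toLeft := by
  ext l
  simp [mem_setBits]

theorem toRight_setBits_inr (L : ι → ℕ × ℕ × ℕ × ℕ) (b : ι → Bool) (c : Config) :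
    (setBits (fun i => (Sum.inr (L i) : Loc)) b c).toRight = setBits L b c.toRight := by
  ext l
  simp [mem_setBits]

theorem getBits_inl (L : ι → ℕ × ℕ) (c : Config) :
    getBits (fun i => (Sum.inl (L i) : Loc)) c = getBits L c.toLeft := by
  funext i
  simp

-- A slice has blank places `Lin`, so it contributes only to entries whose row and column are blank
-- there; such an entry is the entry of the original matrix with the removed bits put back.
open Classical in
theorem sesq_slice {Lin : ι → ℕ × ℕ} (hin : Function.Injective Lin) (d d' : ι → Bool) (v : Vec)
    (a b : Finset (ℕ × ℕ)) :
    sesq (fun c c' => c.toLeft = a ∧ c'.toLeft = b ∧ c.toRight = c'.toRight)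
      (slice (fun i => Sum.inl (Lin i)) d v) (slice (fun i => Sum.inl (Lin i)) d' v) =
      if (∀ i, Lin i ∉ a) ∧ (∀ i, Lin i ∉ b) then gram v (setBits Lin d a) (setBits Lin d' b)
      else 0 := by
  have hv : Supp (fun _ => True) v := fun _ _ => trivial
  have h1 : ∀ (L : ι → Loc) d, ∃ X : Vec →+ Vec, ∀ v, X v = slice L d v := fun L d =>
    ⟨AddMonoidHom.mk' (slice L d) (slice_add L d), fun _ => rfl⟩
  obtain ⟨X, hX⟩ := h1 (fun i => Sum.inl (Lin i)) d
  obtain ⟨Y, hY⟩ := h1 (fun i => Sum.inl (Lin i)) d'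
  rw [← hX, ← hY, sesq_congr (q := fun c c' => ((∀ i, Lin i ∉ a) ∧ (∀ i, Lin i ∉ b)) ∧
    (c.toLeft = setBits Lin d a ∧ c'.toLeft = setBits Lin d' b ∧ c.toRight = c'.toRight)) hv hv]
  · split_ifs with h
    · rw [gram]
      exact sesq_kernel_congr hv hv fun c c' _ _ => by rw [and_iff_right h]
    · exact sesq_of_forall_not hv hv fun c c' _ _ h' => h h'.1
  · intro c c' z z' _ _
    rw [hX, hY, slice_single, slice_single]
    have e : ∀ (d : ι → Bool) (a : Finset (ℕ × ℕ)) (c : Config),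
        ((∀ i, Lin i ∉ a) ∧ c.toLeft = setBits Lin d a) ↔
        (getBits (fun i => (Sum.inl (Lin i) : Loc)) c = d ∧
          (setBits (fun i => (Sum.inl (Lin i) : Loc)) (fun _ => false) c).toLeft = a) := by
      intro d a c
      rw [toLeft_setBits_inl, getBits_inl, eq_setBits_iff hin]
      constructor
      · rintro ⟨h1, h2, h3⟩
        exact ⟨h2, by rw [h3, setBits_eq_self h1]⟩
      · rintro ⟨h1, h2⟩
        have : ∀ i, Lin i ∉ a := by
          intro i hi
          rw [← h2, mem_setBits_false] at hi
          exact hi.2 i rfl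
        exact ⟨this, h1, by rw [h2, setBits_eq_self this]⟩
    rw [sesq_single]
    have e1 := e d a c
    have e2 := e d' b c'
    by_cases g1 : getBits (fun i => (Sum.inl (Lin i) : Loc)) c = d
    · by_cases g2 : getBits (fun i => (Sum.inl (Lin i) : Loc)) c' = d'
      · rw [if_pos g1, if_pos g2, sesq_single]
        refine if_congr ?_ rfl rfl
        rw [toRight_setBits_inl, toRight_setBits_inl]
        tauto
      · rw [if_neg g2, sesq_zero_right, if_neg]
        tauto
    · rw [if_neg g1, sesq_zero_left, if_neg]
      tauto

theorem gram_applyOp_mem {Lin : ι → ℕ × ℕ} {Lout : ι' → ℕ × ℕ}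
    (hout : Function.Injective Lout) (K : Matrix (ι' → Bool) (ι → Bool) ℂ) {v : Vec}
    (hv : Blank (fun i => Sum.inl (Lin i)) (fun i => Sum.inl (Lout i)) v)
    (a b : Finset (ℕ × ℕ)) :
    gram (applyOp (fun i => Sum.inl (Lin i)) (fun i => Sum.inl (Lout i)) K v) a b =
      ∑ d, ∑ d', K (getBits Lout a) d * conj (K (getBits Lout b) d') *
        sesq (fun c c' => c.toLeft = setBits Lout (fun _ => false) a ∧
          c'.toLeft = setBits Lout (fun _ => false) b ∧ c.toRight = c'.toRight)
          (slice (fun i => Sum.inl (Lin i)) d v) (slice (fun i => Sum.inl (Lin i)) d' v) := by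
  classical
  rw [gram, applyOp_eq_sum_slice, sesq_sum_left]
  have hs : ∀ b, Supp (fun c => ∀ i, Sum.inl (Lout i) ∉ c)
      (∑ d, K b d • slice (fun i => Sum.inl (Lin i)) d v) := fun b =>
    Supp.sum fun d _ => (hv.slice d).smul _
  have e : ∀ (x : ι' → Bool) (a : Finset (ℕ × ℕ)) (c : Config), (∀ i, Sum.inl (Lout i) ∉ c) →
      ((setBits (fun i => (Sum.inl (Lout i) : Loc)) x c).toLeft = a ↔
      (getBits Lout a = x ∧ c.toLeft = setBits Lout (fun _ => false) a)) := by
    intro x a c hc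
    rw [toLeft_setBits_inl, eq_comm, eq_setBits_iff hout,
      setBits_eq_self (s := c.toLeft) (fun i hi => hc i (by simpa using hi)), eq_comm (b := c.toLeft)]
  rw [Finset.sum_eq_single (getBits Lout a), sesq_sum_right,
    Finset.sum_eq_single (getBits Lout b)]
  · rw [sesq_mapDomain (hs _) (hs _) (q := fun c c' =>
      c.toLeft = setBits Lout (fun _ => false) a ∧
          c'.toLeft = setBits Lout (fun _ => false) b ∧ c.toRight = c'.toRight)]
    · rw [sesq_sum_left]
      refine Finset.sum_congr rfl fun d _ => ?_
      rw [sesq_sum_right]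
      refine Finset.sum_congr rfl fun d' _ => ?_
      rw [sesq_smul_left, sesq_smul_right, mul_assoc]
    · intro c c' hc hc'
      rw [e _ _ _ hc, e _ _ _ hc', toRight_setBits_inl, toRight_setBits_inl]
      simp
  · intro x _ hx
    rw [sesq_mapDomain (hs _) (hs _) (q := fun _ _ => False)]
    · simp [sesq]
    · intro c c' hc hc'
      rw [e _ _ _ hc']
      simp [hx.symm]
  · simp
  · intro x _ hx
    rw [sesq_sum_right]
    refine Finset.sum_eq_zero fun y _ => ?_
    rw [sesq_mapDomain (hs _) (hs _) (q := fun _ _ => False)]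
    · simp [sesq]
    · intro c c' hc hc'
      rw [e _ _ _ hc]
      simp [hx.symm]
  · simp

/-- This is the map ρ ↦ KρK* in coordinates. It shows that the new state of the memory depends on
the vector only through the old state of the memory. -/
theorem gram_act {L : ι → ℕ × ℕ} (hL : Function.Injective L)
    (K : Matrix (ι → Bool) (ι → Bool) ℂ) (v : Vec) (a b : Finset (ℕ × ℕ)) :
    gram (applyOp (fun i => Sum.inl (L i)) (fun i => Sum.inl (L i)) K v) a b =
      ∑ d, ∑ d', K (getBits L a) d * conj (K (getBits L b) d') *
        gram v (setBits L d a) (setBits L d' b) := by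
  classical
  rw [gram_applyOp_mem hL]
  · refine Finset.sum_congr rfl fun d _ => Finset.sum_congr rfl fun d' _ => ?_
    rw [sesq_slice hL, if_pos, setBits_setBits, setBits_setBits]
    constructor <;>
    · intro i hi
      rw [mem_setBits_false] at hi
      exact hi.2 i rfl
  · exact fun c _ i _ => ⟨i, rfl⟩

open Classical in
/-- Handing over qubits to fresh places of the environment, with a Kraus operator. -/
theorem gram_applyOp_env {Lin : ι → ℕ × ℕ} (hin : Function.Injective Lin)
    {Lout : ι' → ℕ × ℕ × ℕ × ℕ} (hout : Function.Injective Lout)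
    (K : Matrix (ι' → Bool) (ι → Bool) ℂ) {v : Vec}
    (hv : Blank (fun i => Sum.inl (Lin i)) (fun i => Sum.inr (Lout i)) v)
    (a b : Finset (ℕ × ℕ)) :
    gram (applyOp (fun i => Sum.inl (Lin i)) (fun i => Sum.inr (Lout i)) K v) a b =
      if (∀ i, Lin i ∉ a) ∧ (∀ i, Lin i ∉ b) then
        ∑ d, ∑ d', (K.conjTranspose * K) d' d * gram v (setBits Lin d a) (setBits Lin d' b)
      else 0 := by
  rw [gram, applyOp_eq_sum_slice, sesq_sum_left]
  have hs : ∀ b, Supp (fun c => ∀ i, Sum.inr (Lout i) ∉ c)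
      (∑ d, K b d • slice (fun i => Sum.inl (Lin i)) d v) := fun b =>
    Supp.sum fun d _ => (hv.slice d).smul _
  have e : ∀ (x y : ι' → Bool) (c c' : Config), (∀ i, Sum.inr (Lout i) ∉ c) →
      (∀ i, Sum.inr (Lout i) ∉ c') →
      ((setBits (fun i => (Sum.inr (Lout i) : Loc)) x c).toRight =
        (setBits (fun i => (Sum.inr (Lout i) : Loc)) y c').toRight ↔
      (x = y ∧ c.toRight = c'.toRight)) := by
    intro x y c c' hc hc'
    rw [toRight_setBits_inr, toRight_setBits_inr, setBits_inj_of_blank hout]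
    · exact fun i hi => hc i (by simpa using hi)
    · exact fun i hi => hc' i (by simpa using hi)
  have key : ∀ x, sesq (fun c c' => c.toLeft = a ∧ c'.toLeft = b ∧ c.toRight = c'.toRight)
      ((∑ d, K x d • slice (fun i => Sum.inl (Lin i)) d v).mapDomain
        (setBits (fun i => (Sum.inr (Lout i) : Loc)) x))
      (∑ y, (∑ d, K y d • slice (fun i => Sum.inl (Lin i)) d v).mapDomain
        (setBits (fun i => (Sum.inr (Lout i) : Loc)) y)) =
      ∑ d, ∑ d', K x d * conj (K x d') * sesq (fun c c' => c.toLeft = a ∧ c'.toLeft = b ∧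
        c.toRight = c'.toRight) (slice (fun i => Sum.inl (Lin i)) d v)
        (slice (fun i => Sum.inl (Lin i)) d' v) := by
    intro x
    rw [sesq_sum_right, Finset.sum_eq_single x]
    · rw [sesq_mapDomain (hs _) (hs _) (q := fun c c' => c.toLeft = a ∧ c'.toLeft = b ∧
        c.toRight = c'.toRight)]
      · rw [sesq_sum_left]
        refine Finset.sum_congr rfl fun d _ => ?_
        rw [sesq_sum_right]
        refine Finset.sum_congr rfl fun d' _ => ?_
        rw [sesq_smul_left, sesq_smul_right, mul_assoc]
      · intro c c' hc hc'
        rw [e _ _ _ _ hc hc', toLeft_setBits_inr, toLeft_setBits_inr]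
        simp
    · intro y _ hy
      rw [sesq_mapDomain (hs _) (hs _) (q := fun _ _ => False)]
      · simp [sesq]
      · intro c c' hc hc'
        rw [e _ _ _ _ hc hc']
        simp [hy.symm]
    · simp
  simp only [key, sesq_slice hin]
  split_ifs with h
  · rw [Finset.sum_comm]
    refine Finset.sum_congr rfl fun d _ => ?_
    rw [Finset.sum_comm]
    refine Finset.sum_congr rfl fun d' _ => ?_
    -- Tracing out the output, which now belongs to the environment, sums over `x`; only the effect
    -- K*K of the Kraus operator is left.
    rw [← Finset.sum_mul, Matrix.mul_apply]
    congr 1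
    refine Finset.sum_congr rfl fun x _ => ?_
    rw [Matrix.conjTranspose_apply, mul_comm]
    rfl
  · simp

/-- The probability is the trace of the state of the memory. -/
theorem hasSum_gram (v : Vec) : HasSum (fun a => gram v a a) (normSq v : ℂ) := by
  classical
  rw [← sesq_eq]
  have hv : Supp (fun _ => True) v := fun _ _ => trivial
  have : ∀ w : Vec, HasSum (fun a => sesq (fun c c' : Config => c.toLeft = a ∧ c'.toLeft = a ∧
      c.toRight = c'.toRight) v w) (sesq (fun c c' => c = c') v w) := by
    intro w
    induction v using Finsupp.induction_linear with
    | zero => simp only [sesq_zero_left]; exact hasSum_zero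
    | add v v' h h' =>
      simp only [sesq_add_left]
      exact (h fun _ _ => trivial).add (h' fun _ _ => trivial)
    | single c z =>
      induction w using Finsupp.induction_linear with
      | zero => simp only [sesq_zero_right]; exact hasSum_zero
      | add w w' h h' => simp only [sesq_add_right]; exact h.add h'
      | single c' z' =>
        simp only [sesq_single]
        convert hasSum_ite_eq (c.toLeft : Finset (ℕ × ℕ)) (if c = c' then z * conj z' else 0) using 2 with a
        by_cases h : c = c'
        · subst h
          by_cases ha : c.toLeft = a
          · simp [ha]
          · simp [ha, Ne.symm ha]
        · have : ¬ (c.toLeft = a ∧ c'.toLeft = a ∧ c.toRight = c'.toRight) := by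
            rintro ⟨h1, h2, h3⟩
            apply h
            rw [← Finset.toLeft_disjSum_toRight (u := c), ← Finset.toLeft_disjSum_toRight (u := c'),
              h1, h2, h3]
          simp [h, this]
  exact this v

end Sesq

/-! ### Operators on registers -/

section Registers

open scoped ComplexConjugate Matrix

variable {R : Type} [Fintype R] [DecidableEq R] {ℓ : ℕ}

/-- The tensor product of operators on single registers. -/
def tens (X : R → Matrix (Fin ℓ → Bool) (Fin ℓ → Bool) ℂ) :
    Matrix (R × Fin ℓ → Bool) (R × Fin ℓ → Bool) ℂ :=
  fun b c => ∏ ρ : R, X ρ (fun i => b (ρ, i)) (fun i => c (ρ, i))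

theorem measureEach_eq_tens (V : Matrix (Fin ℓ → Bool) (Fin ℓ → Bool) ℂ) (a : R → Bool) :
    measureEach V a = tens fun ρ => if a ρ then V else 1 - V := rfl

theorem sum_registers {β : Type} [AddCommMonoid β] (f : (R × Fin ℓ → Bool) → β) :
    ∑ d, f d = ∑ e : R → Fin ℓ → Bool, f fun q => e q.1 q.2 :=
  Fintype.sum_equiv (Equiv.curry R (Fin ℓ) Bool) _ _ fun _ => rfl

theorem prod_sum_registers {κ : Type} [Fintype κ] [DecidableEq κ] (g : R → κ → ℂ) :
    ∏ ρ, ∑ x, g ρ x = ∑ e : R → κ, ∏ ρ, g ρ (e ρ) := by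
  rw [Finset.prod_univ_sum, Fintype.piFinset_univ]

theorem tens_mul (X Y : R → Matrix (Fin ℓ → Bool) (Fin ℓ → Bool) ℂ) :
    tens X * tens Y = tens fun ρ => X ρ * Y ρ := by
  ext b c
  rw [Matrix.mul_apply, sum_registers]
  simp only [tens, Matrix.mul_apply, prod_sum_registers, ← Finset.prod_mul_distrib]

theorem tens_one : tens (fun _ : R => (1 : Matrix (Fin ℓ → Bool) (Fin ℓ → Bool) ℂ)) = 1 := by
  ext b c
  rw [tens]
  by_cases h : b = c
  · subst h; simp
  · rw [Matrix.one_apply_ne h]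
    obtain ⟨q, hq⟩ := Function.ne_iff.1 h
    refine Finset.prod_eq_zero (Finset.mem_univ q.1) (Matrix.one_apply_ne fun h' => hq ?_)
    exact congrFun h' q.2

theorem tens_conjTranspose (X : R → Matrix (Fin ℓ → Bool) (Fin ℓ → Bool) ℂ) :
    (tens X)ᴴ = tens fun ρ => (X ρ)ᴴ := by
  ext b c
  simp [tens, Matrix.conjTranspose_apply]

theorem tens_eq_zero {X : R → Matrix (Fin ℓ → Bool) (Fin ℓ → Bool) ℂ} {ρ : R} (h : X ρ = 0) :
    tens X = 0 := by
  ext b c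
  exact Finset.prod_eq_zero (Finset.mem_univ ρ) (by rw [h]; rfl)

theorem tens_mulVec (X : R → Matrix (Fin ℓ → Bool) (Fin ℓ → Bool) ℂ)
    (φ : R → (Fin ℓ → Bool) → ℂ) :
    (tens X).mulVec (fun b => ∏ ρ, φ ρ fun i => b (ρ, i)) =
      fun b => ∏ ρ, (X ρ).mulVec (φ ρ) fun i => b (ρ, i) := by
  funext b
  rw [Matrix.mulVec, dotProduct, sum_registers]
  simp only [tens, Matrix.mulVec, dotProduct, prod_sum_registers, ← Finset.prod_mul_distrib]

section MeasureEach

variable {V : Matrix (Fin ℓ → Bool) (Fin ℓ → Bool) ℂ}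

theorem measureEach_sum (V : Matrix (Fin ℓ → Bool) (Fin ℓ → Bool) ℂ) :
    ∑ a : R → Bool, measureEach V a = 1 := by
  ext b c
  rw [Matrix.sum_apply]
  simp only [measureEach]
  rw [← prod_sum_registers (fun ρ (x : Bool) => (if x then V else 1 - V)
    (fun i => b (ρ, i)) (fun i => c (ρ, i))), ← tens_one]
  simp [tens]

theorem measureEach_mul_self (hV : IsStarProjection V) (a : R → Bool) :
    measureEach V a * measureEach V a = measureEach V a := by
  rw [measureEach_eq_tens, tens_mul]
  congr 1
  funext ρ
  split_ifs
  · exact hV.isIdempotentElem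
  · exact hV.one_sub.isIdempotentElem

theorem measureEach_mul_of_ne (hV : IsStarProjection V) {a a' : R → Bool} (h : a ≠ a') :
    measureEach V a * measureEach V a' = 0 := by
  rw [measureEach_eq_tens, measureEach_eq_tens, tens_mul]
  obtain ⟨ρ, hρ⟩ := Function.ne_iff.1 h
  have := hV.isIdempotentElem.eq
  refine tens_eq_zero (ρ := ρ) ?_
  cases ha : a ρ <;> cases ha' : a' ρ <;> simp_all [mul_sub, sub_mul]

theorem measureEach_conjTranspose (hV : IsStarProjection V) (a : R → Bool) :
    (measureEach V a)ᴴ = measureEach V a := by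
  rw [measureEach_eq_tens, tens_conjTranspose]
  congr 1
  funext ρ
  split_ifs
  · exact hV.isSelfAdjoint
  · exact hV.one_sub.isSelfAdjoint

end MeasureEach

/-- The operator that permutes the registers. -/
def permMat (ℓ : ℕ) (π : Equiv.Perm R) : Matrix (R × Fin ℓ → Bool) (R × Fin ℓ → Bool) ℂ :=
  Matrix.of fun b c => if c = (fun q => b (π q.1, q.2)) then 1 else 0

theorem permMat_mulVec (π : Equiv.Perm R) (ψ : (R × Fin ℓ → Bool) → ℂ) :
    (permMat ℓ π).mulVec ψ = fun b => ψ fun q => b (π q.1, q.2) := by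
  funext b
  simp [Matrix.mulVec, dotProduct, permMat]

theorem permMat_mul_apply (π : Equiv.Perm R) (X : Matrix (R × Fin ℓ → Bool) (R × Fin ℓ → Bool) ℂ)
    (b c : R × Fin ℓ → Bool) : (permMat ℓ π * X) b c = X (fun q => b (π q.1, q.2)) c := by
  simp [Matrix.mul_apply, permMat]

theorem mul_permMat_apply (π : Equiv.Perm R) (X : Matrix (R × Fin ℓ → Bool) (R × Fin ℓ → Bool) ℂ)
    (b c : R × Fin ℓ → Bool) :
    (X * permMat ℓ π) b c = X b (fun q => c (π.symm q.1, q.2)) := by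
  have : ∀ d : R × Fin ℓ → Bool, (c = fun q => d (π q.1, q.2)) ↔
      d = fun q => c (π.symm q.1, q.2) := by
    intro d
    constructor
    · rintro rfl; simp
    · rintro rfl; simp
  simp [Matrix.mul_apply, permMat, this]

theorem permMat_one : permMat ℓ (1 : Equiv.Perm R) = 1 := by
  ext b c
  simp [permMat, Matrix.one_apply, eq_comm]

theorem permMat_mul (π σ : Equiv.Perm R) : permMat ℓ π * permMat ℓ σ = permMat ℓ (π * σ) := by
  ext b c
  rw [permMat_mul_apply]
  rfl

theorem permMat_conjTranspose (π : Equiv.Perm R) : (permMat ℓ π)ᴴ = permMat ℓ π⁻¹ := by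
  ext b c
  have : (b = fun q => c (π q.1, q.2)) ↔ c = fun q => b (π⁻¹ q.1, q.2) := by
    constructor
    · rintro rfl; simp
    · rintro rfl; simp
  simp [permMat, Matrix.conjTranspose_apply, this]

/-- Permuting the registers permutes the outcomes of their measurements. Hence a combination of
these projections whose coefficients depend only on the number of accepted registers commutes with
all permutations. -/
theorem permMat_mul_measureEach (V : Matrix (Fin ℓ → Bool) (Fin ℓ → Bool) ℂ) (π : Equiv.Perm R)
    (a : R → Bool) :
    permMat ℓ π * measureEach V (a ∘ π) = measureEach V a * permMat ℓ π := by
  ext b c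
  rw [permMat_mul_apply, mul_permMat_apply, measureEach, measureEach]
  exact Fintype.prod_equiv π _ _ fun ρ => by simp

theorem mem_symSubspace_iff {T : Set R} {ψ : EuclideanSpace ℂ (R × Fin ℓ → Bool)} :
    ψ ∈ symSubspace ℓ T ↔ ∀ π : Equiv.Perm R, (∀ ρ, ρ ∉ T → π ρ = ρ) →
      (permMat ℓ π).mulVec ψ.ofLp = ψ.ofLp := by
  simp only [permMat_mulVec]
  constructor
  · intro h π hπ
    funext b
    exact h π hπ b
  · intro h π hπ b
    exact congrFun (h π hπ) b

theorem symProj_mulVec (T : Set R) (ψ : EuclideanSpace ℂ (R × Fin ℓ → Bool)) :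
    (symProj ℓ T).mulVec ψ.ofLp = ((symSubspace ℓ T).starProjection ψ).ofLp := by
  have h : ψ = ∑ b, ψ b • EuclideanSpace.single b (1 : ℂ) := by
    ext c
    simp [Finset.sum_apply, Pi.single_apply]
  conv_rhs => rw [h]
  rw [map_sum]
  funext a
  simp [Matrix.mulVec, dotProduct, symProj, mul_comm]

theorem inner_eq_dotProduct (φ ψ : EuclideanSpace ℂ (R × Fin ℓ → Bool)) :
    inner ℂ φ ψ = star φ.ofLp ⬝ᵥ ψ.ofLp := by
  rw [EuclideanSpace.inner_eq_star_dotProduct, dotProduct_comm]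

/-- A characterisation of the projection onto the symmetric subspace. -/
theorem symProj_eq_of {T : Set R} {E : Matrix (R × Fin ℓ → Bool) (R × Fin ℓ → Bool) ℂ}
    (h1 : ∀ ψ, WithLp.toLp 2 (E.mulVec ψ) ∈ symSubspace ℓ T)
    (h2 : ∀ w ∈ symSubspace ℓ T, ∀ ψ, star w.ofLp ⬝ᵥ E.mulVec ψ = star w.ofLp ⬝ᵥ ψ) :
    symProj ℓ T = E := by
  refine Matrix.mulVec_injective (funext fun ψ => ?_)
  have := symProj_mulVec T (WithLp.toLp 2 ψ)
  rw [show (symProj ℓ T).mulVec ψ = _ from this]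
  rw [Submodule.eq_starProjection_of_mem_of_inner_eq_zero (v := WithLp.toLp 2 (E.mulVec ψ)) (h1 ψ)]
  intro w hw
  rw [← inner_conj_symm, inner_eq_dotProduct]
  have := h2 w hw ψ
  rw [WithLp.ofLp_sub, dotProduct_sub, this, sub_self, map_zero]

theorem symProj_mem (T : Set R) (ψ : (R × Fin ℓ → Bool) → ℂ) :
    WithLp.toLp 2 ((symProj ℓ T).mulVec ψ) ∈ symSubspace ℓ T := by
  have := symProj_mulVec T (WithLp.toLp 2 ψ)
  rw [show (symProj ℓ T).mulVec ψ = _ from this]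
  exact Submodule.starProjection_apply_mem _ _

theorem symProj_mulVec_of_mem {T : Set R} {w : (R × Fin ℓ → Bool) → ℂ}
    (hw : WithLp.toLp 2 w ∈ symSubspace ℓ T) : (symProj ℓ T).mulVec w = w := by
  have h := symProj_mulVec T (WithLp.toLp 2 w)
  rw [Submodule.starProjection_eq_self_iff.2 hw] at h
  exact h

theorem symProj_conjTranspose (T : Set R) : (symProj ℓ T)ᴴ = symProj ℓ T := by
  ext a b
  rw [Matrix.conjTranspose_apply]
  have h := (symSubspace ℓ T).inner_starProjection_left_eq_right
    (EuclideanSpace.single a 1) (EuclideanSpace.single b 1)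
  rw [EuclideanSpace.inner_single_left, EuclideanSpace.inner_single_right] at h
  simpa [symProj] using h

/-- Invariance under the permutations of more registers is a stronger condition, so the symmetric
subspaces are nested. This is what reduces a sequence of accepting tests to the last one. -/
theorem symProj_mul_of_subset {T T' : Set R} (h : T ⊆ T') :
    symProj ℓ T * symProj ℓ T' = symProj ℓ T' := by
  refine Matrix.mulVec_injective (funext fun ψ => ?_)
  rw [← Matrix.mulVec_mulVec]
  have := symProj_mem (ℓ := ℓ) T' ψ
  have h' : WithLp.toLp 2 ((symProj ℓ T').mulVec ψ) ∈ symSubspace ℓ T := by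
    rw [mem_symSubspace_iff] at this ⊢
    exact fun π hπ => this π fun ρ hρ => hπ ρ fun hρ' => hρ (h hρ')
  exact symProj_mulVec_of_mem h'

theorem symProj_mul_of_superset {T T' : Set R} (h : T ⊆ T') :
    symProj ℓ T' * symProj ℓ T = symProj ℓ T' := by
  have := congrArg Matrix.conjTranspose (symProj_mul_of_subset (ℓ := ℓ) h)
  rwa [Matrix.conjTranspose_mul, symProj_conjTranspose, symProj_conjTranspose] at this

theorem symProj_mul_self (T : Set R) : symProj ℓ T * symProj ℓ T = symProj ℓ T :=
  symProj_mul_of_subset le_rfl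

/-- The projection onto the symmetric subspace commutes with the self-adjoint operators that
commute with the permutations of the registers. -/
theorem symProj_commute {T : Set R} {X : Matrix (R × Fin ℓ → Bool) (R × Fin ℓ → Bool) ℂ}
    (hX : Xᴴ = X) (h : ∀ π : Equiv.Perm R, permMat ℓ π * X = X * permMat ℓ π) :
    symProj ℓ T * X = X * symProj ℓ T := by
  have key : symProj ℓ T * (X * symProj ℓ T) = X * symProj ℓ T := by
    refine Matrix.mulVec_injective (funext fun ψ => ?_)
    rw [← Matrix.mulVec_mulVec]
    have hm : WithLp.toLp 2 ((X * symProj ℓ T).mulVec ψ) ∈ symSubspace ℓ T := by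
      rw [mem_symSubspace_iff]
      intro π hπ
      have := mem_symSubspace_iff.1 (symProj_mem (ℓ := ℓ) T ψ) π hπ
      simp only at this ⊢
      rw [Matrix.mulVec_mulVec, ← Matrix.mul_assoc, h, Matrix.mul_assoc, ← Matrix.mulVec_mulVec,
        ← Matrix.mulVec_mulVec, this, Matrix.mulVec_mulVec]
    exact symProj_mulVec_of_mem (w := (X * symProj ℓ T).mulVec ψ) hm
  -- The range of the projection is mapped into itself by `X`; as both operators are self-adjoint,
  -- the adjoint of this relation gives the other half of commutativity.
  have key' := congrArg Matrix.conjTranspose key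
  rw [Matrix.conjTranspose_mul, Matrix.conjTranspose_mul, hX, symProj_conjTranspose] at key'
  rw [← key', Matrix.mul_assoc, key]

/-! ### The projection onto the symmetric subspace, as a product of lazy transpositions -/

/-- A transposition that is applied with probability `1 / (d + 1)`. -/
def lazySwap (ℓ : ℕ) (d : ℕ) (x y : R) : Matrix (R × Fin ℓ → Bool) (R × Fin ℓ → Bool) ℂ :=
  ((d : ℂ) / (d + 1)) • 1 + (1 / ((d : ℂ) + 1)) • permMat ℓ (Equiv.swap x y)

/-- The product of the lazy transpositions of register `f j` with the registers `f i`, `i < n`. -/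
def lazyRow (ℓ : ℕ) (f : ℕ → R) (j : ℕ) : ℕ → Matrix (R × Fin ℓ → Bool) (R × Fin ℓ → Bool) ℂ
  | 0 => 1
  -- With truncated subtraction `j - (j - n)` is the minimum of `j` and `n`. For `n ≥ j` the factor
  -- exchanges `f j` with itself with probability one, which is the identity. All rows can thus have
  -- the same length, and the program can run through a square of indices.
  | n + 1 => lazySwap ℓ (j - n) (f (j - (j - n))) (f j) * lazyRow ℓ f j n

/-- The product of the first `n` rows of length `N`. -/
def lazyAll (ℓ : ℕ) (f : ℕ → R) (N : ℕ) : ℕ → Matrix (R × Fin ℓ → Bool) (R × Fin ℓ → Bool) ℂ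
  | 0 => 1
  | n + 1 => lazyRow ℓ f n N * lazyAll ℓ f N n

theorem lazySwap_conjTranspose (d : ℕ) (x y : R) : (lazySwap ℓ d x y)ᴴ = lazySwap ℓ d x y := by
  rw [lazySwap, Matrix.conjTranspose_add, Matrix.conjTranspose_smul, Matrix.conjTranspose_smul,
    permMat_conjTranspose, Equiv.swap_inv, Matrix.conjTranspose_one]
  simp

theorem lazySwap_mulVec (d : ℕ) (x y : R) (ψ : (R × Fin ℓ → Bool) → ℂ) :
    (lazySwap ℓ d x y).mulVec ψ = ((d : ℂ) / (d + 1)) • ψ +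
      (1 / ((d : ℂ) + 1)) • (permMat ℓ (Equiv.swap x y)).mulVec ψ := by
  rw [lazySwap, Matrix.add_mulVec, Matrix.smul_mulVec, Matrix.smul_mulVec, Matrix.one_mulVec]

theorem lazySwap_mulVec_of_fixed (d : ℕ) (x y : R) {ψ : (R × Fin ℓ → Bool) → ℂ}
    (h : (permMat ℓ (Equiv.swap x y)).mulVec ψ = ψ) : (lazySwap ℓ d x y).mulVec ψ = ψ := by
  rw [lazySwap_mulVec, h, ← add_smul]
  have : (d : ℂ) + 1 ≠ 0 := Nat.cast_add_one_ne_zero d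
  rw [show (d : ℂ) / (d + 1) + 1 / (d + 1) = 1 by field_simp, one_smul]

/-- Invariance under the transpositions of the first `n` registers. -/
def SwapInvariant (f : ℕ → R) (n : ℕ) (ψ : (R × Fin ℓ → Bool) → ℂ) : Prop :=
  ∀ a < n, ∀ b < n, (permMat ℓ (Equiv.swap (f a) (f b))).mulVec ψ = ψ

variable {f : ℕ → R}

/-- Each lazy transposition is self-adjoint and fixes `w`, so it can be moved to the left side of
the inner product, where it disappears. -/
theorem lazyRow_dot {N j : ℕ} (hj : j < N) {w : (R × Fin ℓ → Bool) → ℂ}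
    (hw : SwapInvariant f N w) (n : ℕ) (ψ : (R × Fin ℓ → Bool) → ℂ) :
    star w ⬝ᵥ (lazyRow ℓ f j n).mulVec ψ = star w ⬝ᵥ ψ := by
  induction n with
  | zero => rw [lazyRow, Matrix.one_mulVec]
  | succ n ih =>
    rw [lazyRow, ← Matrix.mulVec_mulVec, Matrix.dotProduct_mulVec, ← lazySwap_conjTranspose,
      ← Matrix.star_mulVec, lazySwap_mulVec_of_fixed, ih]
    exact hw _ (by omega) _ hj

theorem lazyAll_dot {N : ℕ} {w : (R × Fin ℓ → Bool) → ℂ}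
    (hw : SwapInvariant f N w) (n : ℕ) (hn : n ≤ N) (ψ : (R × Fin ℓ → Bool) → ℂ) :
    star w ⬝ᵥ (lazyAll ℓ f N n).mulVec ψ = star w ⬝ᵥ ψ := by
  induction n with
  | zero => rw [lazyAll, Matrix.one_mulVec]
  | succ n ih =>
    rw [lazyAll, ← Matrix.mulVec_mulVec, lazyRow_dot (by omega) hw, ih (by omega)]

/-- The weights d/(d+1) and 1/(d+1) with d = j - n are those for which the product telescopes to a
uniform average: the next factor leaves the transposed copies collected so far unchanged, and splits
off one transposed copy from the j + 1 - n copies of `w` that are still untouched. -/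
theorem lazyRow_mulVec {N j : ℕ} (hj : j < N) (hf : ∀ a < N, ∀ b < N, f a = f b → a = b)
    {w : (R × Fin ℓ → Bool) → ℂ} (hw : SwapInvariant f j w) (n : ℕ) (hn : n ≤ j) :
    (lazyRow ℓ f j n).mulVec w = (1 / ((j : ℂ) + 1)) •
      ((∑ i ∈ Finset.range n, (permMat ℓ (Equiv.swap (f i) (f j))).mulVec w) +
        ((j + 1 - n : ℕ) : ℂ) • w) := by
  have hj0 : (j : ℂ) + 1 ≠ 0 := Nat.cast_add_one_ne_zero j
  induction n with
  | zero =>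
    rw [lazyRow, Matrix.one_mulVec, Finset.range_zero, Finset.sum_empty, zero_add, smul_smul]
    push_cast
    rw [one_div, inv_mul_cancel₀ hj0, one_smul]
  | succ n ih =>
    have e1 : j - (j - n) = n := by omega
    rw [lazyRow, e1, ← Matrix.mulVec_mulVec, ih (by omega), Matrix.mulVec_smul,
      Matrix.mulVec_add, Matrix.mulVec_smul]
    congr 1
    have e2 : (lazySwap ℓ (j - n) (f n) (f j)).mulVec
        (∑ i ∈ Finset.range n, (permMat ℓ (Equiv.swap (f i) (f j))).mulVec w) =
        ∑ i ∈ Finset.range n, (permMat ℓ (Equiv.swap (f i) (f j))).mulVec w := by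
      apply lazySwap_mulVec_of_fixed
      rw [Matrix.mulVec_sum]
      refine Finset.sum_congr rfl fun i hi => ?_
      rw [Finset.mem_range] at hi
      rw [Matrix.mulVec_mulVec, permMat_mul]
      have h1 : f i ≠ f n := fun h => by have := hf i (by omega) n (by omega) h; omega
      have h2 : f i ≠ f j := fun h => by have := hf i (by omega) j (by omega) h; omega
      have h3 : f n ≠ f j := fun h => by have := hf n (by omega) j (by omega) h; omega
      -- The relation (n j)(i j) = (i j)(n i); the transposition on the right is absorbed by `w`,
      -- which is invariant under it.
      have : Equiv.swap (f n) (f j) * Equiv.swap (f i) (f j) =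
          Equiv.swap (f i) (f j) * Equiv.swap (f n) (f i) := by
        ext x
        simp only [Equiv.Perm.mul_apply, Equiv.swap_apply_def]
        split_ifs <;> simp_all
      rw [this, ← permMat_mul, ← Matrix.mulVec_mulVec, hw n (by omega) i (by omega)]
    rw [e2, Finset.sum_range_succ, add_assoc]
    congr 1
    rw [lazySwap_mulVec, smul_add, smul_smul, smul_smul, add_comm]
    have e3 : ((j + 1 - n : ℕ) : ℂ) = ((j - n : ℕ) : ℂ) + 1 := by
      rw [show j + 1 - n = j - n + 1 by omega]; push_cast; rfl
    have e4 : ((j - n : ℕ) : ℂ) + 1 ≠ 0 := Nat.cast_add_one_ne_zero _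
    rw [e3, mul_one_div_cancel e4, one_smul, mul_div_cancel₀ _ e4]
    rw [show j - n = j + 1 - (n + 1) by omega]

theorem lazyRow_mulVec_of_le {j : ℕ} (ψ : (R × Fin ℓ → Bool) → ℂ) (n : ℕ) (hn : j ≤ n) :
    (lazyRow ℓ f j n).mulVec ψ = (lazyRow ℓ f j j).mulVec ψ := by
  induction n, hn using Nat.le_induction with
  | base => rfl
  | succ n hn ih =>
    rw [lazyRow, ← Matrix.mulVec_mulVec, ih, lazySwap_mulVec_of_fixed]
    rw [show j - (j - n) = j by omega, Equiv.swap_self, ← Equiv.Perm.one_def, permMat_one,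
      Matrix.one_mulVec]

/-- The transpositions of `f j` with `f 0, …, f j` represent the cosets of the symmetric group on
the first `j` registers in the one on the first `j + 1`. Averaging a vector that is invariant under
the smaller group over these representatives makes it invariant under the larger one. -/
theorem swapInvariant_lazyRow {N j : ℕ} (hj : j < N)
    (hf : ∀ a < N, ∀ b < N, f a = f b → a = b)
    {w : (R × Fin ℓ → Bool) → ℂ} (hw : SwapInvariant f j w) :
    SwapInvariant f (j + 1) ((lazyRow ℓ f j N).mulVec w) := by
  rw [lazyRow_mulVec_of_le _ _ hj.le, lazyRow_mulVec hj hf hw _ le_rfl]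
  have e : (∑ i ∈ Finset.range j, (permMat ℓ (Equiv.swap (f i) (f j))).mulVec w) +
        ((j + 1 - j : ℕ) : ℂ) • w =
      ∑ i ∈ Finset.range (j + 1), (permMat ℓ (Equiv.swap (f i) (f j))).mulVec w := by
    rw [Finset.sum_range_succ, Equiv.swap_self, ← Equiv.Perm.one_def, permMat_one,
      Matrix.one_mulVec]
    simp
  rw [e]
  have hw' : ∀ a < j, ∀ b < j, permMat ℓ (Equiv.swap (f a) (f b)) *ᵥ w = w := hw
  have key : ∀ a < j, ∀ b < j + 1, (permMat ℓ (Equiv.swap (f a) (f b))).mulVec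
      (∑ i ∈ Finset.range (j + 1), (permMat ℓ (Equiv.swap (f i) (f j))).mulVec w) =
      ∑ i ∈ Finset.range (j + 1), (permMat ℓ (Equiv.swap (f i) (f j))).mulVec w := by
    intro a ha b hb
    rw [Matrix.mulVec_sum]
    refine Finset.sum_nbij' (Equiv.swap a b) (Equiv.swap a b) ?_ ?_ (fun _ _ => by simp)
      (fun _ _ => by simp) ?_
    · intro i hi
      rw [Finset.mem_range] at hi ⊢
      rw [Equiv.swap_apply_def]
      split_ifs <;> omega
    · intro i hi
      rw [Finset.mem_range] at hi ⊢
      rw [Equiv.swap_apply_def]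
      split_ifs <;> omega
    · intro i hi
      rw [Finset.mem_range] at hi
      rw [Matrix.mulVec_mulVec, permMat_mul]
      have inj : ∀ x < j + 1, ∀ y < j + 1, (f x = f y ↔ x = y) := fun x hx y hy =>
        ⟨hf x (by omega) y (by omega), fun h => h ▸ rfl⟩
      -- Left multiplication by the transposition of `a` and `b` permutes the cosets: the
      -- representative of `i` moves to that of the exchanged index, and the correction is a
      -- transposition among the first `j` registers.
      have hs : ∃ c < j, ∃ d < j, Equiv.swap (f a) (f b) * Equiv.swap (f i) (f j) =
          Equiv.swap (f (Equiv.swap a b i)) (f j) * Equiv.swap (f c) (f d) := by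
        rcases eq_or_ne a b with rfl | hab
        · exact ⟨a, ha, a, ha, by simp [← Equiv.Perm.one_def]⟩
        rcases (Nat.lt_succ_iff_lt_or_eq.1 hb) with hb' | rfl
        · refine ⟨a, ha, b, hb', ?_⟩
          rw [Equiv.mul_swap_eq_swap_mul]
          have h1 : Equiv.swap (f a) (f b) (f i) = f (Equiv.swap a b i) := by
            simp only [Equiv.swap_apply_def, inj i hi a (by omega), inj i hi b hb]
            split_ifs <;> rfl
          have h2 : Equiv.swap (f a) (f b) (f j) = f j := by
            apply Equiv.swap_apply_of_ne_of_ne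
            · rw [Ne, inj _ (by omega) _ (by omega)]; omega
            · rw [Ne, inj _ (by omega) _ (by omega)]; omega
          rw [h1, h2]
        · rcases eq_or_ne i a with rfl | hia
          · refine ⟨i, ha, i, ha, ?_⟩
            rw [Equiv.swap_apply_left]
            simp [← Equiv.Perm.one_def]
          · rcases eq_or_ne i b with rfl | hib
            · refine ⟨a, ha, a, ha, ?_⟩
              rw [Equiv.swap_apply_right]
              simp [← Equiv.Perm.one_def]
            · refine ⟨a, ha, i, by omega, ?_⟩
              rw [Equiv.swap_apply_of_ne_of_ne hia hib]
              have h1 : f i ≠ f a := by rwa [Ne, inj i hi a (by omega)]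
              have h2 : f i ≠ f b := by rwa [Ne, inj i hi b (by omega)]
              have h3 : f a ≠ f b := by rwa [Ne, inj a (by omega) b (by omega)]
              ext x
              simp only [Equiv.Perm.mul_apply, Equiv.swap_apply_def]
              split_ifs <;> simp_all
      obtain ⟨c, hc, d, hd, h⟩ := hs
      rw [h, ← permMat_mul, ← Matrix.mulVec_mulVec, hw' c hc d hd]
  intro a ha b hb
  rw [Matrix.mulVec_smul]
  congr 1
  rcases (Nat.lt_succ_iff_lt_or_eq.1 ha) with ha' | rfl
  · exact key a ha' b hb
  · rcases (Nat.lt_succ_iff_lt_or_eq.1 hb) with hb' | rfl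
    · rw [Equiv.swap_comm]; exact key b hb' a ha
    · rw [Equiv.swap_self, ← Equiv.Perm.one_def, permMat_one, Matrix.one_mulVec]

theorem swapInvariant_lazyAll {N : ℕ} (hf : ∀ a < N, ∀ b < N, f a = f b → a = b)
    (ψ : (R × Fin ℓ → Bool) → ℂ) (n : ℕ) (hn : n ≤ N) :
    SwapInvariant f n ((lazyAll ℓ f N n).mulVec ψ) := by
  induction n with
  | zero => intro a ha; omega
  | succ n ih =>
    rw [lazyAll, ← Matrix.mulVec_mulVec]
    exact swapInvariant_lazyRow (by omega) hf (ih (by omega))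

/-- Transpositions generate the group. The induction is on the size of the support: multiplying `π`
by the transposition of `x` and `π x` makes its support smaller. -/
theorem mem_symSubspace_of_swapInvariant {N : ℕ} {ψ : (R × Fin ℓ → Bool) → ℂ}
    (h : SwapInvariant f N ψ) :
    WithLp.toLp 2 ψ ∈ symSubspace ℓ {ρ | ∃ i < N, f i = ρ} := by
  rw [mem_symSubspace_iff]
  have : ∀ n (π : Equiv.Perm R), π.support.card = n →
      (∀ ρ, ρ ∉ {ρ | ∃ i < N, f i = ρ} → π ρ = ρ) → (permMat ℓ π).mulVec ψ = ψ := by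
    intro n
    induction n using Nat.strong_induction_on with
    | _ n ih =>
      intro π hn hπ
      by_cases h1 : π = 1
      · rw [h1, permMat_one, Matrix.one_mulVec]
      · obtain ⟨x, hx⟩ : ∃ x, π x ≠ x := by
          by_contra hcon
          push Not at hcon
          exact h1 (Equiv.ext hcon)
        have hx' : x ∈ {ρ | ∃ i < N, f i = ρ} := by
          by_contra hcon; exact hx (hπ x hcon)
        have hy' : π x ∈ {ρ | ∃ i < N, f i = ρ} := by
          by_contra hcon; exact hx (π.injective (hπ _ hcon))
        have h2 := Equiv.Perm.card_support_swap_mul hx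
        have h3 := ih _ (hn ▸ h2) (Equiv.swap x (π x) * π) rfl (fun ρ hρ => by
          rw [Equiv.Perm.mul_apply, hπ ρ hρ, Equiv.swap_apply_of_ne_of_ne]
          · rintro rfl; exact hρ hx'
          · rintro rfl; exact hρ hy')
        obtain ⟨i, hi, hfi⟩ := hx'
        obtain ⟨j, hj, hfj⟩ := hy'
        have h4 := h i hi j hj
        rw [hfi, hfj] at h4
        rw [← permMat_mul, ← Matrix.mulVec_mulVec] at h3
        have h5 := congrArg (permMat ℓ (Equiv.swap x (π x))).mulVec h3
        rw [Matrix.mulVec_mulVec, permMat_mul, Equiv.swap_mul_self, permMat_one,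
          Matrix.one_mulVec, h4] at h5
        exact h5
  exact fun π hπ => this _ π rfl hπ

/-- The factors need not be projections themselves. The product is identified by two properties: its
values are symmetric, symmetry being built up row by row, and it preserves inner products with
symmetric vectors. -/
theorem symProj_eq_lazyAll {N : ℕ} (hf : ∀ a < N, ∀ b < N, f a = f b → a = b) :
    symProj ℓ {ρ | ∃ i < N, f i = ρ} = lazyAll ℓ f N N := by
  refine symProj_eq_of (fun ψ => ?_) fun w hw ψ => ?_
  · exact mem_symSubspace_of_swapInvariant (swapInvariant_lazyAll hf ψ N le_rfl)
  · refine lazyAll_dot ?_ N le_rfl ψ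
    intro a ha b hb
    refine mem_symSubspace_iff.1 hw _ fun ρ hρ => Equiv.swap_apply_of_ne_of_ne ?_ ?_
    · rintro rfl; exact hρ ⟨a, ha, rfl⟩
    · rintro rfl; exact hρ ⟨b, hb, rfl⟩

end Registers

/-! ### Symmetric vectors and the number of accepted registers: the probability bound for the test
-/

section Counting

open scoped ComplexConjugate Matrix

variable {R : Type} [Fintype R] [DecidableEq R] {ℓ : ℕ}

/-! ### Norms of vectors of amplitudes -/

/-- The squared Euclidean norm. -/
def nsq {β : Type} [Fintype β] (ψ : β → ℂ) : ℝ := ∑ b, ‖ψ b‖ ^ 2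

section Nsq

variable {β γ : Type} [Fintype β] [Fintype γ]

theorem nsq_nonneg (ψ : β → ℂ) : 0 ≤ nsq ψ := Finset.sum_nonneg fun _ _ => by positivity

theorem nsq_eq_dot (ψ : β → ℂ) : (nsq ψ : ℂ) = star ψ ⬝ᵥ ψ := by
  rw [nsq, dotProduct, Complex.ofReal_sum]
  refine Finset.sum_congr rfl fun b _ => ?_
  rw [Pi.star_apply, ← Complex.normSq_eq_norm_sq, Complex.normSq_eq_conj_mul_self]
  rfl

theorem nsq_mulVec (K : Matrix γ β ℂ) (ψ : β → ℂ) :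
    (nsq (K.mulVec ψ) : ℂ) = star ψ ⬝ᵥ (Kᴴ * K).mulVec ψ := by
  rw [nsq_eq_dot, Matrix.star_mulVec, ← Matrix.mulVec_mulVec, Matrix.dotProduct_mulVec,
    Matrix.dotProduct_mulVec, Matrix.dotProduct_mulVec]

theorem nsq_mulVec_proj {X : Matrix β β ℂ} (h1 : Xᴴ = X) (h2 : X * X = X) (ψ : β → ℂ) :
    (nsq (X.mulVec ψ) : ℂ) = star ψ ⬝ᵥ X.mulVec ψ := by
  rw [nsq_mulVec, h1, h2]

theorem norm_dot_sq_le (φ ψ : β → ℂ) : ‖star φ ⬝ᵥ ψ‖ ^ 2 ≤ nsq φ * nsq ψ := by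
  have h := norm_inner_le_norm (𝕜 := ℂ) (WithLp.toLp 2 φ : EuclideanSpace ℂ β) (WithLp.toLp 2 ψ)
  rw [EuclideanSpace.inner_eq_star_dotProduct, dotProduct_comm] at h
  have h1 : ∀ φ : β → ℂ, ‖(WithLp.toLp 2 φ : EuclideanSpace ℂ β)‖ ^ 2 = nsq φ := fun φ => by
    rw [EuclideanSpace.norm_sq_eq]; rfl
  rw [← h1, ← h1, ← mul_pow]
  exact pow_le_pow_left₀ (norm_nonneg _) h 2

end Nsq

variable {V : Matrix (Fin ℓ → Bool) (Fin ℓ → Bool) ℂ}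

/-- The projection for a set of outcomes of the measurement of all registers. -/
def projOn (V : Matrix (Fin ℓ → Bool) (Fin ℓ → Bool) ℂ) (s : Finset (R → Bool)) :
    Matrix (R × Fin ℓ → Bool) (R × Fin ℓ → Bool) ℂ := ∑ a ∈ s, measureEach V a

theorem projOn_mul (hV : IsStarProjection V) (s t : Finset (R → Bool)) :
    projOn V s * projOn V t = projOn V (s ∩ t) := by
  rw [projOn, projOn, projOn, Finset.sum_mul_sum, ← Finset.sum_filter_add_sum_filter_not s (· ∈ t),
    ← Finset.filter_mem_eq_inter]
  have h1 : ∀ a, ∑ j ∈ t, measureEach V a * measureEach V j =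
      if a ∈ t then measureEach V a else 0 := by
    intro a
    rw [← Finset.sum_ite_eq t a fun _ => measureEach V a]
    refine Finset.sum_congr rfl fun b _ => ?_
    split_ifs with h
    · rw [h, measureEach_mul_self hV]
    · exact measureEach_mul_of_ne hV h
  simp only [h1]
  rw [add_eq_left.2]
  · refine Finset.sum_congr rfl fun a ha => ?_
    rw [if_pos (Finset.mem_filter.1 ha).2]
  · refine Finset.sum_eq_zero fun a ha => ?_
    rw [if_neg (Finset.mem_filter.1 ha).2]

theorem projOn_conjTranspose (hV : IsStarProjection V) (s : Finset (R → Bool)) :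
    (projOn V s)ᴴ = projOn V s := by
  rw [projOn, Matrix.conjTranspose_sum]
  simp only [measureEach_conjTranspose hV]

theorem nsq_projOn (hV : IsStarProjection V) (s : Finset (R → Bool))
    (ψ : (R × Fin ℓ → Bool) → ℂ) :
    nsq ((projOn V s).mulVec ψ) = ∑ a ∈ s, nsq ((measureEach V a).mulVec ψ) := by
  have h : (nsq ((projOn V s).mulVec ψ) : ℂ) =
      ((∑ a ∈ s, nsq ((measureEach V a).mulVec ψ) : ℝ) : ℂ) := by
    rw [nsq_mulVec_proj (projOn_conjTranspose hV s) (by rw [projOn_mul hV, Finset.inter_self]),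
      Complex.ofReal_sum]
    simp only [nsq_mulVec_proj (measureEach_conjTranspose hV _) (measureEach_mul_self hV _)]
    rw [projOn, Matrix.sum_mulVec, dotProduct_sum]
  exact_mod_cast h

theorem sum_nsq_measureEach (hV : IsStarProjection V) (ψ : (R × Fin ℓ → Bool) → ℂ) :
    ∑ a : R → Bool, nsq ((measureEach V a).mulVec ψ) = nsq ψ := by
  rw [← nsq_projOn hV, projOn, measureEach_sum, Matrix.one_mulVec]

theorem permMat_mul_projOn (s : Finset (R → Bool)) (π : Equiv.Perm R)
    (hs : ∀ a, a ∘ π ∈ s ↔ a ∈ s) : permMat ℓ π * projOn V s = projOn V s * permMat ℓ π := by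
  rw [projOn, Finset.mul_sum, Finset.sum_mul]
  refine Finset.sum_nbij' (fun a => a ∘ π.symm) (fun a => a ∘ π) ?_ ?_ ?_ ?_ ?_
  · intro a ha
    rw [← hs]
    convert ha
    funext ρ; simp
  · intro a ha; exact (hs a).2 ha
  · intro a _; funext ρ; simp
  · intro a _; funext ρ; simp
  · intro a _
    rw [← permMat_mul_measureEach]
    congr 2
    funext ρ; simp

theorem numTrue_comp (a : R → Bool) (π : Equiv.Perm R) : numTrue (a ∘ π) = numTrue a := by
  rw [numTrue, numTrue]
  refine Finset.card_bij (fun ρ _ => π ρ) ?_ ?_ ?_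
  · intro ρ hρ; simpa using hρ
  · intro a _ b _ h; exact π.injective h
  · intro ρ hρ; exact ⟨π.symm ρ, by simpa using hρ, by simp⟩

theorem numTrue_le (a : R → Bool) : numTrue a ≤ Fintype.card R := Finset.card_le_univ _

/-- The outcomes with a given number of accepted registers. -/
def countSet (R : Type) [Fintype R] [DecidableEq R] (J : ℕ) : Finset (R → Bool) :=
  Finset.univ.filter fun a => numTrue a = J

theorem mem_countSet {J : ℕ} {a : R → Bool} : a ∈ countSet R J ↔ numTrue a = J := by
  simp [countSet]

theorem nsq_permMat (π : Equiv.Perm R) (ψ : (R × Fin ℓ → Bool) → ℂ) :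
    nsq ((permMat ℓ π).mulVec ψ) = nsq ψ := by
  have h : (nsq ((permMat ℓ π).mulVec ψ) : ℂ) = (nsq ψ : ℂ) := by
    rw [nsq_mulVec, permMat_conjTranspose, permMat_mul, inv_mul_cancel, permMat_one,
      Matrix.one_mulVec, nsq_eq_dot]
  exact_mod_cast h

theorem exists_perm_of_numTrue_eq {a a' : R → Bool} (h : numTrue a = numTrue a') :
    ∃ π : Equiv.Perm R, a' ∘ π = a := by
  have h' : Fintype.card {ρ // a ρ = true} = Fintype.card {ρ // a' ρ = true} := by
    rw [Fintype.card_subtype, Fintype.card_subtype]; exact h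
  obtain e := Fintype.equivOfCardEq h'
  refine ⟨e.extendSubtype, ?_⟩
  funext ρ
  by_cases hρ : a ρ = true
  · rw [Function.comp_apply, hρ]
    exact e.extendSubtype_mem ρ hρ
  · rw [Function.comp_apply]
    have := e.extendSubtype_not_mem ρ hρ
    simp only [Bool.not_eq_true] at hρ this
    rw [hρ, this]

/-- A symmetric vector gives all outcomes with the same count the same weight. -/
theorem nsq_measureEach_eq_of_symmetric {φ : (R × Fin ℓ → Bool) → ℂ}
    (hφ : ∀ π : Equiv.Perm R, (permMat ℓ π).mulVec φ = φ) {a a' : R → Bool}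
    (h : numTrue a = numTrue a') :
    nsq ((measureEach V a).mulVec φ) = nsq ((measureEach V a').mulVec φ) := by
  obtain ⟨π, rfl⟩ := exists_perm_of_numTrue_eq h
  rw [← nsq_permMat π, Matrix.mulVec_mulVec, permMat_mul_measureEach, ← Matrix.mulVec_mulVec, hφ]

theorem card_countSet (J : ℕ) : (Fintype.card R).choose J ≤ (countSet R J).card := by
  rw [← Finset.card_univ, ← Finset.card_powersetCard]
  refine Finset.card_le_card_of_injOn (fun s ρ => decide (ρ ∈ s)) ?_ ?_
  · intro s hs
    have hs := Finset.mem_powersetCard.1 hs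
    rw [Finset.mem_coe, mem_countSet, numTrue]
    simp [hs.2]
  · intro s _ t _ h
    ext ρ
    have := congrFun h ρ
    simpa using this

/-- The outcomes where all registers of a given set are accepted. -/
def acceptSet (W : Finset R) : Finset (R → Bool) := Finset.univ.filter fun a => ∀ ρ ∈ W, a ρ = true

theorem card_acceptSet_inter (W : Finset R) (J : ℕ) :
    (acceptSet W ∩ countSet R J).card ≤ (Fintype.card R - W.card).choose (J - W.card) := by
  rw [← Finset.card_univ, ← Finset.card_sdiff_of_subset (Finset.subset_univ W),
    ← Finset.card_powersetCard]
  refine Finset.card_le_card_of_injOn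
    (fun a => (Finset.univ.filter fun ρ => a ρ = true) \ W) ?_ ?_
  · intro a ha
    rw [Finset.mem_coe, Finset.mem_inter, acceptSet, Finset.mem_filter, mem_countSet] at ha
    rw [Finset.mem_coe, Finset.mem_powersetCard]
    refine ⟨Finset.sdiff_subset_sdiff (Finset.subset_univ _) le_rfl, ?_⟩
    rw [Finset.card_sdiff_of_subset, ← ha.2, numTrue]
    intro ρ hρ
    simpa using ha.1.2 ρ hρ
  · intro a ha a' ha' h
    rw [Finset.mem_coe, Finset.mem_inter, acceptSet, Finset.mem_filter] at ha ha'
    funext ρ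
    by_cases hρ : ρ ∈ W
    · rw [ha.1.2 ρ hρ, ha'.1.2 ρ hρ]
    · have := congrArg (ρ ∈ ·) h
      simp only [Finset.mem_sdiff, Finset.mem_filter, Finset.mem_univ, true_and, hρ,
        not_false_eq_true, and_true, eq_iff_iff] at this
      rwa [Bool.eq_iff_iff]

theorem permMat_symProj (π : Equiv.Perm R) (ψ : (R × Fin ℓ → Bool) → ℂ) :
    (permMat ℓ π).mulVec ((symProj ℓ Set.univ).mulVec ψ) = (symProj ℓ Set.univ).mulVec ψ :=
  mem_symSubspace_iff.1 (symProj_mem (ℓ := ℓ) Set.univ ψ) π fun _ hρ => absurd trivial hρ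

theorem symProj_projOn_countSet (hV : IsStarProjection V) (T : Set R) (J : ℕ) :
    symProj ℓ T * projOn V (countSet R J) = projOn V (countSet R J) * symProj ℓ T :=
  symProj_commute (projOn_conjTranspose hV _) fun π =>
    permMat_mul_projOn _ π fun a => by rw [mem_countSet, mem_countSet, numTrue_comp]

/-- The projected vector gives equal weight to all outcomes with `J` acceptances, but `Φ` itself
only involves outcomes in which the registers of `W` are accepted. In the Cauchy-Schwarz inequality
one may therefore restrict the projected vector to such outcomes, and the ratio of the numbers of
outcomes remains. -/
theorem nsq_symProj_count_le (hV : IsStarProjection V) (W : Finset R) (J : ℕ)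
    {Φ : (R × Fin ℓ → Bool) → ℂ} (hΦ : (projOn V (acceptSet W)).mulVec Φ = Φ)
    (hJ : (projOn V (countSet R J)).mulVec Φ = Φ) :
    nsq ((symProj ℓ Set.univ).mulVec Φ) * (Fintype.card R).choose J ≤
      (Fintype.card R - W.card).choose (J - W.card) * nsq Φ := by
  set φ := (symProj ℓ (Set.univ : Set R)).mulVec Φ with hφ
  have hφJ : (projOn V (countSet R J)).mulVec φ = φ := by
    rw [hφ, Matrix.mulVec_mulVec, ← symProj_projOn_countSet hV, ← Matrix.mulVec_mulVec, hJ]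
  rcases (nsq_nonneg φ).eq_or_lt with h0 | h0
  · rw [← h0, zero_mul]
    exact mul_nonneg (Nat.cast_nonneg _) (nsq_nonneg _)
  -- By symmetry all outcomes with the same count have a common weight `c`, so that norms of `φ` are
  -- computed by counting outcomes. The value for an empty set of outcomes is arbitrary.
  obtain ⟨c, hc⟩ : ∃ c : ℝ, ∀ a ∈ countSet R J, nsq ((measureEach V a).mulVec φ) = c := by
    by_cases hne : (countSet R J).Nonempty
    · obtain ⟨a, ha⟩ := hne
      refine ⟨nsq ((measureEach V a).mulVec φ), fun a' ha' => ?_⟩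
      rw [mem_countSet] at ha ha'
      exact nsq_measureEach_eq_of_symmetric (fun π => permMat_symProj π Φ) (ha'.trans ha.symm)
    · exact ⟨0, fun a ha => absurd ⟨a, ha⟩ hne⟩
  have h1 : nsq φ = (countSet R J).card * c := by
    conv_lhs => rw [← hφJ]
    rw [nsq_projOn hV, Finset.sum_congr rfl hc, Finset.sum_const, nsmul_eq_mul]
  have hc0 : 0 < c := by
    by_contra hcon
    push Not at hcon
    have : nsq φ ≤ 0 := by
      rw [h1]; exact mul_nonpos_of_nonneg_of_nonpos (Nat.cast_nonneg _) hcon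
    linarith
  have h2 : nsq ((projOn V (acceptSet W)).mulVec φ) = (acceptSet W ∩ countSet R J).card * c := by
    conv_lhs => rw [← hφJ]
    rw [Matrix.mulVec_mulVec, projOn_mul hV, nsq_projOn hV,
      Finset.sum_congr rfl fun a ha => hc a (Finset.mem_inter.1 ha).2, Finset.sum_const,
      nsmul_eq_mul]
  -- Writing P for the symmetric projection and Q for acceptance on `W`: ⟨φ,φ⟩ = ⟨φ,Φ⟩ because φ =
  -- PΦ, and ⟨φ,Φ⟩ = ⟨Qφ,Φ⟩ because QΦ = Φ.
  have h3 : (nsq φ : ℂ) = star ((projOn V (acceptSet W)).mulVec φ) ⬝ᵥ Φ := by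
    rw [Matrix.star_mulVec, projOn_conjTranspose hV, ← Matrix.dotProduct_mulVec, hΦ, hφ,
      nsq_mulVec_proj (symProj_conjTranspose _) (symProj_mul_self _), Matrix.star_mulVec,
      symProj_conjTranspose, ← Matrix.dotProduct_mulVec]
  have h4 := norm_dot_sq_le ((projOn V (acceptSet W)).mulVec φ) Φ
  rw [← h3, Complex.norm_real, Real.norm_of_nonneg h0.le, h2] at h4
  have h5 : ((acceptSet W ∩ countSet R J).card : ℝ) ≤
      ((Fintype.card R - W.card).choose (J - W.card) : ℕ) := by
    exact_mod_cast card_acceptSet_inter W J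
  have h6 : ((Fintype.card R).choose J : ℝ) ≤ (countSet R J).card := by
    exact_mod_cast card_countSet (R := R) J
  have h7 : ((Fintype.card R).choose J : ℝ) * c ≤ nsq φ := by rw [h1]; gcongr
  have h8 : nsq φ ^ 2 ≤ ((Fintype.card R - W.card).choose (J - W.card) : ℕ) * c * nsq Φ :=
    h4.trans (by have := nsq_nonneg Φ; gcongr)
  have h9 : nsq φ * ((Fintype.card R).choose J : ℝ) * c ≤
      ((Fintype.card R - W.card).choose (J - W.card) : ℕ) * nsq Φ * c := by
    nlinarith
  exact le_of_mul_le_mul_right h9 hc0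

/-! ### A bound for binomial coefficients -/

/-- The averages of the initial segments of an increasing sequence are increasing; this is the
convexity of its partial sums in a form without division. -/
theorem mul_sum_le_of_monotone {g : ℕ → ℕ} (hg : Monotone g) {j M : ℕ} (h : j ≤ M) :
    M * ∑ i ∈ Finset.range j, g i ≤ j * ∑ i ∈ Finset.range M, g i := by
  induction M, h using Nat.le_induction with
  | base => exact le_rfl
  | succ M hM ih =>
    rw [Finset.sum_range_succ, add_mul, mul_add, one_mul]
    have : ∑ i ∈ Finset.range j, g i ≤ j * g M := by
      calc ∑ i ∈ Finset.range j, g i ≤ ∑ _i ∈ Finset.range j, g M :=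
            Finset.sum_le_sum fun i hi => hg (by have := Finset.mem_range.1 hi; omega)
        _ = j * g M := by simp
    exact Nat.add_le_add ih this

theorem choose_add_eq_sum (k j : ℕ) :
    (k + 1 + j).choose (k + 1) = 1 + ∑ i ∈ Finset.range j, (k + 1 + i).choose k := by
  induction j with
  | zero => simp
  | succ j ih =>
    rw [Finset.sum_range_succ, ← add_assoc 1, ← ih, ← add_assoc, Nat.choose_succ_succ, add_comm]

/-- By the hockey-stick identity the binomial coefficient has the increments C(k+1+i,k), which
increase with i. It is thus convex in j and lies below its chord over [0,M]; the constant term of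
the chord is enlarged from M - j to M. -/
theorem choose_convex (k j M : ℕ) (h : j ≤ M) :
    M * (k + 1 + j).choose (k + 1) ≤ j * (k + 1 + M).choose (k + 1) + M := by
  rw [choose_add_eq_sum, choose_add_eq_sum, mul_add, mul_add]
  have := mul_sum_le_of_monotone (g := fun i => (k + 1 + i).choose k)
    (fun a b hab => Nat.choose_le_choose k (by omega)) h
  omega

theorem two_pow_le_choose (k M : ℕ) (h : k ≤ M) : 2 ^ k ≤ (k + M).choose k := by
  have h2 : ∀ k, 2 ^ k ≤ (k + k).choose k := by
    intro k
    induction k with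
    | zero => simp
    | succ k ih =>
      have := Nat.succ_mul_centralBinom_succ k
      rw [Nat.centralBinom, Nat.centralBinom] at this
      have e : k + 1 + (k + 1) = 2 * (k + 1) := by ring
      have e' : k + k = 2 * k := by ring
      rw [e, pow_succ]
      rw [e'] at ih
      nlinarith
  exact (h2 k).trans (Nat.choose_le_choose k (by omega))

/-- The identity C(κ+M,κ+j)·C(κ+j,κ) = C(κ+M,κ)·C(M,j) turns the ratio into C(κ+j,κ)/C(κ+M,κ), whose
numerator is convex in j. The chord contributes j/M, and its constant term is divided by a binomial
coefficient that is at least 2^κ because M ≥ κ. -/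
theorem choose_ratio_le {κ M j : ℕ} (hκ : 0 < κ) (hM : κ ≤ M) (hj : j ≤ M) :
    (M.choose j : ℝ) ≤ ((κ + M).choose (κ + j) : ℝ) * ((j : ℝ) / M + (1 / 2) ^ κ) := by
  obtain ⟨k, rfl⟩ : ∃ k, κ = k + 1 := ⟨κ - 1, by omega⟩
  have h1 : (k + 1 + M).choose (k + 1 + j) * (k + 1 + j).choose (k + 1) =
      (k + 1 + M).choose (k + 1) * M.choose j := by
    have := Nat.choose_mul (n := k + 1 + M) (k := k + 1 + j) (s := k + 1) (by omega)
    rw [this]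
    congr 2 <;> omega
  have h2 := choose_convex k j M hj
  have h3 := two_pow_le_choose (k + 1) M hM
  have hMpos : (0 : ℝ) < M := by exact_mod_cast (by omega : 0 < M)
  have h1' : ((k + 1 + M).choose (k + 1 + j) : ℝ) * (k + 1 + j).choose (k + 1) =
      (k + 1 + M).choose (k + 1) * M.choose j := by exact_mod_cast h1
  have h2' : (M : ℝ) * (k + 1 + j).choose (k + 1) ≤ j * (k + 1 + M).choose (k + 1) + M := by
    exact_mod_cast h2
  have h3' : (2 : ℝ) ^ (k + 1) ≤ (k + 1 + M).choose (k + 1) := by exact_mod_cast h3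
  set F : ℝ := (((k + 1 + M).choose (k + 1) : ℕ) : ℝ)
  have hF : 0 < F := lt_of_lt_of_le (by positivity) h3'
  have h4 : ((k + 1 + j).choose (k + 1) : ℝ) ≤ F * (j / M + (1 / 2) ^ (k + 1)) := by
    have : ((k + 1 + j).choose (k + 1) : ℝ) ≤ (j * F + M) / M := by
      rw [le_div_iff₀ hMpos, mul_comm]; exact h2'
    refine this.trans ?_
    rw [add_div, div_self hMpos.ne', mul_add]
    have h5 : (1 : ℝ) ≤ F * (1 / 2) ^ (k + 1) := by
      rw [one_div, inv_pow, ← div_eq_mul_inv, le_div_iff₀ (by positivity), one_mul]; exact h3'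
    have h6 : (j : ℝ) * F / M = F * (j / M) := by ring
    linarith
  have h7 : F * (M.choose j : ℝ) ≤ F * (((k + 1 + M).choose (k + 1 + j) : ℝ) *
      ((j : ℝ) / M + (1 / 2) ^ (k + 1))) := by
    rw [← h1']
    calc ((k + 1 + M).choose (k + 1 + j) : ℝ) * (k + 1 + j).choose (k + 1)
        ≤ ((k + 1 + M).choose (k + 1 + j) : ℝ) * (F * (j / M + (1 / 2) ^ (k + 1))) := by gcongr
      _ = _ := by ring
  exact le_of_mul_le_mul_left h7 hF

/-- The probability of passing the symmetric subspace test, if the registers in `W` hold coins, is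
at most the expected fraction of accepted registers among the others, up to an exponentially small
error. -/
theorem nsq_symProj_le (hV : IsStarProjection V) (W : Finset R) {M : ℕ} (hW : 0 < W.card)
    (hM : Fintype.card R = W.card + M) (hWM : W.card ≤ M)
    {Φ : (R × Fin ℓ → Bool) → ℂ} (hΦ : (projOn V (acceptSet W)).mulVec Φ = Φ) :
    nsq ((symProj ℓ Set.univ).mulVec Φ) ≤ ∑ a : R → Bool,
      (((numTrue a : ℝ) - W.card) / M + (1 / 2) ^ W.card) * nsq ((measureEach V a).mulVec Φ) := by
  have hsplit : ∀ (ψ : (R × Fin ℓ → Bool) → ℂ) (g : ℕ → ℝ),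
      ∑ a : R → Bool, g (numTrue a) * nsq ((measureEach V a).mulVec ψ) =
      ∑ J ∈ Finset.range (Fintype.card R + 1),
        g J * nsq ((projOn V (countSet R J)).mulVec ψ) := by
    intro ψ g
    rw [← Finset.sum_fiberwise_of_maps_to (s := Finset.univ) (t := Finset.range (Fintype.card R + 1))
      (g := fun a : R → Bool => numTrue a)
      (fun a _ => Finset.mem_range.2 (Nat.lt_succ_of_le (numTrue_le a)))]
    refine Finset.sum_congr rfl fun J _ => ?_
    rw [nsq_projOn hV, Finset.mul_sum]
    refine Finset.sum_congr rfl fun a ha => ?_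
    rw [mem_countSet.1 ha]
  have h1 := hsplit ((symProj ℓ Set.univ).mulVec Φ) fun _ => 1
  simp only [one_mul] at h1
  rw [sum_nsq_measureEach hV] at h1
  rw [h1, hsplit Φ fun J => (((J : ℝ) - W.card) / M + (1 / 2) ^ W.card)]
  refine Finset.sum_le_sum fun J hJ => ?_
  rw [Finset.mem_range] at hJ
  rw [Matrix.mulVec_mulVec, ← symProj_projOn_countSet hV, ← Matrix.mulVec_mulVec]
  set ΦJ := (projOn V (countSet R J)).mulVec Φ with hΦJ
  by_cases hJW : W.card ≤ J
  · obtain ⟨j, rfl⟩ := Nat.exists_eq_add_of_le hJW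
    have hb := nsq_symProj_count_le hV W (W.card + j) (Φ := ΦJ)
      (by rw [hΦJ, Matrix.mulVec_mulVec, projOn_mul hV, Finset.inter_comm, ← projOn_mul hV,
            ← Matrix.mulVec_mulVec, hΦ])
      (by rw [hΦJ, Matrix.mulVec_mulVec, projOn_mul hV, Finset.inter_self])
    rw [hM, Nat.add_sub_cancel_left, Nat.add_sub_cancel_left] at hb
    have hr := choose_ratio_le hW hWM (j := j) (by omega)
    have hpos : (0 : ℝ) < (W.card + M).choose (W.card + j) := by
      exact_mod_cast Nat.choose_pos (by omega)
    have hcast : (((W.card + j : ℕ) : ℝ) - W.card) / M = (j : ℝ) / M := by push_cast; ring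
    rw [hcast]
    refine le_of_mul_le_mul_right (hb.trans ?_) hpos
    calc (M.choose j : ℝ) * nsq ΦJ
        ≤ (((W.card + M).choose (W.card + j) : ℝ) * ((j : ℝ) / M + (1 / 2) ^ W.card)) * nsq ΦJ := by
          have := nsq_nonneg ΦJ
          gcongr
      _ = _ := by ring
  -- Fewer acceptances than registers in `W` cannot occur. The case needs attention because the
  -- coefficient on the right might be negative there.
  · have : ΦJ = 0 := by
      rw [hΦJ]
      conv_lhs => rw [← hΦ]
      rw [Matrix.mulVec_mulVec, projOn_mul hV]
      have he : countSet R J ∩ acceptSet W = ∅ := by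
        rw [Finset.eq_empty_iff_forall_notMem]
        intro a ha
        rw [Finset.mem_inter, mem_countSet, acceptSet, Finset.mem_filter] at ha
        apply hJW
        rw [← ha.1, numTrue]
        exact Finset.card_le_card fun ρ hρ => by simpa using ha.2.2 ρ hρ
      rw [he, projOn, Finset.sum_empty, Matrix.zero_mulVec]
    rw [this]
    simp [nsq]

end Counting

/-! ### Public counting as a composition of nested projections, and the gain inequality -/

section PublicCount

open scoped ComplexConjugate Matrix

/-! ### The operators of public counting -/

variable {m r ℓ : ℕ}

/-- Verification number `t` with answer `acc`. -/
def testOp (m r ℓ : ℕ) (t : ℕ) (acc : Bool) :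
    Matrix (Slots (m + 1) r ℓ → Bool) (Slots (m + 1) r ℓ → Bool) ℂ :=
  if acc then symProj ℓ {ρ : Fin (m + 1) × Fin r | (ρ.1 : ℕ) ≤ t + 1}
  else 1 - symProj ℓ {ρ : Fin (m + 1) × Fin r | (ρ.1 : ℕ) ≤ t + 1}

/-- The first `j` verifications, with answers `a`. -/
def countOp (m : ℕ) (ω : (Slots 1 r ℓ → Bool) → ℂ) :
    (j : ℕ) → (Fin j → Bool) → Matrix (Slots (m + 1) r ℓ → Bool) (Slots m r ℓ → Bool) ℂ
  | 0, _ => addWallet m ω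
  | j + 1, a => testOp m r ℓ j (a (Fin.last j)) * countOp m ω j (Fin.init a)

theorem foldl_finRange_eq {β : Type} (g : ℕ → Bool → β → β) (init : β)
    (K : (j : ℕ) → (Fin j → Bool) → β)
    (h0 : ∀ a, K 0 a = init) (hs : ∀ j a, K (j + 1) a = g j (a (Fin.last j)) (K j (Fin.init a)))
    (n : ℕ) (a : Fin n → Bool) :
    (List.finRange n).foldl (fun x (t : Fin n) => g t (a t) x) init = K n a := by
  induction n with
  | zero => simp [h0]
  | succ n ih =>
    rw [List.finRange_succ_last, List.foldl_append, List.foldl_map, hs, ← ih (Fin.init a)]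
    rfl

theorem publicCountOp_eq (ω : (Slots 1 r ℓ → Bool) → ℂ) (a : Fin m → Bool) :
    publicCountOp ω a = countOp m ω m a :=
  foldl_finRange_eq (fun t acc K => testOp m r ℓ t acc * K) (addWallet m ω) (countOp m ω)
    (fun _ => rfl) (fun _ _ => rfl) m a

theorem sum_fin_succ_bool {β : Type} [AddCommMonoid β] {j : ℕ} (g : (Fin (j + 1) → Bool) → β) :
    ∑ a, g a = ∑ a : Fin j → Bool, ∑ x : Bool, g (Fin.snoc a x) := by
  rw [Finset.sum_comm, ← Fintype.sum_prod_type']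
  exact Fintype.sum_equiv (Fin.snocEquiv fun _ => Bool).symm _ _ fun a => by
    congr 1
    exact (Fin.snoc_init_self a).symm

theorem countOp_snoc (ω : (Slots 1 r ℓ → Bool) → ℂ) {j : ℕ} (a : Fin j → Bool) (x : Bool) :
    countOp m ω (j + 1) (Fin.snoc a x) = testOp m r ℓ j x * countOp m ω j a := by
  rw [countOp, Fin.snoc_last, Fin.init_snoc]

/-- Seen in the Heisenberg picture: both projections of a test commute with a permutation-invariant
observable, so a test with forgotten outcome leaves the statistics of that observable unchanged. -/
theorem testOp_sum {X : Matrix (Slots (m + 1) r ℓ → Bool) (Slots (m + 1) r ℓ → Bool) ℂ}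
    (hX : Xᴴ = X) (h : ∀ π : Equiv.Perm (Fin (m + 1) × Fin r), permMat ℓ π * X = X * permMat ℓ π)
    (t : ℕ) : ∑ x : Bool, (testOp m r ℓ t x)ᴴ * X * testOp m r ℓ t x = X := by
  simp only [Fintype.sum_bool, testOp, if_true, Bool.false_eq_true, if_false]
  rw [Matrix.conjTranspose_sub, symProj_conjTranspose, Matrix.conjTranspose_one]
  have h1 := symProj_commute (T := {ρ : Fin (m + 1) × Fin r | (ρ.1 : ℕ) ≤ t + 1}) hX h
  set P := symProj ℓ {ρ : Fin (m + 1) × Fin r | (ρ.1 : ℕ) ≤ t + 1}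
  have h2 : P * P = P := symProj_mul_self _
  rw [h1, Matrix.mul_assoc, h2, sub_mul, Matrix.one_mul, h1, mul_sub, Matrix.mul_one, sub_mul,
    Matrix.mul_assoc, h2]
  abel

theorem countOp_sum (ω : (Slots 1 r ℓ → Bool) → ℂ)
    {X : Matrix (Slots (m + 1) r ℓ → Bool) (Slots (m + 1) r ℓ → Bool) ℂ}
    (hX : Xᴴ = X) (h : ∀ π : Equiv.Perm (Fin (m + 1) × Fin r), permMat ℓ π * X = X * permMat ℓ π)
    (j : ℕ) : ∑ a : Fin j → Bool, (countOp m ω j a)ᴴ * X * countOp m ω j a =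
      (addWallet m ω)ᴴ * X * addWallet m ω := by
  induction j with
  | zero => simp [countOp]
  | succ j ih =>
    rw [sum_fin_succ_bool, ← ih]
    refine Finset.sum_congr rfl fun a _ => ?_
    conv_rhs => rw [← testOp_sum hX h j]
    rw [Matrix.mul_sum, Matrix.sum_mul]
    refine Finset.sum_congr rfl fun x _ => ?_
    rw [countOp_snoc, Matrix.conjTranspose_mul]
    simp only [Matrix.mul_assoc]

/-- The tested sets of registers increase, so the later projection absorbs the earlier ones.
Acceptance of all coins is a single test of the complete wallet. -/
theorem countOp_true (ω : (Slots 1 r ℓ → Bool) → ℂ) (j : ℕ) :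
    countOp m ω (j + 1) (fun _ => true) =
      symProj ℓ {ρ : Fin (m + 1) × Fin r | (ρ.1 : ℕ) ≤ j + 1} * addWallet m ω := by
  induction j with
  | zero => rfl
  | succ j ih =>
    rw [countOp, testOp, if_pos rfl]
    have : (Fin.init fun _ : Fin (j + 1 + 1) => true) = fun _ => true := rfl
    rw [this, ih, ← Matrix.mul_assoc, symProj_mul_of_superset]
    intro ρ hρ
    exact le_trans (show (ρ.1 : ℕ) ≤ j + 1 from hρ) (Nat.le_succ _)

theorem nsq_copies {R : Type} [Fintype R] [DecidableEq R] (φ : (Fin ℓ → Bool) → ℂ) :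
    nsq (copies (R := R) φ) = nsq φ ^ Fintype.card R := by
  rw [nsq, sum_registers, nsq]
  have : ∀ e : R → Fin ℓ → Bool, ‖copies (R := R) φ (fun q => e q.1 q.2)‖ ^ 2 =
      ∏ ρ, ‖φ (e ρ)‖ ^ 2 := by
    intro e
    rw [copies, norm_prod, Finset.prod_pow]
  simp only [this]
  rw [← Fintype.piFinset_univ, ← Finset.prod_univ_sum (fun _ : R => Finset.univ)
    (fun _ x => ‖φ x‖ ^ 2), Finset.prod_const, Finset.card_univ]

/-- Separate the first of `m + 1` money states from the others. -/
def slotsSplit (m r ℓ : ℕ) :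
    (Slots (m + 1) r ℓ → Bool) ≃ (Slots 1 r ℓ → Bool) × (Slots m r ℓ → Bool) where
  toFun b := (fun i => b ((0, i.1.2), i.2), fun i => b ((i.1.1.succ, i.1.2), i.2))
  invFun p := fun i => Fin.cases (motive := fun _ => Bool) (p.1 ((0, i.1.2), i.2))
    (fun t => p.2 ((t, i.1.2), i.2)) i.1.1
  left_inv b := by
    funext ⟨⟨c, ρ⟩, i⟩
    refine Fin.cases ?_ (fun t => ?_) c <;> rfl
  right_inv p := by
    refine Prod.ext ?_ rfl
    funext ⟨⟨c, ρ⟩, i⟩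
    obtain rfl : c = 0 := Subsingleton.elim _ _
    rfl

theorem addWallet_mulVec (ω : (Slots 1 r ℓ → Bool) → ℂ) (ψ : (Slots m r ℓ → Bool) → ℂ) :
    (addWallet m ω).mulVec ψ = fun b => ω (slotsSplit m r ℓ b).1 * ψ (slotsSplit m r ℓ b).2 := by
  funext b
  simp only [Matrix.mulVec, dotProduct, addWallet, slotsSplit]
  rw [Finset.sum_eq_single (fun i : Slots m r ℓ => b ((i.1.1.succ, i.1.2), i.2))]
  · rw [if_pos rfl, mul_one]; rfl
  · intro a _ ha
    rw [if_neg ha.symm, mul_zero, zero_mul]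
  · simp

theorem nsq_addWallet (ω : (Slots 1 r ℓ → Bool) → ℂ) (ψ : (Slots m r ℓ → Bool) → ℂ) :
    nsq ((addWallet m ω).mulVec ψ) = nsq ω * nsq ψ := by
  rw [addWallet_mulVec, nsq, nsq, nsq, Finset.sum_mul_sum, ← Fintype.sum_prod_type']
  exact Fintype.sum_equiv (slotsSplit m r ℓ) _ _ fun b => by rw [norm_mul, mul_pow]

variable {V : Matrix (Fin ℓ → Bool) (Fin ℓ → Bool) ℂ} {φ : (Fin ℓ → Bool) → ℂ}

/-- The registers of the coin in the initial wallet. -/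
def walletRegs (m r : ℕ) : Finset (Fin (m + 1) × Fin r) := {0} ×ˢ Finset.univ

theorem card_walletRegs : (walletRegs m r).card = r := by
  simp [walletRegs]

/-- Some register of the initial wallet coin is rejected by `a`. It is in the state φ independently
of everything else, and the corresponding factor is (1 - V)φ = 0. -/
theorem measureEach_addWallet_eq_zero (hφ : V.mulVec φ = φ)
    (ψ : (Slots m r ℓ → Bool) → ℂ) {a : Fin (m + 1) × Fin r → Bool}
    (ha : a ∉ acceptSet (walletRegs m r)) :
    (measureEach V a).mulVec ((addWallet m (copies φ)).mulVec ψ) = 0 := by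
  obtain ⟨ρ, hρ, ha⟩ : ∃ ρ ∈ walletRegs m r, a ρ = false := by
    simpa [acceptSet] using ha
  obtain ⟨c, ρ⟩ := ρ
  obtain rfl : c = 0 := by simpa [walletRegs, eq_comm] using hρ
  -- The submitted state is expanded in basis states, which makes every summand a product over the
  -- registers: φ in the wallet coin and a basis vector in each other register.
  let F : (Slots m r ℓ → Bool) → Fin (m + 1) × Fin r → (Fin ℓ → Bool) → ℂ := fun d q =>
    Fin.cases (motive := fun _ => (Fin ℓ → Bool) → ℂ) φ
      (fun t x => if x = fun i => d ((t, q.2), i) then 1 else 0) q.1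
  have h : (addWallet m (copies φ)).mulVec ψ =
      ∑ d, ψ d • fun b : Slots (m + 1) r ℓ → Bool => ∏ q, F d q fun i => b (q, i) := by
    funext b
    rw [Matrix.mulVec, dotProduct, Finset.sum_apply]
    refine Finset.sum_congr rfl fun d _ => ?_
    rw [Pi.smul_apply, smul_eq_mul, mul_comm]
    congr 1
    rw [addWallet, copies, Fintype.prod_prod_type, Fintype.prod_prod_type, Fin.prod_univ_one,
      Fin.prod_univ_succ]
    congr 1
    rw [← Fintype.prod_prod_type' (f := fun (t : Fin m) (q : Fin r) => F d (t.succ, q) fun i => b ((t.succ, q), i))]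
    simp only [F, Fin.cases_succ]
    rw [Finset.prod_ite_zero]
    simp only [Finset.prod_const_one, Finset.mem_univ, true_implies]
    refine if_congr ?_ rfl rfl
    constructor
    · rintro rfl q
      rfl
    · intro hq
      funext ⟨q, i⟩
      exact congrFun (hq q) i
  rw [h, Matrix.mulVec_sum]
  refine Finset.sum_eq_zero fun d _ => ?_
  rw [Matrix.mulVec_smul, measureEach_eq_tens, tens_mulVec]
  have : ∀ b : Slots (m + 1) r ℓ → Bool, ∏ q, ((if a q then V else 1 - V).mulVec (F d q)) (fun i => b (q, i)) = 0 := by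
    intro b
    refine Finset.prod_eq_zero (Finset.mem_univ (0, ρ)) ?_
    rw [if_neg (by simp [ha])]
    have : F d (0, ρ) = φ := rfl
    rw [this, Matrix.sub_mulVec, Matrix.one_mulVec, hφ, sub_self]
    rfl
  rw [funext this]
  exact smul_zero _

theorem projOn_addWallet (hφ : V.mulVec φ = φ) (ψ : (Slots m r ℓ → Bool) → ℂ) :
    (projOn V (acceptSet (walletRegs m r))).mulVec ((addWallet m (copies φ)).mulVec ψ) =
      (addWallet m (copies φ)).mulVec ψ := by
  conv_rhs => rw [← Matrix.one_mulVec ((addWallet m (copies φ)).mulVec ψ), ← measureEach_sum V]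
  rw [projOn, Matrix.sum_mulVec, Matrix.sum_mulVec]
  exact Finset.sum_subset (Finset.subset_univ _) fun a _ ha =>
    measureEach_addWallet_eq_zero hφ ψ ha

/-- The numbers of accepted registers have the same distribution before and after the public
counting. -/
theorem sum_count_measureEach (hV : IsStarProjection V) (ω : (Slots 1 r ℓ → Bool) → ℂ) (g : ℕ → ℝ)
    (ψ : (Slots m r ℓ → Bool) → ℂ) (j : ℕ) :
    ∑ a : Fin j → Bool, ∑ b : Fin (m + 1) × Fin r → Bool, g (numTrue b) *
        nsq ((measureEach V b * countOp m ω j a).mulVec ψ) =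
      ∑ b, g (numTrue b) * nsq ((measureEach V b).mulVec ((addWallet m ω).mulVec ψ)) := by
  -- The observable with value `g` at the number of accepted registers; it is invariant under
  -- permutations because its coefficients depend on this number only.
  set X : Matrix (Slots (m + 1) r ℓ → Bool) (Slots (m + 1) r ℓ → Bool) ℂ :=
    ∑ b, (g (numTrue b) : ℂ) • measureEach V b with hXdef
  have hX : Xᴴ = X := by
    rw [hXdef, Matrix.conjTranspose_sum]
    refine Finset.sum_congr rfl fun b _ => ?_
    rw [Matrix.conjTranspose_smul, measureEach_conjTranspose hV]
    congr 1
    exact Complex.conj_ofReal _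
  have hXp : ∀ π : Equiv.Perm (Fin (m + 1) × Fin r), permMat ℓ π * X = X * permMat ℓ π := by
    intro π
    rw [hXdef, Finset.mul_sum, Finset.sum_mul]
    refine (Fintype.sum_equiv (Equiv.arrowCongr π (Equiv.refl Bool)) _ _ fun b => ?_)
    rw [Matrix.mul_smul, Matrix.smul_mul, ← permMat_mul_measureEach]
    have h1 : (Equiv.arrowCongr π (Equiv.refl Bool)) b ∘ π = b := by
      funext ρ; simp
    rw [h1]
    conv_lhs => rw [← h1]
    rw [numTrue_comp, h1]
  have hq : ∀ ψ : (Slots (m + 1) r ℓ → Bool) → ℂ,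
      ((∑ b, g (numTrue b) * nsq ((measureEach V b).mulVec ψ) : ℝ) : ℂ) = star ψ ⬝ᵥ X.mulVec ψ := by
    intro ψ
    rw [hXdef, Matrix.sum_mulVec, dotProduct_sum, Complex.ofReal_sum]
    refine Finset.sum_congr rfl fun b _ => ?_
    rw [Complex.ofReal_mul, nsq_mulVec_proj (measureEach_conjTranspose hV _)
      (measureEach_mul_self hV _), Matrix.smul_mulVec, dotProduct_smul, smul_eq_mul]
  have hK : ∀ (K : Matrix (Slots (m + 1) r ℓ → Bool) (Slots m r ℓ → Bool) ℂ),
      star (K.mulVec ψ) ⬝ᵥ X.mulVec (K.mulVec ψ) = star ψ ⬝ᵥ (Kᴴ * X * K).mulVec ψ := by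
    intro K
    rw [Matrix.star_mulVec, ← Matrix.dotProduct_mulVec, Matrix.mulVec_mulVec, Matrix.mulVec_mulVec,
      Matrix.mul_assoc]
  have h := countOp_sum ω hX hXp j
  have h' := congrArg (fun Y => star ψ ⬝ᵥ Y.mulVec ψ) h
  simp only [Matrix.sum_mulVec, dotProduct_sum, ← hK, ← hq] at h'
  rw [← Complex.ofReal_sum] at h'
  simp only [← Matrix.mulVec_mulVec]
  exact_mod_cast h'

variable (hV : IsStarProjection V) (hφ : V.mulVec φ = φ) (hφ1 : nsq φ = 1)

include hV hφ1 in
theorem sum_nsq_countOp (ψ : (Slots m r ℓ → Bool) → ℂ) :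
    ∑ a : Fin m → Bool, ∑ b : Fin (m + 1) × Fin r → Bool,
      nsq ((measureEach V b * countOp m (copies φ : (Slots 1 r ℓ → Bool) → ℂ) m a).mulVec ψ) =
      nsq ψ := by
  have h := sum_count_measureEach hV (copies φ) (fun _ => 1) ψ m
  simp only [one_mul] at h
  rw [h, sum_nsq_measureEach hV, nsq_addWallet, nsq_copies, hφ1, one_pow, one_mul]

include hV hφ hφ1 in
/-- What the public counting gains is covered by what the private verification of all registers
gains, up to an exponentially small error. -/
theorem countOp_gain (hm : 0 < m) (hr : 0 < r) (ψ : (Slots m r ℓ → Bool) → ℂ) :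
    (r : ℝ) * m * nsq ((countOp m (copies φ : (Slots 1 r ℓ → Bool) → ℂ) m (fun _ => true)).mulVec ψ) ≤
      ∑ a : Fin m → Bool, ∑ b : Fin (m + 1) × Fin r → Bool, ((numTrue b : ℝ) - r) *
        nsq ((measureEach V b * countOp m (copies φ : (Slots 1 r ℓ → Bool) → ℂ) m a).mulVec ψ) +
      (r : ℝ) * m * (1 / 2) ^ r * nsq ψ := by
  -- The expected gain of the simulation, accepted registers minus the `r` coins minted for the
  -- wallet, can be computed on the untested wallet.
  have h := sum_count_measureEach hV (copies φ) (fun x => (x : ℝ) - r) ψ m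
  rw [h]
  -- Here `W` is the wallet coin with its `r` registers and the other `m * r` registers are the
  -- submitted ones; there are at least `r` of them because `m` is positive.
  have h2 := nsq_symProj_le (M := m * r) hV (walletRegs m r) (by rw [card_walletRegs]; exact hr)
    (by rw [card_walletRegs]; simp; ring) (by rw [card_walletRegs]; nlinarith)
    (projOn_addWallet hφ ψ)
  have h3 : nsq ((countOp m (copies φ) m (fun _ : Fin m => true)).mulVec ψ) =
      nsq ((symProj ℓ Set.univ).mulVec ((addWallet m (copies φ)).mulVec ψ)) := by
    obtain ⟨j, rfl⟩ := Nat.exists_eq_succ_of_ne_zero hm.ne'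
    rw [countOp_true, Matrix.mulVec_mulVec]
    congr 4
    refine Set.eq_univ_of_forall fun ρ => ?_
    have := ρ.1.isLt
    show (ρ.1 : ℕ) ≤ j + 1
    omega
  rw [h3]
  have hpos : (0 : ℝ) < r * m := by positivity
  have h4 := mul_le_mul_of_nonneg_left h2 hpos.le
  refine h4.trans (le_of_eq ?_)
  have h5 : nsq ((addWallet m (copies φ)).mulVec ψ) = nsq ψ := by
    rw [nsq_addWallet, nsq_copies, hφ1, one_pow, one_mul]
  rw [card_walletRegs]
  simp only [add_mul, Finset.sum_add_distrib, mul_add]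
  congr 1
  · rw [Finset.mul_sum]
    refine Finset.sum_congr rfl fun b _ => ?_
    push_cast
    field_simp
  · rw [← Finset.mul_sum, sum_nsq_measureEach hV, h5]
    ring

end PublicCount

/-! ### Reversible circuits acting on superpositions of configurations -/

section VecOps

open scoped symmDiff

/-! ### Gates as linear maps on vectors -/

/-- Linear maps on state vectors. -/
abbrev VecEnd := Module.End ℂ Vec

open Classical in
/-- The linear map of `State.act`. -/
def actMap {k : ℕ} (L : Fin k → Loc) (U : Matrix (Fin k → Bool) (Fin k → Bool) ℂ) : VecEnd :=
  if Function.Injective L then opMap L L U else 1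

theorem State.act_eq (s : State) {k : ℕ} (L : Fin k → Loc)
    (U : Matrix (Fin k → Bool) (Fin k → Bool) ℂ) :
    s.act L U = { s with vec := actMap L U s.vec } := by
  rw [State.act, actMap]
  split_ifs <;> rfl

/-- The linear map that permutes or relabels the basis states. -/
def relabel (f : Config → Config) : VecEnd := Finsupp.lmapDomain ℂ ℂ f

theorem relabel_single (f : Config → Config) (c : Config) (z : ℂ) :
    relabel f (Finsupp.single c z) = Finsupp.single (f c) z := by
  simp [relabel]

theorem relabel_mul (f g : Config → Config) : relabel f * relabel g = relabel (f ∘ g) := by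
  refine Finsupp.lhom_ext fun c z => ?_
  rw [Module.End.mul_apply, relabel_single, relabel_single, relabel_single]
  rfl

theorem relabel_id : relabel id = 1 := by
  refine Finsupp.lhom_ext fun c z => ?_
  rw [relabel_single]; rfl

theorem Supp.relabel {p q : Config → Prop} {v : Vec} (hv : Supp p v) {f : Config → Config}
    (h : ∀ c, p c → q (f c)) : Supp q (QMoney.relabel f v) := by
  refine hv.induction (motive := fun v => Supp q (QMoney.relabel f v)) ?_ ?_ ?_
  · rw [map_zero]; exact Supp.zero
  · intro v w hv hw
    rw [map_add]; exact hv.add hw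
  · intro c z hc
    rw [relabel_single]; exact Supp.single (h c hc) _

theorem actMap_single {k : ℕ} {L : Fin k → Loc} (hL : Function.Injective L)
    (U : Matrix (Fin k → Bool) (Fin k → Bool) ℂ) (c : Config) (z : ℂ) :
    actMap L U (Finsupp.single c z) =
      ∑ b, Finsupp.single (setBits L b c) (U b (getBits L c) * z) := by
  rw [actMap, if_pos hL]
  refine (applyOp_single L L U c z).trans ?_
  simp only [setBits_setBits]

theorem actMap_eq_relabel {k : ℕ} {L : Fin k → Loc} (hL : Function.Injective L)
    (g : (Fin k → Bool) → (Fin k → Bool)) {U : Matrix (Fin k → Bool) (Fin k → Bool) ℂ}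
    (hU : ∀ a b, U a b = if a = g b then 1 else 0) :
    actMap L U = relabel fun c => setBits L (g (getBits L c)) c := by
  refine Finsupp.lhom_ext fun c z => ?_
  rw [actMap_single hL, relabel_single, Finset.sum_eq_single (g (getBits L c))]
  · rw [hU, if_pos rfl, one_mul]
  · intro b _ hb
    rw [hU, if_neg hb, zero_mul, Finsupp.single_zero]
  · simp

/-- Flip a qubit if a condition holds. -/
def flipIf (l : Loc) (p : Config → Prop) [DecidablePred p] (c : Config) : Config :=
  if p c then c ∆ {l} else c

theorem mem_flipIf {l l' : Loc} {p : Config → Prop} [DecidablePred p] {c : Config} :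
    l' ∈ flipIf l p c ↔ (p c ∧ l' = l ∧ l' ∉ c) ∨ (¬ (p c ∧ l' = l) ∧ l' ∈ c) := by
  rw [flipIf]
  by_cases hp : p c
  · by_cases hl : l' = l
    · simp [hp, hl, Finset.mem_symmDiff]
    · simp [hp, hl, Finset.mem_symmDiff]
  · simp [hp]

/-- The gate `X`. -/
def xMap (l : Loc) : VecEnd := relabel (flipIf l fun _ => True)

/-- The controlled not. -/
def cnotMap (l₁ l₂ : Loc) : VecEnd := relabel (flipIf l₂ fun c => l₁ ∈ c)

/-- The Toffoli gate. -/
def toffoliMap (l₁ l₂ l₃ : Loc) : VecEnd := relabel (flipIf l₃ fun c => l₁ ∈ c ∧ l₂ ∈ c)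

theorem injective_one (l : Loc) : Function.Injective ![l] := fun i j _ => Subsingleton.elim i j

theorem injective_two {l₁ l₂ : Loc} (h : l₁ ≠ l₂) : Function.Injective ![l₁, l₂] := by
  intro i j hij
  fin_cases i <;> fin_cases j <;> simp_all

theorem injective_three {l₁ l₂ l₃ : Loc} (h : l₁ ≠ l₂) (h' : l₁ ≠ l₃) (h'' : l₂ ≠ l₃) :
    Function.Injective ![l₁, l₂, l₃] := by
  intro i j hij
  fin_cases i <;> fin_cases j <;> simp_all

theorem actMap_x (l : Loc) : actMap ![l] Gate.x.matrix = xMap l := by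
  rw [actMap_eq_relabel (injective_one l) (fun b _ => !(b 0))]
  · rw [xMap]
    congr 1
    funext c
    ext l'
    rw [mem_flipIf, mem_setBits]
    by_cases h : l' = l
    · subst h; simp
    · simp [h, Ne.symm h]
  · intro a b
    simp only [Gate.matrix]
    refine if_congr ?_ rfl rfl
    constructor
    · intro h; funext i; rw [Subsingleton.elim i 0]; exact h
    · rintro rfl; rfl

theorem actMap_cnot {l₁ l₂ : Loc} (h : l₁ ≠ l₂) : actMap ![l₁, l₂] cnotMatrix = cnotMap l₁ l₂ := by
  rw [actMap_eq_relabel (injective_two h) (fun b => ![b 0, xor (b 1) (b 0)])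
    (U := cnotMatrix) (fun _ _ => rfl), cnotMap]
  congr 1
  funext c
  ext l'
  rw [mem_flipIf, mem_setBits]
  simp only [Fin.exists_fin_two, Fin.forall_fin_two]
  by_cases h2 : l' = l₂
  · subst h2
    by_cases h3 : l₁ ∈ c <;> simp [h, h3]
  · by_cases h1 : l' = l₁
    · subst h1; by_cases h4 : l' ∈ c <;> simp [h, h2, Ne.symm h2, h4]
    · simp [h1, h2, Ne.symm h1, Ne.symm h2]

theorem actMap_cnot_self (l : Loc) : actMap ![l, l] cnotMatrix = 1 := by
  rw [actMap, if_neg]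
  intro h
  have := @h 0 1 rfl
  exact absurd this (by decide)

theorem actMap_toffoli {l₁ l₂ l₃ : Loc} (h : l₁ ≠ l₂) (h' : l₁ ≠ l₃) (h'' : l₂ ≠ l₃) :
    actMap ![l₁, l₂, l₃] toffoliMatrix = toffoliMap l₁ l₂ l₃ := by
  rw [actMap_eq_relabel (injective_three h h' h'')
    (fun b => ![b 0, b 1, xor (b 2) (b 0 && b 1)]) (U := toffoliMatrix) (fun _ _ => rfl), toffoliMap]
  congr 1
  funext c
  ext l'
  rw [mem_flipIf, mem_setBits]
  simp only [Fin.exists_fin_succ, Fin.forall_fin_succ, IsEmpty.forall_iff, IsEmpty.exists_iff]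
  by_cases h3 : l' = l₃
  · subst h3
    by_cases h1 : l₁ ∈ c <;> by_cases h2 : l₂ ∈ c <;> by_cases h4 : l' ∈ c <;>
      simp [h', h'', h1, h2, h4]
  · by_cases h1 : l' = l₁
    · subst h1; by_cases h4 : l' ∈ c <;> simp [h.symm, h3, Ne.symm h3, h4]
    · by_cases h2 : l' = l₂
      · subst h2; by_cases h4 : l' ∈ c <;> simp [h, h3, Ne.symm h3, h4]
      · simp [h1, h2, h3, Ne.symm h1, Ne.symm h2, Ne.symm h3]

theorem actMap_toffoli_self (l₁ l₂ : Loc) : actMap ![l₁, l₂, l₂] toffoliMatrix = 1 := by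
  rw [actMap, if_neg]
  intro h
  have := @h 1 2 rfl
  exact absurd this (by decide)

theorem xMap_mul_self (l : Loc) : xMap l * xMap l = 1 := by
  rw [xMap, relabel_mul, ← relabel_id]
  congr 1
  funext c
  ext l'
  simp only [Function.comp_apply, mem_flipIf, id]
  by_cases h : l' = l <;> simp [h]

theorem cnotMap_mul_self {l₁ l₂ : Loc} (h : l₁ ≠ l₂) : cnotMap l₁ l₂ * cnotMap l₁ l₂ = 1 := by
  rw [cnotMap, relabel_mul, ← relabel_id]
  congr 1
  funext c
  ext l'
  simp only [Function.comp_apply, mem_flipIf, id]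
  by_cases h' : l' = l₂
  · subst h'; by_cases h1 : l₁ ∈ c <;> simp [mem_flipIf, h, h1]
  · simp [mem_flipIf, h']

theorem toffoliMap_mul_self {l₁ l₂ l₃ : Loc} (h : l₁ ≠ l₃) (h' : l₂ ≠ l₃) :
    toffoliMap l₁ l₂ l₃ * toffoliMap l₁ l₂ l₃ = 1 := by
  rw [toffoliMap, relabel_mul, ← relabel_id]
  congr 1
  funext c
  ext l'
  simp only [Function.comp_apply, mem_flipIf, id]
  by_cases h'' : l' = l₃
  · subst h''; by_cases h1 : l₁ ∈ c <;> by_cases h2 : l₂ ∈ c <;> simp [mem_flipIf, h, h', h1, h2]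
  · simp [mem_flipIf, h'']

/-- The rotation. -/
def rotMap (l : Loc) (p q : ℕ) : VecEnd := actMap ![l] (rotMatrix p q)

/-- The angle of the rotation. -/
def rotAngle (p q : ℕ) : ℝ := Real.arccos (Real.sqrt ((p : ℝ) / ((p : ℝ) + (q : ℝ))))

theorem sum_fin_one_bool {β : Type} [AddCommMonoid β] (f : (Fin 1 → Bool) → β) :
    ∑ b, f b = f (fun _ => false) + f (fun _ => true) := by
  rw [Fintype.sum_equiv (Equiv.funUnique (Fin 1) Bool) f (fun x => f fun _ => x)
    (fun b => by congr 1; funext i; rw [Subsingleton.elim i 0]; rfl), Fintype.sum_bool, add_comm]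

theorem rotMap_single_of_notMem {l : Loc} {c : Config} (h : l ∉ c) (p q : ℕ) (z : ℂ) :
    rotMap l p q (Finsupp.single c z) = Finsupp.single c (Real.cos (rotAngle p q) * z) +
      Finsupp.single (insert l c) (Real.sin (rotAngle p q) * z) := by
  rw [rotMap, actMap_single (injective_one l), sum_fin_one_bool]
  have h1 : setBits ![l] (fun _ => false) c = c := by
    ext l'; rw [mem_setBits]
    by_cases h' : l' = l
    · subst h'; simp [h]
    · simp [Ne.symm h']
  have h2 : setBits ![l] (fun _ => true) c = insert l c := by
    ext l'; rw [mem_setBits]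
    by_cases h' : l' = l
    · subst h'; simp
    · simp [h', Ne.symm h']
  rw [h1, h2]
  simp [rotMatrix, h, rotAngle]

theorem rotMap_single_of_mem {l : Loc} {c : Config} (h : l ∈ c) (p q : ℕ) (z : ℂ) :
    rotMap l p q (Finsupp.single c z) =
      Finsupp.single (c.erase l) (-Real.sin (rotAngle p q) * z) +
      Finsupp.single c (Real.cos (rotAngle p q) * z) := by
  rw [rotMap, actMap_single (injective_one l), sum_fin_one_bool]
  have h1 : setBits ![l] (fun _ => false) c = c.erase l := by
    ext l'; rw [mem_setBits]
    by_cases h' : l' = l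
    · subst h'; simp
    · simp [h', Ne.symm h']
  have h2 : setBits ![l] (fun _ => true) c = c := by
    ext l'; rw [mem_setBits]
    by_cases h' : l' = l
    · subst h'; simp [h]
    · simp [Ne.symm h']
  rw [h1, h2]
  simp [rotMatrix, h, rotAngle]

theorem flipIf_true_of_mem {l : Loc} {c : Config} (h : l ∈ c) :
    flipIf l (fun _ => True) c = c.erase l := by
  ext l'
  rw [mem_flipIf]
  by_cases h' : l' = l
  · subst h'; simp [h]
  · simp [h']

theorem flipIf_true_of_notMem {l : Loc} {c : Config} (h : l ∉ c) :
    flipIf l (fun _ => True) c = insert l c := by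
  ext l'
  rw [mem_flipIf]
  by_cases h' : l' = l
  · subst h'; simp [h]
  · simp [h']

/-- The rotation composed with its reflection gives the identity. -/
theorem rot_x_rot (l : Loc) (p q : ℕ) : rotMap l p q * xMap l * rotMap l p q = xMap l := by
  refine Finsupp.lhom_ext fun c z => ?_
  have hcs : (Real.cos (rotAngle p q) : ℂ) ^ 2 + (Real.sin (rotAngle p q) : ℂ) ^ 2 = 1 := by
    exact_mod_cast Real.cos_sq_add_sin_sq (rotAngle p q)
  simp only [Module.End.mul_apply, xMap]
  by_cases h : l ∈ c
  · have h0 : l ∉ c.erase l := Finset.notMem_erase l c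
    rw [rotMap_single_of_mem h, map_add, relabel_single, relabel_single, flipIf_true_of_notMem h0,
      flipIf_true_of_mem h, Finset.insert_erase h, map_add, rotMap_single_of_mem h,
      rotMap_single_of_notMem h0, Finset.insert_erase h, relabel_single, flipIf_true_of_mem h]
    have e1 : -(Real.sin (rotAngle p q) : ℂ) * (-Real.sin (rotAngle p q) * z) +
        Real.cos (rotAngle p q) * (Real.cos (rotAngle p q) * z) = z := by
      linear_combination z * hcs
    have e2 : (Real.cos (rotAngle p q) : ℂ) * (-Real.sin (rotAngle p q) * z) +
        Real.sin (rotAngle p q) * (Real.cos (rotAngle p q) * z) = 0 := by ring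
    rw [add_add_add_comm, ← Finsupp.single_add, ← Finsupp.single_add, e1, e2, Finsupp.single_zero,
      add_zero]
  · have h1 : l ∈ insert l c := Finset.mem_insert_self l c
    rw [rotMap_single_of_notMem h, map_add, relabel_single, relabel_single, flipIf_true_of_mem h1,
      flipIf_true_of_notMem h, Finset.erase_insert h, map_add, rotMap_single_of_mem h1,
      rotMap_single_of_notMem h, Finset.erase_insert h, relabel_single, flipIf_true_of_notMem h]
    have e1 : -(Real.sin (rotAngle p q) : ℂ) * (Real.cos (rotAngle p q) * z) +
        Real.cos (rotAngle p q) * (Real.sin (rotAngle p q) * z) = 0 := by ring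
    have e2 : (Real.cos (rotAngle p q) : ℂ) * (Real.cos (rotAngle p q) * z) +
        Real.sin (rotAngle p q) * (Real.sin (rotAngle p q) * z) = z := by
      linear_combination z * hcs
    rw [add_add_add_comm, ← Finsupp.single_add, ← Finsupp.single_add, e1, e2, Finsupp.single_zero,
      zero_add]

/-! ### Exchanging registers -/

/-- A permutation of the places, acting on basis states. -/
def permConfig (e : Equiv.Perm Loc) (c : Config) : Config := c.map e.toEmbedding

theorem mem_permConfig {e : Equiv.Perm Loc} {c : Config} {l : Loc} :
    l ∈ permConfig e c ↔ e.symm l ∈ c := by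
  rw [permConfig, Finset.mem_map_equiv]

/-- The controlled exchange of two qubits, as a circuit. -/
def cswapMap (a x y : Loc) : VecEnd :=
  if x = y then 1 else cnotMap y x * toffoliMap a x y * cnotMap y x

theorem cswapMap_mul_self {a x y : Loc} (hy : a ≠ y) :
    cswapMap a x y * cswapMap a x y = 1 := by
  rw [cswapMap]
  split_ifs with h
  · exact one_mul 1
  · have h1 := cnotMap_mul_self (Ne.symm h)
    have h2 := toffoliMap_mul_self hy h
    calc cnotMap y x * toffoliMap a x y * cnotMap y x * (cnotMap y x * toffoliMap a x y * cnotMap y x)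
        = cnotMap y x * (toffoliMap a x y * (cnotMap y x * cnotMap y x) * toffoliMap a x y) *
            cnotMap y x := by simp only [mul_assoc]
      _ = 1 := by rw [h1, mul_one, h2, mul_one, h1]

/-- The first controlled not stores the parity of the two bits at `x`; the Toffoli gate adds it to
`y`, which thereby takes the old value of `x` if the control is on; the last controlled not then
restores `x`, or completes the exchange. -/
theorem cswapMap_eq {a x y : Loc} (hx : a ≠ x) (hy : a ≠ y) : cswapMap a x y =
    relabel fun c => if a ∈ c then permConfig (Equiv.swap x y) c else c := by
  rw [cswapMap]
  split_ifs with h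
  · subst h
    rw [← relabel_id]
    congr 1
    funext c
    split_ifs
    · ext l; rw [mem_permConfig]; simp
    · rfl
  · rw [cnotMap, toffoliMap, relabel_mul, relabel_mul]
    congr 1
    funext c
    ext l
    simp only [Function.comp_apply, mem_flipIf]
    by_cases ha : a ∈ c
    · rw [if_pos ha, mem_permConfig, Equiv.symm_swap]
      by_cases hlx : l = x
      · subst hlx
        rw [Equiv.swap_apply_left]
        by_cases h1 : l ∈ c <;> by_cases h2 : y ∈ c <;> simp [mem_flipIf, h, Ne.symm h, hx, hy, ha, h1, h2]
      · by_cases hly : l = y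
        · subst hly
          rw [Equiv.swap_apply_right]
          by_cases h1 : l ∈ c <;> by_cases h2 : x ∈ c <;> simp [mem_flipIf, h, Ne.symm h, hx, hy, ha, h1, h2]
        · rw [Equiv.swap_apply_of_ne_of_ne hlx hly]
          simp [hlx, hly]
    · rw [if_neg ha]
      by_cases hlx : l = x
      · subst hlx
        by_cases h1 : l ∈ c <;> by_cases h2 : y ∈ c <;> simp [mem_flipIf, h, Ne.symm h, hx, hy, ha, h1, h2]
      · by_cases hly : l = y
        · subst hly
          by_cases h1 : l ∈ c <;> by_cases h2 : x ∈ c <;> simp [mem_flipIf, h, Ne.symm h, hx, hy, ha, h1, h2]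
        · simp [hlx, hly]

/-- Composition of maps in increasing order. -/
def upProd (g : ℕ → VecEnd) : ℕ → VecEnd
  | 0 => 1
  | n + 1 => g n * upProd g n

/-- Composition of maps in decreasing order. -/
def downProd (g : ℕ → VecEnd) : ℕ → VecEnd
  | 0 => 1
  | n + 1 => downProd g n * g n

theorem downProd_mul_upProd {g h : ℕ → VecEnd} (n : ℕ) (H : ∀ i < n, h i * g i = 1) :
    downProd h n * upProd g n = 1 := by
  induction n with
  | zero => exact one_mul 1
  | succ n ih =>
    rw [downProd, upProd]
    calc downProd h n * h n * (g n * upProd g n)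
        = downProd h n * (h n * g n) * upProd g n := by simp only [mul_assoc]
      _ = 1 := by rw [H n (by omega), mul_one, ih fun i hi => H i (by omega)]

/-- Memory cell `x` of bank `b`. -/
abbrev cell (b x : ℕ) : Loc := Sum.inl (b, x)

/-- The exchange of registers `i` and `j` of `ℓ` qubits in bank `0`, for the first `t` qubits. -/
def regSwap (ℓ i j : ℕ) : ℕ → Equiv.Perm Loc
  | 0 => 1
  | t + 1 => Equiv.swap (cell 0 (i * ℓ + t)) (cell 0 (j * ℓ + t)) * regSwap ℓ i j t

theorem regSwap_other {ℓ i j : ℕ} (t : ℕ) {l : Loc} (h : ∀ x, l ≠ cell 0 x) :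
    regSwap ℓ i j t l = l := by
  induction t with
  | zero => rfl
  | succ t ih =>
    rw [regSwap, Equiv.Perm.mul_apply, ih, Equiv.swap_apply_of_ne_of_ne (h _) (h _)]

theorem regSwap_apply {ℓ i j : ℕ} (t : ℕ) (ht : t ≤ ℓ) (ρ b : ℕ) (hb : b < ℓ) :
    regSwap ℓ i j t (cell 0 (ρ * ℓ + b)) =
      cell 0 ((if b < t then Equiv.swap i j ρ else ρ) * ℓ + b) := by
  have inj : ∀ x y x' y' : ℕ, y < ℓ → y' < ℓ →
      (cell 0 (x * ℓ + y) = cell 0 (x' * ℓ + y') ↔ x = x' ∧ y = y') := by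
    intro x y x' y' hy hy'
    simp only [Sum.inl.injEq, Prod.mk.injEq, true_and]
    constructor
    · intro h
      have h1 : (x * ℓ + y) % ℓ = (x' * ℓ + y') % ℓ := by rw [h]
      rw [add_comm, Nat.add_mul_mod_self_right, add_comm, Nat.add_mul_mod_self_right,
        Nat.mod_eq_of_lt hy, Nat.mod_eq_of_lt hy'] at h1
      have h2 : x * ℓ = x' * ℓ := by omega
      exact ⟨Nat.eq_of_mul_eq_mul_right (by omega) h2, h1⟩
    · rintro ⟨rfl, rfl⟩; rfl
  induction t with
  | zero => simp [regSwap]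
  | succ t ih =>
    rw [regSwap, Equiv.Perm.mul_apply, ih (by omega), Equiv.swap_apply_def]
    simp only [inj _ _ _ _ hb (show t < ℓ by omega)]
    by_cases hbt : b = t
    · subst hbt
      simp only [lt_irrefl, if_false, and_true, Nat.lt_succ_self, if_true, Equiv.swap_apply_def]
      split_ifs <;> rfl
    · have : b < t + 1 ↔ b < t := by omega
      simp [hbt, this]

/-- The controlled exchange of two registers, as a circuit. -/
def cswapRegs (ℓ i j : ℕ) (a : Loc) : ℕ → VecEnd :=
  upProd fun t => cswapMap a (cell 0 (i * ℓ + t)) (cell 0 (j * ℓ + t))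

theorem cswapRegs_eq {ℓ i j : ℕ} {a : Loc} (ha : ∀ x, a ≠ cell 0 x) (t : ℕ) :
    cswapRegs ℓ i j a t =
      relabel fun c => if a ∈ c then permConfig (regSwap ℓ i j t) c else c := by
  induction t with
  | zero =>
    rw [cswapRegs, upProd, ← relabel_id]
    congr 1
    funext c
    split_ifs
    · ext l; rw [mem_permConfig]; rfl
    · rfl
  | succ t ih =>
    have h0 : cswapRegs ℓ i j a (t + 1) =
        cswapMap a (cell 0 (i * ℓ + t)) (cell 0 (j * ℓ + t)) * cswapRegs ℓ i j a t := rfl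
    rw [h0, ih, cswapMap_eq (ha _) (ha _), relabel_mul]
    congr 1
    funext c
    simp only [Function.comp_apply]
    by_cases hac : a ∈ c
    · rw [if_pos hac, if_pos hac, if_pos]
      · ext l
        rw [mem_permConfig, mem_permConfig, mem_permConfig]
        rfl
      · rw [mem_permConfig]
        have : (regSwap ℓ i j t).symm a = a := by
          rw [Equiv.symm_apply_eq, regSwap_other t ha]
        rwa [this]
    · rw [if_neg hac, if_neg hac, if_neg hac]

end VecOps

/-! ### An exact circuit for the symmetric projection: rotated controls, a chain of success flags,
and uncomputation -/

section SymTest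

/-! ### The circuit for the symmetric subspace test -/

theorem cos_rotAngle (p q : ℕ) : Real.cos (rotAngle p q) =
    Real.sqrt ((p : ℝ) / ((p : ℝ) + (q : ℝ))) := by
  have h0 : (0 : ℝ) ≤ (p : ℝ) / ((p : ℝ) + (q : ℝ)) := by positivity
  have h1 : (p : ℝ) / ((p : ℝ) + (q : ℝ)) ≤ 1 :=
    div_le_one_of_le₀ (by linarith [Nat.cast_nonneg (α := ℝ) q]) (by positivity)
  exact Real.cos_arccos (by linarith [Real.sqrt_nonneg ((p : ℝ) / ((p : ℝ) + (q : ℝ)))])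
    (Real.sqrt_le_one.2 h1)

theorem cos_rotAngle_sq (p q : ℕ) : Real.cos (rotAngle p q) ^ 2 = (p : ℝ) / ((p : ℝ) + (q : ℝ)) := by
  rw [cos_rotAngle, Real.sq_sqrt (by positivity)]

/-- The places of banks `1` and `2`. -/
def IsAncilla (l : Loc) : Prop := ∃ x, l = cell 1 x ∨ l = cell 2 x

/-- The places of banks `1` and `2` are blank. -/
def Clean (c : Config) : Prop := ∀ l, IsAncilla l → l ∉ c

theorem clean_permConfig {e : Equiv.Perm Loc} (he : ∀ l, IsAncilla l → e l = l) {c : Config}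
    (hc : Clean c) : Clean (permConfig e c) := by
  intro l hl h
  rw [mem_permConfig, (Equiv.symm_apply_eq e).2 (he l hl).symm] at h
  exact hc l hl h

/-- Put the ancillas of `M` in state `1`. -/
def enc (M : Config) : VecEnd := relabel fun c => c ∪ M

/-- One controlled permutation, followed by recording its success in the chain. -/
def stepFwd (a c c' : Loc) (d : ℕ) (C : VecEnd) : VecEnd :=
  toffoliMap c a c' * rotMap a d 1 * xMap a * C * rotMap a d 1

/-- The inverse of `stepFwd`. -/
def stepBwd (a c c' : Loc) (d : ℕ) (C : VecEnd) : VecEnd :=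
  xMap a * rotMap a d 1 * xMap a * C * rotMap a d 1 * xMap a * toffoliMap c a c'

/-- The instruction set has no inverse rotations, but R·X·R = X shows that X·R·X is the inverse of
R, and all other gates are involutions. -/
theorem stepBwd_mul_stepFwd {a c c' : Loc} (h : c ≠ c') (h' : a ≠ c') (d : ℕ) {C C' : VecEnd}
    (hC : C' * C = 1) : stepBwd a c c' d C' * stepFwd a c c' d C = 1 := by
  have h1 := toffoliMap_mul_self h h'
  have h2 := rot_x_rot a d 1
  have h3 := xMap_mul_self a
  calc stepBwd a c c' d C' * stepFwd a c c' d C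
      = xMap a * rotMap a d 1 * xMap a * C' * rotMap a d 1 * xMap a *
          (toffoliMap c a c' * toffoliMap c a c') * rotMap a d 1 * xMap a * C * rotMap a d 1 := by
        simp only [stepBwd, stepFwd, mul_assoc]
    _ = xMap a * rotMap a d 1 * xMap a * C' * (rotMap a d 1 * xMap a * rotMap a d 1) * xMap a * C *
          rotMap a d 1 := by rw [h1]; simp only [mul_one, mul_assoc]
    _ = xMap a * rotMap a d 1 * xMap a * C' * (xMap a * xMap a) * C * rotMap a d 1 := by
        rw [h2]; simp only [mul_assoc]
    _ = xMap a * rotMap a d 1 * xMap a * (C' * C) * rotMap a d 1 := by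
        rw [h3]; simp only [mul_one, mul_assoc]
    _ = xMap a * (rotMap a d 1 * xMap a * rotMap a d 1) := by
        rw [hC]; simp only [mul_one, mul_assoc]
    _ = 1 := by rw [h2, h3]

/-- The weighted mean of the identity and a permutation of the places. -/
def lazyMap (d : ℕ) (e : Equiv.Perm Loc) : VecEnd :=
  ((d : ℂ) / (d + 1)) • 1 + (1 / ((d : ℂ) + 1)) • relabel (permConfig e)

theorem lazyMap_apply (d : ℕ) (e : Equiv.Perm Loc) (w : Vec) : lazyMap d e w =
    ((d : ℂ) / (d + 1)) • w + (1 / ((d : ℂ) + 1)) • relabel (permConfig e) w := rfl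

theorem supp_clean_lazyMap {e : Equiv.Perm Loc} (he : ∀ l, IsAncilla l → e l = l) {w : Vec}
    (hw : Supp Clean w) (d : ℕ) : Supp Clean (lazyMap d e w) :=
  (hw.smul _).add ((hw.relabel fun _ hc => clean_permConfig he hc).smul _)

theorem toffoli_single_mem {l₁ l₂ l₃ : Loc} {c : Config} (h1 : l₁ ∈ c) (h2 : l₂ ∈ c) (h3 : l₃ ∉ c)
    (z : ℂ) : toffoliMap l₁ l₂ l₃ (Finsupp.single c z) = Finsupp.single (insert l₃ c) z := by
  rw [toffoliMap, relabel_single]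
  congr 1
  ext l
  rw [mem_flipIf]
  by_cases h : l = l₃
  · subst h; simp [h1, h2, h3]
  · simp [h]

theorem toffoli_single_notMem {l₁ l₂ l₃ : Loc} {c : Config} (h : ¬ (l₁ ∈ c ∧ l₂ ∈ c))
    (z : ℂ) : toffoliMap l₁ l₂ l₃ (Finsupp.single c z) = Finsupp.single c z := by
  rw [toffoliMap, relabel_single, flipIf, if_neg h]

/-- The control is in the state cos·|0⟩ + sin·|1⟩ with cos² = d/(d+1), and the permutation acts on
the second part. After X and a second rotation, the part with control 1 carries cos² times the
identity plus sin² times the permutation, which is the lazy mean; the part with control 0 carries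
cos·sin times their difference. Only the former extends the chain. -/
theorem stepFwd_single {a c c' : Loc} (hac : a ≠ c) (hac' : a ≠ c') (hcc' : c ≠ c') (d : ℕ)
    {e : Equiv.Perm Loc} (ha : e a = a) (hc : e c = c) (hc' : e c' = c') {s : Config}
    (has : a ∉ s) (hcs : c ∈ s) (hcs' : c' ∉ s) (z : ℂ) :
    stepFwd a c c' d (relabel fun x => if a ∈ x then permConfig e x else x) (Finsupp.single s z) =
      Finsupp.single (insert c' (insert a s)) ((d : ℂ) / (d + 1) * z) +
      Finsupp.single (insert c' (insert a (permConfig e s))) (1 / ((d : ℂ) + 1) * z) +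
      (Finsupp.single (permConfig e s) ((Real.cos (rotAngle d 1) : ℂ) * (Real.sin (rotAngle d 1) : ℂ) * z) -
      Finsupp.single s ((Real.cos (rotAngle d 1) : ℂ) * (Real.sin (rotAngle d 1) : ℂ) * z)) := by
  have hd : (d : ℝ) + 1 ≠ 0 := Nat.cast_add_one_ne_zero d
  have hcos : (Real.cos (rotAngle d 1) : ℂ) ^ 2 = (d : ℂ) / (d + 1) := by
    have := cos_rotAngle_sq d 1
    rw [← Complex.ofReal_pow, this]
    push_cast
    rfl
  have hsin : (Real.sin (rotAngle d 1) : ℂ) ^ 2 = 1 / ((d : ℂ) + 1) := by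
    have h1 := Real.sin_sq_add_cos_sq (rotAngle d 1)
    rw [cos_rotAngle_sq d 1] at h1
    have h2 : Real.sin (rotAngle d 1) ^ 2 = 1 / ((d : ℝ) + 1) := by
      rw [eq_sub_of_add_eq h1]; push_cast; field_simp; ring
    rw [← Complex.ofReal_pow, h2]
    push_cast
    rfl
  have fix : ∀ l, e l = l → ∀ x, l ∈ permConfig e x ↔ l ∈ x := by
    intro l hl x
    rw [mem_permConfig, (Equiv.symm_apply_eq e).2 hl.symm]
  have hins : permConfig e (insert a s) = insert a (permConfig e s) := by
    rw [permConfig, Finset.map_insert]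
    congr 1
  set s' := permConfig e s with hs'
  have has' : a ∉ s' := by rwa [hs', fix a ha]
  have hcs1 : c ∈ s' := by rwa [hs', fix c hc]
  have hcs1' : c' ∉ s' := by rwa [hs', fix c' hc']
  set co : ℂ := (Real.cos (rotAngle d 1) : ℂ) with hco
  set si : ℂ := (Real.sin (rotAngle d 1) : ℂ) with hsi
  have ins : ∀ x : Config, a ∈ insert a x := fun x => Finset.mem_insert_self _ _
  simp only [stepFwd, Module.End.mul_apply]
  rw [rotMap_single_of_notMem has, map_add, relabel_single, relabel_single, if_neg has,
    if_pos (ins s), hins, map_add, xMap, relabel_single, relabel_single, flipIf_true_of_notMem has,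
    flipIf_true_of_mem (ins _), Finset.erase_insert has', map_add, rotMap_single_of_mem (ins s),
    rotMap_single_of_notMem has', Finset.erase_insert has, ← hco, ← hsi]
  simp only [map_add]
  rw [toffoli_single_notMem (by tauto), toffoli_single_mem (by simp [hcs]) (ins _)
    (by simp [hac'.symm, hcs']), toffoli_single_notMem (by tauto),
    toffoli_single_mem (by simp [hcs1]) (ins _) (by simp [hac'.symm, hcs1'])]
  rw [← hcos, ← hsin,
    show co * (co * z) = co ^ 2 * z by ring, show si * (si * z) = si ^ 2 * z by ring,
    show -si * (co * z) = -(co * si * z) by ring, show co * (si * z) = co * si * z by ring]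
  simp only [Finsupp.single_neg]
  abel

/-- The failure term is a multiple of the permuted vector minus the vector. It vanishes on invariant
vectors, on which a step therefore succeeds with certainty. -/
theorem stepFwd_enc {a c c' : Loc} (hac : a ≠ c) (hac' : a ≠ c') (hcc' : c ≠ c') (d : ℕ)
    (hA : IsAncilla a) (hC : IsAncilla c) (hC' : IsAncilla c')
    {e : Equiv.Perm Loc} (he : ∀ l, IsAncilla l → e l = l) {M : Config} (hM : ∀ l ∈ M, IsAncilla l)
    (ha : a ∉ M) (hc : c ∈ M) (hc' : c' ∉ M) {w : Vec} (hw : Supp Clean w) :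
    stepFwd a c c' d (relabel fun x => if a ∈ x then permConfig e x else x) (enc M w) =
      enc (insert c' (insert a M)) (lazyMap d e w) +
      enc M ((Real.cos (rotAngle d 1) * Real.sin (rotAngle d 1) : ℂ) •
        (relabel (permConfig e) w - w)) := by
  refine hw.induction (motive := fun w => stepFwd a c c' d _ (enc M w) =
    enc (insert c' (insert a M)) (lazyMap d e w) +
      enc M ((Real.cos (rotAngle d 1) * Real.sin (rotAngle d 1) : ℂ) •
        (relabel (permConfig e) w - w))) ?_ ?_ ?_
  · simp
  · intro v w hv hw
    rw [map_add, map_add, hv, hw]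
    simp only [map_add, smul_add, smul_sub, map_sub]
    abel
  · intro s z hs
    have h1 : permConfig e (s ∪ M) = permConfig e s ∪ M := by
      ext l
      rw [mem_permConfig, Finset.mem_union, Finset.mem_union, mem_permConfig]
      by_cases hl : IsAncilla l
      · rw [(Equiv.symm_apply_eq e).2 (he l hl).symm]
      · have h2 : ¬ IsAncilla (e.symm l) := by
          intro h
          have := he _ h
          rw [Equiv.apply_symm_apply] at this
          exact hl (this ▸ h)
        have h3 : l ∉ M := fun h => hl (hM _ h)
        have h4 : e.symm l ∉ M := fun h => h2 (hM _ h)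
        simp [h3, h4]
    have hsub : ∀ x : Config, insert c' (insert a (x ∪ M)) = x ∪ insert c' (insert a M) := by
      intro x; ext l; simp only [Finset.mem_insert, Finset.mem_union]; tauto
    rw [enc, relabel_single, stepFwd_single hac hac' hcc' d (he a hA) (he c hC) (he c' hC')
      (by simp [ha, hs a hA]) (by simp [hc]) (by simp [hc', hs c' hC']), h1, hsub, hsub,
      lazyMap_apply, relabel_single, Finsupp.smul_single, Finsupp.smul_single, map_add, smul_sub,
      map_sub, Finsupp.smul_single, Finsupp.smul_single, enc, relabel_single, relabel_single,
      relabel_single, relabel_single]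
    rfl

/-- The ancillas in state `1` after `k` successful steps. -/
def chainSet (k : ℕ) : Config :=
  (Finset.range k).image (cell 1) ∪ (Finset.range (k + 1)).image (cell 2)

theorem mem_chainSet {k : ℕ} {l : Loc} : l ∈ chainSet k ↔
    (∃ x < k, l = cell 1 x) ∨ ∃ x < k + 1, l = cell 2 x := by
  simp only [chainSet, Finset.mem_union, Finset.mem_image, Finset.mem_range]
  simp only [eq_comm]

theorem cell_one_mem_chainSet {k x : ℕ} : cell 1 x ∈ chainSet k ↔ x < k := by
  rw [mem_chainSet]
  simp

theorem cell_two_mem_chainSet {k x : ℕ} : cell 2 x ∈ chainSet k ↔ x < k + 1 := by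
  rw [mem_chainSet]
  simp

theorem chainSet_succ (k : ℕ) :
    chainSet (k + 1) = insert (cell 2 (k + 1)) (insert (cell 1 k) (chainSet k)) := by
  ext l
  rw [Finset.mem_insert, Finset.mem_insert, mem_chainSet, mem_chainSet]
  constructor
  · rintro (⟨x, hx, rfl⟩ | ⟨x, hx, rfl⟩)
    · rcases Nat.lt_succ_iff_lt_or_eq.1 hx with h | rfl
      · exact Or.inr (Or.inr (Or.inl ⟨x, h, rfl⟩))
      · exact Or.inr (Or.inl rfl)
    · rcases Nat.lt_succ_iff_lt_or_eq.1 hx with h | rfl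
      · exact Or.inr (Or.inr (Or.inr ⟨x, h, rfl⟩))
      · exact Or.inl rfl
  · rintro (rfl | rfl | ⟨x, hx, rfl⟩ | ⟨x, hx, rfl⟩)
    · exact Or.inr ⟨_, by omega, rfl⟩
    · exact Or.inl ⟨_, by omega, rfl⟩
    · exact Or.inl ⟨_, by omega, rfl⟩
    · exact Or.inr ⟨_, by omega, rfl⟩

/-- The chain was broken before step `k`. -/
def Broken (k : ℕ) (c : Config) : Prop := ∀ x, k ≤ x → cell 2 x ∉ c

/-- `G` acts from step `k` to step `k'` of the chain as `E`. -/
def Chain (k k' : ℕ) (G E : VecEnd) : Prop :=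
  (∀ w, Supp Clean w → Supp Clean (E w)) ∧
  (∀ u, Supp (Broken k) u → Supp (Broken k') (G u)) ∧
  ∀ w, Supp Clean w → ∃ u, Supp (Broken k') u ∧
    G (enc (chainSet k) w) = enc (chainSet k') (E w) + u

theorem Chain.refl (k : ℕ) : Chain k k 1 1 :=
  ⟨fun _ h => h, fun _ h => h, fun _ _ => ⟨0, Supp.zero, by simp⟩⟩

theorem Chain.trans {k k' k'' : ℕ} {G E G' E' : VecEnd} (h : Chain k k' G E)
    (h' : Chain k' k'' G' E') : Chain k k'' (G' * G) (E' * E) := by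
  refine ⟨fun w hw => h'.1 _ (h.1 _ hw), fun u hu => h'.2.1 _ (h.2.1 _ hu), fun w hw => ?_⟩
  obtain ⟨u, hu, e⟩ := h.2.2 w hw
  obtain ⟨u', hu', e'⟩ := h'.2.2 (E w) (h.1 w hw)
  refine ⟨u' + G' u, hu'.add (h'.2.1 u hu), ?_⟩
  rw [Module.End.mul_apply, Module.End.mul_apply, e, map_add, e', add_assoc]

theorem Supp.actMap {p : Config → Prop} {v : Vec} (hv : Supp p v) {k : ℕ} {L : Fin k → Loc}
    {U : Matrix (Fin k → Bool) (Fin k → Bool) ℂ} (h : ∀ c b, p c → p (setBits L b c)) :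
    Supp p (actMap L U v) := by
  rw [QMoney.actMap]
  split_ifs
  · refine Supp.applyOp hv fun c b hc => ?_
    rw [setBits_setBits]
    exact h c b hc
  · exact hv

theorem Supp.rotMap {p : Config → Prop} {v : Vec} (hv : Supp p v) {a : Loc}
    (h : ∀ c b, p c → p (setBits ![a] b c)) (m n : ℕ) : Supp p (rotMap a m n v) :=
  hv.actMap h

/-- A broken chain cannot be repaired: the flag `k` is a control of the Toffoli gate that would set
flag `k + 1`. For an intact chain the failure term leaves flag `k + 1` and all later ones at zero,
so it is broken from the next step on. -/
theorem chain_step (k d : ℕ) {e : Equiv.Perm Loc} (he : ∀ l, IsAncilla l → e l = l) :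
    Chain k (k + 1) (stepFwd (cell 1 k) (cell 2 k) (cell 2 (k + 1)) d
      (relabel fun x => if cell 1 k ∈ x then permConfig e x else x)) (lazyMap d e) := by
  have one : ∀ x, IsAncilla (cell 1 x) := fun x => ⟨x, Or.inl rfl⟩
  have two : ∀ x, IsAncilla (cell 2 x) := fun x => ⟨x, Or.inr rfl⟩
  refine ⟨fun w hw => supp_clean_lazyMap he hw d, fun u hu => ?_, fun w hw => ?_⟩
  · simp only [stepFwd, Module.End.mul_apply]
    have hset : ∀ c b, Broken k c → Broken k (setBits ![cell 1 k] b c) := by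
      intro c b hc x hx
      rw [mem_setBits_of_ne (by simp)]
      exact hc x hx
    refine Supp.mono (p := Broken k) ?_ fun c hc x hx => hc x (by omega)
    refine Supp.relabel (p := Broken k) ?_ fun c hc => ?_
    · refine Supp.rotMap ?_ hset _ _
      refine Supp.relabel (p := Broken k) ?_ fun c hc x hx => ?_
      · refine Supp.relabel (p := Broken k) (Supp.rotMap hu hset _ _) fun c hc x hx => ?_
        split_ifs
        · rw [mem_permConfig, (Equiv.symm_apply_eq e).2 (he _ (two x)).symm]
          exact hc x hx
        · exact hc x hx
      · rw [mem_flipIf]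
        simp [hc x hx]
    · rw [flipIf, if_neg]
      · exact hc
      · exact fun h => hc k le_rfl h.1
  · refine ⟨enc (chainSet k) ((Real.cos (rotAngle d 1) * Real.sin (rotAngle d 1) : ℂ) •
        (relabel (permConfig e) w - w)), ?_, ?_⟩
    rotate_left
    · rw [chainSet_succ]
      refine stepFwd_enc (by simp) (by simp) (by simp) d (one _) (two _) (two _) he ?_ ?_ ?_ ?_ hw
      · intro l hl
        rw [mem_chainSet] at hl
        rcases hl with ⟨x, _, rfl⟩ | ⟨x, _, rfl⟩
        exacts [one x, two x]
      · rw [cell_one_mem_chainSet]; omega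
      · rw [cell_two_mem_chainSet]; omega
      · rw [cell_two_mem_chainSet]; omega
    · refine Supp.relabel (p := Clean) ?_ fun c hc x hx => ?_
      · exact ((hw.relabel fun _ hc => clean_permConfig he hc).sub hw).smul _
      · rw [Finset.mem_union, cell_two_mem_chainSet]
        have := hc _ (two x)
        simp only [this, false_or]
        omega

theorem chain_upProd {g E : ℕ → VecEnd} {k : ℕ → ℕ} (n : ℕ)
    (h : ∀ i < n, Chain (k i) (k (i + 1)) (g i) (E i)) :
    Chain (k 0) (k n) (upProd g n) (upProd E n) := by
  induction n with
  | zero => exact Chain.refl _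
  | succ n ih => exact (ih fun i hi => h i (by omega)).trans (h n (by omega))

/-- The steps of the test of `N` registers of `ℓ` qubits in bank `0`. -/
def testStep (ℓ N j i : ℕ) : VecEnd :=
  stepFwd (cell 1 (j * N + i)) (cell 2 (j * N + i)) (cell 2 (j * N + i + 1)) (j - i)
    (cswapRegs ℓ (j - (j - i)) j (cell 1 (j * N + i)) ℓ)

/-- The inverse of the exchange of registers. -/
def cswapRegsInv (ℓ i j : ℕ) (a : Loc) : ℕ → VecEnd :=
  downProd fun t => cswapMap a (cell 0 (i * ℓ + t)) (cell 0 (j * ℓ + t))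

/-- The inverses of the steps. -/
def testStepInv (ℓ N j i : ℕ) : VecEnd :=
  stepBwd (cell 1 (j * N + i)) (cell 2 (j * N + i)) (cell 2 (j * N + i + 1)) (j - i)
    (cswapRegsInv ℓ (j - (j - i)) j (cell 1 (j * N + i)) ℓ)

/-- All steps of the test. -/
def testFwd (ℓ N : ℕ) : VecEnd := upProd (fun j => upProd (testStep ℓ N j) N) N

/-- The inverse of all steps of the test. -/
def testBwd (ℓ N : ℕ) : VecEnd := downProd (fun j => downProd (testStepInv ℓ N j) N) N

theorem testBwd_mul_testFwd (ℓ N : ℕ) : testBwd ℓ N * testFwd ℓ N = 1 :=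
  downProd_mul_upProd N fun _ _ => downProd_mul_upProd N fun _ _ =>
    stepBwd_mul_stepFwd (by simp) (by simp) _
      (downProd_mul_upProd ℓ fun _ _ => cswapMap_mul_self (by simp))

/-- The operator that the test applies on acceptance. -/
def testLazy (ℓ N : ℕ) : VecEnd :=
  upProd (fun j => upProd (fun i => lazyMap (j - i) (regSwap ℓ (j - (j - i)) j ℓ)) N) N

theorem regSwap_ancilla (ℓ i j t : ℕ) {l : Loc} (hl : IsAncilla l) : regSwap ℓ i j t l = l := by
  refine regSwap_other t fun x => ?_
  rcases hl with ⟨y, rfl | rfl⟩ <;> simp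

theorem testStep_eq (ℓ N j i : ℕ) : testStep ℓ N j i =
    stepFwd (cell 1 (j * N + i)) (cell 2 (j * N + i)) (cell 2 (j * N + i + 1)) (j - i)
      (relabel fun x => if cell 1 (j * N + i) ∈ x then
        permConfig (regSwap ℓ (j - (j - i)) j ℓ) x else x) := by
  rw [testStep, cswapRegs_eq (by simp)]

theorem chain_testFwd (ℓ N : ℕ) : Chain 0 (N * N) (testFwd ℓ N) (testLazy ℓ N) := by
  have h := chain_upProd (k := fun j => j * N) (g := fun j => upProd (testStep ℓ N j) N)
    (E := fun j => upProd (fun i => lazyMap (j - i) (regSwap ℓ (j - (j - i)) j ℓ)) N) N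
    fun j _ => by
      have h := chain_upProd (k := fun i => j * N + i) (g := testStep ℓ N j)
        (E := fun i => lazyMap (j - i) (regSwap ℓ (j - (j - i)) j ℓ)) N fun i _ => by
          rw [testStep_eq]
          exact chain_step _ _ fun l hl => regSwap_ancilla _ _ _ _ hl
      rwa [add_zero, ← Nat.succ_mul] at h
  rwa [zero_mul] at h

/-- On vectors fixed by all exchanges of registers the failure terms vanish and the lazy means act
trivially, so the forward circuit merely sets all flags. Read backwards, this says what
uncomputation does after acceptance. -/
theorem testFwd_of_fixed (ℓ N : ℕ) {w : Vec} (hw : Supp Clean w)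
    (h : ∀ i < N, ∀ j < N, relabel (permConfig (regSwap ℓ i j ℓ)) w = w) :
    testFwd ℓ N (enc (chainSet 0) w) = enc (chainSet (N * N)) w := by
  have step : ∀ j < N, ∀ i < N, testStep ℓ N j i (enc (chainSet (j * N + i)) w) =
      enc (chainSet (j * N + i + 1)) w := by
    intro j hj i _
    have one : ∀ x, IsAncilla (cell 1 x) := fun x => ⟨x, Or.inl rfl⟩
    have two : ∀ x, IsAncilla (cell 2 x) := fun x => ⟨x, Or.inr rfl⟩
    have hd : ((j - i : ℕ) : ℂ) + 1 ≠ 0 := Nat.cast_add_one_ne_zero _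
    rw [testStep_eq, stepFwd_enc (by simp) (by simp) (by simp) _ (one _) (two _) (two _)
      (fun l hl => regSwap_ancilla _ _ _ _ hl) _ _ _ _ hw, chainSet_succ, lazyMap_apply,
      h _ (by omega) _ hj, sub_self, smul_zero, map_zero, add_zero, ← add_smul, ← add_div,
      div_self hd, one_smul]
    · intro l hl
      rw [mem_chainSet] at hl
      rcases hl with ⟨x, _, rfl⟩ | ⟨x, _, rfl⟩
      exacts [one x, two x]
    · rw [cell_one_mem_chainSet]; omega
    · rw [cell_two_mem_chainSet]; omega
    · rw [cell_two_mem_chainSet]; omega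
  have gen : ∀ (g : ℕ → VecEnd) (k : ℕ → ℕ) (n : ℕ),
      (∀ i < n, g i (enc (chainSet (k i)) w) = enc (chainSet (k (i + 1))) w) →
      upProd g n (enc (chainSet (k 0)) w) = enc (chainSet (k n)) w := by
    intro g k n
    induction n with
    | zero => intro _; rfl
    | succ n ih =>
      intro hg
      rw [upProd, Module.End.mul_apply, ih fun i hi => hg i (by omega), hg n (by omega)]
  have := gen (fun j => upProd (testStep ℓ N j) N) (fun j => j * N) N fun j hj => by
    have := gen (testStep ℓ N j) (fun i => j * N + i) N fun i hi => step j hj i hi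
    rwa [add_zero, ← Nat.succ_mul] at this
  rwa [zero_mul] at this

/-- One branch of the test. -/
def testMap (ℓ N : ℕ) (acc : Bool) (v : Vec) : Vec :=
  xMap (cell 2 0) (testBwd ℓ N ((testFwd ℓ N (xMap (cell 2 0) v)).filter
    fun c => decide (cell 2 (N * N) ∈ c) = acc))

theorem filter_eq_self_of_supp {p q : Config → Prop} [DecidablePred q] {v : Vec} (hv : Supp p v)
    (h : ∀ c, p c → q c) : v.filter q = v := by
  rw [Finsupp.filter_eq_self_iff]
  exact fun c hc => h c (hv c (Finsupp.mem_support_iff.2 hc))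

theorem filter_eq_zero_of_supp {p q : Config → Prop} [DecidablePred q] {v : Vec} (hv : Supp p v)
    (h : ∀ c, p c → ¬ q c) : v.filter q = 0 := by
  rw [Finsupp.filter_eq_zero_iff]
  intro c hc
  by_contra h0
  exact h c (hv c (Finsupp.mem_support_iff.2 h0)) hc

theorem xMap_of_clean {w : Vec} (hw : Supp Clean w) :
    xMap (cell 2 0) w = enc (chainSet 0) w := by
  refine hw.induction (motive := fun w => xMap (cell 2 0) w = enc (chainSet 0) w) ?_ ?_ ?_
  · simp
  · intro v w hv hw
    rw [map_add, map_add, hv, hw]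
  · intro c z hc
    rw [xMap, enc, relabel_single, relabel_single,
      flipIf_true_of_notMem (hc _ ⟨0, Or.inr rfl⟩)]
    congr 1
    ext l
    simp [chainSet, or_comm]

/-- Measuring the last flag separates the success branch from the broken ones. After success the
register state is already symmetric, hence it is also what the forward circuit would have produced
from itself, and the inverse circuit returns it with clean ancillas. Linearity then settles the
rejecting branch. -/
theorem testMap_eq {ℓ N : ℕ} {w : Vec} (hw : Supp Clean w)
    (h : ∀ i < N, ∀ j < N,
      relabel (permConfig (regSwap ℓ i j ℓ)) (testLazy ℓ N w) = testLazy ℓ N w) (acc : Bool) :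
    testMap ℓ N acc w = if acc then testLazy ℓ N w else w - testLazy ℓ N w := by
  obtain ⟨h1, -, h3⟩ := chain_testFwd ℓ N
  obtain ⟨u, hu, e⟩ := h3 w hw
  have hclean := h1 w hw
  have inv : ∀ v, testBwd ℓ N (testFwd ℓ N v) = v := fun v =>
    congrArg (fun f : VecEnd => f v) (testBwd_mul_testFwd ℓ N)
  have xx : ∀ v, xMap (cell 2 0) (xMap (cell 2 0) v) = v := fun v =>
    congrArg (fun f : VecEnd => f v) (xMap_mul_self (cell 2 0))
  have hfix := testFwd_of_fixed ℓ N hclean h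
  have hE : Supp (fun c => cell 2 (N * N) ∈ c) (enc (chainSet (N * N)) (testLazy ℓ N w)) := by
    refine Supp.relabel hclean fun c _ => ?_
    rw [Finset.mem_union, cell_two_mem_chainSet]
    omega
  -- Symmetry of the projected vector is used here: its encoding with a full chain is the image of
  -- the same vector with the initial chain.
  have hbE : testBwd ℓ N (enc (chainSet (N * N)) (testLazy ℓ N w)) =
      xMap (cell 2 0) (testLazy ℓ N w) := by
    rw [← hfix, inv, xMap_of_clean hclean]
  rw [testMap, xMap_of_clean hw, e, Finsupp.filter_add]
  cases acc
  · rw [filter_eq_zero_of_supp hE (by simp), filter_eq_self_of_supp hu (fun c hc => by simpa using hc _ le_rfl),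
      zero_add]
    -- The broken part is the total minus the success part, and the inverse circuit is known on
    -- both, so `u` itself need not be described.
    have hu' : u = testFwd ℓ N (enc (chainSet 0) w) - enc (chainSet (N * N)) (testLazy ℓ N w) := by
      rw [e]; abel
    rw [hu', map_sub, inv, hbE, ← xMap_of_clean hw, map_sub, xx, xx]
    rfl
  · rw [filter_eq_self_of_supp hE (by simp), filter_eq_zero_of_supp hu (fun c hc => by simpa using hc _ le_rfl),
      add_zero, hbE, xx]
    rfl

/-! ### The test as an operator on the registers of the wallet -/

/-- The cells of bank `0` that hold `m` money states. -/
def bank0 (m r ℓ : ℕ) : Slots m r ℓ → ℕ × ℕ := fun i => (0, (i.1.1 * r + i.1.2) * ℓ + i.2)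

theorem slot_index_inj {r ℓ : ℕ} {a a' b b' c c' : ℕ} (hb : b < r) (hb' : b' < r) (hc : c < ℓ)
    (hc' : c' < ℓ) (h : (a * r + b) * ℓ + c = (a' * r + b') * ℓ + c') : a = a' ∧ b = b' ∧ c = c' := by
  have key : ∀ {ℓ x x' c c' : ℕ}, c < ℓ → c' < ℓ → x * ℓ + c = x' * ℓ + c' → x = x' ∧ c = c' := by
    intro ℓ x x' c c' hc hc' h
    have h1 : (x * ℓ + c) % ℓ = (x' * ℓ + c') % ℓ := by rw [h]
    rw [add_comm, Nat.add_mul_mod_self_right, add_comm, Nat.add_mul_mod_self_right,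
      Nat.mod_eq_of_lt hc, Nat.mod_eq_of_lt hc'] at h1
    have h2 : x * ℓ = x' * ℓ := by omega
    exact ⟨Nat.eq_of_mul_eq_mul_right (by omega) h2, h1⟩
  obtain ⟨h1, h2⟩ := key hc hc' h
  obtain ⟨h3, h4⟩ := key hb hb' h1
  exact ⟨h3, h4, h2⟩

theorem slots_injective {β : Type} (f : ℕ → β) (hf : Function.Injective f) (m r ℓ : ℕ) :
    Function.Injective fun i : Slots m r ℓ => f ((i.1.1 * r + i.1.2) * ℓ + i.2) := by
  rintro ⟨⟨a, b⟩, c⟩ ⟨⟨a', b'⟩, c'⟩ h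
  obtain ⟨h1, h2, h3⟩ := slot_index_inj b.2 b'.2 c.2 c'.2 (hf h)
  simp only at h1 h2 h3
  simp only [Prod.mk.injEq, Fin.ext_iff, h1, h2, h3, and_self]

theorem bank0_injective (m r ℓ : ℕ) : Function.Injective (bank0 m r ℓ) :=
  slots_injective (fun x => (0, x)) (fun _ _ h => (Prod.mk.inj h).2) m r ℓ

/-- The register with a given index. -/
def regOf (m r : ℕ) (hr : 0 < r) (x : ℕ) : Fin (m + 1) × Fin r :=
  (Fin.ofNat (m + 1) (x / r), ⟨x % r, Nat.mod_lt _ hr⟩)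

theorem regOf_index {m r : ℕ} (hr : 0 < r) {x : ℕ} (hx : x < (m + 1) * r) :
    ((regOf m r hr x).1 : ℕ) * r + (regOf m r hr x).2 = x := by
  have : x / r < m + 1 := Nat.div_lt_of_lt_mul (by rwa [mul_comm])
  simp only [regOf, Fin.ofNat, Nat.mod_eq_of_lt this]
  rw [mul_comm]; exact Nat.div_add_mod x r

theorem regOf_of_index {m r : ℕ} (hr : 0 < r) (ρ : Fin (m + 1) × Fin r) :
    regOf m r hr (ρ.1 * r + ρ.2) = ρ := by
  have h1 : ((ρ.1 : ℕ) * r + ρ.2) / r = ρ.1 := by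
    rw [mul_comm, Nat.mul_add_div hr, Nat.div_eq_of_lt ρ.2.2, add_zero]
  have h2 : ((ρ.1 : ℕ) * r + ρ.2) % r = ρ.2 := by
    rw [add_comm, Nat.add_mul_mod_self_right, Nat.mod_eq_of_lt ρ.2.2]
  refine Prod.ext (Fin.ext ?_) (Fin.ext ?_)
  · simp [regOf, Fin.ofNat, h1, Nat.mod_eq_of_lt ρ.1.2]
  · simp [regOf, h2]

theorem relabel_regSwap {m r ℓ : ℕ} (hr : 0 < r) {i j : ℕ} (hi : i < (m + 1) * r)
    (hj : j < (m + 1) * r) (w : Vec) :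
    relabel (permConfig (regSwap ℓ i j ℓ)) w =
      applyOp (fun q => Sum.inl (bank0 (m + 1) r ℓ q)) (fun q => Sum.inl (bank0 (m + 1) r ℓ q))
        (permMat ℓ (Equiv.swap (regOf m r hr i) (regOf m r hr j))) w := by
  set W : Slots (m + 1) r ℓ → Loc := fun q => Sum.inl (bank0 (m + 1) r ℓ q) with hW
  have hWinj : Function.Injective W := fun x y h => bank0_injective _ _ _ (Sum.inl_injective h)
  set π := Equiv.swap (regOf m r hr i) (regOf m r hr j) with hπ
  have hππ : ∀ ρ, π (π ρ) = ρ := fun ρ => Equiv.swap_apply_self _ _ _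
  have idx : ∀ ρ : Fin (m + 1) × Fin r, Equiv.swap i j ((ρ.1 : ℕ) * r + ρ.2) =
      ((π ρ).1 : ℕ) * r + (π ρ).2 := by
    intro ρ
    have hρ := regOf_of_index hr ρ
    have hiff : ∀ x, x < (m + 1) * r → ((ρ.1 : ℕ) * r + ρ.2 = x ↔ ρ = regOf m r hr x) := by
      intro x hx
      constructor
      · rintro rfl; exact hρ.symm
      · intro h; rw [h, regOf_index hr hx]
    rw [hπ, Equiv.swap_apply_def, Equiv.swap_apply_def]
    simp only [hiff i hi, hiff j hj]
    split_ifs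
    · rw [regOf_index hr hj]
    · rw [regOf_index hr hi]
    · rfl
  have hreg : ∀ q, regSwap ℓ i j ℓ (W q) = W (π q.1, q.2) := by
    intro q
    have := regSwap_apply (i := i) (j := j) ℓ le_rfl ((q.1.1 : ℕ) * r + q.1.2) q.2 q.2.2
    rw [if_pos q.2.2, idx] at this
    exact this
  induction w using Finsupp.induction_linear with
  | zero => rw [map_zero, applyOp_zero]
  | add v w hv hw => rw [map_add, applyOp_add, hv, hw]
  | single c z =>
    rw [relabel_single, applyOp_single,
      Finset.sum_eq_single (fun q => getBits W c (π q.1, q.2))]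
    · rw [setBits_setBits, permMat, Matrix.of_apply, if_pos, one_mul]
      · congr 1
        ext l
        rw [mem_permConfig, mem_setBits]
        by_cases hl : ∃ q, W q = l
        · obtain ⟨q, rfl⟩ := hl
          have h1 : (regSwap ℓ i j ℓ).symm (W q) = W (π q.1, q.2) := by
            rw [Equiv.symm_apply_eq, hreg, hππ]
          rw [h1]
          constructor
          · intro h; exact Or.inr ⟨q, by simpa using h, rfl⟩
          · rintro (⟨_, h⟩ | ⟨q', h, hq'⟩)
            · exact absurd rfl (h q)
            · obtain rfl := hWinj hq'
              simpa using h
        · push Not at hl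
          have h1 : (regSwap ℓ i j ℓ).symm l = l := by
            rw [Equiv.symm_apply_eq]
            rcases Nat.eq_zero_or_pos ℓ with rfl | hℓ
            · rfl
            · by_cases hc : ∃ x, l = cell 0 x
              · obtain ⟨x, rfl⟩ := hc
                have hx : x = x / ℓ * ℓ + x % ℓ := by rw [mul_comm, Nat.div_add_mod]
                rw [hx, regSwap_apply ℓ le_rfl _ _ (Nat.mod_lt _ hℓ), if_pos (Nat.mod_lt _ hℓ),
                  Equiv.swap_apply_of_ne_of_ne]
                all_goals
                  intro h
                  have hlt : x / ℓ < (m + 1) * r := by omega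
                  refine hl (regOf m r hr (x / ℓ), ⟨x % ℓ, Nat.mod_lt _ hℓ⟩) ?_
                  simp only [hW, bank0, regOf_index hr hlt]
                  rw [← hx]
              · push Not at hc
                exact (regSwap_other ℓ hc).symm
          rw [h1]
          constructor
          · intro h; exact Or.inl ⟨h, hl⟩
          · rintro (⟨h, _⟩ | ⟨q, _, hq⟩)
            · exact h
            · exact absurd hq (hl q)
      · funext q
        simp [hππ]
    · intro b _ hb
      rw [permMat, Matrix.of_apply, if_neg, zero_mul, Finsupp.single_zero]
      intro h
      refine hb ?_
      funext q
      rw [h]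
      simp [hππ]
    · simp

theorem testLazy_eq {m r ℓ : ℕ} (hr : 0 < r) {N : ℕ} (hN : N ≤ (m + 1) * r) (w : Vec) :
    testLazy ℓ N w = applyOp (fun q => Sum.inl (bank0 (m + 1) r ℓ q))
      (fun q => Sum.inl (bank0 (m + 1) r ℓ q)) (lazyAll ℓ (regOf m r hr) N N) w := by
  have hinj : Function.Injective (fun q => (Sum.inl (bank0 (m + 1) r ℓ q) : Loc)) :=
    fun x y h => bank0_injective _ _ _ (Sum.inl_injective h)
  have row : ∀ j < N, ∀ n ≤ N, ∀ w : Vec,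
      upProd (fun i => lazyMap (j - i) (regSwap ℓ (j - (j - i)) j ℓ)) n w =
      applyOp (fun q => Sum.inl (bank0 (m + 1) r ℓ q)) (fun q => Sum.inl (bank0 (m + 1) r ℓ q))
        (lazyRow ℓ (regOf m r hr) j n) w := by
    intro j hj n
    induction n with
    | zero => intro _ w; exact (applyOp_one w).symm
    | succ n ih =>
      intro hn w
      rw [upProd, Module.End.mul_apply, ih (by omega), lazyRow, lazyMap_apply,
        relabel_regSwap (m := m) hr (by omega) (by omega), ← applyOp_applyOp_same hinj, lazySwap,
        applyOp_add_op, applyOp_smul_op, applyOp_smul_op, applyOp_one]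
  have all : ∀ n ≤ N, ∀ w : Vec,
      upProd (fun j => upProd (fun i => lazyMap (j - i) (regSwap ℓ (j - (j - i)) j ℓ)) N) n w =
      applyOp (fun q => Sum.inl (bank0 (m + 1) r ℓ q)) (fun q => Sum.inl (bank0 (m + 1) r ℓ q))
        (lazyAll ℓ (regOf m r hr) N n) w := by
    intro n
    induction n with
    | zero => intro _ w; exact (applyOp_one w).symm
    | succ n ih =>
      intro hn w
      rw [upProd, Module.End.mul_apply, ih (by omega), row n (by omega) N le_rfl,
        applyOp_applyOp_same hinj, lazyAll]
  exact all N le_rfl w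

/-- The test circuit applies the projection onto the symmetric subspace, or its complement. -/
theorem testMap_eq_applyOp {m r ℓ t : ℕ} (hr : 0 < r) (ht : t < m) {w : Vec} (hw : Supp Clean w)
    (acc : Bool) : testMap ℓ ((t + 2) * r) acc w =
      applyOp (fun q => Sum.inl (bank0 (m + 1) r ℓ q)) (fun q => Sum.inl (bank0 (m + 1) r ℓ q))
        (testOp m r ℓ t acc) w := by
  have hinj : Function.Injective (fun q => (Sum.inl (bank0 (m + 1) r ℓ q) : Loc)) :=
    fun x y h => bank0_injective _ _ _ (Sum.inl_injective h)
  have hN : (t + 2) * r ≤ (m + 1) * r := Nat.mul_le_mul_right _ (by omega)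
  have hf : ∀ a < (t + 2) * r, ∀ b < (t + 2) * r, regOf m r hr a = regOf m r hr b → a = b := by
    intro a ha b hb h
    rw [← regOf_index hr (lt_of_lt_of_le ha hN), h, regOf_index hr (lt_of_lt_of_le hb hN)]
  -- When submitted coin number `t`, counted from zero, is tested, the wallet has t + 2 coins
  -- including the initial one and the coin under test, so the first (t + 2)·r registers take part.
  have hset : {ρ : Fin (m + 1) × Fin r | ∃ i < (t + 2) * r, regOf m r hr i = ρ} =
      {ρ | (ρ.1 : ℕ) ≤ t + 1} := by
    ext ρ
    constructor
    · rintro ⟨i, hi, rfl⟩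
      have h1 := regOf_index hr (lt_of_lt_of_le hi hN)
      rw [Set.mem_ofPred_eq]
      by_contra h2
      have : (t + 2) * r ≤ ((regOf m r hr i).1 : ℕ) * r := Nat.mul_le_mul_right _ (by omega)
      omega
    · intro h
      refine ⟨ρ.1 * r + ρ.2, ?_, regOf_of_index hr ρ⟩
      have h1 : (ρ.1 : ℕ) * r ≤ (t + 1) * r := Nat.mul_le_mul_right _ h
      have h2 := ρ.2.2
      have h3 : (t + 2) * r = (t + 1) * r + r := by ring
      omega
  have hlazy := symProj_eq_lazyAll (ℓ := ℓ) hf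
  rw [hset] at hlazy
  have hE := testLazy_eq (ℓ := ℓ) hr hN w
  rw [← hlazy] at hE
  rw [testMap_eq hw]
  · rw [hE, testOp]
    cases acc
    · simp only [Bool.false_eq_true, if_false]
      rw [applyOp_sub_op, applyOp_one]
    · rfl
  · intro i hi j hj
    rw [hE, relabel_regSwap hr (lt_of_lt_of_le hi hN) (lt_of_lt_of_le hj hN),
      applyOp_applyOp_same hinj]
    congr 1
    refine Matrix.mulVec_injective (funext fun ψ => ?_)
    rw [← Matrix.mulVec_mulVec]
    have h1 := mem_symSubspace_iff.1 (symProj_mem (ℓ := ℓ)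
      {ρ : Fin (m + 1) × Fin r | (ρ.1 : ℕ) ≤ t + 1} ψ)
    refine h1 _ fun ρ hρ => ?_
    rw [← hset] at hρ
    refine Equiv.swap_apply_of_ne_of_ne ?_ ?_
    · rintro rfl; exact hρ ⟨i, hi, rfl⟩
    · rintro rfl; exact hρ ⟨j, hj, rfl⟩

end SymTest

/-! ### The test as a uniform elementary program, with its running time -/

section Programs

/-! ### Programs without branching -/

/-- From the store `σ`, the program `P` makes at most `c` steps, applies `F` to the quantum state,
and ends with a store that satisfies `Q`. -/
def Runs (P : Prog) (c : ℕ) (σ : ℕ → ℕ) (Q : (ℕ → ℕ) → Prop) (F : VecEnd) : Prop :=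
  ∃ σ', Q σ' ∧ ∃ t ≤ c, ∀ {r ℓ : ℕ} (O : Oracles r ℓ) (s : State), s.store = σ →
    exec O P s = {{ s with store := σ', vec := F s.vec, time := s.time + t }}

/-- The stores differ at most on the variables in `S`. -/
def Frame (S : Finset ℕ) (σ σ' : ℕ → ℕ) : Prop := ∀ x, x ∉ S → σ' x = σ x

theorem Frame.refl (S : Finset ℕ) (σ : ℕ → ℕ) : Frame S σ σ := fun _ _ => rfl

theorem Frame.trans {S S' T : Finset ℕ} {σ σ' σ'' : ℕ → ℕ} (h : Frame S σ σ')
    (h' : Frame S' σ' σ'') (hS : S ⊆ T) (hS' : S' ⊆ T) : Frame T σ σ'' := fun x hx =>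
  (h' x fun hx' => hx (hS' hx')).trans (h x fun hx' => hx (hS hx'))

theorem Frame.mono {S T : Finset ℕ} {σ σ' : ℕ → ℕ} (h : Frame S σ σ') (hS : S ⊆ T) :
    Frame T σ σ' := fun x hx => h x fun hx' => hx (hS hx')

theorem Frame.update {S : Finset ℕ} {σ σ' : ℕ → ℕ} (h : Frame S σ σ') {x : ℕ} (hx : x ∈ S)
    (v : ℕ) : Frame S σ (Function.update σ' x v) := by
  intro y hy
  rw [Function.update_of_ne (by rintro rfl; exact hy hx), h y hy]

namespace Runs

variable {P P' : Prog} {c c' : ℕ} {σ σ' : ℕ → ℕ} {Q Q' : (ℕ → ℕ) → Prop} {F F' : VecEnd}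

theorem seq (h : Runs P c σ Q F) (h' : ∀ σ', Q σ' → Runs P' c' σ' Q' F') :
    Runs (.seq P P') (c + c') σ Q' (F' * F) := by
  obtain ⟨σ₁, h₁, t, ht, e⟩ := h
  obtain ⟨σ₂, h₂, t', ht', e'⟩ := h' σ₁ h₁
  refine ⟨σ₂, h₂, t + t', by omega, fun O s hs => ?_⟩
  rw [exec, e O s hs, Multiset.singleton_bind, e' O _ rfl, add_assoc]
  rfl

theorem seqE (h : Runs P c σ (· = σ') F) (h' : Runs P' c' σ' Q' F') :
    Runs (.seq P P') (c + c') σ Q' (F' * F) :=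
  h.seq fun _ h₁ => h₁ ▸ h'

theorem mono (h : Runs P c σ Q F) (hc : c ≤ c') (hQ : ∀ τ, Q τ → Q' τ) (hF : F = F') :
    Runs P c' σ Q' F' := by
  obtain ⟨σ₁, h₁, t, ht, e⟩ := h
  exact ⟨σ₁, hQ _ h₁, t, ht.trans hc, hF ▸ e⟩

end Runs

theorem runs_const (x c : ℕ) (σ : ℕ → ℕ) :
    Runs (.const x c) 1 σ (· = Function.update σ x c) 1 :=
  ⟨_, rfl, 1, le_rfl, fun O s hs => by subst hs; rfl⟩

theorem runs_add (x y z : ℕ) (σ : ℕ → ℕ) :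
    Runs (.add x y z) 1 σ (· = Function.update σ x (σ y + σ z)) 1 :=
  ⟨_, rfl, 1, le_rfl, fun O s hs => by subst hs; rfl⟩

theorem runs_sub (x y z : ℕ) (σ : ℕ → ℕ) :
    Runs (.sub x y z) 1 σ (· = Function.update σ x (σ y - σ z)) 1 :=
  ⟨_, rfl, 1, le_rfl, fun O s hs => by subst hs; rfl⟩

theorem runs_x (b y : ℕ) (σ : ℕ → ℕ) :
    Runs (.gate .x (b, y)) 1 σ (· = σ) (xMap (cell b (σ y))) :=
  ⟨_, rfl, 1, le_rfl, fun O s hs => by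
    subst hs; rw [exec, State.act_eq, ← actMap_x]; rfl⟩

theorem runs_cnot (b y b' y' : ℕ) (σ : ℕ → ℕ) : Runs (.cnot (b, y) (b', y')) 1 σ (· = σ)
    (actMap ![cell b (σ y), cell b' (σ y')] cnotMatrix) :=
  ⟨_, rfl, 1, le_rfl, fun O s hs => by subst hs; rw [exec, State.act_eq]; rfl⟩

theorem runs_toffoli (b y b' y' b'' y'' : ℕ) (σ : ℕ → ℕ) :
    Runs (.toffoli (b, y) (b', y') (b'', y'')) 1 σ (· = σ)
    (actMap ![cell b (σ y), cell b' (σ y'), cell b'' (σ y'')] toffoliMatrix) :=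
  ⟨_, rfl, 1, le_rfl, fun O s hs => by subst hs; rw [exec, State.act_eq]; rfl⟩

theorem runs_rot (b y p q : ℕ) (σ : ℕ → ℕ) :
    Runs (.rot (b, y) p q) 1 σ (· = σ) (rotMap (cell b (σ y)) (σ p) (σ q)) :=
  ⟨_, rfl, 1, le_rfl, fun O s hs => by subst hs; rw [exec, State.act_eq]; rfl⟩

/-- `I t` is the loop invariant after `t` passes. The linear map may depend on the number of the
pass, since the body addresses different qubits each time. -/
theorem runs_loop {x : ℕ} {P : Prog} {c : ℕ} {σ : ℕ → ℕ} (I : ℕ → (ℕ → ℕ) → Prop)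
    {F : ℕ → VecEnd} (h0 : I 0 σ)
    (h : ∀ t < σ x, ∀ τ, I t τ → Runs P c τ (I (t + 1)) (F t)) :
    Runs (.loop x P) (1 + σ x * c) σ (I (σ x)) (upProd F (σ x)) := by
  have key : ∀ n ≤ σ x, ∃ σ', I n σ' ∧ ∃ t ≤ 1 + n * c, ∀ {r ℓ : ℕ} (O : Oracles r ℓ) (s : State),
      s.store = σ → (fun M : Multiset State => M.bind fun s' => exec O P s')^[n] {s.tick 1} =
        {{ s with store := σ', vec := upProd F n s.vec, time := s.time + t }} := by
    intro n
    induction n with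
    | zero => exact fun _ => ⟨σ, h0, 1, by omega, fun O s hs => by subst hs; rfl⟩
    | succ n ih =>
      intro hn
      obtain ⟨σ₁, h₁, t, ht, e⟩ := ih (by omega)
      obtain ⟨σ₂, h₂, t', ht', e'⟩ := h n (by omega) σ₁ h₁
      refine ⟨σ₂, h₂, t + t', by rw [add_one_mul]; omega, fun O s hs => ?_⟩
      rw [Function.iterate_succ_apply', e O s hs, Multiset.singleton_bind, e' O _ rfl, add_assoc]
      rfl
  obtain ⟨σ', h', t, ht, e⟩ := key _ le_rfl
  refine ⟨σ', h', t, ht, fun O s hs => ?_⟩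
  rw [exec, hs]
  exact e O s hs

/-- `x := y * z` -/
def mulP (x y z : ℕ) : Prog := .seq (.const x 0) (.loop y (.add x x z))

theorem upProd_one (n : ℕ) : upProd (fun _ => 1) n = 1 := by
  induction n with
  | zero => rfl
  | succ n ih => rw [upProd, ih, one_mul]

theorem runs_mulP {x y z : ℕ} (hy : y ≠ x) (hz : z ≠ x) (σ : ℕ → ℕ) :
    Runs (mulP x y z) (σ y + 2) σ (· = Function.update σ x (σ y * σ z)) 1 := by
  have h := runs_loop (x := y) (P := .add x x z) (c := 1) (σ := Function.update σ x 0)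
    (fun t τ => τ = Function.update σ x (t * σ z)) (F := fun _ => 1) (by simp)
    (fun t _ τ hτ => (runs_add x x z τ).mono le_rfl (fun τ' h => by
      subst hτ h
      rw [Function.update_self, Function.update_of_ne hz, Function.update_idem, add_one_mul]) rfl)
  refine ((runs_const x 0 σ).seqE h).mono ?_ (fun τ hτ => ?_) ?_
  · rw [Function.update_of_ne hy]; omega
  · rw [hτ, Function.update_of_ne hy]
  · rw [upProd_one, one_mul]

/-- `P` for the values `0, …, n - 1` of the variable `i`, where `n` is the value of a variable. -/
def forUp (i n : ℕ) (P : Prog) : Prog := .seq (.const i 0) (.loop n (.seq P (.add i i 1)))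

/-- `P` for the values `n - 1, …, 0` of the variable `i`. -/
def forDown (i n : ℕ) (P : Prog) : Prog := .seq (.add i n 4) (.loop n (.seq (.sub i i 1) P))

theorem runs_forUp {i n : ℕ} {P : Prog} {c : ℕ} {σ : ℕ → ℕ} {S : Finset ℕ} {F : ℕ → VecEnd}
    (hi : i ∉ S) (hn : n ∉ insert i S) (h1 : 1 ∉ insert i S) (hσ : σ 1 = 1)
    (h : ∀ t < σ n, ∀ τ, Frame (insert i S) σ τ → τ i = t → Runs P c τ (Frame S τ) (F t)) :
    Runs (forUp i n P) (2 + σ n * (c + 1)) σ (Frame (insert i S) σ) (upProd F (σ n)) := by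
  have hni : n ≠ i := fun e => hn (e ▸ Finset.mem_insert_self _ _)
  have h' := runs_loop (x := n) (P := .seq P (.add i i 1)) (c := c + 1)
    (σ := Function.update σ i 0)
    (fun t τ => Frame (insert i S) σ τ ∧ τ i = t) (F := F)
    ⟨(Frame.refl _ σ).update (Finset.mem_insert_self _ _) 0, Function.update_self _ _ _⟩
    (fun t ht τ hτ => by
      rw [Function.update_of_ne hni] at ht
      refine ((h t ht τ hτ.1 hτ.2).seq fun σ' hσ' => (runs_add i i 1 σ').mono le_rfl
        (Q' := fun τ => Frame (insert i S) σ τ ∧ τ i = t + 1) ?_ rfl).mono le_rfl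
        (fun _ h => h) (one_mul _)
      rintro _ rfl
      have hf := hτ.1.trans hσ' subset_rfl (Finset.subset_insert i S)
      refine ⟨hf.update (Finset.mem_insert_self _ _) _, ?_⟩
      rw [Function.update_self, hσ' i hi, hf 1 h1, hσ, hτ.2])
  refine ((runs_const i 0 σ).seqE h').mono ?_ (fun _ h => h.1) ?_
  · rw [Function.update_of_ne hni]; omega
  · rw [Function.update_of_ne hni, mul_one]

theorem upProd_succ' (g : ℕ → VecEnd) (n : ℕ) :
    upProd g (n + 1) = upProd (fun t => g (t + 1)) n * g 0 := by
  induction n with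
  | zero => rfl
  | succ n ih => rw [upProd, ih, upProd, mul_assoc]

theorem upProd_reverse (g : ℕ → VecEnd) (n : ℕ) :
    upProd (fun t => g (n - 1 - t)) n = downProd g n := by
  induction n with
  | zero => rfl
  | succ n ih =>
    rw [upProd_succ', downProd, ← ih]
    congr 2
    funext t
    congr 1
    omega

theorem runs_forDown {i n : ℕ} {P : Prog} {c : ℕ} {σ : ℕ → ℕ} {S : Finset ℕ} {F : ℕ → VecEnd}
    (hi : i ∉ S) (hn : n ∉ insert i S) (h1 : 1 ∉ insert i S) (hσ : σ 1 = 1) (hσ4 : σ 4 = 0)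
    (h : ∀ t < σ n, ∀ τ, Frame (insert i S) σ τ → τ i = t → Runs P c τ (Frame S τ) (F t)) :
    Runs (forDown i n P) (2 + σ n * (c + 1)) σ (Frame (insert i S) σ) (downProd F (σ n)) := by
  have hni : n ≠ i := fun e => hn (e ▸ Finset.mem_insert_self _ _)
  have h' := runs_loop (x := n) (P := .seq (.sub i i 1) P) (c := c + 1)
    (σ := Function.update σ i (σ n + σ 4))
    (fun t τ => Frame (insert i S) σ τ ∧ τ i = σ n - t) (F := fun t => F (σ n - 1 - t))
    ⟨(Frame.refl _ σ).update (Finset.mem_insert_self _ _) _, by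
      rw [Function.update_self, hσ4]; rfl⟩
    (fun t ht τ hτ => by
      rw [Function.update_of_ne hni] at ht
      have hf := hτ.1.update (x := i) (Finset.mem_insert_self _ _) (τ i - τ 1)
      have hi' : Function.update τ i (τ i - τ 1) i = σ n - 1 - t := by
        rw [Function.update_self, hτ.1 1 h1, hσ, hτ.2]; omega
      refine ((runs_sub i i 1 τ).seqE (h (σ n - 1 - t) (by omega) _ hf hi')).mono (by omega)
        (fun τ' hτ' => ⟨hf.trans hτ' subset_rfl (Finset.subset_insert i S), ?_⟩) (mul_one _)
      rw [hτ' i hi, hi']; omega)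
  refine ((runs_add i n 4 σ).seqE h').mono ?_ (fun _ h => h.1) ?_
  · rw [Function.update_of_ne hni]; omega
  · rw [Function.update_of_ne hni, mul_one, upProd_reverse]

/-! ### The program of the symmetric subspace test

The program variables are: `1` the constant one, `2` the number of qubits of a register, `4` the
constant zero, `5` the number of tested registers, `6` and `7` the indices of the step. -/

/-- The controlled exchange of a qubit of register `11` and one of register `6`. -/
def swapBitP : Prog :=
  .seq (mulP 13 11 2) <| .seq (.add 13 13 12) <| .seq (mulP 14 6 2) <| .seq (.add 14 14 12) <|
  .seq (.cnot (0, 14) (0, 13)) <| .seq (.toffoli (1, 8) (0, 13) (0, 14)) (.cnot (0, 14) (0, 13))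

/-- The indices of a step. -/
def indexP : Prog :=
  .seq (mulP 8 6 5) <| .seq (.add 8 8 7) <| .seq (.add 9 8 1) <| .seq (.sub 10 6 7) (.sub 11 6 10)

/-- After `indexP`, variables 8 and 9 hold the positions jN + i and jN + i + 1 of the control and of
the flags, variable 10 the rotation parameter j - i, and variable 11 the partner register j - (j -
i). The gates are those of `stepFwd`, the first one on the right. -/
def testStepP : Prog :=
  .seq indexP <| .seq (.rot (1, 8) 10 1) <| .seq (forUp 12 2 swapBitP) <|
  .seq (.gate .x (1, 8)) <| .seq (.rot (1, 8) 10 1) (.toffoli (2, 8) (1, 8) (2, 9))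

def testStepInvP : Prog :=
  .seq indexP <| .seq (.toffoli (2, 8) (1, 8) (2, 9)) <| .seq (.gate .x (1, 8)) <|
  .seq (.rot (1, 8) 10 1) <| .seq (forDown 12 2 swapBitP) <|
  .seq (.gate .x (1, 8)) <| .seq (.rot (1, 8) 10 1) (.gate .x (1, 8))

def testFwdP : Prog := forUp 6 5 (forUp 7 5 testStepP)

def testBwdP : Prog := forDown 6 5 (forDown 7 5 testStepInvP)

/-- The test; the answer is stored in variable `16`. -/
def testP : Prog :=
  .seq (.gate .x (2, 4)) <| .seq testFwdP <| .seq (mulP 8 5 5) <| .seq (.measure 16 (2, 8)) <|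
  .seq testBwdP (.gate .x (2, 4))

/-- If both cells coincide, which happens beyond the diagonal of a row, the gates have repeated
operands and are without effect. That agrees with the convention in `cswapMap`, so the program needs
no case distinction. -/
theorem actMap_cswap {a x y : Loc} (hx : a ≠ x) (hy : a ≠ y) :
    actMap ![y, x] cnotMatrix * (actMap ![a, x, y] toffoliMatrix * actMap ![y, x] cnotMatrix) =
      cswapMap a x y := by
  rw [cswapMap]
  split_ifs with h
  · subst h
    rw [actMap_cnot_self, actMap_toffoli_self]
    simp
  · rw [actMap_cnot (Ne.symm h), actMap_toffoli hx hy h, mul_assoc]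

theorem runs_swapBitP (σ : ℕ → ℕ) : Runs swapBitP (σ 11 + σ 6 + 9) σ (Frame {13, 14} σ)
    (cswapMap (cell 1 (σ 8)) (cell 0 (σ 11 * σ 2 + σ 12)) (cell 0 (σ 6 * σ 2 + σ 12))) := by
  refine ((runs_mulP (by decide) (by decide) σ).seqE <| (runs_add _ _ _ _).seqE <|
    (runs_mulP (by decide) (by decide) _).seqE <| (runs_add _ _ _ _).seqE <|
    (runs_cnot _ _ _ _ _).seqE <| (runs_toffoli _ _ _ _ _ _ _).seqE <|
    (runs_cnot _ _ _ _ _)).mono ?_ ?_ ?_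
  · simp [Function.update_apply]; omega
  · rintro _ rfl x hx
    simp only [Finset.mem_insert, Finset.mem_singleton, not_or] at hx
    simp [Function.update_apply, hx.1, hx.2]
  · simp only [mul_one, Function.update_apply]
    simp only [reduceCtorEq, Nat.reduceEqDiff, if_true, if_false]
    exact actMap_cswap (by simp) (by simp)

/-- The store after `indexP`. -/
def indexStore (σ : ℕ → ℕ) : ℕ → ℕ :=
  Function.update (Function.update (Function.update (Function.update σ 8 (σ 6 * σ 5 + σ 7))
    9 (σ 6 * σ 5 + σ 7 + 1)) 10 (σ 6 - σ 7)) 11 (σ 6 - (σ 6 - σ 7))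

theorem runs_indexP {σ : ℕ → ℕ} (h1 : σ 1 = 1) :
    Runs indexP (σ 6 + 6) σ (· = indexStore σ) 1 := by
  refine ((runs_mulP (by decide) (by decide) σ).seqE <| (runs_add _ _ _ _).seqE <|
    (runs_add _ _ _ _).seqE <| (runs_sub _ _ _ _).seqE <| (runs_sub _ _ _ _)).mono ?_ ?_ ?_
  · omega
  · rintro _ rfl
    simp [indexStore, Function.update_apply, h1]
  · simp

theorem frame_indexStore (σ : ℕ → ℕ) : Frame {8, 9, 10, 11} σ (indexStore σ) :=
  ((((Frame.refl _ σ).update (by decide) _).update (by decide) _).update (by decide) _).update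
    (by decide) _

theorem indexStore_eight (σ : ℕ → ℕ) : indexStore σ 8 = σ 6 * σ 5 + σ 7 := by
  simp [indexStore, Function.update_apply]
theorem indexStore_nine (σ : ℕ → ℕ) : indexStore σ 9 = σ 6 * σ 5 + σ 7 + 1 := by
  simp [indexStore, Function.update_apply]
theorem indexStore_ten (σ : ℕ → ℕ) : indexStore σ 10 = σ 6 - σ 7 := by
  simp [indexStore, Function.update_apply]
theorem indexStore_eleven (σ : ℕ → ℕ) : indexStore σ 11 = σ 6 - (σ 6 - σ 7) := by
  simp [indexStore, Function.update_apply]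

/-- The variables that a step changes. -/
abbrev stepVars : Finset ℕ := {8, 9, 10, 11, 12, 13, 14}

variable {Z : ℕ}

theorem runs_swapRegsP {σ : ℕ → ℕ} (h1 : σ 1 = 1) (h2 : σ 2 ≤ Z) (hZ : 1 ≤ Z)
    (h6 : σ 6 ≤ Z) (h11 : σ 11 ≤ Z) :
    Runs (forUp 12 2 swapBitP) (14 * Z ^ 2) σ (Frame {12, 13, 14} σ)
      (cswapRegs (σ 2) (σ 11) (σ 6) (cell 1 (σ 8)) (σ 2)) := by
  refine (runs_forUp (i := 12) (n := 2) (S := {13, 14}) (c := 11 * Z) (by decide) (by decide)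
    (by decide) h1 fun t _ τ hτ ht => ?_).mono ?_ (fun _ h => h) rfl
  · have := runs_swapBitP τ
    rw [hτ 11 (by decide), hτ 6 (by decide), hτ 8 (by decide), hτ 2 (by decide), ht] at this
    exact this.mono (by omega) (fun _ h => h) rfl
  · have : σ 2 * (11 * Z + 1) ≤ Z * (11 * Z + 1) := Nat.mul_le_mul_right _ h2
    nlinarith

theorem runs_swapRegsInvP {σ : ℕ → ℕ} (h1 : σ 1 = 1) (h4 : σ 4 = 0) (h2 : σ 2 ≤ Z) (hZ : 1 ≤ Z)
    (h6 : σ 6 ≤ Z) (h11 : σ 11 ≤ Z) :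
    Runs (forDown 12 2 swapBitP) (14 * Z ^ 2) σ (Frame {12, 13, 14} σ)
      (cswapRegsInv (σ 2) (σ 11) (σ 6) (cell 1 (σ 8)) (σ 2)) := by
  refine (runs_forDown (i := 12) (n := 2) (S := {13, 14}) (c := 11 * Z) (by decide) (by decide)
    (by decide) h1 h4 fun t _ τ hτ ht => ?_).mono ?_ (fun _ h => h) rfl
  · have := runs_swapBitP τ
    rw [hτ 11 (by decide), hτ 6 (by decide), hτ 8 (by decide), hτ 2 (by decide), ht] at this
    exact this.mono (by omega) (fun _ h => h) rfl
  · have : σ 2 * (11 * Z + 1) ≤ Z * (11 * Z + 1) := Nat.mul_le_mul_right _ h2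
    nlinarith

theorem runs_testStepP {σ : ℕ → ℕ} (h1 : σ 1 = 1) (h2 : σ 2 ≤ Z) (hZ : 1 ≤ Z) (h6 : σ 6 ≤ Z) :
    Runs testStepP (25 * Z ^ 2) σ (Frame stepVars σ) (testStep (σ 2) (σ 5) (σ 6) (σ 7)) := by
  have f := frame_indexStore σ
  have e : ∀ x, x ∉ ({8, 9, 10, 11} : Finset ℕ) → indexStore σ x = σ x := f
  have hs := runs_swapRegsP (σ := indexStore σ) (Z := Z) (by rw [e 1 (by decide), h1])
    (by rwa [e 2 (by decide)]) hZ (by rwa [e 6 (by decide)]) (by rw [indexStore_eleven]; omega)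
  rw [e 2 (by decide), e 6 (by decide), indexStore_eleven, indexStore_eight] at hs
  refine ((runs_indexP h1).seqE <| (runs_rot 1 8 10 1 _).seqE <| hs.seq
    (c' := 3) (Q' := Frame stepVars σ)
    (F' := toffoliMap (cell 2 (σ 6 * σ 5 + σ 7)) (cell 1 (σ 6 * σ 5 + σ 7))
        (cell 2 (σ 6 * σ 5 + σ 7 + 1)) *
      rotMap (cell 1 (σ 6 * σ 5 + σ 7)) (σ 6 - σ 7) 1 * xMap (cell 1 (σ 6 * σ 5 + σ 7)))
    fun τ hτ => ?_).mono ?_ (fun _ h => h) ?_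
  · have g : ∀ x, x ∉ ({12, 13, 14} : Finset ℕ) → τ x = indexStore σ x := hτ
    refine ((runs_x 1 8 τ).seqE <| (runs_rot 1 8 10 1 τ).seqE <|
      runs_toffoli 2 8 1 8 2 9 τ).mono le_rfl ?_ ?_
    · rintro _ rfl
      exact f.trans hτ (by decide) (by decide)
    · rw [g 8 (by decide), g 9 (by decide), g 10 (by decide), g 1 (by decide), indexStore_eight,
        indexStore_nine, indexStore_ten, e 1 (by decide), h1,
        actMap_toffoli (by simp) (by simp) (by simp), mul_assoc]
  · nlinarith
  · rw [indexStore_eight, indexStore_ten, e 1 (by decide), h1, testStep, stepFwd]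
    simp only [mul_one, mul_assoc]

theorem runs_testStepInvP {σ : ℕ → ℕ} (h1 : σ 1 = 1) (h4 : σ 4 = 0) (h2 : σ 2 ≤ Z) (hZ : 1 ≤ Z)
    (h6 : σ 6 ≤ Z) :
    Runs testStepInvP (27 * Z ^ 2) σ (Frame stepVars σ) (testStepInv (σ 2) (σ 5) (σ 6) (σ 7)) := by
  have f := frame_indexStore σ
  have e : ∀ x, x ∉ ({8, 9, 10, 11} : Finset ℕ) → indexStore σ x = σ x := f
  have hs := runs_swapRegsInvP (σ := indexStore σ) (Z := Z) (by rw [e 1 (by decide), h1])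
    (by rw [e 4 (by decide), h4])
    (by rwa [e 2 (by decide)]) hZ (by rwa [e 6 (by decide)]) (by rw [indexStore_eleven]; omega)
  rw [e 2 (by decide), e 6 (by decide), indexStore_eleven, indexStore_eight] at hs
  refine ((runs_indexP h1).seqE <| (runs_toffoli 2 8 1 8 2 9 _).seqE <| (runs_x 1 8 _).seqE <|
    (runs_rot 1 8 10 1 _).seqE <| hs.seq
    (c' := 3) (Q' := Frame stepVars σ)
    (F' := xMap (cell 1 (σ 6 * σ 5 + σ 7)) *
      rotMap (cell 1 (σ 6 * σ 5 + σ 7)) (σ 6 - σ 7) 1 * xMap (cell 1 (σ 6 * σ 5 + σ 7)))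
    fun τ hτ => ?_).mono ?_ (fun _ h => h) ?_
  · have g : ∀ x, x ∉ ({12, 13, 14} : Finset ℕ) → τ x = indexStore σ x := hτ
    refine ((runs_x 1 8 τ).seqE <| (runs_rot 1 8 10 1 τ).seqE <|
      runs_x 1 8 τ).mono le_rfl ?_ ?_
    · rintro _ rfl
      exact f.trans hτ (by decide) (by decide)
    · rw [g 8 (by decide), g 10 (by decide), g 1 (by decide), indexStore_eight,
        indexStore_ten, e 1 (by decide), h1, mul_assoc]
  · nlinarith
  · rw [indexStore_eight, indexStore_nine, indexStore_ten, e 1 (by decide), h1, testStepInv,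
      stepBwd, actMap_toffoli (by simp) (by simp) (by simp)]
    simp only [mul_one, mul_assoc]

theorem runs_testFwdP {σ : ℕ → ℕ} (h1 : σ 1 = 1) (h2 : σ 2 ≤ Z) (hZ : 1 ≤ Z) (h5 : σ 5 ≤ Z) :
    Runs testFwdP (31 * Z ^ 4) σ (Frame (insert 6 (insert 7 stepVars)) σ)
      (testFwd (σ 2) (σ 5)) := by
  have hZ2 : Z ≤ Z ^ 2 := Nat.le_self_pow (by norm_num) Z
  have hZ3 : Z ≤ Z ^ 3 := Nat.le_self_pow (by norm_num) Z
  have hZ4 : Z ≤ Z ^ 4 := Nat.le_self_pow (by norm_num) Z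
  refine (runs_forUp (i := 6) (n := 5) (S := insert 7 stepVars) (c := 28 * Z ^ 3) (by decide)
    (by decide) (by decide) h1 fun j hj τ hτ hj' => ?_).mono ?_ (fun _ h => h) rfl
  · have e5 := hτ 5 (by decide)
    have e2 := hτ 2 (by decide)
    have e1 := hτ 1 (by decide)
    have := runs_forUp (P := testStepP) (i := 7) (n := 5) (S := stepVars) (c := 25 * Z ^ 2) (σ := τ)
      (F := testStep (σ 2) (σ 5) j) (by decide)
      (by decide) (by decide) (by rw [e1, h1]) fun i _ ρ hρ hi => by
        have := runs_testStepP (σ := ρ) (Z := Z) (by rw [hρ 1 (by decide), e1, h1])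
          (by rwa [hρ 2 (by decide), e2]) hZ (by rw [hρ 6 (by decide), hj']; omega)
        rwa [hρ 2 (by decide), hρ 5 (by decide), hρ 6 (by decide), e2, e5, hj', hi] at this
    rw [e5] at this
    refine this.mono ?_ (fun _ h => h) rfl
    calc 2 + σ 5 * (25 * Z ^ 2 + 1) ≤ 2 + Z * (25 * Z ^ 2 + 1) := by gcongr
      _ = 2 + 25 * Z ^ 3 + Z := by ring
      _ ≤ 28 * Z ^ 3 := by omega
  · calc 2 + σ 5 * (28 * Z ^ 3 + 1) ≤ 2 + Z * (28 * Z ^ 3 + 1) := by gcongr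
      _ = 2 + 28 * Z ^ 4 + Z := by ring
      _ ≤ 31 * Z ^ 4 := by omega

theorem runs_testBwdP {σ : ℕ → ℕ} (h1 : σ 1 = 1) (h4 : σ 4 = 0) (h2 : σ 2 ≤ Z) (hZ : 1 ≤ Z)
    (h5 : σ 5 ≤ Z) :
    Runs testBwdP (33 * Z ^ 4) σ (Frame (insert 6 (insert 7 stepVars)) σ)
      (testBwd (σ 2) (σ 5)) := by
  have hZ2 : Z ≤ Z ^ 2 := Nat.le_self_pow (by norm_num) Z
  have hZ3 : Z ≤ Z ^ 3 := Nat.le_self_pow (by norm_num) Z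
  have hZ4 : Z ≤ Z ^ 4 := Nat.le_self_pow (by norm_num) Z
  refine (runs_forDown (i := 6) (n := 5) (S := insert 7 stepVars) (c := 30 * Z ^ 3) (by decide)
    (by decide) (by decide) h1 h4 fun j hj τ hτ hj' => ?_).mono ?_ (fun _ h => h) rfl
  · have e5 := hτ 5 (by decide)
    have e4 := hτ 4 (by decide)
    have e2 := hτ 2 (by decide)
    have e1 := hτ 1 (by decide)
    have := runs_forDown (P := testStepInvP) (i := 7) (n := 5) (S := stepVars) (c := 27 * Z ^ 2)
      (σ := τ) (F := testStepInv (σ 2) (σ 5) j) (by decide)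
      (by decide) (by decide) (by rw [e1, h1]) (by rw [e4, h4]) fun i _ ρ hρ hi => by
        have := runs_testStepInvP (σ := ρ) (Z := Z) (by rw [hρ 1 (by decide), e1, h1])
          (by rw [hρ 4 (by decide), e4, h4])
          (by rwa [hρ 2 (by decide), e2]) hZ (by rw [hρ 6 (by decide), hj']; omega)
        rwa [hρ 2 (by decide), hρ 5 (by decide), hρ 6 (by decide), e2, e5, hj', hi] at this
    rw [e5] at this
    refine this.mono ?_ (fun _ h => h) rfl
    calc 2 + σ 5 * (27 * Z ^ 2 + 1) ≤ 2 + Z * (27 * Z ^ 2 + 1) := by gcongr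
      _ = 2 + 27 * Z ^ 3 + Z := by ring
      _ ≤ 30 * Z ^ 3 := by omega
  · calc 2 + σ 5 * (30 * Z ^ 3 + 1) ≤ 2 + Z * (30 * Z ^ 3 + 1) := by gcongr
      _ = 2 + 30 * Z ^ 4 + Z := by ring
      _ ≤ 33 * Z ^ 4 := by omega

/-- The variables that the test changes. -/
abbrev testVars : Finset ℕ := {6, 7, 8, 9, 10, 11, 12, 13, 14, 16}

/-- The measurement creates two branches, which the deterministic format `Runs` does not cover. The
program is therefore treated as a deterministic part, the measurement, and a deterministic part for
each outcome. -/
theorem exec_testP {σ : ℕ → ℕ} (h1 : σ 1 = 1) (h4 : σ 4 = 0) (h2 : σ 2 ≤ Z) (hZ : 1 ≤ Z)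
    (h5 : σ 5 ≤ Z) : ∃ (σ' : Bool → ℕ → ℕ) (t : Bool → ℕ),
      (∀ b, Frame testVars σ (σ' b) ∧ σ' b 16 = b.toNat ∧ t b ≤ 70 * Z ^ 4) ∧
      ∀ {r ℓ : ℕ} (O : Oracles r ℓ) (s : State), s.store = σ →
        exec O testP s = (Finset.univ : Finset Bool).val.map fun b =>
          { s with store := σ' b, vec := testMap (σ 2) (σ 5) b s.vec, time := s.time + t b } := by
  have hZ4 : Z ≤ Z ^ 4 := Nat.le_self_pow (by norm_num) Z
  have first : Runs (.seq (.gate .x (2, 4)) <| .seq testFwdP (mulP 8 5 5)) (31 * Z ^ 4 + Z + 3) σ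
      (fun τ => Frame (insert 6 (insert 7 stepVars)) σ τ ∧ τ 8 = σ 5 * σ 5)
      (testFwd (σ 2) (σ 5) * xMap (cell 2 0)) := by
    refine ((runs_x 2 4 σ).seqE <| (runs_testFwdP h1 h2 hZ h5).seq (c' := Z + 2) (F' := 1)
      fun τ hτ => ?_).mono (by omega) (fun _ h => h) (by rw [h4, one_mul])
    refine (runs_mulP (by decide) (by decide) τ).mono (by rw [hτ 5 (by decide)]; omega) ?_ rfl
    rintro _ rfl
    exact ⟨hτ.update (by decide) _, by rw [Function.update_self, hτ 5 (by decide)]⟩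
  obtain ⟨σ₁, ⟨f₁, e₈⟩, t₁, ht₁, ex₁⟩ := first
  have second : ∀ b : Bool, Runs (.seq testBwdP (.gate .x (2, 4))) (33 * Z ^ 4 + 1)
      (Function.update σ₁ 16 b.toNat) (Frame (insert 6 (insert 7 stepVars))
        (Function.update σ₁ 16 b.toNat)) (xMap (cell 2 0) * testBwd (σ 2) (σ 5)) := by
    intro b
    have g : Frame (insert 16 (insert 6 (insert 7 stepVars))) σ (Function.update σ₁ 16 b.toNat) :=
      (f₁.mono (Finset.subset_insert _ _)).update (Finset.mem_insert_self _ _) _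
    have := runs_testBwdP (σ := Function.update σ₁ 16 b.toNat) (Z := Z) (by rw [g 1 (by decide), h1])
      (by rw [g 4 (by decide), h4]) (by rwa [g 2 (by decide)]) hZ (by rwa [g 5 (by decide)])
    rw [g 2 (by decide), g 5 (by decide)] at this
    refine this.seq fun τ hτ => (runs_x 2 4 τ).mono le_rfl ?_ ?_
    · rintro _ rfl; exact hτ
    · rw [hτ 4 (by decide), g 4 (by decide), h4]
  choose σ₂ f₂ t₂ ht₂ ex₂ using second
  refine ⟨σ₂, fun b => t₁ + 1 + t₂ b, fun b => ⟨?_, ?_, ?_⟩, fun O s hs => ?_⟩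
  · exact ((f₁.mono (T := testVars) (by decide)).update (by decide) _).trans (f₂ b) subset_rfl
      (by decide)
  · rw [f₂ b 16 (by decide), Function.update_self]
  · have := ht₂ b; show t₁ + 1 + t₂ b ≤ _; omega
  · have ex₁' := ex₁ O s hs
    rw [exec] at ex₁'
    -- Reassociation of the sequence isolates the measurement between the two deterministic parts.
    have assoc : exec O testP s = (((exec O (.gate .x (2, 4)) s).bind fun s' =>
        exec O (.seq testFwdP (mulP 8 5 5)) s').bind fun s' =>
          exec O (.measure 16 (2, 8)) s').bind fun s' =>
            exec O (.seq testBwdP (.gate .x (2, 4))) s' := by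
      simp only [testP, exec, Multiset.bind_assoc]
    obtain ⟨u, hu⟩ : ∃ u : State, u = { s with
        store := σ₁, vec := (testFwd (σ 2) (σ 5) * xMap (cell 2 0)) s.vec, time := s.time + t₁ } :=
      ⟨_, rfl⟩
    have hloc : u.loc (2, 8) = cell 2 (σ 5 * σ 5) := by rw [hu]; simp only [State.loc, e₈]
    rw [assoc, ex₁', Multiset.singleton_bind, ← hu, exec, Multiset.bind_map, hloc]
    have : ∀ b : Bool, exec O (.seq testBwdP (.gate .x (2, 4)))
        (((u.project (cell 2 (σ 5 * σ 5)) b).assign 16 b.toNat).tick 1) = _ := fun b =>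
      ex₂ b O _ (by rw [hu]; rfl)
    simp only [this]
    rw [Multiset.bind_singleton]
    refine Multiset.map_congr rfl fun b _ => ?_
    simp only [State.tick, State.assign, State.project, testMap, hu]
    congr 1
    omega

end Programs

/-! ### Conservation of probability, and the preparation of fresh coins -/

section Norms

open scoped ComplexConjugate

/-! ### Preservation of the norm -/

variable {ι ι' : Type} [Fintype ι] [Fintype ι'] [DecidableEq ι] [DecidableEq ι']

/-- The fibres of `v` over the untouched places are the same for `K` and for the identity, and `K`
preserves the norm of each of them. -/
theorem normSq_applyOp_isometry {Lin : ι → Loc} {Lout : ι' → Loc} (hin : Function.Injective Lin)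
    (hout : Function.Injective Lout) {K : Matrix (ι' → Bool) (ι → Bool) ℂ}
    (hK : ∀ ψ, nsq (K.mulVec ψ) = nsq ψ) {v : Vec} (hv : Blank Lin Lout v) :
    normSq (applyOp Lin Lout K v) = normSq v := by
  obtain ⟨R, hR⟩ := normSq_applyOp_eq_sum (Lin := Lin) v
  have h2 := hR Lin hin (1 : Matrix (ι → Bool) (ι → Bool) ℂ) fun c _ i _ => ⟨i, rfl⟩
  rw [applyOp_one] at h2
  rw [hR Lout hout K hv, h2]
  refine Finset.sum_congr rfl fun r _ => ?_
  rw [Matrix.one_mulVec]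
  exact hK _

theorem nsq_mulVec_of_unitary {K : Matrix (ι → Bool) (ι → Bool) ℂ}
    (hK : K ∈ Matrix.unitaryGroup (ι → Bool) ℂ) (ψ : (ι → Bool) → ℂ) :
    nsq (K.mulVec ψ) = nsq ψ := by
  have h : K.conjTranspose * K = 1 := Matrix.mem_unitaryGroup_iff'.1 hK
  have := nsq_mulVec K ψ
  rw [h, Matrix.one_mulVec, ← nsq_eq_dot] at this
  exact_mod_cast this

theorem normSq_actMap {k : ℕ} (L : Fin k → Loc) {U : Matrix (Fin k → Bool) (Fin k → Bool) ℂ}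
    (hU : U ∈ Matrix.unitaryGroup (Fin k → Bool) ℂ) (v : Vec) :
    normSq (actMap L U v) = normSq v := by
  rw [actMap]
  split_ifs with h
  · exact normSq_applyOp_isometry h h (nsq_mulVec_of_unitary hU) fun c _ i _ => ⟨i, rfl⟩
  · rfl

theorem rotMatrix_unitary (p q : ℕ) : rotMatrix p q ∈ Matrix.unitaryGroup (Fin 1 → Bool) ℂ := by
  have h : (Real.cos (rotAngle p q) : ℂ) ^ 2 + (Real.sin (rotAngle p q) : ℂ) ^ 2 = 1 := by
    exact_mod_cast Real.cos_sq_add_sin_sq (rotAngle p q)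
  rw [Matrix.mem_unitaryGroup_iff']
  funext a b
  obtain ⟨x, rfl⟩ : ∃ x, a = fun _ => x := ⟨a 0, funext fun i => by rw [Subsingleton.elim i 0]⟩
  obtain ⟨y, rfl⟩ : ∃ y, b = fun _ => y := ⟨b 0, funext fun i => by rw [Subsingleton.elim i 0]⟩
  rw [Matrix.mul_apply, sum_fin_one_bool, Matrix.one_apply]
  simp only [Matrix.star_eq_conjTranspose, Matrix.conjTranspose_apply, funext_iff, forall_const]
  rw [rotAngle] at h
  simp only [rotMatrix]
  generalize Real.arccos (Real.sqrt ((p : ℝ) / ((p : ℝ) + (q : ℝ)))) = θ at h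
  cases x <;> cases y <;>
    simp [-Complex.ofReal_cos, -Complex.ofReal_sin] <;>
    first | linear_combination h | ring

theorem gate_unitary (g : Gate) : g.matrix ∈ Matrix.unitaryGroup (Fin 1 → Bool) ℂ := by
  rw [Matrix.mem_unitaryGroup_iff']
  funext a b
  obtain ⟨x, rfl⟩ : ∃ x, a = fun _ => x := ⟨a 0, funext fun i => by rw [Subsingleton.elim i 0]⟩
  obtain ⟨y, rfl⟩ : ∃ y, b = fun _ => y := ⟨b 0, funext fun i => by rw [Subsingleton.elim i 0]⟩
  rw [Matrix.mul_apply, sum_fin_one_bool, Matrix.one_apply]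
  simp only [Matrix.star_eq_conjTranspose, Matrix.conjTranspose_apply, funext_iff, forall_const]
  cases g
  · cases x <;> cases y <;> simp [Gate.matrix]
  · have h2 : ((Real.sqrt 2 : ℝ) : ℂ) ^ 2 = 2 := by
      rw [← Complex.ofReal_pow, Real.sq_sqrt (by norm_num)]; norm_num
    have h3 : ((Real.sqrt 2 : ℝ) : ℂ)⁻¹ * ((Real.sqrt 2 : ℝ) : ℂ)⁻¹ = 1 / 2 := by
      rw [← mul_inv, ← sq, h2]; norm_num
    cases x <;> cases y <;> simp [Gate.matrix] <;> linear_combination 2 * h3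
  · have h1 : conj (Complex.exp (Complex.I * (Real.pi / 4 : ℝ))) *
        Complex.exp (Complex.I * (Real.pi / 4 : ℝ)) = 1 := by
      rw [← Complex.exp_conj, ← Complex.exp_add, map_mul, Complex.conj_I, Complex.conj_ofReal,
        neg_mul, neg_add_cancel, Complex.exp_zero]
    cases x <;> cases y <;> simp [Gate.matrix]
    push_cast at h1
    exact h1

theorem basis_perm_unitary {g : (ι → Bool) → (ι → Bool)} (hg : ∀ b, g (g b) = b)
    {U : Matrix (ι → Bool) (ι → Bool) ℂ} (hU : ∀ a b, U a b = if a = g b then 1 else 0) :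
    U ∈ Matrix.unitaryGroup (ι → Bool) ℂ := by
  rw [Matrix.mem_unitaryGroup_iff']
  funext a b
  rw [Matrix.mul_apply, Matrix.one_apply, Finset.sum_eq_single (g b)]
  · rw [Matrix.star_eq_conjTranspose, Matrix.conjTranspose_apply, hU, hU, if_pos rfl, mul_one]
    have : g b = g a ↔ a = b := ⟨fun h => by rw [← hg a, ← h, hg], fun h => by rw [h]⟩
    by_cases h : a = b
    · subst h; simp
    · rw [if_neg (by rwa [this]), if_neg h]; simp
  · intro c _ hc
    rw [hU c b, if_neg hc, mul_zero]
  · simp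

theorem cnotMatrix_unitary : cnotMatrix ∈ Matrix.unitaryGroup (Fin 2 → Bool) ℂ := by
  refine basis_perm_unitary (g := fun b => ![b 0, xor (b 1) (b 0)]) (fun b => ?_) fun _ _ => rfl
  funext i
  fin_cases i <;> simp [Bool.xor_assoc]

theorem toffoliMatrix_unitary : toffoliMatrix ∈ Matrix.unitaryGroup (Fin 3 → Bool) ℂ := by
  refine basis_perm_unitary (g := fun b => ![b 0, b 1, xor (b 2) (b 0 && b 1)]) (fun b => ?_)
    fun _ _ => rfl
  funext i
  fin_cases i <;> simp [Bool.xor_assoc]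

theorem normSq_filter_add (v : Vec) (l : Loc) :
    normSq (v.filter fun c => decide (l ∈ c) = true) +
      normSq (v.filter fun c => decide (l ∈ c) = false) = normSq v := by
  have h : ∀ b : Bool, normSq (v.filter fun c => decide (l ∈ c) = b) =
      ∑ c ∈ v.support, if decide (l ∈ c) = b then ‖v c‖ ^ 2 else 0 := by
    intro b
    rw [normSq_eq_sum (s := v.support)]
    · refine Finset.sum_congr rfl fun c _ => ?_
      rw [Finsupp.filter_apply]
      split_ifs <;> simp
    · rw [Finsupp.support_filter]
      exact Finset.filter_subset _ _
  rw [h, h, ← Finset.sum_add_distrib, normSq_eq_sum subset_rfl]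
  refine Finset.sum_congr rfl fun c _ => ?_
  by_cases hl : l ∈ c <;> simp [hl]

/-! ### Minting -/

/-- A column vector as a matrix. -/
def colMatrix (C : (ι → Bool) → ℂ) : Matrix (ι → Bool) (Fin 0 → Bool) ℂ := Matrix.of fun b _ => C b

theorem colMatrix_apply (C : (ι → Bool) → ℂ) (b : ι → Bool) (d : Fin 0 → Bool) :
    colMatrix C b d = C b := rfl

/-- Discard the contents of the places `L` to the environment and prepare the state `C` there. -/
def prep (L F : ι → Loc) (C : (ι → Bool) → ℂ) (v : Vec) : Vec :=
  applyOp (Fin.elim0 : Fin 0 → Loc) L (colMatrix C) (applyOp L F 1 v)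

theorem prep_single {L F : ι → Loc} (hLF : ∀ i j, L i ≠ F j) (C : (ι → Bool) → ℂ) (c : Config)
    (z : ℂ) : prep L F C (Finsupp.single c z) =
      ∑ b, Finsupp.single (setBits L b (setBits F (getBits L c) c)) (C b * z) := by
  rw [prep, applyOp_single, Finset.sum_eq_single (getBits L c)]
  · rw [Matrix.one_apply_eq, one_mul, applyOp_single]
    refine Finset.sum_congr rfl fun b _ => ?_
    have h0 : ∀ s : Config, setBits (Fin.elim0 : Fin 0 → Loc) (fun _ => false) s = s := fun s =>
      setBits_eq_self fun i => i.elim0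
    rw [h0, setBits_comm (fun i j => (hLF j i).symm), setBits_setBits, colMatrix_apply]
  · intro b _ hb
    rw [Matrix.one_apply_ne hb, zero_mul, Finsupp.single_zero]
  · simp

theorem prep_zero (L F : ι → Loc) (C : (ι → Bool) → ℂ) : prep L F C 0 = 0 := by
  rw [prep, applyOp_zero, applyOp_zero]

theorem prep_add (L F : ι → Loc) (C : (ι → Bool) → ℂ) (v w : Vec) :
    prep L F C (v + w) = prep L F C v + prep L F C w := by
  rw [prep, applyOp_add, applyOp_add, prep, prep]

theorem prep_sum {κ : Type} (L F : ι → Loc) (C : (ι → Bool) → ℂ) (s : Finset κ) (f : κ → Vec) :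
    prep L F C (∑ x ∈ s, f x) = ∑ x ∈ s, prep L F C (f x) := by
  classical
  induction s using Finset.induction with
  | empty => simp [prep_zero]
  | insert a s ha ih => rw [Finset.sum_insert ha, Finset.sum_insert ha, prep_add, ih]

theorem setBits_sumElim {L : ι → Loc} {L' : ι' → Loc} (h : ∀ i j, L i ≠ L' j)
    (b : ι ⊕ ι' → Bool) (c : Config) :
    setBits (Sum.elim L L') b c = setBits L' (b ∘ Sum.inr) (setBits L (b ∘ Sum.inl) c) := by
  ext l
  simp only [mem_setBits, Sum.forall, Sum.exists, Sum.elim_inl, Sum.elim_inr, Function.comp_apply]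
  constructor
  · rintro (⟨h1, h2, h3⟩ | ⟨i, h1, rfl⟩ | ⟨i, h1, rfl⟩)
    · exact Or.inl ⟨Or.inl ⟨h1, h2⟩, h3⟩
    · exact Or.inl ⟨Or.inr ⟨i, h1, rfl⟩, fun j => (h i j).symm⟩
    · exact Or.inr ⟨i, h1, rfl⟩
  · rintro (⟨⟨h1, h2⟩ | ⟨i, h1, rfl⟩, h3⟩ | ⟨i, h1, rfl⟩)
    · exact Or.inl ⟨h1, h2, h3⟩
    · exact Or.inr (Or.inl ⟨i, h1, rfl⟩)
    · exact Or.inr (Or.inr ⟨i, h1, rfl⟩)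

/-- Preparations at disjoint places with disjoint rubbish places do not interfere. This is what
allows minting a public coin by minting its registers one after another. -/
theorem prep_prep {L F : ι → Loc} {L' F' : ι' → Loc} (hLF : ∀ i j, L i ≠ F j)
    (hLF' : ∀ i j, L' i ≠ F' j) (hL : ∀ i j, L i ≠ L' j) (hF : ∀ i j, F i ≠ F' j)
    (h1 : ∀ i j, L i ≠ F' j) (h2 : ∀ i j, L' i ≠ F j)
    (C : (ι → Bool) → ℂ) (C' : (ι' → Bool) → ℂ) (v : Vec) :
    prep L' F' C' (prep L F C v) = prep (Sum.elim L L') (Sum.elim F F')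
      (fun b => C (b ∘ Sum.inl) * C' (b ∘ Sum.inr)) v := by
  induction v using Finsupp.induction_linear with
  | zero => simp only [prep_zero]
  | add v w hv hw => simp only [prep_add, hv, hw]
  | single c z =>
    rw [prep_single hLF, prep_sum, prep_single]
    · simp only [prep_single hLF']
      rw [← (Equiv.sumArrowEquivProdArrow ι ι' Bool).symm.sum_comp, Fintype.sum_prod_type]
      refine Finset.sum_congr rfl fun b _ => Finset.sum_congr rfl fun b' _ => ?_
      have e1 : (((Equiv.sumArrowEquivProdArrow ι ι' Bool).symm (b, b')) ∘ Sum.inl) = b := rfl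
      have e2 : (((Equiv.sumArrowEquivProdArrow ι ι' Bool).symm (b, b')) ∘ Sum.inr) = b' := rfl
      have g1 : getBits L' (setBits L b (setBits F (getBits L c) c)) = getBits L' c := by
        funext i
        simp only [getBits_apply, mem_setBits_of_ne fun j => hL j i,
          mem_setBits_of_ne fun j => (h2 i j).symm]
      rw [setBits_sumElim hL, setBits_sumElim hF, e1, e2, g1, setBits_comm (L := F') (L' := L)
        (fun i j => (h1 j i).symm)]
      congr 1
      ring
    · rintro (i | i) (j | j)
      exacts [hLF i j, h1 i j, h2 i j, hLF' i j]

theorem prep_reindex (L F : ι → Loc) (C : (ι → Bool) → ℂ) (e : ι' ≃ ι) (v : Vec) :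
    prep (L ∘ e) (F ∘ e) (fun b => C fun i => b (e.symm i)) v = prep L F C v := by
  rw [prep, prep, ← applyOp_reindex L F e e (1 : Matrix (ι → Bool) (ι → Bool) ℂ) v,
    ← applyOp_reindex (Fin.elim0 : Fin 0 → Loc) L (Equiv.refl _) e (colMatrix C)]
  have h : ((1 : Matrix (ι → Bool) (ι → Bool) ℂ).submatrix
      (fun (b : ι' → Bool) i => b (e.symm i)) fun (d : ι' → Bool) i => d (e.symm i)) = 1 := by
    refine Matrix.submatrix_one _ fun b b' h => ?_
    funext i
    have := congrFun h (e i)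
    simpa using this
  rw [h]
  rfl

theorem slice_elim0 (d : Fin 0 → Bool) (v : Vec) : slice (Fin.elim0 : Fin 0 → Loc) d v = v := by
  induction v using Finsupp.induction_linear with
  | zero => exact slice_zero _ _
  | add v w hv hw => rw [slice_add, hv, hw]
  | single c z =>
    rw [slice_single, if_pos (Subsingleton.elim _ _), setBits_eq_self fun i => i.elim0]

theorem supp_discard {L F : ι → Loc} (hLF : ∀ i j, L i ≠ F j) (v : Vec) :
    Supp (fun c => ∀ i, L i ∉ c) (applyOp L F 1 v) := by
  refine Supp.applyOp (p := fun _ => True) (fun _ _ => trivial) fun c b _ i => ?_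
  rw [mem_setBits_of_ne fun j => (hLF i j).symm, mem_setBits_false]
  exact fun h => h.2 i rfl

theorem normSq_prep {L F : ι → Loc} (hL : Function.Injective L) (hF : Function.Injective F)
    (hLF : ∀ i j, L i ≠ F j) {C : (ι → Bool) → ℂ} (hC : nsq C = 1) {v : Vec}
    (hv : Supp (fun c => ∀ i, F i ∉ c) v) : normSq (prep L F C v) = normSq v := by
  rw [prep, normSq_applyOp hL]
  · simp only [slice_elim0, Finset.univ_unique, Finset.sum_singleton, normSq_smul]
    rw [← Finset.sum_mul, normSq_applyOp_isometry hL hF]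
    · simp only [colMatrix_apply]
      rw [nsq] at hC; rw [hC, one_mul]
    · intro ψ; rw [Matrix.one_mulVec]
    · exact hv.mono fun c hc i hi => absurd hi (hc i)
  · exact (supp_discard hLF v).mono fun c hc i hi => absurd hi (hc i)

/-- The old contents go to the environment unchanged, and tracing them out forces the two old bit
patterns to be equal; the new contents contribute the pure state C in every term. -/
theorem gram_prep {L : ι → ℕ × ℕ} (hL : Function.Injective L) {F : ι → ℕ × ℕ × ℕ × ℕ}
    (hF : Function.Injective F) (C : (ι → Bool) → ℂ) {v : Vec}
    (hv : Supp (fun c => ∀ i, (Sum.inr (F i) : Loc) ∉ c) v) (a b : Finset (ℕ × ℕ)) :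
    gram (prep (fun i => Sum.inl (L i)) (fun i => Sum.inr (F i)) C v) a b =
      ∑ d, ∑ d', (if d = d' then C (getBits L a) * conj (C (getBits L b)) else 0) *
        gram v (setBits L d a) (setBits L d' b) := by
  have h0 : (Fin.elim0 : Fin 0 → Loc) = fun i => Sum.inl ((Fin.elim0 : Fin 0 → ℕ × ℕ) i) :=
    funext fun i => i.elim0
  have hs := supp_discard (L := fun i => (Sum.inl (L i) : Loc)) (F := fun i => Sum.inr (F i))
    (by simp) v
  have h1 := gram_applyOp_mem (Lin := (Fin.elim0 : Fin 0 → ℕ × ℕ)) hL (colMatrix C)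
    (v := applyOp (fun i => Sum.inl (L i)) (fun i => Sum.inr (F i)) 1 v)
    (hs.mono fun c hc i hi => absurd hi (hc i)) a b
  rw [prep, h0, h1]
  rw [← h0]
  simp only [slice_elim0, Finset.univ_unique, Finset.sum_singleton]
  rw [show sesq (fun c c' => c.toLeft = setBits L (fun _ => false) a ∧
      c'.toLeft = setBits L (fun _ => false) b ∧ c.toRight = c'.toRight)
      (applyOp (fun i => Sum.inl (L i)) (fun i => Sum.inr (F i)) 1 v)
      (applyOp (fun i => Sum.inl (L i)) (fun i => Sum.inr (F i)) 1 v) =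
      gram (applyOp (fun i => Sum.inl (L i)) (fun i => Sum.inr (F i)) 1 v)
        (setBits L (fun _ => false) a) (setBits L (fun _ => false) b) from rfl,
    gram_applyOp_env hL hF _ (hv.mono fun c hc i hi => absurd hi (hc i)), if_pos, Finset.mul_sum]
  · refine Finset.sum_congr rfl fun d _ => ?_
    rw [Finset.mul_sum]
    refine Finset.sum_congr rfl fun d' _ => ?_
    rw [Matrix.conjTranspose_one, one_mul, Matrix.one_apply, setBits_setBits, setBits_setBits]
    by_cases h : d = d'
    · subst h; simp [colMatrix_apply]
    · simp [h, Ne.symm h]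
  · constructor <;>
    · intro i hi
      rw [mem_setBits_false] at hi
      exact hi.2 i rfl

end Norms

/-! ### The private oracles, and the programs for minting, submitting and moving registers -/

section Oracles

/-! ### Programs with oracle calls -/

variable {ℓ : ℕ} {V : Matrix (Fin ℓ → Bool) (Fin ℓ → Bool) ℂ} {φ : (Fin ℓ → Bool) → ℂ}

/-- The oracles of the private scheme. -/
def privOracles (V : Matrix (Fin ℓ → Bool) (Fin ℓ → Bool) ℂ) (φ : (Fin ℓ → Bool) → ℂ) :
    Oracles 1 ℓ where
  coin := copies φ
  count := fun m => (Finset.univ : Finset (Fin m × Fin 1 → Bool)).val.map fun a =>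
    { outcome := numTrue a, kept := m, op := measureEach V a }
  verifySk := {{ outcome := 0, kept := 1, op := 1 }}

theorem univ_val_map_eq_sum {α β : Type} [Fintype α] (f : α → β) :
    (Finset.univ : Finset α).val.map f = ∑ a, ({f a} : Multiset β) := by
  rw [Finset.sum, ← Multiset.sum_map_singleton ((Finset.univ : Finset α).val.map f),
    Multiset.map_map]
  rfl

theorem sum_bind {α β γ : Type} (s : Finset α) (f : α → Multiset β) (g : β → Multiset γ) :
    (∑ a ∈ s, f a).bind g = ∑ a ∈ s, (f a).bind g := by
  classical
  induction s using Finset.induction with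
  | empty => simp
  | insert a s ha ih => rw [Finset.sum_insert ha, Finset.sum_insert ha, Multiset.add_bind, ih]

/-- Mint `κ` private coins into consecutive registers. -/
def mintP (q : QRef) : Prog :=
  .seq (.add 18 q.2 4) (.loop 3 (.seq (.mint (q.1, 18)) (.add 18 18 2)))

/-- The environment places used by `mintP`. -/
def mintEnv (k r ℓ : ℕ) : Slots 1 r ℓ → ℕ × ℕ × ℕ × ℕ := fun i => (k + i.1.2, 0, 0, i.2)

theorem mintEnv_injective (k r ℓ : ℕ) : Function.Injective (mintEnv k r ℓ) := by
  rintro ⟨⟨a, b⟩, c⟩ ⟨⟨a', b'⟩, c'⟩ h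
  simp only [mintEnv, Prod.mk.injEq] at h
  obtain ⟨h1, -, -, h2⟩ := h
  have : a = a' := Subsingleton.elim _ _
  simp only [Prod.mk.injEq, Fin.ext_iff, this, true_and]
  omega

theorem State.block_injective (s : State) (q : QRef) (m r ℓ : ℕ) :
    Function.Injective (s.block q m r ℓ) :=
  slots_injective (fun x => (Sum.inl (q.1, s.store q.2 + x) : Loc)) (fun x y h => by
    simpa using h) m r ℓ

theorem State.fresh_injective (s : State) (m r ℓ : ℕ) : Function.Injective (s.fresh m r ℓ) := by
  rintro ⟨⟨a, b⟩, c⟩ ⟨⟨a', b'⟩, c'⟩ h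
  simpa [State.fresh, Fin.ext_iff, and_assoc] using h

/-- The inductive step of `exec_mintP`: registers `0, …, p - 1` and register `p` are combined into
one preparation of p + 1 copies. -/
theorem prep_succ (L F : ℕ → Fin ℓ → Loc) (p : ℕ) (L' F' : Slots 1 1 ℓ → Loc)
    (hL' : ∀ i, L' i = L p i.2) (hF' : ∀ i, F' i = F p i.2)
    (hLF : ∀ x y i j, L x i ≠ F y j) (hL : ∀ x < p, ∀ i j, L x i ≠ L p j)
    (hF : ∀ x < p, ∀ i j, F x i ≠ F p j) (v : Vec) :
    prep L' F' (copies φ) (prep (fun i : Fin p × Fin ℓ => L i.1 i.2) (fun i => F i.1 i.2)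
      (copies φ) v) = prep (fun i : Fin (p + 1) × Fin ℓ => L i.1 i.2) (fun i => F i.1 i.2)
      (copies φ) v := by
  let g : (Fin p × Fin ℓ) ⊕ Slots 1 1 ℓ → Fin (p + 1) × Fin ℓ :=
    Sum.elim (fun i => (i.1.castSucc, i.2)) fun i => (Fin.last p, i.2)
  have hg : Function.Bijective g := by
    constructor
    · rintro (⟨a, b⟩ | ⟨a, b⟩) (⟨a', b'⟩ | ⟨a', b'⟩) h
      · simpa [g] using h
      · simp only [g, Sum.elim_inl, Sum.elim_inr, Prod.mk.injEq] at h
        exact absurd h.1 (Fin.castSucc_lt_last a).ne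
      · simp only [g, Sum.elim_inl, Sum.elim_inr, Prod.mk.injEq] at h
        exact absurd h.1.symm (Fin.castSucc_lt_last a').ne
      · simp only [g, Sum.elim_inr, Prod.mk.injEq, true_and] at h
        rw [h, Subsingleton.elim a a']
    · rintro ⟨a, b⟩
      induction a using Fin.lastCases with
      | last => exact ⟨Sum.inr ((0, 0), b), rfl⟩
      | cast a => exact ⟨Sum.inl (a, b), rfl⟩
  rw [prep_prep (fun _ _ => hLF _ _ _ _) (fun i j => by rw [hL', hF']; exact hLF _ _ _ _)
    (fun i j => by rw [hL']; exact hL _ i.1.2 _ _) (fun i j => by rw [hF']; exact hF _ i.1.2 _ _)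
    (fun i j => by rw [hF']; exact hLF _ _ _ _) (fun i j => by rw [hL']; exact hLF _ _ _ _),
    ← prep_reindex (fun i : Fin (p + 1) × Fin ℓ => L i.1 i.2) _ _ (Equiv.ofBijective g hg)]
  congr 1
  · funext i
    rcases i with i | i
    · rfl
    · exact hL' i
  · funext i
    rcases i with i | i
    · rfl
    · exact hF' i
  · funext b
    have h1 : ∀ x, b ((Equiv.ofBijective g hg).symm (g x)) = b x := fun x => by
      rw [← Equiv.ofBijective_apply g (hf := hg), Equiv.symm_apply_apply]
    have h2 : ∀ (a : Fin p) i, b ((Equiv.ofBijective g hg).symm (a.castSucc, i)) =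
        b (Sum.inl (a, i)) := fun a i => h1 (Sum.inl (a, i))
    have h3 : ∀ i, b ((Equiv.ofBijective g hg).symm (Fin.last p, i)) =
        b (Sum.inr ((0, 0), i)) := fun i => h1 (Sum.inr ((0, 0), i))
    simp only [copies, Fin.prod_univ_castSucc, h2, h3, Function.comp_apply]
    congr 1
    simp [Fintype.prod_prod_type]

/-- Variable 18 is the write address and advances by the size of a register. Each call discards the
old register to environment places named after that call, which is why `mintEnv` carries the number
of the register in its first component. -/
theorem exec_mintP {r : ℕ} {t : State} {q : QRef} (h2 : t.store 2 = ℓ)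
    (h3 : t.store 3 = r) (h4 : t.store 4 = 0) :
    exec (privOracles V φ) (mintP q) t = {{ t with
      store := Function.update t.store 18 (t.store q.2 + r * ℓ)
      vec := prep (t.block q 1 r ℓ) (fun i => Sum.inr (mintEnv t.calls r ℓ i)) (copies φ) t.vec
      time := t.time + (2 + r * (ℓ + 2))
      queries := t.queries + r
      calls := t.calls + r
      minted := t.minted + r }} := by
  have key : ∀ p : ℕ, (fun M : Multiset State => M.bind fun s' =>
      exec (privOracles V φ) (.seq (.mint (q.1, 18)) (.add 18 18 2)) s')^[p]
      {((t.assign 18 (t.store q.2 + t.store 4)).tick 1).tick 1} = {{ t with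
      store := Function.update t.store 18 (t.store q.2 + p * ℓ)
      vec := prep (fun i : Fin p × Fin ℓ => cell q.1 (t.store q.2 + (i.1 * ℓ + i.2)))
        (fun i => Sum.inr (t.calls + i.1, 0, 0, (i.2 : ℕ))) (copies φ) t.vec
      time := t.time + (2 + p * (ℓ + 2))
      queries := t.queries + p
      calls := t.calls + p
      minted := t.minted + p }} := by
    intro p
    induction p with
    | zero =>
      rw [Function.iterate_zero, id]
      have hp : prep (fun i : Fin 0 × Fin ℓ => cell q.1 (t.store q.2 + (i.1 * ℓ + i.2)))
          (fun i => Sum.inr (t.calls + i.1, 0, 0, (i.2 : ℕ))) (copies φ) t.vec = t.vec := by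
        induction t.vec using Finsupp.induction_linear with
        | zero => exact prep_zero _ _ _
        | add v w hv hw => rw [prep_add, hv, hw]
        | single c z =>
          have hb : ∀ (L : Fin 0 × Fin ℓ → Loc) b (c : Config), setBits L b c = c := by
            intro L b c
            rw [Subsingleton.elim b fun _ => false]
            exact setBits_eq_self fun i => i.1.elim0
          rw [prep_single (by simp), Fintype.sum_unique, hb, hb]
          simp [copies]
      rw [hp, h4]
      simp [State.tick, State.assign]
    | succ p ih =>
      rw [Function.iterate_succ_apply', ih, Multiset.singleton_bind, exec, exec,
        Multiset.singleton_bind, exec]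
      congr 1
      have hvec := prep_succ (φ := φ) (fun x (i : Fin ℓ) => cell q.1 (t.store q.2 + (x * ℓ + i)))
        (fun x i => Sum.inr (t.calls + x, 0, 0, (i : ℕ))) p
        (fun i => cell q.1 (t.store q.2 + p * ℓ + ((i.1.1 * 1 + i.1.2) * ℓ + i.2)))
        (fun i => Sum.inr (t.calls + p, i.1.1, i.1.2, (i.2 : ℕ)))
        (fun i => by
          simp only [Fin.val_eq_zero, zero_mul, zero_add]
          rw [add_assoc])
        (fun i => by simp only [Fin.val_eq_zero])
        (by simp)
        (fun x hx i j h => by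
          simp only [Sum.inl.injEq, Prod.mk.injEq, true_and] at h
          have : x * ℓ + ℓ ≤ p * ℓ := by rw [← Nat.succ_mul]; exact Nat.mul_le_mul_right _ hx
          have := i.2
          omega)
        (fun x hx i j h => by
          simp only [Sum.inr.injEq, Prod.mk.injEq] at h
          omega) t.vec
      simp only [State.doMint, State.assign, State.tick, State.block, State.fresh,
        Function.update_self, Function.update_idem]
      rw [← hvec]
      simp only [Function.update_apply, h2, one_mul]
      congr 1
      · funext x
        by_cases hx : x = 18 <;> simp [hx]
        ring
      · ring
  have hex : exec (privOracles V φ) (mintP q) t = (fun M : Multiset State => M.bind fun s' =>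
      exec (privOracles V φ) (.seq (.mint (q.1, 18)) (.add 18 18 2)) s')^[r]
      {((t.assign 18 (t.store q.2 + t.store 4)).tick 1).tick 1} := by
    rw [mintP, exec, exec, Multiset.singleton_bind, exec]
    have : ((t.assign 18 (t.store q.2 + t.store 4)).tick 1).store 3 = r := by
      simp [State.tick, State.assign, h3]
    rw [this]
  rw [hex, key r]
  congr 2
  rw [← prep_reindex _ _ _ ((Equiv.uniqueProd (Fin r) (Fin 1)).prodCongr (Equiv.refl (Fin ℓ)))]
  congr 1
  · funext i
    simp [State.block]
  · funext b
    simp only [copies, Fintype.prod_prod_type, Finset.univ_unique, Finset.prod_singleton]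
    rfl

/-- The enumeration of the registers of `m` money states. -/
def slotEquiv {m r M : ℕ} (h : M = m * r) : Fin m × Fin r ≃ Fin M :=
  finProdFinEquiv.trans (finCongr h.symm)

theorem slotEquiv_val {m r M : ℕ} (h : M = m * r) (ρ : Fin m × Fin r) :
    (slotEquiv h ρ : ℕ) = ρ.1 * r + ρ.2 := by
  simp [slotEquiv, finProdFinEquiv]
  ring

/-- The environment places of a submission of the registers of `m` money states. -/
def submitEnv (m r ℓ k : ℕ) : Slots m r ℓ → ℕ × ℕ × ℕ × ℕ := fun i => (k, i.1.1 * r + i.1.2, 0, i.2)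

theorem submitEnv_injective (m r ℓ k : ℕ) : Function.Injective (submitEnv m r ℓ k) := by
  rintro ⟨⟨a, b⟩, c⟩ ⟨⟨a', b'⟩, c'⟩ e
  simp only [submitEnv, Prod.mk.injEq, true_and] at e
  rw [← slotEquiv_val (rfl : m * r = m * r) (a, b), ← slotEquiv_val (rfl : m * r = m * r) (a', b')]
    at e
  have h1 := (slotEquiv (rfl : m * r = m * r)).injective (Fin.ext e.1)
  simp [h1, Fin.ext_iff, e.2]

/-- The private scheme regards the registers of `m` public coins as `m * r` coins with one register
each. Enumerating the pairs of coin and register translates between the two indexings. -/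
theorem exec_submit {m r : ℕ} {t : State} {q : QRef} {x y : ℕ} (hy : t.store y = m * r) :
    exec (privOracles V φ) (.submit x q y) t =
      ∑ a : Fin m × Fin r → Bool, {{ t with
        store := Function.update t.store x (numTrue a)
        vec := applyOp (t.block q m r ℓ) (fun i => Sum.inr (submitEnv m r ℓ t.calls i))
          (measureEach V a) t.vec
        time := t.time + (m * r * (ℓ + 1) + 1)
        queries := t.queries + (m * r + 1)
        calls := t.calls + 1
        submitted := t.submitted ++ [(m * r, numTrue a)] }} := by
  let e : Fin m × Fin r ≃ Fin (t.store y) × Fin 1 :=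
    (slotEquiv hy).trans (Equiv.prodUnique (Fin (t.store y)) (Fin 1)).symm
  have he : ∀ ρ, (e ρ) = (slotEquiv hy ρ, 0) := fun ρ => rfl
  rw [exec]
  simp only [privOracles, Multiset.map_map]
  rw [univ_val_map_eq_sum, ← (Equiv.arrowCongr e (Equiv.refl Bool)).sum_comp]
  refine Finset.sum_congr rfl fun a _ => ?_
  have hnum : numTrue ((Equiv.arrowCongr e (Equiv.refl Bool)) a) = numTrue a := by
    rw [numTrue, numTrue]
    refine (Finset.card_equiv e fun ρ => ?_).symm
    simp [Equiv.arrowCongr]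
  have hvec : applyOp (t.block q (t.store y) 1 ℓ) (t.fresh (t.store y) 1 ℓ)
      (measureEach V ((Equiv.arrowCongr e (Equiv.refl Bool)) a)) t.vec =
      applyOp (t.block q m r ℓ) (fun i => Sum.inr (submitEnv m r ℓ t.calls i))
          (measureEach V a) t.vec := by
    rw [← applyOp_reindex (t.block q (t.store y) 1 ℓ) (t.fresh (t.store y) 1 ℓ)
      (e.prodCongr (Equiv.refl (Fin ℓ))) (e.prodCongr (Equiv.refl (Fin ℓ)))]
    congr 1
    · funext i
      have := slotEquiv_val hy i.1
      simp [State.block, he, this]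
    · funext i
      have := slotEquiv_val hy i.1
      simp [State.fresh, submitEnv, he, this]
    · funext b d
      rw [Matrix.submatrix_apply, measureEach, measureEach, ← e.prod_comp]
      refine Finset.prod_congr rfl fun ρ _ => ?_
      simp [Equiv.arrowCongr]
  simp only [Function.comp_apply, State.doSubmit, hnum, hvec]
  simp only [hy, one_mul]

/-- Move a block to blank cells of bank `0`. -/
def moveP (q : QRef) : Prog :=
  .seq (.add 19 q.2 4) (.loop 13 (.seq (.cnot (q.1, 19) (0, 18)) <|
    .seq (.cnot (0, 18) (q.1, 19)) <| .seq (.add 18 18 1) (.add 19 19 1)))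

/-- Move `n` qubits from the cells `src` to the cells `dst`. -/
def moveMap (src dst : ℕ → Loc) : ℕ → VecEnd :=
  upProd fun i => cnotMap (dst i) (src i) * cnotMap (src i) (dst i)

theorem runs_moveP {σ : ℕ → ℕ} {q : QRef} (hq : q.1 ≠ 0) (h1 : σ 1 = 1)
    (h4 : σ 4 = 0) : Runs (moveP q) (2 + σ 13 * 4) σ (Frame {18, 19} σ)
      (moveMap (fun i => cell q.1 (σ q.2 + i)) (fun i => cell 0 (σ 18 + i)) (σ 13)) := by
  have h := runs_loop (x := 13) (P := .seq (.cnot (q.1, 19) (0, 18)) <|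
    .seq (.cnot (0, 18) (q.1, 19)) <| .seq (.add 18 18 1) (.add 19 19 1)) (c := 4)
    (σ := Function.update σ 19 (σ q.2 + σ 4))
    (fun t τ => Frame {18, 19} σ τ ∧ τ 18 = σ 18 + t ∧ τ 19 = σ q.2 + t)
    (F := fun i => cnotMap (cell 0 (σ 18 + i)) (cell q.1 (σ q.2 + i)) *
      cnotMap (cell q.1 (σ q.2 + i)) (cell 0 (σ 18 + i)))
    ⟨(Frame.refl _ _).update (by decide) _, by simp, by simp [h4]⟩
    (fun t _ τ hτ => by
      have h01 : ∀ x y, cell 0 x ≠ cell q.1 y := fun x y h => by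
        simp only [Sum.inl.injEq, Prod.mk.injEq] at h
        exact hq h.1.symm
      refine ((runs_cnot _ _ _ _ τ).seqE <| (runs_cnot _ _ _ _ τ).seqE <|
        (runs_add _ _ _ τ).seqE (runs_add _ _ _ _)).mono (by norm_num) ?_ ?_
      · rintro _ rfl
        refine ⟨(hτ.1.update (by decide) _).update (by decide) _, ?_, ?_⟩
        · simp [Function.update_apply, hτ.2.1, hτ.1 1 (by decide), h1]; omega
        · simp [Function.update_apply, hτ.2.2, hτ.1 1 (by decide), h1]; omega
      · rw [hτ.2.1, hτ.2.2, actMap_cnot (h01 _ _), actMap_cnot fun h => h01 _ _ h.symm]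
        simp)
  refine ((runs_add 19 q.2 4 σ).seqE h).mono ?_ (fun τ hτ => hτ.1) ?_
  · simp [Function.update_apply]; omega
  · simp [Function.update_apply, moveMap]

/-- Two controlled nots move a bit into a blank cell: the first copies it, the second erases the
original. The hypotheses keep the targets blank until their turn comes. -/
theorem moveMap_single {src dst : ℕ → Loc} (n : ℕ) (hs : ∀ i < n, ∀ j < n, src i = src j → i = j)
    (hd : ∀ i < n, ∀ j < n, dst i = dst j → i = j) (hsd : ∀ i j, src i ≠ dst j) {c : Config}
    (hc : ∀ i < n, dst i ∉ c) (z : ℂ) : ∃ c', moveMap src dst n (Finsupp.single c z) =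
      Finsupp.single c' z ∧ ∀ l, l ∈ c' ↔ (∃ i < n, l = dst i ∧ src i ∈ c) ∨
        (l ∈ c ∧ ∀ i < n, l ≠ dst i ∧ l ≠ src i) := by
  induction n with
  | zero => exact ⟨c, rfl, fun l => by simp⟩
  | succ n ih =>
    obtain ⟨c', e, h⟩ := ih (fun i hi j hj => hs i (by omega) j (by omega))
      (fun i hi j hj => hd i (by omega) j (by omega)) fun i hi => hc i (by omega)
    have hsn : src n ∈ c' ↔ src n ∈ c := by
      rw [h]
      constructor
      · rintro (⟨i, _, h1, _⟩ | h1)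
        · exact absurd h1 (hsd _ _)
        · exact h1.1
      · exact fun h1 => Or.inr ⟨h1, fun i hi => ⟨hsd _ _, fun e => by
          have := hs n (by omega) i (by omega) e; omega⟩⟩
    have hdn : dst n ∉ c' := by
      rw [h]
      rintro (⟨i, hi, h1, _⟩ | h1)
      · have := hd n (by omega) i (by omega) h1; omega
      · exact hc n (by omega) h1.1
    refine ⟨flipIf (src n) (fun c => dst n ∈ c) (flipIf (dst n) (fun c => src n ∈ c) c'), ?_, ?_⟩
    · rw [moveMap, upProd, Module.End.mul_apply]
      have e' : upProd (fun i => cnotMap (dst i) (src i) * cnotMap (src i) (dst i)) n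
        (Finsupp.single c z) = _ := e
      rw [e', Module.End.mul_apply, cnotMap, cnotMap, relabel_single, relabel_single]
    · intro l
      have h1 : dst n ∈ flipIf (dst n) (fun c => src n ∈ c) c' ↔ src n ∈ c := by
        rw [mem_flipIf]; simp [hdn, hsn]
      rw [mem_flipIf, h1, mem_flipIf, hsn]
      by_cases hl : l = src n
      · subst hl
        have hr : ¬ ((∃ i < n + 1, src n = dst i ∧ src i ∈ c) ∨
            (src n ∈ c ∧ ∀ i < n + 1, src n ≠ dst i ∧ src n ≠ src i)) := by
          rintro (⟨i, _, h1, _⟩ | h1)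
          · exact hsd _ _ h1
          · exact (h1.2 n (by omega)).2 rfl
        simp only [hr, iff_false]
        have := hsd n n
        by_cases h3 : src n ∈ c <;> simp [this, h3, hsn]
      · by_cases hl' : l = dst n
        · subst hl'
          have hr : ((∃ i < n + 1, dst n = dst i ∧ src i ∈ c) ∨
            (dst n ∈ c ∧ ∀ i < n + 1, dst n ≠ dst i ∧ dst n ≠ src i)) ↔ src n ∈ c := by
            constructor
            · rintro (⟨i, hi, h1, h2⟩ | h1)
              · rwa [hd n (by omega) i hi h1]
              · exact absurd rfl (h1.2 n (by omega)).1
            · exact fun h1 => Or.inl ⟨n, by omega, rfl, h1⟩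
          rw [hr]
          have := (hsd n n).symm
          by_cases h3 : src n ∈ c <;> simp [this, h3, hdn]
        · simp only [hl, hl', and_false, false_and, false_or, not_false_eq_true, true_and]
          rw [h]
          constructor
          · rintro (⟨i, hi, k1⟩ | ⟨k1, h2⟩)
            · exact Or.inl ⟨i, by omega, k1⟩
            · refine Or.inr ⟨k1, fun i hi => ?_⟩
              rcases Nat.lt_succ_iff_lt_or_eq.1 hi with hi | rfl
              · exact h2 i hi
              · exact ⟨hl', hl⟩
          · rintro (⟨i, hi, k1⟩ | ⟨k1, h2⟩)
            · rcases Nat.lt_succ_iff_lt_or_eq.1 hi with hi | rfl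
              · exact Or.inl ⟨i, hi, k1⟩
              · exact absurd k1.1 hl'
            · exact Or.inr ⟨k1, fun i hi => h2 i (by omega)⟩

theorem addWallet_split {m r : ℕ} (ω : (Slots 1 r ℓ → Bool) → ℂ) (b₁ : Slots 1 r ℓ → Bool)
    (b₂ d : Slots m r ℓ → Bool) : addWallet m ω ((slotsSplit m r ℓ).symm (b₁, b₂)) d =
      ω b₁ * if b₂ = d then 1 else 0 := by
  have h : ∀ b, addWallet m ω b d =
    ω (slotsSplit m r ℓ b).1 * if (slotsSplit m r ℓ b).2 = d then 1 else 0 := fun _ => rfl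
  rw [h, Equiv.apply_symm_apply]

/-- Minting a coin into the blank bank `0` and moving `m` money states behind it. -/
theorem moveMap_prep {m r b a : ℕ} (hb : b ≠ 0) (ω : (Slots 1 r ℓ → Bool) → ℂ) {v : Vec}
    {F : Slots 1 r ℓ → ℕ × ℕ × ℕ × ℕ} (hv : Supp (fun c => ∀ x, cell 0 x ∉ c) v)
    (hF : Supp (fun c => ∀ i, (Sum.inr (F i) : Loc) ∉ c) v) :
    moveMap (fun i => cell b (a + i)) (fun i => cell 0 (r * ℓ + i)) (m * r * ℓ)
      (prep (fun i => cell 0 ((i.1.1 * r + i.1.2) * ℓ + i.2)) (fun i => Sum.inr (F i)) ω v) =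
    applyOp (fun i : Slots m r ℓ => cell b (a + ((i.1.1 * r + i.1.2) * ℓ + i.2)))
      (fun i => Sum.inl (bank0 (m + 1) r ℓ i)) (addWallet m ω) v := by
  set W : Slots 1 r ℓ → Loc := fun i => cell 0 ((i.1.1 * r + i.1.2) * ℓ + i.2) with hW
  set B : Slots m r ℓ → Loc := fun i => cell b (a + ((i.1.1 * r + i.1.2) * ℓ + i.2)) with hB
  have hBinj : Function.Injective B := slots_injective (fun x => (cell b (a + x) : Loc))
    (fun x y h => by simpa using h) m r ℓ
  have hWinj : Function.Injective W := slots_injective (fun x => (cell 0 x : Loc))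
    (fun x y h => by simpa using h) 1 r ℓ
  refine (hv.and hF).induction (motive := fun v => moveMap _ _ _ (prep W _ ω v) =
    applyOp B (fun i => Sum.inl (bank0 (m + 1) r ℓ i)) (addWallet m ω) v) ?_ ?_ ?_
  · rw [prep_zero, applyOp_zero, map_zero]
  · intro v w hv hw
    rw [prep_add, applyOp_add, map_add, hv, hw]
  · rintro c z ⟨hc, hcF⟩
    have hg : getBits W c = fun _ => false := funext fun i => by simp [hW, hc]
    rw [prep_single (by simp [hW]), applyOp_single, map_sum]
    simp only [hg]
    rw [← (slotsSplit m r ℓ).symm.sum_comp, Fintype.sum_prod_type]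
    refine Finset.sum_congr rfl fun b₁ _ => ?_
    have hcw : ∀ l, l ∈ setBits W b₁ (setBits (fun i => (Sum.inr (F i) : Loc)) (fun _ => false) c) ↔
        (l ∈ c ∧ ∀ i, W i ≠ l) ∨ ∃ i, b₁ i = true ∧ W i = l := by
      intro l
      rw [setBits_eq_self hcF, mem_setBits]
    obtain ⟨c', e, h⟩ := moveMap_single (src := fun i => cell b (a + i))
      (dst := fun i => cell 0 (r * ℓ + i)) (m * r * ℓ) (by simp) (by simp) (by simp [hb])
      (c := setBits W b₁ (setBits (fun i => (Sum.inr (F i) : Loc)) (fun _ => false) c)) (by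
        -- The minted wallet coin occupies the addresses below `r * ℓ` and the moved coins are
        -- placed from `r * ℓ` on, so the targets are blank.
        intro i _ hi
        rw [hcw] at hi
        rcases hi with h1 | ⟨j, _, h1⟩
        · exact hc _ h1.1
        · have hj : ((j.1.1 : ℕ) * r + j.1.2) * ℓ + j.2 = r * ℓ + i := by simpa [hW] using h1
          have h0 : (j.1.1 : ℕ) = 0 := Fin.val_eq_zero _
          rw [h0, zero_mul, zero_add] at hj
          have h2 : ((j.1.2 : ℕ) + 1) * ℓ ≤ r * ℓ := Nat.mul_le_mul_right _ j.1.2.2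
          have h3 := j.2.2
          rw [add_one_mul] at h2
          omega) (ω b₁ * z)
    rw [e, Finset.sum_eq_single (getBits B c)]
    · have hs : ∀ b₂ : Slots m r ℓ → Bool, ∀ i,
          (slotsSplit m r ℓ).symm (b₁, b₂) i =
            Fin.cases (motive := fun _ => Bool) (b₁ ((0, i.1.2), i.2))
              (fun j => b₂ ((j, i.1.2), i.2)) i.1.1 := fun _ _ => rfl
      have hK : addWallet m ω ((slotsSplit m r ℓ).symm (b₁, getBits B c)) (getBits B c) = ω b₁ := by
        rw [addWallet_split, if_pos rfl, mul_one]
      rw [hK]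
      congr 1
      ext l
      have hlt : ∀ i : Slots m r ℓ, ((i.1.1 : ℕ) * r + i.1.2) * ℓ + i.2 < m * r * ℓ := by
        intro i
        have h1 := (slotEquiv (rfl : m * r = m * r) i.1).2
        rw [slotEquiv_val] at h1
        have h2 : ((i.1.1 : ℕ) * r + i.1.2 + 1) * ℓ ≤ m * r * ℓ := Nat.mul_le_mul_right _ h1
        have h3 := i.2.2
        rw [add_one_mul] at h2
        omega
      have hex : ∀ x < m * r * ℓ, ∃ i : Slots m r ℓ, ((i.1.1 : ℕ) * r + i.1.2) * ℓ + i.2 = x := by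
        intro x hx
        have hℓ : 0 < ℓ := by
          rcases Nat.eq_zero_or_pos ℓ with h | h
          · simp [h] at hx
          · exact h
        have h1 : x / ℓ < m * r := Nat.div_lt_of_lt_mul (by rwa [mul_comm])
        refine ⟨((slotEquiv (rfl : m * r = m * r)).symm ⟨x / ℓ, h1⟩, ⟨x % ℓ, Nat.mod_lt _ hℓ⟩), ?_⟩
        have h2 := slotEquiv_val (rfl : m * r = m * r)
          ((slotEquiv (rfl : m * r = m * r)).symm ⟨x / ℓ, h1⟩)
        rw [Equiv.apply_symm_apply] at h2
        rw [← h2, mul_comm]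
        exact Nat.div_add_mod x ℓ
      have hBc : ∀ i, B i ∈ setBits W b₁ (setBits (fun i => (Sum.inr (F i) : Loc))
          (fun _ => false) c) ↔ B i ∈ c := by
        intro i
        rw [hcw]
        have : ∀ j, W j ≠ B i := by simp [hW, hB, hb.symm]
        simp [this]
      rw [h, mem_setBits (L := fun i => (Sum.inl (bank0 (m + 1) r ℓ i) : Loc)),
        mem_setBits_false (L := B)]
      constructor
      · rintro (⟨i, hi, rfl, h1⟩ | ⟨h1, h2⟩)
        · obtain ⟨j, rfl⟩ := hex i hi
          have h3 := (hBc j).1 h1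
          refine Or.inr ⟨((j.1.1.succ, j.1.2), j.2), ?_, ?_⟩
          · rw [hs]; simpa using h3
          · simp only [bank0, Fin.val_succ]
            congr 2
            ring
        · rcases (hcw l).1 h1 with ⟨h3, h4⟩ | ⟨i, hi, rfl⟩
          · refine Or.inl ⟨⟨h3, fun i hi => (h2 _ (hlt i)).2 hi.symm⟩, fun i hi => ?_⟩
            exact hc _ (hi ▸ h3)
          · refine Or.inr ⟨i.map (Prod.map (fun _ => 0) id) id, ?_, ?_⟩
            · rw [hs]
              have : i = ((0, i.1.2), i.2) := by
                ext <;> simp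
              rw [this] at hi
              simpa using hi
            · simp [bank0, hW]
      · rintro (⟨⟨h1, h2⟩, h3⟩ | ⟨⟨⟨k, ρ⟩, x⟩, h1, rfl⟩)
        · refine Or.inr ⟨(hcw l).2 (Or.inl ⟨h1, fun i hi => hc _ (hi ▸ h1)⟩), fun i hi => ⟨?_, ?_⟩⟩
          · rintro rfl; exact hc _ h1
          · rintro rfl
            obtain ⟨j, rfl⟩ := hex i hi
            exact h2 j rfl
        · rw [hs] at h1
          induction k using Fin.cases with
          | zero =>
            refine Or.inr ⟨(hcw _).2 (Or.inr ⟨((0, ρ), x), by simpa using h1, by simp [bank0, hW]⟩),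
              fun i hi => ⟨?_, by simp [bank0, hb.symm]⟩⟩
            simp only [bank0, ne_eq, Sum.inl.injEq, Prod.mk.injEq, true_and]
            have h2 : ((ρ : ℕ) + 1) * ℓ ≤ r * ℓ := Nat.mul_le_mul_right _ ρ.2
            have h3 := x.2
            rw [add_one_mul] at h2
            simp
            omega
          | succ k =>
            refine Or.inl ⟨_, hlt ((k, ρ), x), ?_, (hBc ((k, ρ), x)).2 (by simpa using h1)⟩
            simp only [bank0, Fin.val_succ]
            congr 2
            ring
    · intro b₂ _ hb₂
      rw [addWallet_split, if_neg hb₂, mul_zero, zero_mul, Finsupp.single_zero]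
    · simp

end Oracles

/-! ### Public verifiers and the public bank, played by means of the private oracles -/

section Compiled

/-! ### Public counting and private verification by means of the private scheme -/

variable {ℓ : ℕ} {V : Matrix (Fin ℓ → Bool) (Fin ℓ → Bool) ℂ} {φ : (Fin ℓ → Bool) → ℂ}

/-- The banks `0`, `1`, `2` are blank. -/
def LowBlank (c : Config) : Prop := ∀ b < 3, ∀ x, cell b x ∉ c

theorem numTrue_snoc {j : ℕ} (a : Fin j → Bool) (x : Bool) :
    numTrue (Fin.snoc a x : Fin (j + 1) → Bool) = numTrue a + x.toNat := by
  have h : ∀ {R : Type} [Fintype R] (a : R → Bool), numTrue a = ∑ i, (a i).toNat := by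
    intro R _ a
    rw [numTrue, Finset.card_filter]
    refine Finset.sum_congr rfl fun i _ => ?_
    cases a i <;> rfl
  rw [h, h, Fin.sum_univ_castSucc]
  simp

/-- The loop over the submitted coins; the number of accepted coins is stored in variable `17`. -/
def countP (y : ℕ) : Prog :=
  .seq (.const 17 0) <| .seq (.add 5 3 3) <| .loop y <|
    .seq testP <| .seq (.add 17 17 16) (.add 5 5 3)

/-- The variables changed by `countP`. -/
abbrev countVars : Finset ℕ := insert 5 (insert 17 testVars)

theorem supp_clean_wallet {m r : ℕ} {B : Slots m r ℓ → Loc}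
    (K : Matrix (Slots (m + 1) r ℓ → Bool) (Slots m r ℓ → Bool) ℂ) {v : Vec}
    (hv : Supp LowBlank v) :
    Supp Clean (applyOp B (fun i => Sum.inl (bank0 (m + 1) r ℓ i)) K v) := by
  refine Supp.applyOp hv fun c b hc l hl => ?_
  rw [mem_setBits_of_ne, mem_setBits_false]
  · rintro ⟨h, _⟩
    rcases hl with ⟨x, rfl | rfl⟩
    exacts [hc 1 (by norm_num) x h, hc 2 (by norm_num) x h]
  · rintro i rfl
    rcases hl with ⟨x, h | h⟩ <;> simp [bank0] at h

/-- Throughout the loop, variable 5 is the number of registers under test and variable 17 counts the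
accepted coins. One branch remains for each sequence of answers, in the state given by the
corresponding operator of public counting. `Z` bounds all sizes that occur. -/
theorem exec_countP {r' ℓ' m r Z y : ℕ} {O : Oracles r' ℓ'} {t : State} (h1 : t.store 1 = 1)
    (h2 : t.store 2 = ℓ) (h3 : t.store 3 = r) (h4 : t.store 4 = 0) (hy : t.store y = m)
    (hy' : 20 ≤ y) (hr : 0 < r) (hZ : 1 ≤ Z) (hZℓ : ℓ ≤ Z) (hZm : (m + 1) * r ≤ Z)
    {B : Slots m r ℓ → Loc} {ω : (Slots 1 r ℓ → Bool) → ℂ} {v : Vec} (hv : Supp LowBlank v)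
    (ht : t.vec = applyOp B (fun i => Sum.inl (bank0 (m + 1) r ℓ i)) (addWallet m ω) v) :
    ∃ (σ : (Fin m → Bool) → ℕ → ℕ) (τ : (Fin m → Bool) → ℕ),
      (∀ a, Frame countVars t.store (σ a) ∧ σ a 17 = numTrue a ∧ τ a ≤ 3 + m * (70 * Z ^ 4 + 2)) ∧
      exec O (countP y) t = ∑ a, {{ t with
        store := σ a
        vec := applyOp B (fun i => Sum.inl (bank0 (m + 1) r ℓ i)) (countOp m ω m a) v
        time := t.time + τ a }} := by
  have hinj : Function.Injective (fun i => (Sum.inl (bank0 (m + 1) r ℓ i) : Loc)) :=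
    fun _ _ h => bank0_injective _ _ _ (Sum.inl_injective h)
  have hblank : Supp (fun c => ∀ i, Sum.inl (bank0 (m + 1) r ℓ i) ∈ c →
      ∃ j, B j = Sum.inl (bank0 (m + 1) r ℓ i)) v :=
    hv.mono fun c hc i hi => absurd hi (hc 0 (by norm_num) _)
  -- The first test concerns the wallet coin and the first submitted coin, hence `r + r` registers.
  set σ₀ : ℕ → ℕ := Function.update (Function.update t.store 17 0) 5 (r + r) with hσ₀
  have key : ∀ j ≤ m, ∃ (σ : (Fin j → Bool) → ℕ → ℕ) (τ : (Fin j → Bool) → ℕ),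
      (∀ a, Frame countVars t.store (σ a) ∧ σ a 17 = numTrue a ∧ σ a 5 = (j + 2) * r ∧
        τ a ≤ 3 + j * (70 * Z ^ 4 + 2)) ∧
      (fun M : Multiset State => M.bind fun s' =>
        exec O (.seq testP <| .seq (.add 17 17 16) (.add 5 5 3)) s')^[j]
        {{ t with store := σ₀, time := t.time + 3 }} = ∑ a, {{ t with
        store := σ a
        vec := applyOp B (fun i => Sum.inl (bank0 (m + 1) r ℓ i)) (countOp m ω j a) v
        time := t.time + τ a }} := by
    intro j
    induction j with
    | zero =>
      refine fun _ => ⟨fun _ => σ₀, fun _ => 3, fun a => ⟨?_, ?_, ?_, Nat.le_add_right _ _⟩, ?_⟩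
      · exact ((Frame.refl _ _).update (by decide) _).update (by decide) _
      · simp [hσ₀, numTrue]
      · simp [hσ₀]; ring
      · rw [Function.iterate_zero, id, Fintype.sum_unique]
        simp only [countOp, ← ht]
    | succ j ih =>
      intro hj
      obtain ⟨σ, τ, h, e⟩ := ih (by omega)
      have step : ∀ a : Fin j → Bool, ∃ (σ' : Bool → ℕ → ℕ) (τ' : Bool → ℕ),
          (∀ x, Frame countVars t.store (σ' x) ∧ σ' x 17 = numTrue a + x.toNat ∧
            σ' x 5 = (j + 1 + 2) * r ∧ τ' x ≤ 3 + (j + 1) * (70 * Z ^ 4 + 2)) ∧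
          exec O (.seq testP <| .seq (.add 17 17 16) (.add 5 5 3)) { t with
            store := σ a
            vec := applyOp B (fun i => Sum.inl (bank0 (m + 1) r ℓ i)) (countOp m ω j a) v
            time := t.time + τ a } = ∑ x : Bool, {{ t with
            store := σ' x
            vec := applyOp B (fun i => Sum.inl (bank0 (m + 1) r ℓ i))
              (testOp m r ℓ j x * countOp m ω j a :
                Matrix (Slots (m + 1) r ℓ → Bool) (Slots m r ℓ → Bool) ℂ) v
            time := t.time + τ' x }} := by
        intro a
        obtain ⟨f, h17, h5, hτ⟩ := h a
        have hN : (j + 2) * r ≤ (m + 1) * r := Nat.mul_le_mul_right _ (by omega)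
        obtain ⟨σ₂, τ₂, k, ex⟩ := exec_testP (σ := σ a) (Z := Z) (by rw [f 1 (by decide), h1])
          (by rw [f 4 (by decide), h4]) (by rw [f 2 (by decide), h2]; exact hZℓ) hZ
          (by rw [h5]; exact hN.trans hZm)
        refine ⟨fun x => Function.update (Function.update (σ₂ x) 17 (σ₂ x 17 + σ₂ x 16)) 5
          (σ₂ x 5 + σ₂ x 3), fun x => τ a + τ₂ x + 2, fun x => ?_, ?_⟩
        · obtain ⟨g, h16, hτ₂⟩ := k x
          have f' : Frame countVars t.store (σ₂ x) :=
            f.trans g subset_rfl (by decide)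
          refine ⟨(f'.update (by decide) _).update (by decide) _, ?_, ?_, ?_⟩
          · show Function.update (Function.update (σ₂ x) 17 (σ₂ x 17 + σ₂ x 16)) 5 _ 17 = _
            rw [Function.update_of_ne (show (17 : ℕ) ≠ 5 by decide), Function.update_self,
              g 17 (by decide), h17, h16]
          · show Function.update (Function.update (σ₂ x) 17 (σ₂ x 17 + σ₂ x 16)) 5
              (σ₂ x 5 + σ₂ x 3) 5 = _
            rw [Function.update_self, f' 3 (by decide), h3, g 5 (by decide), h5]; ring
          · have : (j + 1) * (70 * Z ^ 4 + 2) = j * (70 * Z ^ 4 + 2) + 70 * Z ^ 4 + 2 := by ring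
            show τ a + τ₂ x + 2 ≤ _
            omega
        · rw [exec, ex O _ rfl, univ_val_map_eq_sum, sum_bind]
          refine Finset.sum_congr rfl fun x _ => ?_
          rw [Multiset.singleton_bind, exec, exec, Multiset.singleton_bind, exec]
          congr 1
          simp only [State.assign, State.tick, f 2 (by decide), h2, h5]
          rw [testMap_eq_applyOp hr (show j < m by omega) (supp_clean_wallet _ hv),
            applyOp_applyOp hinj _ _ hblank]
          simp only [Function.update_of_ne (show (5 : ℕ) ≠ 17 by decide),
            Function.update_of_ne (show (3 : ℕ) ≠ 17 by decide), add_assoc]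
      choose σ' τ' h' e' using step
      refine ⟨fun a => σ' (Fin.init a) (a (Fin.last j)), fun a => τ' (Fin.init a) (a (Fin.last j)),
        fun a => ?_, ?_⟩
      · obtain ⟨k1, k2, k3, k4⟩ := h' (Fin.init a) (a (Fin.last j))
        refine ⟨k1, ?_, k3, k4⟩
        show σ' (Fin.init a) (a (Fin.last j)) 17 = _
        rw [k2, ← numTrue_snoc, Fin.snoc_init_self]
      · rw [Function.iterate_succ_apply', e, sum_bind, sum_fin_succ_bool]
        refine Finset.sum_congr rfl fun a _ => ?_
        rw [Multiset.singleton_bind, e']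
        refine Finset.sum_congr rfl fun x _ => ?_
        simp only [Fin.init_snoc, Fin.snoc_last, countOp_snoc]
  obtain ⟨σ, τ, h, e⟩ := key m le_rfl
  refine ⟨σ, τ, fun a => ⟨(h a).1, (h a).2.1, (h a).2.2.2⟩, ?_⟩
  rw [← e, countP, exec, exec, Multiset.singleton_bind, exec, exec, Multiset.singleton_bind, exec]
  have hm : ((((t.assign 17 0).tick 1).assign 5 (((t.assign 17 0).tick 1).store 3 +
      ((t.assign 17 0).tick 1).store 3)).tick 1).store y = m := by
    simp only [State.assign, State.tick]
    rw [Function.update_of_ne (by omega), Function.update_of_ne (by omega), hy]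
  rw [hm]
  congr 2
  simp only [State.assign, State.tick, hσ₀]
  rw [Function.update_of_ne (by decide), h3]

/-- The submission of money states to a verifier of the public scheme. -/
def submitP (x : ℕ) (q : QRef) (y : ℕ) : Prog :=
  .ite y (.const x 0) <| .seq (mintP (0, 4)) <|
    .seq (.seq (mulP 15 y 3) <| .seq (mulP 13 15 2) (moveP q)) <|
    .seq (countP y) <| .seq (.add 15 15 3) <| .seq (.submit 14 (0, 4) 15) (.add x 17 4)

/-- The variables below `20`. -/
abbrev lowVars : Finset ℕ := Finset.Ico 5 20

/-- The answer given to the simulated adversary is the number of publicly accepted coins. The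
outcome `b` of the private verifier afterwards enters only the record of the utility and scratch
variables. Since the wallet ends up in the environment, the low banks are blank again for the next
call. -/
theorem exec_submitP {m r Z x y : ℕ} {q : QRef} {t : State} (h1 : t.store 1 = 1)
    (h2 : t.store 2 = ℓ) (h3 : t.store 3 = r) (h4 : t.store 4 = 0) (hy : t.store y = m)
    (hy' : 20 ≤ y) (hq : 3 ≤ q.1) (hq' : 20 ≤ q.2)
    (hm : 0 < m) (hr : 0 < r) (hZ : 1 ≤ Z) (hZℓ : ℓ ≤ Z) (hZm : (m + 1) * r ≤ Z)
    (hZT : m * r * ℓ ≤ Z) (hv : Supp LowBlank t.vec)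
    (henv : Supp (fun c => ∀ e, Sum.inr e ∈ c → e.1 < t.calls) t.vec) :
    ∃ (σ : (Fin m → Bool) → (Fin (m + 1) × Fin r → Bool) → ℕ → ℕ)
      (τ : (Fin m → Bool) → (Fin (m + 1) × Fin r → Bool) → ℕ),
      (∀ a b, Frame (insert x lowVars) t.store (σ a b) ∧ σ a b x = numTrue a ∧
        τ a b ≤ 100 * Z ^ 5) ∧
      exec (privOracles V φ) (submitP x q y) t = ∑ a, ∑ b, {{ t with
        store := σ a b
        vec := applyOp (t.block q m r ℓ)
          (fun i => Sum.inr (submitEnv (m + 1) r ℓ (t.calls + r) i))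
          (measureEach V b * countOp m (copies φ : (Slots 1 r ℓ → Bool) → ℂ) m a :
            Matrix (Slots (m + 1) r ℓ → Bool) (Slots m r ℓ → Bool) ℂ) t.vec
        time := t.time + τ a b
        queries := t.queries + (r + ((m + 1) * r + 1))
        calls := t.calls + (r + 1)
        minted := t.minted + r
        submitted := t.submitted ++ [((m + 1) * r, numTrue b)] }} := by
  have hW : Function.Injective (fun i => (Sum.inl (bank0 (m + 1) r ℓ i) : Loc)) :=
    fun _ _ h => bank0_injective _ _ _ (Sum.inl_injective h)
  set σ₁ : ℕ → ℕ := Function.update t.store 18 (0 + r * ℓ) with hσ₁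
  have f₁ : Frame lowVars t.store σ₁ := (Frame.refl _ _).update (by decide) _
  have low : ∀ z, 20 ≤ z → z ∉ lowVars := by
    intro z hz h; rw [Finset.mem_Ico] at h; omega
  have move : Runs (.seq (mulP 15 y 3) <| .seq (mulP 13 15 2) (moveP q))
      (m + 2 + (m * r + 2 + (2 + m * r * ℓ * 4))) σ₁
      (fun τ => Frame lowVars t.store τ ∧ τ 15 = m * r)
      (moveMap (fun i => cell q.1 (t.store q.2 + i)) (fun i => cell 0 (r * ℓ + i)) (m * r * ℓ)) := by
    have hy1 : σ₁ y = m := by rw [f₁ y (low y hy'), hy]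
    refine ((runs_mulP (by omega) (by decide) σ₁).seqE <|
      (runs_mulP (by decide) (by decide) _).seqE <| runs_moveP (by omega) ?_ ?_).mono ?_ ?_ ?_
    · simp [Function.update_apply, hσ₁, h1]
    · simp [Function.update_apply, hσ₁, h4]
    · simp [Function.update_apply, hy1, f₁ 2 (by decide), f₁ 3 (by decide), h2, h3]
    · intro τ hτ
      have g := ((f₁.update (x := 15) (by decide) (σ₁ y * σ₁ 3)).update (x := 13) (by decide)
        ((Function.update σ₁ 15 (σ₁ y * σ₁ 3)) 15 * (Function.update σ₁ 15 (σ₁ y * σ₁ 3)) 2))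
      refine ⟨g.trans hτ subset_rfl (by decide), ?_⟩
      rw [hτ 15 (by decide)]
      simp [Function.update_apply, hy1, f₁ 3 (by decide), h3]
    · have e13 : q.2 ≠ 13 := by omega
      have e15 : q.2 ≠ 15 := by omega
      simp [Function.update_apply, hy1, f₁ 2 (by decide), f₁ 3 (by decide), h2, h3, e13, e15,
        f₁ q.2 (low _ hq')]
      simp [hσ₁]
  obtain ⟨σ₂, ⟨f₂, h15⟩, τ₂, hτ₂, ex₂⟩ := move
  obtain ⟨u, hu⟩ : ∃ u : State, u = { t with
      store := σ₂
      vec := applyOp (t.block q m r ℓ) (fun i => Sum.inl (bank0 (m + 1) r ℓ i))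
        (addWallet m (copies φ)) t.vec
      time := t.time + (1 + (2 + r * (ℓ + 2)) + τ₂)
      queries := t.queries + r
      calls := t.calls + r
      minted := t.minted + r } := ⟨_, rfl⟩
  have hpre : exec (privOracles V φ) (submitP x q y) t =
      (exec (privOracles V φ) (countP y) u).bind fun s => exec (privOracles V φ)
        (.seq (.add 15 15 3) <| .seq (.submit 14 (0, 4) 15) (.add x 17 4)) s := by
    rw [submitP, exec, if_neg (by rw [hy]; omega), exec,
      exec_mintP (t := t.tick 1) (r := r) h2 h3 h4, Multiset.singleton_bind, exec, ex₂ _ _ (by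
        simp only [State.tick, hσ₁, h4]), Multiset.singleton_bind, exec, hu]
    have hvec : moveMap (fun i => cell q.1 (t.store q.2 + i)) (fun i => cell 0 (r * ℓ + i))
        (m * r * ℓ) (prep ((t.tick 1).block (0, 4) 1 r ℓ)
          (fun i => Sum.inr (mintEnv (t.tick 1).calls r ℓ i)) (copies φ) (t.tick 1).vec) =
        applyOp (t.block q m r ℓ) (fun i => Sum.inl (bank0 (m + 1) r ℓ i))
          (addWallet m (copies φ)) t.vec := by
      have hb : (t.tick 1).block (0, 4) 1 r ℓ =
          fun i => cell 0 ((i.1.1 * r + i.1.2) * ℓ + i.2) := by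
        funext i; simp [State.block, State.tick, h4]
      rw [hb]
      refine moveMap_prep (by omega) _ (hv.mono fun c hc => hc 0 (by norm_num))
        (henv.mono fun c hc i hi => ?_)
      have := hc _ hi
      simp only [mintEnv, State.tick] at this
      omega
    rw [hvec]
    simp only [State.tick, add_assoc]
  have hus : u.store = σ₂ := by rw [hu]
  obtain ⟨σ₃, τ₃, h₃, ex₃⟩ := exec_countP (O := privOracles V φ) (t := u) (Z := Z) (y := y)
    (r := r) (ℓ := ℓ) (m := m) (by rw [hus, f₂ 1 (by decide), h1])
    (by rw [hus, f₂ 2 (by decide), h2]) (by rw [hus, f₂ 3 (by decide), h3])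
    (by rw [hus, f₂ 4 (by decide), h4]) (by rw [hus, f₂ y (low y hy'), hy]) hy' hr hZ hZℓ hZm hv
    (by rw [hu])
  rw [hus] at h₃
  have h15' : ∀ a, Function.update (σ₃ a) 15 (σ₃ a 15 + σ₃ a 3) 15 = (m + 1) * r := by
    intro a
    rw [Function.update_self, (h₃ a).1 15 (by decide), (h₃ a).1 3 (by decide), h15,
      f₂ 3 (by decide), h3]
    ring
  refine ⟨fun a b => Function.update (Function.update (Function.update (σ₃ a) 15 (σ₃ a 15 + σ₃ a 3))
    14 (numTrue b)) x (σ₃ a 17 + 0),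
    fun a b => 1 + (2 + r * (ℓ + 2)) + τ₂ + τ₃ a + 1 + ((m + 1) * r * (ℓ + 1) + 1) + 1,
    fun a b => ⟨?_, ?_, ?_⟩, ?_⟩
  · have g : Frame (insert x lowVars) t.store (σ₃ a) :=
      f₂.trans (h₃ a).1 (Finset.subset_insert _ _)
        ((show countVars ⊆ lowVars by decide).trans (Finset.subset_insert _ _))
    exact ((g.update (Finset.mem_insert_of_mem (by decide)) _).update
      (Finset.mem_insert_of_mem (by decide)) _).update (Finset.mem_insert_self _ _) _
  · exact (Function.update_self _ _ _).trans ((add_zero _).trans (h₃ a).2.1)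
  · have k1 := (h₃ a).2.2
    have hrZ : r ≤ Z := by nlinarith
    have hmZ : m ≤ Z := by nlinarith
    have k2 : r * (ℓ + 2) ≤ Z * Z + 2 * Z := by nlinarith [Nat.mul_le_mul hrZ hZℓ]
    have k3 : (m + 1) * r * (ℓ + 1) ≤ Z * Z + Z := by nlinarith [Nat.mul_le_mul hZm hZℓ]
    have k4 : m * (70 * Z ^ 4 + 2) ≤ Z * (70 * Z ^ 4 + 2) := Nat.mul_le_mul_right _ hmZ
    have k5 : m * r ≤ Z := le_trans (Nat.mul_le_mul_right _ (by omega)) hZm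
    have p1 : Z ≤ Z ^ 5 := Nat.le_self_pow (by norm_num) Z
    have p2 : Z * Z ≤ Z ^ 5 := by
      rw [← sq]; exact Nat.pow_le_pow_right hZ (by norm_num)
    have p3 : Z * (70 * Z ^ 4 + 2) = 70 * Z ^ 5 + 2 * Z := by ring
    show 1 + (2 + r * (ℓ + 2)) + τ₂ + τ₃ a + 1 + ((m + 1) * r * (ℓ + 1) + 1) + 1 ≤ 100 * Z ^ 5
    omega
  · rw [hpre, ex₃, sum_bind]
    refine Finset.sum_congr rfl fun a _ => ?_
    rw [Multiset.singleton_bind, exec, exec, Multiset.singleton_bind, exec,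
      exec_submit (m := m + 1) (r := r) (h15' a), sum_bind]
    refine Finset.sum_congr rfl fun b _ => ?_
    rw [Multiset.singleton_bind, exec]
    congr 1
    have hb : ∀ s : State, s.store 4 = 0 → s.block (0, 4) (m + 1) r ℓ =
        fun i => Sum.inl (bank0 (m + 1) r ℓ i) := by
      intro s hs; funext i; simp [State.block, bank0, hs]
    have hs4 : σ₃ a 4 = 0 := by rw [(h₃ a).1 4 (by decide), f₂ 4 (by decide), h4]
    rw [hb _ (by simp [State.assign, State.tick, hs4])]
    simp only [State.assign, State.tick, hu]
    rw [applyOp_applyOp hW _ _ (hv.mono fun c hc i hi => absurd hi (hc 0 (by norm_num) _))]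
    simp only [Function.update_of_ne (show (17 : ℕ) ≠ 14 by decide),
      Function.update_of_ne (show (4 : ℕ) ≠ 14 by decide),
      Function.update_of_ne (show (17 : ℕ) ≠ 15 by decide),
      Function.update_of_ne (show (4 : ℕ) ≠ 15 by decide), hs4, add_assoc]

/-- The private verification of a money state of the public scheme. -/
def verifyP (x : ℕ) (q : QRef) : Prog :=
  .seq (.submit 14 q 3) <| .seq (.sub 13 3 14) <| .seq (.rot (1, 4) 13 14) <|
    .seq (.measure x (1, 4)) (.ite x .skip (.gate .x (1, 4)))

theorem rotMap_of_blank {l : Loc} {w : Vec} (hw : Supp (fun c => l ∉ c) w) (p q : ℕ) :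
    rotMap l p q w = (Real.cos (rotAngle p q) : ℂ) • w +
      xMap l ((Real.sin (rotAngle p q) : ℂ) • w) := by
  refine hw.induction (motive := fun w => rotMap l p q w = (Real.cos (rotAngle p q) : ℂ) • w +
    xMap l ((Real.sin (rotAngle p q) : ℂ) • w)) ?_ ?_ ?_
  · simp
  · intro v w hv hw
    rw [map_add, hv, hw, smul_add, smul_add, map_add]
    abel
  · intro c z hc
    rw [rotMap_single_of_notMem hc, Finsupp.smul_single, Finsupp.smul_single, xMap, relabel_single,
      flipIf_true_of_notMem hc]
    rfl

theorem filter_rotMap {l : Loc} {w : Vec} (hw : Supp (fun c => l ∉ c) w) (p q : ℕ) (b : Bool) :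
    (rotMap l p q w).filter (fun c => decide (l ∈ c) = b) =
      if b then xMap l ((Real.sin (rotAngle p q) : ℂ) • w) else
        (Real.cos (rotAngle p q) : ℂ) • w := by
  have h2 : Supp (fun c => l ∈ c) (xMap l ((Real.sin (rotAngle p q) : ℂ) • w)) := by
    refine Supp.relabel (hw.smul _) fun c hc => ?_
    rw [mem_flipIf]; simp [hc]
  rw [rotMap_of_blank hw, Finsupp.filter_add]
  cases b
  · rw [filter_eq_self_of_supp (hw.smul _) (by simp), filter_eq_zero_of_supp h2 (by simp), add_zero]
    rfl
  · rw [filter_eq_zero_of_supp (hw.smul _) (by simp), filter_eq_self_of_supp h2 (by simp), zero_add]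
    rfl

theorem sin_rotAngle (p q : ℕ) (h : 0 < p + q) : Real.sin (rotAngle p q) =
    Real.sqrt ((q : ℝ) / ((p : ℝ) + q)) := by
  have h0 : (0 : ℝ) < (p : ℝ) + q := by exact_mod_cast h
  rw [rotAngle, Real.sin_arccos, Real.sq_sqrt (by positivity)]
  congr 1
  field_simp
  ring

/-- The rotation with parameters r - j and j gives outcome 1 with probability j/r. Depending on the
outcome the qubit is flipped back, so the ancilla is returned blank and each branch is just a
multiple of the original vector. -/
theorem exec_biasedCoin {r' ℓ' r j x : ℕ} (O : Oracles r' ℓ') {u : State} (h3 : u.store 3 = r)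
    (h14 : u.store 14 = j) (h4 : u.store 4 = 0) (hx : 20 ≤ x) (hr : 0 < r) (hj : j ≤ r)
    (hv : Supp (fun c => cell 1 0 ∉ c) u.vec) :
    exec O (.seq (.sub 13 3 14) <| .seq (.rot (1, 4) 13 14) <|
      .seq (.measure x (1, 4)) (.ite x .skip (.gate .x (1, 4)))) u = ∑ b : Bool, {{ u with
        store := Function.update (Function.update u.store 13 (r - j)) x b.toNat
        vec := ((Real.sqrt (if b then (j : ℝ) / r else 1 - (j : ℝ) / r) : ℝ) : ℂ) • u.vec
        time := u.time + 5 }} := by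
  have hr0 : (r : ℝ) ≠ 0 := by positivity
  have hcast : ((r - j : ℕ) : ℝ) = r - j := Nat.cast_sub hj
  have hsum : ((r - j : ℕ) : ℝ) + j = r := by rw [hcast]; ring
  have hpos : 0 < r - j + j := by omega
  have hc : Real.cos (rotAngle (r - j) j) = Real.sqrt (1 - j / r) := by
    rw [cos_rotAngle, hsum, hcast]
    congr 1
    field_simp
  have hs : Real.sin (rotAngle (r - j) j) = Real.sqrt (j / r) := by
    rw [sin_rotAngle _ _ hpos, hsum]
  have e4 : Function.update u.store 13 (r - j) 4 = 0 := by
    rw [Function.update_of_ne (by decide), h4]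
  have e14 : Function.update u.store 13 (r - j) 14 = j := by
    rw [Function.update_of_ne (by decide), h14]
  have ex : ∀ b : Bool, Function.update (Function.update u.store 13 (r - j)) x b.toNat 4 = 0 :=
    fun b => by rw [Function.update_of_ne (by omega), e4]
  rw [exec, exec, Multiset.singleton_bind, exec, exec, Multiset.singleton_bind, exec, exec,
    univ_val_map_eq_sum, sum_bind]
  refine Finset.sum_congr rfl fun b _ => ?_
  rw [Multiset.singleton_bind]
  simp only [State.act_eq, State.project, State.assign, State.tick, State.loc, h3, h14, e4, e14,
    Function.update_self]
  rw [exec, show actMap ![cell 1 0] (rotMatrix (r - j) j) = rotMap (cell 1 0) (r - j) j from rfl,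
    filter_rotMap hv]
  simp only [Function.update_self]
  cases b
  · simp [exec, State.tick, hc]
  · have e := ex true
    simp only [Bool.toNat_true] at e
    have hxx : ∀ w : Vec, xMap (cell 1 0) (xMap (cell 1 0) w) = w := fun w =>
      LinearMap.congr_fun (xMap_mul_self (cell 1 0)) w
    simp [exec, State.tick, State.act_eq, State.loc, e, hs, actMap_x, hxx]

theorem exec_verifyP {r x : ℕ} {q : QRef} {t : State}
    (h3 : t.store 3 = r) (h4 : t.store 4 = 0) (hx' : 20 ≤ x) (hr : 0 < r)
    (hv : Supp LowBlank t.vec) :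
    ∃ (σ : (Fin 1 × Fin r → Bool) → Bool → ℕ → ℕ),
      (∀ a b, Frame (insert x lowVars) t.store (σ a b) ∧ σ a b x = b.toNat) ∧
      exec (privOracles V φ) (verifyP x q) t = ∑ a, ∑ b : Bool, {{ t with
        store := σ a b
        vec := applyOp (t.block q 1 r ℓ) (fun i => Sum.inr (submitEnv 1 r ℓ t.calls i))
          (((Real.sqrt (if b then (numTrue a : ℝ) / r else 1 - (numTrue a : ℝ) / r) : ℝ) : ℂ) •
            measureEach V a) t.vec
        time := t.time + (1 * r * (ℓ + 1) + 6)
        queries := t.queries + (1 * r + 1)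
        calls := t.calls + 1
        submitted := t.submitted ++ [(1 * r, numTrue a)] }} := by
  refine ⟨fun a b => Function.update (Function.update (Function.update t.store 14 (numTrue a)) 13
    (r - numTrue a)) x b.toNat, fun a b => ⟨?_, Function.update_self _ _ _⟩, ?_⟩
  · exact (((Frame.refl _ _).update (Finset.mem_insert_of_mem (by decide)) _).update
      (Finset.mem_insert_of_mem (by decide)) _).update (Finset.mem_insert_self _ _) _
  · rw [verifyP, exec, exec_submit (m := 1) (r := r) (by rw [h3, one_mul]), sum_bind]
    refine Finset.sum_congr rfl fun a _ => ?_
    have hle : numTrue a ≤ r := by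
      refine (Finset.card_filter_le _ _).trans ?_
      simp
    rw [Multiset.singleton_bind, exec_biasedCoin (r := r) (j := numTrue a) _ ?_ ?_ ?_ hx' hr hle ?_]
    · simp only [applyOp_smul_op, add_assoc]
    · show Function.update t.store 14 (numTrue a) 3 = r
      rw [Function.update_of_ne (by decide), h3]
    · exact Function.update_self (14 : ℕ) (numTrue a) t.store
    · show Function.update t.store 14 (numTrue a) 4 = 0
      rw [Function.update_of_ne (by decide), h4]
    · refine Supp.applyOp hv fun c b hc => ?_
      rw [mem_setBits_of_ne, mem_setBits_false]
      · exact fun h => hc 1 (by norm_num) 0 h.1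
      · simp

end Compiled

/-! ### Comparing two games through reduced density matrices and a potential -/

section Relation

/-! ### The simulation relation -/

/-- The cells of the simulated memory. -/
def shiftLoc : ℕ × ℕ ↪ ℕ × ℕ := ⟨fun l => (l.1 + 3, l.2), fun l l' h => by
  simp only [Prod.mk.injEq, add_left_inj] at h
  exact Prod.ext h.1 h.2⟩

@[simp] theorem shiftLoc_apply (l : ℕ × ℕ) : shiftLoc l = (l.1 + 3, l.2) := rfl

theorem getBits_shift {ι : Type} (L : ι → ℕ × ℕ) (a : Finset (ℕ × ℕ)) :
    getBits (fun i => shiftLoc (L i)) (a.map shiftLoc) = getBits L a := by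
  funext i
  rw [getBits_apply, getBits_apply]
  simp only [Finset.mem_map']

theorem setBits_shift {ι : Type} [Fintype ι] (L : ι → ℕ × ℕ) (d : ι → Bool)
    (a : Finset (ℕ × ℕ)) :
    setBits (fun i => shiftLoc (L i)) d (a.map shiftLoc) = (setBits L d a).map shiftLoc := by
  ext l
  by_cases hl : ∃ l', shiftLoc l' = l
  · obtain ⟨l', rfl⟩ := hl
    rw [Finset.mem_map', mem_setBits, mem_setBits, Finset.mem_map']
    simp only [ne_eq, shiftLoc.injective.eq_iff]
  · constructor
    · rw [mem_setBits]
      rintro (⟨h, _⟩ | ⟨i, _, h⟩)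
      · obtain ⟨l', _, h⟩ := Finset.mem_map.1 h
        exact absurd ⟨l', h⟩ hl
      · exact absurd ⟨_, h⟩ hl
    · intro h
      obtain ⟨l', _, h⟩ := Finset.mem_map.1 h
      exact absurd ⟨l', h⟩ hl

/-- Matrices indexed by the configurations of the memory. -/
abbrev MemMatrix := Finset (ℕ × ℕ) → Finset (ℕ × ℕ) → ℂ

/-- The reduced density matrix of the simulated memory. -/
def simGram (v : Vec) : MemMatrix := fun a b => gram v (a.map shiftLoc) (b.map shiftLoc)

/-- The effect on density matrices of an operation on the cells `L`. -/
def kernMap {ι : Type} [Fintype ι] [DecidableEq ι] (k : (ι → Bool) → (ι → Bool) → (ι → Bool) → (ι → Bool) → ℂ)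
    (L : ι → ℕ × ℕ) : MemMatrix →+ MemMatrix where
  toFun g a b := ∑ d, ∑ d', k (getBits L a) (getBits L b) d d' * g (setBits L d a) (setBits L d' b)
  map_zero' := by funext a b; simp
  map_add' g g' := by
    funext a b
    simp only [Pi.add_apply, mul_add, Finset.sum_add_distrib]

theorem kernMap_apply {ι : Type} [Fintype ι] [DecidableEq ι]
    (k : (ι → Bool) → (ι → Bool) → (ι → Bool) → (ι → Bool) → ℂ) (L : ι → ℕ × ℕ) (g : MemMatrix)
    (a b : Finset (ℕ × ℕ)) : kernMap k L g a b =
      ∑ d, ∑ d', k (getBits L a) (getBits L b) d d' * g (setBits L d a) (setBits L d' b) := rfl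

theorem simGram_of_gram {ι : Type} [Fintype ι] [DecidableEq ι]
    {k : (ι → Bool) → (ι → Bool) → (ι → Bool) → (ι → Bool) → ℂ} {L : ι → ℕ × ℕ} {v w : Vec}
    (h : gram w = kernMap k (fun i => shiftLoc (L i)) (gram v)) :
    simGram w = kernMap k L (simGram v) := by
  funext a b
  rw [simGram, h, kernMap_apply, kernMap_apply]
  simp only [getBits_shift, setBits_shift, simGram]

variable {ι : Type} [Fintype ι] [DecidableEq ι]

/-- In all these kernels, `x` and `y` are the bits of the row and of the column of the new matrix,
and `d`, `d'` those of the old entry. The kernel here is conjugation by `K`. -/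
def actKern (K : Matrix (ι → Bool) (ι → Bool) ℂ) :
    (ι → Bool) → (ι → Bool) → (ι → Bool) → (ι → Bool) → ℂ :=
  fun x y d d' => K x d * (starRingEnd ℂ) (K y d')

def prepKern (C : (ι → Bool) → ℂ) : (ι → Bool) → (ι → Bool) → (ι → Bool) → (ι → Bool) → ℂ :=
  fun x y d d' => if d = d' then C x * (starRingEnd ℂ) (C y) else 0

/-- Places that were handed over are blank afterwards, so only blank rows and columns occur, and `E`
is the effect K*K. The indices of `E` are in the order of the trace of ρE. -/
def envKern (E : Matrix (ι → Bool) (ι → Bool) ℂ) :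
    (ι → Bool) → (ι → Bool) → (ι → Bool) → (ι → Bool) → ℂ :=
  fun x y d d' => if x = (fun _ => false) ∧ y = (fun _ => false) then E d' d else 0

/-- `Kᴴ * K`. -/
def opGram {β γ : Type} [Fintype γ] (K : Matrix γ β ℂ) : Matrix β β ℂ := K.conjTranspose * K

theorem gram_act_eq {L : ι → ℕ × ℕ} (hL : Function.Injective L)
    (K : Matrix (ι → Bool) (ι → Bool) ℂ) (v : Vec) :
    gram (applyOp (fun i => Sum.inl (L i)) (fun i => Sum.inl (L i)) K v) =
      kernMap (actKern K) L (gram v) := by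
  funext a b
  rw [gram_act hL]
  rfl

theorem gram_prep_eq {L : ι → ℕ × ℕ} (hL : Function.Injective L) {F : ι → ℕ × ℕ × ℕ × ℕ}
    (hF : Function.Injective F) (C : (ι → Bool) → ℂ) {v : Vec}
    (hv : Supp (fun c => ∀ i, (Sum.inr (F i) : Loc) ∉ c) v) :
    gram (prep (fun i => Sum.inl (L i)) (fun i => Sum.inr (F i)) C v) =
      kernMap (prepKern C) L (gram v) := by
  funext a b
  rw [gram_prep hL hF C hv]
  rfl

theorem gram_env_eq {ι' : Type} [Fintype ι'] [DecidableEq ι'] {L : ι → ℕ × ℕ}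
    (hL : Function.Injective L) {F : ι' → ℕ × ℕ × ℕ × ℕ} (hF : Function.Injective F)
    (K : Matrix (ι' → Bool) (ι → Bool) ℂ) {v : Vec}
    (hv : Supp (fun c => ∀ i, (Sum.inr (F i) : Loc) ∉ c) v) :
    gram (applyOp (fun i => Sum.inl (L i)) (fun i => Sum.inr (F i)) K v) =
      kernMap (envKern (opGram K)) L (gram v) := by
  classical
  funext a b
  rw [gram_applyOp_env hL hF K (hv.mono fun c hc i hi => absurd hi (hc i)), kernMap_apply]
  have h : ∀ a : Finset (ℕ × ℕ), getBits L a = (fun _ => false) ↔ ∀ i, L i ∉ a := by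
    intro a
    simp [funext_iff]
  by_cases hab : (∀ i, L i ∉ a) ∧ ∀ i, L i ∉ b
  · rw [if_pos hab]
    simp only [envKern, if_pos (show _ ∧ _ from ⟨(h a).2 hab.1, (h b).2 hab.2⟩)]
    rfl
  · rw [if_neg hab]
    have : ¬ (getBits L a = (fun _ => false) ∧ getBits L b = fun _ => false) := by
      rwa [h, h]
    simp only [envKern, if_neg this, zero_mul, Finset.sum_const_zero]

theorem envKern_sum {β : Type} [Fintype β] (E : β → Matrix (ι → Bool) (ι → Bool) ℂ)
    (L : ι → ℕ × ℕ) (g : MemMatrix) :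
    ∑ x, kernMap (envKern (E x)) L g = kernMap (envKern (∑ x, E x)) L g := by
  funext a b
  simp only [Finset.sum_apply, kernMap_apply]
  rw [Finset.sum_comm]
  refine Finset.sum_congr rfl fun d _ => ?_
  rw [Finset.sum_comm]
  refine Finset.sum_congr rfl fun d' _ => ?_
  rw [← Finset.sum_mul]
  congr 1
  simp only [envKern]
  split_ifs
  · rw [Matrix.sum_apply]
  · simp

/-- The variables of the simulated program. -/
def vA (x : ℕ) : ℕ := 2 * x + 20

/-- The variables of the program that computes the number of registers. -/
def vP (x : ℕ) : ℕ := 2 * x + 21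

theorem vA_injective : Function.Injective vA := fun x y h => by simp only [vA] at h; omega

theorem vP_injective : Function.Injective vP := fun x y h => by simp only [vP] at h; omega

theorem vA_ne_vP (x y : ℕ) : vA x ≠ vP y := by simp only [vA, vP]; omega

theorem vA_ge (x : ℕ) : 20 ≤ vA x := by simp only [vA]; omega

theorem vP_ge (x : ℕ) : 20 ≤ vP x := by simp only [vP]; omega

/-- The qubit of the simulated memory. -/
def sq (q : QRef) : QRef := (q.1 + 3, vA q.2)

/-- All environment qubits were created in the first `k` oracle calls. -/
def EnvBound (k : ℕ) (c : Config) : Prop := ∀ e, Sum.inr e ∈ c → e.1 < k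

/-- The number of submitted money states. -/
def State.total (s : State) : ℕ := (s.submitted.map Prod.fst).sum

/-- The properties of the branches of the simulated run. -/
structure Regular (s : State) : Prop where
  env : Supp (EnvBound s.calls) s.vec
  total : s.total ≤ s.queries
  queries : s.queries ≤ s.time

/-- A bound for the time of the simulation of a single instruction that takes time `τ`. -/
def stepBound (r τ : ℕ) : ℕ := 100 * ((r + 1) * (τ + 1)) ^ 5

theorem stepBound_mono (r : ℕ) {τ τ' : ℕ} (h : τ ≤ τ') : stepBound r τ ≤ stepBound r τ' := by
  unfold stepBound; gcongr

theorem one_le_stepBound (r τ : ℕ) : 100 ≤ stepBound r τ := by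
  have : 1 ≤ ((r + 1) * (τ + 1)) ^ 5 := Nat.one_le_pow _ _ (by positivity)
  unfold stepBound; omega

/-- The relation between a branch `s` of the simulated run and a branch `t` of the simulation. -/
structure SimRel (r ℓ T : ℕ) (s t : State) : Prop where
  store : ∀ x, t.store (vA x) = s.store x
  one : t.store 1 = 1
  qubits : t.store 2 = ℓ
  regs : t.store 3 = r
  zero : t.store 4 = 0
  low : Supp LowBlank t.vec
  env : Supp (EnvBound t.calls) t.vec
  time : t.time ≤ T + s.time * stepBound r s.time
  queries : t.queries ≤ 3 * (r + 1) * s.queries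
  flexible : t.flexible ≤ t.queries

/-- A simulated instruction of duration τ ≥ 1 is charged the bound for τ, which is at most the bound
for the final time; the product form of the time invariant therefore reproduces itself. -/
theorem SimRel.time_step {r T τ τ' a b : ℕ} (h : a ≤ T + b * stepBound r b) (hτ : 1 ≤ τ)
    (h' : τ' ≤ stepBound r τ) : a + τ' ≤ T + (b + τ) * stepBound r (b + τ) := by
  have h1 := Nat.mul_le_mul_left b (stepBound_mono r (Nat.le_add_right b τ))
  have h2 := stepBound_mono r (Nat.le_add_left τ b)
  have h3 := Nat.mul_le_mul_right (stepBound r (b + τ)) hτ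
  rw [add_mul]
  omega

/-- The potential that decreases in no step of the simulation: the flexible utility of the
simulation, minus the (slightly discounted) utility of the simulated adversary, in private coins. -/
def potential (r : ℕ) (s t : State) : ℝ :=
  t.prob * (t.flexible - r * (s.allOrNothing - (1 / 2) ^ r * s.total))

/-- A branch of the simulated run is represented by several branches of the simulation. -/
structure Rep (r ℓ T : ℕ) (s : State) (N : Multiset State) : Prop where
  regular : Regular s
  rel : ∀ t ∈ N, SimRel r ℓ T s t
  gram : gram s.vec = (N.map fun t => simGram t.vec).sum

/-- The simulation of `F` by `F'`. -/
def Sim (r ℓ T : ℕ) (F F' : State → Multiset State) : Prop :=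
  -- `Λ` groups the branches of the simulation under the branches of the simulated run that they
  -- represent. The last two clauses are conservation of the total probability and growth of the
  -- potential.
  ∀ s N, Rep r ℓ T s N → ∃ Λ : Multiset (State × Multiset State),
    Λ.map Prod.fst = F s ∧ Λ.bind Prod.snd = N.bind F' ∧ (∀ p ∈ Λ, Rep r ℓ T p.1 p.2) ∧
    (Λ.map fun p => (p.2.map State.prob).sum).sum = (N.map State.prob).sum ∧
    (N.map (potential r s)).sum ≤ (Λ.map fun p => (p.2.map (potential r p.1)).sum).sum

variable {r ℓ T : ℕ}

theorem Sim.id : Sim r ℓ T (fun s => {s}) (fun t => {t}) := fun s N h =>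
  ⟨{(s, N)}, by simp, by rw [Multiset.singleton_bind, Multiset.bind_singleton N (fun t => t),
    Multiset.map_id'], by simpa using h, by simp, by simp⟩

theorem Sim.comp {F F' G G' : State → Multiset State} (hF : Sim r ℓ T F F') (hG : Sim r ℓ T G G') :
    Sim r ℓ T (fun s => (F s).bind G) (fun t => (F' t).bind G') := by
  classical
  intro s N h
  obtain ⟨Λ, h1, h2, h3, h4, h5⟩ := hF s N h
  have hG' : ∀ p : State × Multiset State, ∃ Λ' : Multiset (State × Multiset State),
      Rep r ℓ T p.1 p.2 → Λ'.map Prod.fst = G p.1 ∧ Λ'.bind Prod.snd = p.2.bind G' ∧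
      (∀ p' ∈ Λ', Rep r ℓ T p'.1 p'.2) ∧
      (Λ'.map fun p => (p.2.map State.prob).sum).sum = (p.2.map State.prob).sum ∧
      (p.2.map (potential r p.1)).sum ≤ (Λ'.map fun p => (p.2.map (potential r p.1)).sum).sum := by
    intro p
    by_cases hp : Rep r ℓ T p.1 p.2
    · obtain ⟨Λ', h⟩ := hG _ _ hp
      exact ⟨Λ', fun _ => h⟩
    · exact ⟨0, fun h => absurd h hp⟩
  choose f hf using hG'
  refine ⟨Λ.bind f, ?_, ?_, ?_, ?_, ?_⟩
  · show _ = (F s).bind G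
    rw [Multiset.map_bind, ← h1, Multiset.bind_map]
    exact Multiset.bind_congr fun p hp => (hf p (h3 p hp)).1
  · rw [← Multiset.bind_assoc, ← h2, Multiset.bind_assoc, Multiset.bind_assoc]
    exact Multiset.bind_congr fun p hp => (hf p (h3 p hp)).2.1
  · intro p' hp'
    obtain ⟨p, hp, hp'⟩ := Multiset.mem_bind.1 hp'
    exact (hf p (h3 p hp)).2.2.1 p' hp'
  · rw [Multiset.map_bind, Multiset.sum_bind, ← h4]
    congr 1
    exact Multiset.map_congr rfl fun p hp => (hf p (h3 p hp)).2.2.2.1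
  · rw [Multiset.map_bind, Multiset.sum_bind]
    exact h5.trans (Multiset.sum_map_le_sum_map _ _ fun p hp => (hf p (h3 p hp)).2.2.2.2)

/-- For branching and loops: the instruction to be executed may depend on `s`, and every
representing branch makes the same choice, since it agrees with `s` on the simulated variables. -/
theorem Sim.congr {F F' : State → Multiset State} (h : ∀ s N, Rep r ℓ T s N →
    ∃ G G' : State → Multiset State, Sim r ℓ T G G' ∧ F s = G s ∧ ∀ t ∈ N, F' t = G' t) :
    Sim r ℓ T F F' := by
  intro s N hN
  obtain ⟨G, G', hG, e, e'⟩ := h s N hN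
  rw [e, Multiset.bind_congr e']
  exact hG s N hN

theorem Sim.iterate {F F' : State → Multiset State} (h : Sim r ℓ T F F') (n : ℕ) :
    Sim r ℓ T (fun s => (fun M : Multiset State => M.bind F)^[n] {s})
      (fun t => (fun M : Multiset State => M.bind F')^[n] {t}) := by
  induction n with
  | zero => exact Sim.id
  | succ n ih =>
    simp only [Function.iterate_succ_apply']
    exact ih.comp h

/-- Every outcome acts on the reduced density matrix by an additive map `Φ o`, the same for the
simulated run and for its simulation. It is therefore enough to treat one representing branch at a
time; the sum over all of them follows by additivity. -/
theorem Sim.of_step {F F' : State → Multiset State} (h : ∀ s, Regular s →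
    ∃ (β : Type) (_ : Fintype β) (f : β → State) (Φ : β → MemMatrix →+ MemMatrix),
      F s = Finset.univ.val.map f ∧
      (∀ o, Regular (f o) ∧ gram (f o).vec = Φ o (gram s.vec)) ∧
      ∀ t, SimRel r ℓ T s t → ∃ N : β → Multiset State, F' t = ∑ o, N o ∧
        (∀ o, ∀ t' ∈ N o, SimRel r ℓ T (f o) t') ∧
        (∀ o, ((N o).map fun t' => simGram t'.vec).sum = Φ o (simGram t.vec)) ∧
        ∑ o, ((N o).map State.prob).sum = t.prob ∧
        potential r s t ≤ ∑ o, ((N o).map (potential r (f o))).sum) : Sim r ℓ T F F' := by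
  classical
  intro s N hN
  obtain ⟨β, _, f, Φ, hF, hf, H⟩ := h s hN.regular
  have H' : ∀ t, ∃ N' : β → Multiset State, SimRel r ℓ T s t → F' t = ∑ o, N' o ∧
        (∀ o, ∀ t' ∈ N' o, SimRel r ℓ T (f o) t') ∧
        (∀ o, ((N' o).map fun t' => simGram t'.vec).sum = Φ o (simGram t.vec)) ∧
        ∑ o, ((N' o).map State.prob).sum = t.prob ∧
        potential r s t ≤ ∑ o, ((N' o).map (potential r (f o))).sum := by
    intro t
    by_cases ht : SimRel r ℓ T s t
    · obtain ⟨N', h⟩ := H t ht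
      exact ⟨N', fun _ => h⟩
    · exact ⟨0, fun h => absurd h ht⟩
  choose g hg using H'
  have hg' : ∀ t ∈ N, _ := fun t ht => hg t (hN.rel t ht)
  have swap : ∀ u : β → State → ℝ, ∑ o, ((N.bind fun t => g t o).map (u o)).sum =
      (N.map fun t => ∑ o, ((g t o).map (u o)).sum).sum := by
    intro u
    simp only [Multiset.map_bind, Multiset.sum_bind]
    exact (Multiset.sum_map_sum_map _ _)
  refine ⟨Finset.univ.val.map fun o => (f o, N.bind fun t => g t o), ?_, ?_, ?_, ?_, ?_⟩
  · rw [hF, Multiset.map_map]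
    rfl
  · rw [Multiset.bind_map]
    rw [Multiset.bind_bind]
    refine Multiset.bind_congr fun t ht => ?_
    rw [(hg' t ht).1]
    rfl
  · intro p hp
    obtain ⟨o, _, rfl⟩ := Multiset.mem_map.1 hp
    refine ⟨(hf o).1, fun t' ht' => ?_, ?_⟩
    · obtain ⟨t, ht, ht'⟩ := Multiset.mem_bind.1 ht'
      exact (hg' t ht).2.1 o t' ht'
    · rw [(hf o).2, hN.gram, Multiset.map_bind, Multiset.sum_bind, map_multiset_sum,
        Multiset.map_map]
      congr 1
      exact Multiset.map_congr rfl fun t ht => ((hg' t ht).2.2.1 o).symm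
  · rw [Multiset.map_map]
    refine (swap fun _ => State.prob).trans ?_
    congr 1
    exact Multiset.map_congr rfl fun t ht => (hg' t ht).2.2.2.1
  · rw [Multiset.map_map]
    refine le_trans ?_ (swap fun o => potential r (f o)).ge
    exact Multiset.sum_map_le_sum_map _ _ fun t ht => (hg' t ht).2.2.2.2

/-- The total probability of a representation. -/
theorem Rep.prob {s : State} {N : Multiset State} (h : Rep r ℓ T s N) :
    (N.map State.prob).sum = s.prob := by
  classical
  have hinj : Function.Injective fun a : Finset (ℕ × ℕ) => a.map shiftLoc :=
    Finset.map_injective _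
  have h1 : ∀ t, SimRel r ℓ T s t →
      HasSum (fun a => simGram t.vec a a) (t.prob : ℂ) := by
    intro t ht
    refine (hinj.hasSum_iff (f := fun a => QMoney.gram t.vec a a) fun a ha => ?_).2
      (hasSum_gram t.vec)
    -- A configuration that is not shifted from the simulated memory has an occupied cell in a bank
    -- below 3. As these banks are blank, such diagonal entries vanish and the simulated memory
    -- carries the whole trace.
    have : ∃ l ∈ a, l.1 < 3 := by
      by_contra hl
      push Not at hl
      refine ha ⟨a.preimage shiftLoc shiftLoc.injective.injOn, ?_⟩
      ext l
      simp only [Finset.mem_map, Finset.mem_preimage]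
      constructor
      · rintro ⟨l', h1, rfl⟩; exact h1
      · intro h1
        have h2 := hl l h1
        have h3 : shiftLoc (l.1 - 3, l.2) = l := by
          ext
          · simp; omega
          · rfl
        exact ⟨_, by rwa [h3], h3⟩
    obtain ⟨l, hl, hl'⟩ := this
    refine sesq_of_forall_not ht.low ht.low fun c c' hc _ hcc => ?_
    refine hc l.1 hl' l.2 (Finset.mem_toLeft.1 ?_)
    rw [hcc.1]; exact hl
  have h2 : HasSum (fun a => QMoney.gram s.vec a a) (((N.map State.prob).sum : ℝ) : ℂ) := by
    have h3 : ∀ M : Multiset State, (∀ t ∈ M, SimRel r ℓ T s t) →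
        HasSum (fun a => (M.map fun t => simGram t.vec).sum a a)
          (((M.map State.prob).sum : ℝ) : ℂ) := by
      intro M
      induction M using Multiset.induction with
      | empty => intro _; simp
      | cons t M ih =>
        intro hM
        simp only [Multiset.map_cons, Multiset.sum_cons, Pi.add_apply, Complex.ofReal_add]
        exact (h1 t (hM t (Multiset.mem_cons_self _ _))).add
          (ih fun t ht => hM t (Multiset.mem_cons_of_mem ht))
    rw [h.gram]
    exact h3 N h.rel
  exact_mod_cast h2.unique (hasSum_gram s.vec)

end Relation

/-! ### Classical assignments, gates and measurements within the simulated memory -/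

section LocalSteps

/-! ### Simulation of the instructions without oracle calls -/

variable {r ℓ T : ℕ}

theorem injective_inl {ι : Type} {L : ι → ℕ × ℕ} :
    Function.Injective (fun i => (Sum.inl (L i) : Loc)) ↔ Function.Injective L :=
  ⟨fun h _ _ e => h (congrArg Sum.inl e), fun h => Sum.inl_injective.comp h⟩

theorem injective_shift {ι : Type} {L : ι → ℕ × ℕ} :
    Function.Injective (fun i => shiftLoc (L i)) ↔ Function.Injective L :=
  ⟨fun h _ _ e => h (congrArg shiftLoc e), fun h => shiftLoc.injective.comp h⟩

open Classical in
/-- The effect of `actMap` on density matrices. -/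
def actGram {n : ℕ} (L : Fin n → ℕ × ℕ) (K : Matrix (Fin n → Bool) (Fin n → Bool) ℂ) :
    MemMatrix →+ MemMatrix :=
  if Function.Injective L then kernMap (actKern K) L else AddMonoidHom.id _

theorem gram_actMap {n : ℕ} (L : Fin n → ℕ × ℕ) (K : Matrix (Fin n → Bool) (Fin n → Bool) ℂ)
    (v : Vec) : gram (actMap (fun i => Sum.inl (L i)) K v) = actGram L K (gram v) := by
  rw [actMap, actGram]
  by_cases h : Function.Injective L
  · rw [if_pos h, if_pos (injective_inl.2 h)]
    exact gram_act_eq h K v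
  · rw [if_neg h, if_neg (injective_inl.not.2 h)]
    rfl

theorem simGram_actMap {n : ℕ} (L : Fin n → ℕ × ℕ) (K : Matrix (Fin n → Bool) (Fin n → Bool) ℂ)
    (v : Vec) : simGram (actMap (fun i => Sum.inl (shiftLoc (L i))) K v) =
      actGram L K (simGram v) := by
  have h := gram_actMap (fun i => shiftLoc (L i)) K v
  rw [actGram] at h ⊢
  by_cases hL : Function.Injective L
  · rw [if_pos (injective_shift.2 hL)] at h
    rw [if_pos hL]
    exact simGram_of_gram h
  · rw [if_neg (injective_shift.not.2 hL)] at h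
    rw [if_neg hL]
    funext a b
    exact congrFun (congrFun h _) _

/-- The branches correspond one to one and no utility is changed, so by the normalization `hn` the
potential is even preserved. The hypothesis `hc` says that both programs do the same thing up to the
shift of banks and the renaming of variables. -/
theorem Sim.localStep {β : Type} [Fintype β] {n : ℕ} (σ σ' : β → (ℕ → ℕ) → ℕ → ℕ)
    (L L' : (ℕ → ℕ) → Fin n → ℕ × ℕ)
    (K K' : β → (ℕ → ℕ) → Matrix (Fin n → Bool) (Fin n → Bool) ℂ) {F F' : State → Multiset State}
    (hF : ∀ s, F s = Finset.univ.val.map fun o => { s with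
      store := σ o s.store
      vec := actMap (fun i => Sum.inl (L s.store i)) (K o s.store) s.vec
      time := s.time + 1 })
    (hF' : ∀ s, F' s = Finset.univ.val.map fun o => { s with
      store := σ' o s.store
      vec := actMap (fun i => Sum.inl (L' s.store i)) (K' o s.store) s.vec
      time := s.time + 1 })
    (hc : ∀ s t : ℕ → ℕ, (∀ x, t (vA x) = s x) → (∀ o x, σ' o t (vA x) = σ o s x) ∧
      (∀ o, ∀ x < 20, σ' o t x = t x) ∧ (∀ i, L' t i = shiftLoc (L s i)) ∧ ∀ o, K' o t = K o s)
    (hn : ∀ t v, ∑ o, normSq (actMap (fun i => Sum.inl (L' t i)) (K' o t) v) = normSq v) :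
    Sim r ℓ T F F' := by
  refine Sim.of_step fun s hs => ⟨β, inferInstance, _, fun o => actGram (L s.store) (K o s.store),
    hF s, fun o => ⟨⟨?_, hs.total, ?_⟩, gram_actMap _ _ _⟩, fun t ht => ⟨fun o => {{ t with
      store := σ' o t.store
      vec := actMap (fun i => Sum.inl (L' t.store i)) (K' o t.store) t.vec
      time := t.time + 1 }}, ?_, fun o t' ht' => ?_, fun o => ?_, ?_, ?_⟩⟩
  · refine hs.env.actMap fun c b hc e he => hc e ?_
    rwa [mem_setBits_of_ne (by simp)] at he
  · exact hs.queries.trans (Nat.le_succ _)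
  · rw [hF', univ_val_map_eq_sum]
  · obtain ⟨h1, h2, h3, h4⟩ := hc _ _ ht.store
    obtain rfl := Multiset.mem_singleton.1 ht'
    refine ⟨h1 o, (h2 o 1 (by norm_num)).trans ht.one, (h2 o 2 (by norm_num)).trans ht.qubits,
      (h2 o 3 (by norm_num)).trans ht.regs, (h2 o 4 (by norm_num)).trans ht.zero, ?_, ?_,
      SimRel.time_step ht.time le_rfl ((one_le_stepBound r 1).trans' (by norm_num)), ht.queries,
      ht.flexible⟩
    · refine ht.low.actMap fun c d hc b hb x hx => hc b hb x ?_
      rwa [mem_setBits_of_ne] at hx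
      intro i
      rw [h3]
      simp only [shiftLoc_apply, ne_eq, Sum.inl.injEq, Prod.mk.injEq, not_and]
      omega
    · refine ht.env.actMap fun c b hc e he => hc e ?_
      rwa [mem_setBits_of_ne (by simp)] at he
  · obtain ⟨h1, h2, h3, h4⟩ := hc _ _ ht.store
    rw [Multiset.map_singleton, Multiset.sum_singleton]
    simp only [h3, h4]
    exact simGram_actMap _ _ _
  · simp only [Multiset.map_singleton, Multiset.sum_singleton]
    exact hn _ _
  · simp only [Multiset.map_singleton, Multiset.sum_singleton]
    refine le_of_eq ?_
    rw [potential, State.prob, ← hn t.store t.vec, Finset.sum_mul]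
    rfl

theorem actMap_elim0 (v : Vec) :
    actMap (fun i : Fin 0 => (Sum.inl (i.elim0 : ℕ × ℕ) : Loc)) 1 v = v := by
  rw [actMap, if_pos (Function.injective_of_subsingleton _)]
  exact applyOp_one v

/-- Instructions that change a single classical variable. -/
theorem Sim.assign {x : ℕ} {f f' : (ℕ → ℕ) → ℕ} {F F' : State → Multiset State}
    (hF : ∀ s, F s = {(s.assign x (f s.store)).tick 1})
    (hF' : ∀ t, F' t = {(t.assign (vA x) (f' t.store)).tick 1})
    (hf : ∀ s t : ℕ → ℕ, (∀ x, t (vA x) = s x) → f' t = f s) : Sim r ℓ T F F' := by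
  refine Sim.localStep (β := Unit) (n := 0) (fun _ s => Function.update s x (f s))
    (fun _ t => Function.update t (vA x) (f' t)) (fun _ i => i.elim0) (fun _ i => i.elim0)
    (fun _ _ => 1) (fun _ _ => 1) (fun s => ?_) (fun s => ?_) (fun s t h => ⟨fun _ z => ?_, fun _ z hz => ?_,
      fun i => i.elim0, fun _ => rfl⟩) fun t v => ?_
  · rw [hF]; simp [State.assign, State.tick, actMap_elim0]
  · rw [hF']; simp [State.assign, State.tick, actMap_elim0]
  · by_cases hz : z = x
    · subst hz; simp [hf s t h]
    · rw [Function.update_of_ne hz, Function.update_of_ne (vA_injective.ne hz), h]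
  · rw [Function.update_of_ne (by have := vA_ge x; omega)]
  · rw [Finset.univ_unique, Finset.sum_singleton, actMap_elim0]

theorem Sim.tick : Sim r ℓ T (fun s => {s.tick 1}) (fun t => {t.tick 1}) := by
  refine Sim.localStep (β := Unit) (n := 0) (fun _ s => s)
    (fun _ t => t) (fun _ i => i.elim0) (fun _ i => i.elim0)
    (fun _ _ => 1) (fun _ _ => 1) (fun s => ?_) (fun s => ?_) (fun s t h => ⟨fun _ z => h z, fun _ z hz => rfl,
      fun i => i.elim0, fun _ => rfl⟩) fun t v => ?_
  · simp [State.tick, actMap_elim0]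
  · simp [State.tick, actMap_elim0]
  · rw [Finset.univ_unique, Finset.sum_singleton, actMap_elim0]

/-- Unitary instructions. -/
theorem Sim.act {n : ℕ} {L L' : (ℕ → ℕ) → Fin n → ℕ × ℕ}
    {U U' : (ℕ → ℕ) → Matrix (Fin n → Bool) (Fin n → Bool) ℂ} {F F' : State → Multiset State}
    (hF : ∀ s, F s = {(s.act (fun i => Sum.inl (L s.store i)) (U s.store)).tick 1})
    (hF' : ∀ s, F' s = {(s.act (fun i => Sum.inl (L' s.store i)) (U' s.store)).tick 1})
    (hL : ∀ s t : ℕ → ℕ, (∀ x, t (vA x) = s x) → ∀ i, L' t i = shiftLoc (L s i))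
    (hU : ∀ s t : ℕ → ℕ, (∀ x, t (vA x) = s x) → U' t = U s)
    (hu : ∀ t, U' t ∈ Matrix.unitaryGroup (Fin n → Bool) ℂ) : Sim r ℓ T F F' := by
  refine Sim.localStep (β := Unit) (n := n) (fun _ s => s)
    (fun _ t => t) L L' (fun _ => U) (fun _ => U') (fun s => ?_) (fun s => ?_)
    (fun s t h => ⟨fun _ z => h z, fun _ z hz => rfl, hL s t h, fun _ => hU s t h⟩) fun t v => ?_
  · rw [hF, State.act_eq]; simp [State.tick]
  · rw [hF', State.act_eq]; simp [State.tick]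
  · rw [Finset.univ_unique, Finset.sum_singleton]
    exact normSq_actMap _ (hu t) v

/-- The projection of a qubit to a basis state. -/
def bitProj (b : Bool) : Matrix (Fin 1 → Bool) (Fin 1 → Bool) ℂ :=
  Matrix.of fun x y => if x = y ∧ x 0 = b then 1 else 0

theorem actMap_bitProj (l : Loc) (b : Bool) (v : Vec) :
    actMap ![l] (bitProj b) v = v.filter fun c => decide (l ∈ c) = b := by
  induction v using Finsupp.induction_linear with
  | zero => rw [map_zero]; exact (Finsupp.filter_zero _).symm
  | add v w hv hw => rw [map_add, hv, hw, Finsupp.filter_add]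
  | single c z =>
    rw [actMap_single (injective_one l), filter_single_eq, Finset.sum_eq_single (getBits ![l] c)]
    · rw [setBits_getBits]
      simp only [bitProj, Matrix.of_apply, true_and, getBits_apply, Matrix.cons_val_zero]
      by_cases h : l ∈ c <;> cases b <;> simp [h]
    · intro d _ hd
      simp [bitProj, hd]
    · simp

theorem Sim.measure {x : ℕ} {q : QRef} {r₁ ℓ₁ r₂ ℓ₂ : ℕ} (O : Oracles r₁ ℓ₁) (O' : Oracles r₂ ℓ₂) :
    Sim r ℓ T (exec O (.measure x q)) (exec O' (.measure (vA x) (sq q))) := by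
  have h1 : ∀ (r' ℓ' : ℕ) (O : Oracles r' ℓ') x (q : QRef) s, exec O (.measure x q) s =
      (Finset.univ : Finset Bool).val.map fun o => { s with
        store := Function.update s.store x o.toNat
        vec := actMap (fun i : Fin 1 => Sum.inl ((![(q.1, s.store q.2)] : Fin 1 → ℕ × ℕ) i)) (bitProj o) s.vec
        time := s.time + 1 } := by
    intro r' ℓ' O x q s
    rw [exec]
    refine Multiset.map_congr rfl fun b _ => ?_
    have : (fun i : Fin 1 => (Sum.inl ((![(q.1, s.store q.2)] : Fin 1 → ℕ × ℕ) i) : Loc)) = ![s.loc q] := by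
      funext i; rw [Subsingleton.elim i 0]; rfl
    rw [this, actMap_bitProj]
    rfl
  refine Sim.localStep (β := Bool) (n := 1) (fun o s => Function.update s x o.toNat)
    (fun o t => Function.update t (vA x) o.toNat) (fun s => ![(q.1, s q.2)])
    (fun t => ![((sq q).1, t (sq q).2)]) (fun o _ => bitProj o) (fun o _ => bitProj o)
    (h1 _ _ O x q) (h1 _ _ O' (vA x) (sq q)) (fun s t h => ⟨fun o z => ?_, fun o z hz => ?_,
      fun i => ?_, fun _ => rfl⟩) fun t v => ?_
  · by_cases hz : z = x
    · subst hz; simp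
    · rw [Function.update_of_ne hz, Function.update_of_ne (vA_injective.ne hz), h]
  · rw [Function.update_of_ne (by have := vA_ge x; omega)]
  · rw [Subsingleton.elim i 0]
    simp [sq, h]
  · have : (fun i : Fin 1 => (Sum.inl ((![((sq q).1, t (sq q).2)] : Fin 1 → ℕ × ℕ) i) : Loc)) =
        ![Sum.inl ((sq q).1, t (sq q).2)] := by
      funext i; rw [Subsingleton.elim i 0]; rfl
    simp only [this, actMap_bitProj, Fintype.sum_bool]
    exact normSq_filter_add _ _

end LocalSteps

/-! ### Minting and private verification: both leave the potential exactly unchanged -/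

section OracleSteps

/-! ### Simulation of the oracle calls -/

variable {r ℓ T : ℕ} {V : Matrix (Fin ℓ → Bool) (Fin ℓ → Bool) ℂ} {φ : (Fin ℓ → Bool) → ℂ}

/-- The oracles of the public scheme. -/
def pubOracles (r : ℕ) (V : Matrix (Fin ℓ → Bool) (Fin ℓ → Bool) ℂ) (φ : (Fin ℓ → Bool) → ℂ) :
    Oracles r ℓ where
  coin := copies φ
  count := fun m => (Finset.univ : Finset (Fin m → Bool)).val.map fun a =>
    { outcome := numTrue a, kept := m + 1, op := publicCountOp (copies φ) a }
  verifySk := (Finset.univ : Finset ((Fin 1 × Fin r → Bool) × Bool)).val.map fun q =>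
    let pAcc : ℝ := (numTrue q.1 : ℝ) / (r : ℝ)
    { outcome := q.2.toNat
      kept := 1
      op := ((Real.sqrt (if q.2 then pAcc else 1 - pAcc) : ℝ) : ℂ) • measureEach V q.1 }

/-- The memory cells of `m` money states. -/
def cells (s : State) (q : QRef) (m r ℓ : ℕ) : Slots m r ℓ → ℕ × ℕ := fun i =>
  (q.1, s.store q.2 + ((i.1.1 * r + i.1.2) * ℓ + i.2))

theorem cells_injective (s : State) (q : QRef) (m r ℓ : ℕ) :
    Function.Injective (cells s q m r ℓ) :=
  injective_inl.1 (s.block_injective q m r ℓ)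

theorem SimRel.block {s t : State} (h : SimRel r ℓ T s t) (q : QRef) (m : ℕ) :
    t.block (sq q) m r ℓ = fun i => Sum.inl (shiftLoc (cells s q m r ℓ i)) := by
  funext i
  simp [State.block, cells, sq, h.store]

theorem EnvBound.fresh {k : ℕ} {v : Vec} (h : Supp (EnvBound k) v) {ι : Type}
    {F : ι → ℕ × ℕ × ℕ × ℕ} (hF : ∀ i, k ≤ (F i).1) :
    Supp (fun c => ∀ i, (Sum.inr (F i) : Loc) ∉ c) v :=
  h.mono fun c hc i hi => absurd (hc _ hi) (by have := hF i; omega)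

theorem EnvBound.applyOp {ι ι' : Type} [Fintype ι] [DecidableEq ι] [Fintype ι'] [DecidableEq ι']
    {k k' : ℕ} {v : Vec} (h : Supp (EnvBound k) v) (hk : k ≤ k') {Lin : ι → Loc} {Lout : ι' → Loc}
    (hL : ∀ i e, Lout i = Sum.inr e → e.1 < k') (K : Matrix (ι' → Bool) (ι → Bool) ℂ) :
    Supp (EnvBound k') (applyOp Lin Lout K v) := by
  refine h.applyOp fun c b hc e he => ?_
  rcases mem_setBits.1 he with ⟨h1, _⟩ | ⟨i, _, h1⟩
  · exact (hc e (mem_setBits_false.1 h1).1).trans_le hk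
  · exact hL i e h1

theorem LowBlank.applyOp {ι ι' : Type} [Fintype ι] [DecidableEq ι] [Fintype ι'] [DecidableEq ι']
    {v : Vec} (h : Supp LowBlank v) {Lin : ι → Loc} {Lout : ι' → Loc}
    (hL : ∀ i b x, b < 3 → Lout i ≠ cell b x) (K : Matrix (ι' → Bool) (ι → Bool) ℂ) :
    Supp LowBlank (applyOp Lin Lout K v) := by
  refine h.applyOp fun c d hc b hb x hx => ?_
  rw [mem_setBits_of_ne fun i => hL i b x hb, mem_setBits_false] at hx
  exact hc b hb x hx.1

theorem EnvBound.prep {ι : Type} [Fintype ι] [DecidableEq ι] {k k' : ℕ} {v : Vec}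
    (h : Supp (EnvBound k) v) (hk : k ≤ k') {L : ι → ℕ × ℕ} {F : ι → ℕ × ℕ × ℕ × ℕ}
    (hF : ∀ i, (F i).1 < k') (C : (ι → Bool) → ℂ) :
    Supp (EnvBound k') (prep (fun i => Sum.inl (L i)) (fun i => Sum.inr (F i)) C v) :=
  EnvBound.applyOp (EnvBound.applyOp h hk (fun i _ e => Sum.inr_injective e ▸ hF i) 1) le_rfl
    (fun _ _ e => absurd e Sum.inl_ne_inr) (colMatrix C)

theorem LowBlank.prep {ι : Type} [Fintype ι] [DecidableEq ι] {v : Vec}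
    (h : Supp LowBlank v) {L : ι → ℕ × ℕ} (F : ι → ℕ × ℕ × ℕ × ℕ) (hL : ∀ i, 3 ≤ (L i).1)
    (C : (ι → Bool) → ℂ) :
    Supp LowBlank (prep (fun i => Sum.inl (L i)) (fun i => Sum.inr (F i)) C v) := by
  refine LowBlank.applyOp (LowBlank.applyOp h (fun _ _ _ _ => Sum.inr_ne_inl) 1)
    (fun i b x hb e => ?_) (colMatrix C)
  have := hL i
  rw [Sum.inl_injective e] at this
  exact absurd hb (by simpa using this)

theorem doMint_vec (O : Oracles r ℓ) (s : State) (q : QRef) : (s.doMint O q).vec =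
    prep (fun i => Sum.inl (cells s q 1 r ℓ i)) (fun i => Sum.inr (s.calls, i.1.1, i.1.2, (i.2 : ℕ)))
      O.coin s.vec := rfl

theorem store_frame {s s' t t' : ℕ → ℕ} {z : ℕ} (hfr : Frame (insert (vA z) lowVars) t t')
    (h : ∀ x, t (vA x) = s x) (hz : t' (vA z) = s' z) (hs : ∀ x, x ≠ z → s' x = s x) :
    (∀ x, t' (vA x) = s' x) ∧ ∀ x < 5, t' x = t x := by
  constructor
  · intro x
    by_cases hx : x = z
    · rw [hx, hz]
    · rw [hs x hx, hfr, h]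
      have h1 := vA_ge x
      have h2 := vA_injective.ne hx
      simp only [Finset.mem_insert, Finset.mem_Ico]
      omega
  · intro x hx
    rw [hfr]
    have h1 := vA_ge z
    simp only [Finset.mem_insert, Finset.mem_Ico]
    omega

/-- Probabilities of branches become sums over finitely many amplitude vectors `ψ c` that do not
depend on the operator. Inequalities for vectors on the registers are transferred to the memory by
summation over `c`. -/
theorem normSq_applyOp_decomp {ι : Type} [Fintype ι] [DecidableEq ι] {Lin : ι → Loc}
    (hin : Function.Injective Lin) (v : Vec) :
    ∃ (R : Finset Config) (ψ : Config → (ι → Bool) → ℂ), normSq v = ∑ c ∈ R, nsq (ψ c) ∧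
      ∀ {ι' : Type} [Fintype ι'] [DecidableEq ι'] (Lout : ι' → Loc)
      (_ : Function.Injective Lout) (K : Matrix (ι' → Bool) (ι → Bool) ℂ) (_ : Blank Lin Lout v),
      normSq (applyOp Lin Lout K v) = ∑ c ∈ R, nsq (K.mulVec (ψ c)) := by
  obtain ⟨R, hR⟩ := normSq_applyOp_eq_sum (Lin := Lin) v
  refine ⟨R, fun c d => slice Lin d v c, ?_, fun Lout h K hK => hR Lout h K hK⟩
  have h2 := hR Lin hin (1 : Matrix (ι → Bool) (ι → Bool) ℂ) fun c _ i _ => ⟨i, rfl⟩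
  rw [applyOp_one] at h2
  rw [h2]
  simp only [Matrix.one_mulVec]
  rfl

theorem total_append (s : State) (m j : ℕ) :
    ((s.submitted ++ [(m, j)]).map Prod.fst).sum = s.total + m := by
  simp [State.total]

/-- The simulation pays `r` private coins where the simulated adversary pays one public coin, and
the potential counts the latter `r`-fold. Normalization of φ keeps the probability. -/
theorem Sim.mint (hφ1 : nsq φ = 1) (q : QRef) :
    Sim r ℓ T (exec (pubOracles r V φ) (.mint q)) (exec (privOracles V φ) (mintP (sq q))) := by
  have hω : nsq (copies φ : (Slots 1 r ℓ → Bool) → ℂ) = 1 := by rw [nsq_copies, hφ1, one_pow]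
  refine Sim.of_step fun s hs => ⟨Unit, inferInstance, fun _ => s.doMint (pubOracles r V φ) q,
    fun _ => kernMap (prepKern (copies φ)) (cells s q 1 r ℓ), ?_,
    fun _ => ⟨⟨?_, ?_, ?_⟩, ?_⟩, fun t ht => ?_⟩
  · rw [exec]
    rfl
  · rw [doMint_vec]
    exact EnvBound.prep hs.env (Nat.le_succ _) (fun _ => Nat.lt_succ_self _) _
  · exact hs.total.trans (Nat.le_succ _)
  · have := hs.queries
    simp only [State.doMint]
    omega
  · rw [doMint_vec]
    exact gram_prep_eq (cells_injective s q 1 r ℓ)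
      (F := fun i : Slots 1 r ℓ => (s.calls, i.1.1, i.1.2, i.2))
      (Sum.inr_injective.of_comp_iff _ |>.1 (s.fresh_injective 1 r ℓ)) (copies φ)
      (EnvBound.fresh hs.env fun _ => le_rfl)
  · have hfresh : Supp (fun c => ∀ i, (Sum.inr (mintEnv t.calls r ℓ i) : Loc) ∉ c) t.vec :=
      EnvBound.fresh ht.env fun i => Nat.le_add_right _ _
    refine ⟨fun _ => exec (privOracles V φ) (mintP (sq q)) t, by simp, ?_, ?_, ?_, ?_⟩
    · intro _ t' ht'
      rw [exec_mintP ht.qubits ht.regs ht.zero] at ht'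
      obtain rfl := Multiset.mem_singleton.1 ht'
      have hst := store_frame (z := 0) (s := s.store) (s' := s.store) (t := t.store)
        (t' := Function.update t.store 18 (t.store (sq q).2 + r * ℓ))
        ((Frame.refl _ _).update (Finset.mem_insert_of_mem (by decide)) _) ht.store
        (by rw [Function.update_of_ne (by decide), ht.store]) fun _ _ => rfl
      refine ⟨hst.1, (hst.2 1 (by norm_num)).trans ht.one, (hst.2 2 (by norm_num)).trans ht.qubits,
        (hst.2 3 (by norm_num)).trans ht.regs, (hst.2 4 (by norm_num)).trans ht.zero, ?_, ?_,
        SimRel.time_step ht.time (Nat.le_add_left 1 (r * ℓ)) ?_, ?_, ?_⟩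
      · simp only [ht.block]
        exact LowBlank.prep ht.low _ (fun i => Nat.le_add_left _ _) _
      · simp only [ht.block]
        refine EnvBound.prep ht.env (Nat.le_add_right _ r) (fun i => ?_) _
        simp only [mintEnv]
        have := i.1.2.2
        omega
      · have h1 : (r + 1) * (r * ℓ + 1 + 1) ≤ ((r + 1) * (r * ℓ + 1 + 1)) ^ 5 :=
          Nat.le_self_pow (by norm_num) _
        have h2 : 2 + r * (ℓ + 2) ≤ 2 * ((r + 1) * (r * ℓ + 1 + 1)) := by nlinarith [Nat.zero_le (r * (r * ℓ))]
        unfold stepBound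
        omega
      · have := ht.queries
        show t.queries + r ≤ 3 * (r + 1) * (s.queries + 1)
        nlinarith
      · have := ht.flexible
        simp only [State.flexible] at this ⊢
        push_cast
        have hr : (0 : ℝ) ≤ r := Nat.cast_nonneg r
        linarith
    · intro _
      rw [exec_mintP ht.qubits ht.regs ht.zero, Multiset.map_singleton, Multiset.sum_singleton]
      simp only [ht.block]
      exact simGram_of_gram (gram_prep_eq (injective_shift.2 (cells_injective s q 1 r ℓ))
        (mintEnv_injective _ _ _) _ hfresh)
    all_goals
      have hn : normSq (prep (t.block (sq q) 1 r ℓ) (fun i => Sum.inr (mintEnv t.calls r ℓ i))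
          (copies φ) t.vec) = normSq t.vec :=
        normSq_prep (t.block_injective (sq q) 1 r ℓ)
          (Sum.inr_injective.comp (mintEnv_injective _ _ _)) (by simp [State.block]) hω hfresh
      rw [exec_mintP ht.qubits ht.regs ht.zero, Finset.univ_unique, Finset.sum_singleton,
        Multiset.map_singleton, Multiset.sum_singleton]
    · exact hn
    · refine le_of_eq ?_
      rw [potential, potential, State.prob, State.prob, hn]
      simp only [State.flexible, State.allOrNothing, State.total, State.doMint]
      push_cast
      ring

theorem norm_sq_sqrt {x : ℝ} (hx : 0 ≤ x) : ‖((Real.sqrt x : ℝ) : ℂ)‖ ^ 2 = x := by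
  rw [Complex.norm_real, Real.norm_eq_abs, sq_abs, Real.sq_sqrt hx]

/-- If `j` registers are accepted, the flexible utility grows by `j` with certainty and the
simulated one by 1 with probability j/r; in the potential the two contributions cancel on average.
-/
theorem Sim.verify (hV : IsStarProjection V) (hr : 0 < r) (x : ℕ) (q : QRef) :
    Sim r ℓ T (exec (pubOracles r V φ) (.verify x q))
      (exec (privOracles V φ) (verifyP (vA x) (sq q))) := by
  have hr0 : (0 : ℝ) < r := by exact_mod_cast hr
  obtain ⟨c, hc⟩ : ∃ c : (Fin 1 × Fin r → Bool) → Bool → ℝ, ∀ a b,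
      c a b = if b then (numTrue a : ℝ) / r else 1 - (numTrue a : ℝ) / r := ⟨_, fun _ _ => rfl⟩
  have hle : ∀ a : Fin 1 × Fin r → Bool, (numTrue a : ℝ) ≤ r := fun a => by
    have := numTrue_le a
    simp only [Fintype.card_prod, Fintype.card_fin, one_mul] at this
    exact_mod_cast this
  have hc0 : ∀ a b, 0 ≤ c a b := by
    intro a b
    rw [hc]
    split_ifs
    · positivity
    · have := div_le_one_of_le₀ (hle a) hr0.le
      linarith
  refine Sim.of_step fun s hs => ⟨(Fin 1 × Fin r → Bool) × Bool, inferInstance,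
    fun p => s.doVerify x q (⟨p.2.toNat, 1, ((Real.sqrt (c p.1 p.2) : ℝ) : ℂ) • measureEach V p.1⟩ :
      KrausOp 1 r ℓ), fun p => kernMap (envKern (opGram (((Real.sqrt (c p.1 p.2) : ℝ) : ℂ) •
      measureEach V p.1)))
      (cells s q 1 r ℓ), ?_, fun p => ⟨⟨?_, ?_, ?_⟩, ?_⟩, fun t ht => ?_⟩
  · rw [exec]
    simp only [pubOracles, Multiset.map_map, hc]
    rfl
  · refine EnvBound.applyOp hs.env (Nat.le_succ _) (fun i e h => ?_) _
    rw [← Sum.inr_injective h]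
    exact Nat.lt_succ_self _
  · exact hs.total.trans (Nat.le_succ _)
  · have := hs.queries
    simp only [State.doVerify]
    omega
  · exact gram_env_eq (cells_injective s q 1 r ℓ)
      (F := fun i : Slots 1 r ℓ => (s.calls, i.1.1, i.1.2, i.2))
      (Sum.inr_injective.of_comp_iff _ |>.1 (s.fresh_injective 1 r ℓ)) _
      (EnvBound.fresh hs.env fun _ => le_rfl)
  · have hfresh : Supp (fun c => ∀ i, (Sum.inr (submitEnv 1 r ℓ t.calls i) : Loc) ∉ c) t.vec :=
      EnvBound.fresh ht.env fun i => le_rfl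
    obtain ⟨σ, hσ, hex⟩ := exec_verifyP (V := V) (φ := φ) (x := vA x) (q := sq q) ht.regs ht.zero
      (vA_ge x) hr ht.low
    simp only [← hc] at hex
    obtain ⟨R, ψ, hψ, hK⟩ := normSq_applyOp_decomp (t.block_injective (sq q) 1 r ℓ) t.vec
    have hn : ∀ a b, normSq (applyOp (t.block (sq q) 1 r ℓ)
        (fun i => Sum.inr (submitEnv 1 r ℓ t.calls i))
        (((Real.sqrt (c a b) : ℝ) : ℂ) • measureEach V a) t.vec) =
        c a b * ∑ e ∈ R, nsq ((measureEach V a).mulVec (ψ e)) := by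
      intro a b
      rw [applyOp_smul_op, normSq_smul, norm_sq_sqrt (hc0 a b),
        hK (fun i => Sum.inr (submitEnv 1 r ℓ t.calls i))
          (Sum.inr_injective.comp (submitEnv_injective _ _ _ _)) _
          (hfresh.mono fun c hc i hi => absurd hi (hc i))]
    have hsum : ∑ a, ∑ e ∈ R, nsq ((measureEach V a).mulVec (ψ e)) = normSq t.vec := by
      rw [hψ, Finset.sum_comm]
      exact Finset.sum_congr rfl fun e _ => sum_nsq_measureEach hV _
    refine ⟨fun p => {{ t with
        store := σ p.1 p.2
        vec := applyOp (t.block (sq q) 1 r ℓ) (fun i => Sum.inr (submitEnv 1 r ℓ t.calls i))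
          (((Real.sqrt (c p.1 p.2) : ℝ) : ℂ) • measureEach V p.1) t.vec
        time := t.time + (1 * r * (ℓ + 1) + 6)
        queries := t.queries + (1 * r + 1)
        calls := t.calls + 1
        submitted := t.submitted ++ [(1 * r, numTrue p.1)] }}, ?_, ?_, ?_, ?_, ?_⟩
    · rw [hex, Fintype.sum_prod_type]
    · intro p t' ht'
      obtain rfl := Multiset.mem_singleton.1 ht'
      have hst := store_frame (z := x) (s := s.store) (s' := Function.update s.store x p.2.toNat)
        (hσ p.1 p.2).1 ht.store (by rw [(hσ p.1 p.2).2, Function.update_self])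
        fun z hz => Function.update_of_ne hz _ _
      refine ⟨hst.1, (hst.2 1 (by norm_num)).trans ht.one, (hst.2 2 (by norm_num)).trans ht.qubits,
        (hst.2 3 (by norm_num)).trans ht.regs, (hst.2 4 (by norm_num)).trans ht.zero, ?_, ?_,
        SimRel.time_step ht.time (Nat.le_add_left 1 (r * ℓ)) ?_, ?_, ?_⟩
      · refine LowBlank.applyOp ht.low ?_ _
        rintro i b x - h
        cases h
      · refine EnvBound.applyOp ht.env (Nat.le_succ _) (fun i e h => ?_) _
        rw [← Sum.inr_injective h]
        exact Nat.lt_succ_self _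
      · have h1 : (r + 1) * (r * ℓ + 1 + 1) ≤ ((r + 1) * (r * ℓ + 1 + 1)) ^ 5 :=
          Nat.le_self_pow (by norm_num) _
        have h2 : 1 * r * (ℓ + 1) + 6 ≤ 6 * ((r + 1) * (r * ℓ + 1 + 1)) := by
          nlinarith [Nat.zero_le (r * (r * ℓ)), Nat.zero_le (r * ℓ)]
        unfold stepBound
        omega
      · have := ht.queries
        show t.queries + (1 * r + 1) ≤ 3 * (r + 1) * (s.queries + 1)
        nlinarith
      · have := ht.flexible
        have := hle p.1
        simp only [State.flexible, List.map_append, List.sum_append, List.map_cons, List.map_nil,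
          List.sum_cons, List.sum_nil] at *
        push_cast
        linarith
    · intro p
      rw [Multiset.map_singleton, Multiset.sum_singleton]
      simp only [ht.block]
      exact simGram_of_gram (gram_env_eq (injective_shift.2 (cells_injective s q 1 r ℓ))
        (submitEnv_injective _ _ _ _) _ hfresh)
    · simp only [Multiset.map_singleton, Multiset.sum_singleton, State.prob, hn,
        Fintype.sum_prod_type, Fintype.sum_bool]
      rw [← hsum]
      refine Finset.sum_congr rfl fun a _ => ?_
      rw [hc, hc, if_pos rfl, if_neg (by decide)]
      ring
    · simp only [Multiset.map_singleton, Multiset.sum_singleton, potential, State.prob, hn,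
        Fintype.sum_prod_type, Fintype.sum_bool]
      rw [← hsum, Finset.sum_mul]
      -- For a fixed outcome `a` of the registers, the two results of the biased coin have weights
      -- j/r and 1 - j/r, and r·(j/r) = j.
      refine Finset.sum_le_sum fun a _ => le_of_eq ?_
      rw [hc, hc, if_pos rfl, if_neg (by decide)]
      simp only [State.flexible, State.allOrNothing, State.total, State.doVerify, List.map_append,
        List.sum_append, List.map_cons, List.map_nil, List.sum_cons, List.sum_nil]
      simp
      field_simp
      ring

end OracleSteps

/-! ### Submissions to verifiers, and the simulation of arbitrary programs -/

section Compiler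

variable {r ℓ T : ℕ} {V : Matrix (Fin ℓ → Bool) (Fin ℓ → Bool) ℂ} {φ : (Fin ℓ → Bool) → ℂ}

theorem numTrue_eq_iff {m : ℕ} {a : Fin m → Bool} : m = numTrue a ↔ a = fun _ => true := by
  constructor
  · intro h
    have h1 : (Finset.univ.filter fun i => a i = true) = Finset.univ :=
      Finset.eq_univ_of_card _ (by rw [Fintype.card_fin]; exact h.symm)
    funext i
    have h2 := Finset.mem_univ i
    rw [← h1] at h2
    exact (Finset.mem_filter.1 h2).2
  · rintro rfl
    simp [numTrue]

/-- The projections of all outcomes add up to the identity. Hence measuring the discarded wallet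
privately, with the outcome ignored, cannot be seen in the memory. -/
theorem sum_opGram_measureEach (hV : IsStarProjection V) {R : Type} [Fintype R] [DecidableEq R]
    {β : Type} (C : Matrix (R × Fin ℓ → Bool) β ℂ) :
    ∑ b : R → Bool, opGram (measureEach V b * C) = opGram C := by
  have h : ∀ b : R → Bool, opGram (measureEach V b * C) =
      C.conjTranspose * (measureEach V b * C) := by
    intro b
    rw [opGram, Matrix.conjTranspose_mul, measureEach_conjTranspose hV, Matrix.mul_assoc,
      ← Matrix.mul_assoc (measureEach V b), measureEach_mul_self hV]
  simp only [h]
  rw [← Matrix.mul_sum, ← Matrix.sum_mul, measureEach_sum, Matrix.one_mul, opGram]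

/-- With no submitted coin there are no places to act on, and the effect is the scalar ‖φ‖² to the
power `r`, which is 1. -/
theorem kernMap_addWallet_zero (hφ1 : nsq φ = 1) (L : Slots 0 r ℓ → ℕ × ℕ) (g : MemMatrix) :
    kernMap (envKern (opGram (addWallet 0 (copies φ : (Slots 1 r ℓ → Bool) → ℂ)))) L g = g := by
  have h1 := nsq_mulVec (addWallet 0 (copies φ : (Slots 1 r ℓ → Bool) → ℂ)) fun _ => 1
  rw [nsq_addWallet, nsq_copies, hφ1, ← opGram] at h1
  have h2 : ∀ d d' : Slots 0 r ℓ → Bool,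
      opGram (addWallet 0 (copies φ : (Slots 1 r ℓ → Bool) → ℂ)) d d' = 1 := by
    intro d d'
    rw [Subsingleton.elim d default, Subsingleton.elim d' default]
    have h3 : nsq (fun _ : Slots 0 r ℓ → Bool => (1 : ℂ)) = 1 := by simp [nsq]
    simp only [h3, dotProduct, Fintype.sum_unique, Matrix.mulVec, Pi.star_apply, star_one, one_mul,
      mul_one, one_pow, Complex.ofReal_one] at h1
    exact h1.symm
  funext a b
  have hs : ∀ (d : Slots 0 r ℓ → Bool) (a : Finset (ℕ × ℕ)), setBits L d a = a := by
    intro d a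
    rw [Subsingleton.elim d (fun _ => false)]
    exact setBits_eq_self fun i => i.1.1.elim0
  rw [kernMap_apply]
  simp only [envKern, h2, hs, Fintype.sum_unique]
  rw [if_pos ⟨Subsingleton.elim _ _, Subsingleton.elim _ _⟩, one_mul]

/-- The only kind of step in which the potential may really grow. The simulation gains the accepted
registers of the wallet minus the `r` coins minted for it, the simulated adversary gains `m` only if
all its coins are accepted, and `countOp_gain` compares the two; the error term is paid for by the
discount (1/2)^r for each submitted coin. -/
theorem Sim.submit (hV : IsStarProjection V) (hφ : V.mulVec φ = φ) (hφ1 : nsq φ = 1) (hr : 0 < r)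
    (x : ℕ) (q : QRef) (y : ℕ) :
    Sim r ℓ T (exec (pubOracles r V φ) (.submit x q y))
      (exec (privOracles V φ) (submitP (vA x) (sq q) (vA y))) := by
  refine Sim.of_step fun s hs => ?_
  obtain ⟨m, hm⟩ : ∃ m, s.store y = m := ⟨_, rfl⟩
  obtain ⟨f, hf⟩ : ∃ f : (Fin m → Bool) → State, ∀ a, f a = s.doSubmit x q m
      (⟨numTrue a, m + 1, countOp m (copies φ) m a⟩ : KrausOp m r ℓ) := ⟨_, fun _ => rfl⟩
  refine ⟨Fin m → Bool, inferInstance, f, fun a => kernMap (envKern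
      (opGram (countOp m (copies φ : (Slots 1 r ℓ → Bool) → ℂ) m a))) (cells s q m r ℓ), ?_,
      fun a => ⟨⟨?_, ?_, ?_⟩, ?_⟩, fun t ht => ?_⟩
  · subst hm
    rw [exec]
    simp only [pubOracles, Multiset.map_map, publicCountOp_eq]
    exact Multiset.map_congr rfl fun a _ => (hf a).symm
  · rw [hf]
    refine EnvBound.applyOp hs.env (Nat.le_succ _) (fun i e h => ?_) _
    rw [← Sum.inr_injective h]
    exact Nat.lt_succ_self _
  · rw [hf, State.total]
    simp only [State.doSubmit, total_append]
    have := hs.total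
    omega
  · rw [hf]
    simp only [State.doSubmit]
    have := hs.queries
    nlinarith [Nat.zero_le (m * (r * ℓ))]
  · rw [hf]
    exact gram_env_eq (cells_injective s q m r ℓ)
      (F := fun i : Slots (m + 1) r ℓ => (s.calls, i.1.1, i.1.2, i.2))
      (Sum.inr_injective.of_comp_iff _ |>.1 (s.fresh_injective (m + 1) r ℓ)) _
      (EnvBound.fresh hs.env fun _ => le_rfl)
  rcases Nat.eq_zero_or_pos m with rfl | hm0
  -- An empty submission is answered without minting: the public verifier would only create and
  -- discard a wallet coin, which has no effect on the memory or on the utilities.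
  · have hty : t.store (vA y) = 0 := by rw [ht.store, hm]
    have hex : exec (privOracles V φ) (submitP (vA x) (sq q) (vA y)) t =
        {((t.tick 1).assign (vA x) 0).tick 1} := by
      rw [submitP, exec, if_pos hty, exec]
    refine ⟨fun _ => {((t.tick 1).assign (vA x) 0).tick 1}, ?_, ?_, ?_, ?_, ?_⟩
    · rw [hex, Fintype.sum_unique]
    · intro a t' ht'
      obtain rfl := Multiset.mem_singleton.1 ht'
      have hst := store_frame (z := x) (s := s.store) (t := t.store)
        (s' := Function.update s.store x (numTrue a)) (t' := Function.update t.store (vA x) 0)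
        ((Frame.refl _ _).update (Finset.mem_insert_self _ _) _) ht.store
        (by rw [Function.update_self, Function.update_self]; simp [numTrue])
        fun z hz => Function.update_of_ne hz _ _
      rw [hf]
      refine ⟨hst.1, (hst.2 1 (by norm_num)).trans ht.one, (hst.2 2 (by norm_num)).trans ht.qubits,
        (hst.2 3 (by norm_num)).trans ht.regs, (hst.2 4 (by norm_num)).trans ht.zero, ht.low, ht.env,
        ?_, ?_, ht.flexible⟩
      · refine (add_assoc _ _ _).le.trans (SimRel.time_step ht.time (Nat.le_add_left 1 _)
          ((one_le_stepBound _ _).trans' (by norm_num)))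
      · exact ht.queries.trans (Nat.mul_le_mul_left _ (Nat.le_add_right _ _))
    · intro a
      rw [Multiset.map_singleton, Multiset.sum_singleton]
      exact (kernMap_addWallet_zero hφ1 _ _).symm
    · simp [State.prob, State.tick, State.assign]
    · rw [Fintype.sum_unique, Multiset.map_singleton, Multiset.sum_singleton, hf]
      refine le_of_eq ?_
      simp [potential, State.prob, State.flexible, State.allOrNothing, State.total, State.tick,
        State.assign, State.doSubmit]
  · set C : (Fin m → Bool) → Matrix (Slots (m + 1) r ℓ → Bool) (Slots m r ℓ → Bool) ℂ :=
      fun a => countOp m (copies φ) m a with hC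
    -- The time that the simulated machine is charged for this call. The bound (r + 1)(τ + 1) used
    -- for `Z` below dominates the numbers of registers and of qubits, and thus yields the bound
    -- `stepBound r τ`.
    set τ : ℕ := m * (r * ℓ + 1) + 1 with hτ
    have hℓ : ℓ ≤ m * (r * ℓ) := by
      rw [← mul_assoc]; exact Nat.le_mul_of_pos_left _ (Nat.mul_pos hm0 hr)
    have hτ1 : m * (r * ℓ) + m + 1 = τ := by rw [hτ]; ring
    have hτZ : τ ≤ (r + 1) * (τ + 1) := by nlinarith
    obtain ⟨σ, τ', hσ, hex⟩ := exec_submitP (V := V) (φ := φ) (Z := (r + 1) * (τ + 1)) (x := vA x)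
      (y := vA y) (q := sq q) (m := m) (r := r) (ℓ := ℓ) (t := t) ht.one ht.qubits ht.regs ht.zero
      (by rw [ht.store, hm]) (vA_ge y) (Nat.le_add_left 3 _) (vA_ge _) hm0 hr (by nlinarith)
      (by omega) (by nlinarith) (by rw [mul_assoc]; omega) ht.low ht.env
    have henv : Supp (EnvBound (t.calls + r)) t.vec :=
      ht.env.mono fun c hc e he => (hc e he).trans_le (Nat.le_add_right _ _)
    have hfresh : Supp (fun c => ∀ i : Slots (m + 1) r ℓ,
        (Sum.inr (submitEnv (m + 1) r ℓ (t.calls + r) i) : Loc) ∉ c) t.vec :=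
      EnvBound.fresh henv fun i => le_rfl
    obtain ⟨u, hu⟩ : ∃ u : (Fin m → Bool) → (Fin (m + 1) × Fin r → Bool) → State, ∀ a b,
        u a b = { t with
        store := σ a b
        vec := applyOp (t.block (sq q) m r ℓ)
          (fun i => Sum.inr (submitEnv (m + 1) r ℓ (t.calls + r) i))
          (measureEach V b * C a : Matrix (Slots (m + 1) r ℓ → Bool) (Slots m r ℓ → Bool) ℂ) t.vec
        time := t.time + τ' a b
        queries := t.queries + (r + ((m + 1) * r + 1))
        calls := t.calls + (r + 1)
        minted := t.minted + r
        submitted := t.submitted ++ [((m + 1) * r, numTrue b)] } := ⟨_, fun _ _ => rfl⟩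
    obtain ⟨R, ψ, hψ, hK⟩ := normSq_applyOp_decomp (t.block_injective (sq q) m r ℓ) t.vec
    have hn : ∀ a b, (u a b).prob = ∑ e ∈ R, nsq ((measureEach V b * C a :
        Matrix (Slots (m + 1) r ℓ → Bool) (Slots m r ℓ → Bool) ℂ).mulVec (ψ e)) := by
      intro a b
      rw [hu]
      exact hK (fun i => Sum.inr (submitEnv (m + 1) r ℓ (t.calls + r) i))
          (Sum.inr_injective.comp (submitEnv_injective _ _ _ _)) _
          (hfresh.mono fun c hc i hi => absurd hi (hc i))
    have hsum : ∑ a, ∑ b, (u a b).prob = t.prob := by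
      simp only [hn]
      rw [State.prob, hψ]
      rw [Finset.sum_congr rfl fun a _ => Finset.sum_comm, Finset.sum_comm]
      exact Finset.sum_congr rfl fun e _ => sum_nsq_countOp hV hφ1 _
    refine ⟨fun a => Finset.univ.val.map (u a), ?_, ?_, ?_, ?_, ?_⟩
    · simp only [univ_val_map_eq_sum, hu]
      exact hex
    · intro a t' ht'
      obtain ⟨b, _, rfl⟩ := Multiset.mem_map.1 ht'
      have hst := store_frame (z := x) (s := s.store) (s' := Function.update s.store x (numTrue a))
        (hσ a b).1 ht.store (by rw [(hσ a b).2.1, Function.update_self])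
        fun z hz => Function.update_of_ne hz _ _
      rw [hu, hf]
      refine ⟨hst.1, (hst.2 1 (by norm_num)).trans ht.one, (hst.2 2 (by norm_num)).trans ht.qubits,
        (hst.2 3 (by norm_num)).trans ht.regs, (hst.2 4 (by norm_num)).trans ht.zero, ?_, ?_,
        SimRel.time_step ht.time (Nat.le_add_left 1 _) (hσ a b).2.2, ?_, ?_⟩
      · exact LowBlank.applyOp ht.low (fun _ _ _ _ => Sum.inr_ne_inl) _
      · refine EnvBound.applyOp henv (Nat.le_succ _) (fun i e h => ?_) _
        rw [← Sum.inr_injective h]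
        exact Nat.lt_succ_self _
      · have := ht.queries
        show t.queries + (r + ((m + 1) * r + 1)) ≤ 3 * (r + 1) * (s.queries + (m + 1))
        nlinarith [Nat.zero_le (m * r)]
      · have h1 := ht.flexible
        have h2 : (numTrue b : ℝ) ≤ (m + 1) * r := by
          have := numTrue_le b
          simp only [Fintype.card_prod, Fintype.card_fin] at this
          exact_mod_cast this
        simp only [State.flexible, List.map_append, List.sum_append, List.map_cons, List.map_nil,
          List.sum_cons, List.sum_nil] at *
        push_cast
        have hr' : (0 : ℝ) ≤ r := Nat.cast_nonneg r
        linarith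
    · intro a
      rw [Multiset.map_map]
      refine Eq.trans (b := ∑ b, kernMap (envKern (opGram
        (measureEach V b * C a : Matrix (Slots (m + 1) r ℓ → Bool) (Slots m r ℓ → Bool) ℂ))) (cells s q m r ℓ) (simGram t.vec)) ?_ ?_
      · refine Finset.sum_congr rfl fun b _ => ?_
        rw [Function.comp_apply, hu]
        simp only [ht.block]
        exact simGram_of_gram (gram_env_eq (injective_shift.2 (cells_injective s q m r ℓ))
          (submitEnv_injective _ _ _ _) _ hfresh)
      · rw [envKern_sum]
        exact congrArg (fun E => kernMap (envKern E) (cells s q m r ℓ) (simGram t.vec))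
          (sum_opGram_measureEach hV (C a))
    · simp only [Multiset.map_map]
      exact hsum
    · simp only [Multiset.map_map]
      show _ ≤ ∑ a, ∑ b, potential r (f a) (u a b)
      obtain ⟨δ, hδ⟩ : ∃ δ : ℝ, δ = (1 / 2) ^ r := ⟨_, rfl⟩
      -- `countOp_gain` summed over the fibres. On the left, summation over the private outcomes `b`
      -- restores the probability that all coins are accepted.
      have hgain : (r : ℝ) * m * ∑ b, (u (fun _ => true) b).prob ≤
          ∑ a, ∑ b, ((numTrue b : ℝ) - r) * (u a b).prob + r * m * δ * t.prob := by
        rw [State.prob, hψ, hδ]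
        simp only [hn]
        simp only [Finset.mul_sum (s := R)]
        rw [Finset.sum_comm, Finset.mul_sum]
        rw [Finset.sum_congr rfl fun a _ => Finset.sum_comm, Finset.sum_comm (s := Finset.univ),
          ← Finset.sum_add_distrib]
        refine Finset.sum_le_sum fun e _ => ?_
        have h := countOp_gain hV hφ hφ1 hm0 hr (ψ e)
        refine le_trans (le_of_eq (congrArg (fun z => (r : ℝ) * m * z) ?_)) h
        refine Eq.trans ?_ (sum_nsq_measureEach hV ((C fun _ => true).mulVec (ψ e)))
        simp only [Matrix.mulVec_mulVec]
      -- The utility of the simulated adversary changes only on the branches with all answers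
      -- positive; the total number of submitted coins grows by `m` on every branch.
      have hpot : ∀ a b, potential r (f a) (u a b) = (u a b).prob *
          (t.flexible - r * (s.allOrNothing - δ * s.total)) + ((numTrue b : ℝ) - r) * (u a b).prob +
          r * m * δ * (u a b).prob - (if a = (fun _ => true) then r * m * (u a b).prob else 0) := by
        intro a b
        have htot : (f a).total = s.total + m := by
          rw [hf]
          exact total_append s m _
        rw [potential, htot, hf]
        simp only [State.doSubmit, State.allOrNothing, State.flexible, ← hδ,
          show (u a b).submitted = _ from congrArg State.submitted (hu a b),
          show (u a b).accepted = _ from congrArg State.accepted (hu a b),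
          show (u a b).minted = _ from congrArg State.minted (hu a b),
          List.map_append, List.sum_append, List.map_cons, List.map_nil, List.sum_cons,
          List.sum_nil, numTrue_eq_iff]
        split_ifs <;> push_cast <;> ring
      simp only [hpot, Finset.sum_sub_distrib, Finset.sum_add_distrib, ← Finset.sum_mul,
        ← Finset.mul_sum, hsum]
      have hif : ∑ a : Fin m → Bool, ∑ b, (if a = (fun _ => true) then r * m * (u a b).prob else 0) =
          r * m * ∑ b, (u (fun _ => true) b).prob := by
        rw [Finset.sum_eq_single fun _ => true]
        · simp [Finset.mul_sum]
        · intro a _ ha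
          simp [ha]
        · simp
      rw [hif, potential, ← hδ]
      linarith

/-- The simulation of an adversary against the public scheme. -/
def compile : Prog → Prog
  | .skip => .skip
  | .const x c => .const (vA x) c
  | .add x y z => .add (vA x) (vA y) (vA z)
  | .sub x y z => .sub (vA x) (vA y) (vA z)
  | .gate g q => .gate g (sq q)
  | .cnot q₁ q₂ => .cnot (sq q₁) (sq q₂)
  | .toffoli q₁ q₂ q₃ => .toffoli (sq q₁) (sq q₂) (sq q₃)
  | .rot q y z => .rot (sq q) (vA y) (vA z)
  | .measure x q => .measure (vA x) (sq q)
  | .mint q => mintP (sq q)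
  | .verify x q => verifyP (vA x) (sq q)
  | .submit x q y => submitP (vA x) (sq q) (vA y)
  | .seq P Q => .seq (compile P) (compile Q)
  | .ite x P Q => .ite (vA x) (compile P) (compile Q)
  | .loop x P => .loop (vA x) (compile P)
  | .compute x f => .compute (vA x) fun σ => f fun y => σ (vA y)
  | .unitary k L U => .unitary k (L.trans shiftLoc) fun σ => U fun y => σ (vA y)

theorem compile_elementary {P : Prog} (h : P.Elementary) : (compile P).Elementary := by
  induction P with
  | seq P Q ihP ihQ => exact ⟨ihP h.1, ihQ h.2⟩
  | ite x P Q ihP ihQ => exact ⟨ihP h.1, ihQ h.2⟩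
  | loop x P ih => exact ih h
  | compute => exact h.elim
  | unitary => exact h.elim
  | _ => simp [compile, Prog.Elementary, mintP, verifyP, submitP, mulP, moveP, countP, testP,
      testFwdP, testBwdP, forUp, forDown, testStepP, testStepInvP, swapBitP, indexP]

theorem sim_compile (hV : IsStarProjection V) (hφ : V.mulVec φ = φ) (hφ1 : nsq φ = 1) (hr : 0 < r)
    (P : Prog) : Sim r ℓ T (exec (pubOracles r V φ) P) (exec (privOracles V φ) (compile P)) := by
  induction P with
  | skip =>
    refine Sim.congr fun s N h => ⟨_, _, Sim.tick, by rw [exec], fun t _ => by rw [compile, exec]⟩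
  | const x c =>
    exact Sim.assign (f := fun _ => c) (f' := fun _ => c) (fun s => by rw [exec])
      (fun t => by rw [compile, exec]) fun s t h => rfl
  | add x y z =>
    exact Sim.assign (f := fun s => s y + s z) (f' := fun t => t (vA y) + t (vA z))
      (fun s => by rw [exec]) (fun t => by rw [compile, exec]) fun s t h => by rw [h, h]
  | sub x y z =>
    exact Sim.assign (f := fun s => s y - s z) (f' := fun t => t (vA y) - t (vA z))
      (fun s => by rw [exec]) (fun t => by rw [compile, exec]) fun s t h => by rw [h, h]
  | compute x f =>
    exact Sim.assign (f := f) (f' := fun σ => f fun y => σ (vA y))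
      (fun s => by rw [exec]) (fun t => by rw [compile, exec]) fun s t h => by
        rw [show (fun y => t (vA y)) = s from funext h]
  | gate g q =>
    refine Sim.act (n := 1) (L := fun s => ![(q.1, s q.2)])
      (L' := fun t => ![((sq q).1, t (sq q).2)]) (U := fun _ => g.matrix) (U' := fun _ => g.matrix)
      (fun s => ?_) (fun t => ?_) (fun s t h i => ?_) (fun _ _ _ => rfl) fun _ => gate_unitary g
    · rw [exec]; congr 3; funext i; fin_cases i; rfl
    · rw [compile, exec]; congr 3; funext i; fin_cases i; rfl
    · fin_cases i; simp [sq, h]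
  | rot q y z =>
    refine Sim.act (n := 1) (L := fun s => ![(q.1, s q.2)])
      (L' := fun t => ![((sq q).1, t (sq q).2)]) (U := fun s => rotMatrix (s y) (s z))
      (U' := fun t => rotMatrix (t (vA y)) (t (vA z)))
      (fun s => ?_) (fun t => ?_) (fun s t h i => ?_) (fun s t h => by simp only [h])
      fun _ => rotMatrix_unitary _ _
    · rw [exec]; congr 3; funext i; fin_cases i; rfl
    · rw [compile, exec]; congr 3; funext i; fin_cases i; rfl
    · fin_cases i; simp [sq, h]
  | cnot q₁ q₂ =>
    refine Sim.act (n := 2) (L := fun s => ![(q₁.1, s q₁.2), (q₂.1, s q₂.2)])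
      (L' := fun t => ![((sq q₁).1, t (sq q₁).2), ((sq q₂).1, t (sq q₂).2)])
      (U := fun _ => cnotMatrix) (U' := fun _ => cnotMatrix)
      (fun s => ?_) (fun t => ?_) (fun s t h i => ?_) (fun _ _ _ => rfl) fun _ => cnotMatrix_unitary
    · rw [exec]; congr 3; funext i; fin_cases i <;> rfl
    · rw [compile, exec]; congr 3; funext i; fin_cases i <;> rfl
    · fin_cases i <;> simp [sq, h]
  | toffoli q₁ q₂ q₃ =>
    refine Sim.act (n := 3) (L := fun s => ![(q₁.1, s q₁.2), (q₂.1, s q₂.2), (q₃.1, s q₃.2)])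
      (L' := fun t => ![((sq q₁).1, t (sq q₁).2), ((sq q₂).1, t (sq q₂).2),
        ((sq q₃).1, t (sq q₃).2)])
      (U := fun _ => toffoliMatrix) (U' := fun _ => toffoliMatrix)
      (fun s => ?_) (fun t => ?_) (fun s t h i => ?_) (fun _ _ _ => rfl)
      fun _ => toffoliMatrix_unitary
    · rw [exec]; congr 3; funext i; fin_cases i <;> rfl
    · rw [compile, exec]; congr 3; funext i; fin_cases i <;> rfl
    · fin_cases i <;> simp [sq, h]
  | measure x q => exact Sim.measure _ _
  | mint q => exact Sim.mint hφ1 q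
  | verify x q => exact Sim.verify hV hr x q
  | submit x q y => exact Sim.submit hV hφ hφ1 hr x q y
  | seq P Q ihP ihQ =>
    refine Sim.congr fun s N h => ⟨_, _, ihP.comp ihQ, by rw [exec], fun t _ => by
      rw [compile, exec]⟩
  | ite x P Q ihP ihQ =>
    refine Sim.congr fun s N h => ?_
    by_cases hx : s.store x = 0
    · refine ⟨_, _, Sim.tick.comp ihP, ?_, fun t ht => ?_⟩
      · rw [exec, if_pos hx, Multiset.singleton_bind]
      · rw [compile, exec, if_pos (((h.rel t ht).store x).trans hx), Multiset.singleton_bind]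
    · refine ⟨_, _, Sim.tick.comp ihQ, ?_, fun t ht => ?_⟩
      · rw [exec, if_neg hx, Multiset.singleton_bind]
      · rw [compile, exec, if_neg (fun h0 => hx (((h.rel t ht).store x).symm.trans h0)),
          Multiset.singleton_bind]
  | loop x P ih =>
    refine Sim.congr fun s N h => ⟨_, _, Sim.tick.comp (ih.iterate (s.store x)), ?_,
      fun t ht => ?_⟩
    · rw [exec, Multiset.singleton_bind]
    · rw [compile, exec, Multiset.singleton_bind, (h.rel t ht).store x]
  | unitary k L U =>
    refine Sim.act (n := k) (L := fun _ i => L i) (L' := fun _ i => shiftLoc (L i))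
      (U := fun s => (U s : Matrix (Fin k → Bool) (Fin k → Bool) ℂ))
      (U' := fun t => (U fun y => t (vA y) : Matrix (Fin k → Bool) (Fin k → Bool) ℂ))
      (fun s => ?_) (fun t => ?_) (fun s t h i => rfl) (fun s t h => ?_) fun t => ?_
    · rw [exec]
    · rw [compile, exec]
      rfl
    · rw [show (fun y => t (vA y)) = s from funext h]
    · exact (U fun y => t (vA y)).2

end Compiler

/-! ### The winning probability of the reduction is a measurable function of the key -/

section Measurability

/-! ### Measurable dependence on the key -/

variable {X : Type} [MeasurableSpace X]

/-- A family of vectors with measurable coefficients and with a common finite support. -/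
def MeasVec (f : X → Vec) : Prop :=
  (∃ S : Finset Config, ∀ x, (f x).support ⊆ S) ∧ ∀ c, Measurable fun x => f x c

theorem MeasVec.zero : MeasVec fun _ : X => (0 : Vec) :=
  ⟨⟨∅, by simp⟩, fun c => by simp⟩

theorem MeasVec.add {f g : X → Vec} (hf : MeasVec f) (hg : MeasVec g) :
    MeasVec fun x => f x + g x := by
  classical
  obtain ⟨⟨S, hS⟩, hf⟩ := hf
  obtain ⟨⟨S', hS'⟩, hg⟩ := hg
  exact ⟨⟨S ∪ S', fun x => Finsupp.support_add.trans (Finset.union_subset_union (hS x) (hS' x))⟩,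
    fun c => by simp only [Finsupp.add_apply]; exact (hf c).add (hg c)⟩

theorem MeasVec.sum {κ : Type} (s : Finset κ) {f : κ → X → Vec} (h : ∀ i ∈ s, MeasVec (f i)) :
    MeasVec fun x => ∑ i ∈ s, f i x := by
  classical
  induction s using Finset.induction with
  | empty => simpa using MeasVec.zero
  | insert i s hi ih =>
    simp only [Finset.sum_insert hi]
    exact (h i (Finset.mem_insert_self _ _)).add
      (ih fun j hj => h j (Finset.mem_insert_of_mem hj))

theorem MeasVec.single (c : Config) {z : X → ℂ} (hz : Measurable z) :
    MeasVec fun x => (Finsupp.single c (z x) : Vec) := by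
  classical
  refine ⟨⟨{c}, fun x => Finsupp.support_single_subset⟩, fun c' => ?_⟩
  by_cases h : c = c'
  · simpa [h] using hz
  · simp [Finsupp.single_apply, h]

theorem MeasVec.applyOp {ι ι' : Type} [Fintype ι] [DecidableEq ι] [Fintype ι'] [DecidableEq ι']
    (Lin : ι → Loc) (Lout : ι' → Loc) {K : X → Matrix (ι' → Bool) (ι → Bool) ℂ}
    (hK : ∀ a b, Measurable fun x => K x a b) {f : X → Vec} (hf : MeasVec f) :
    MeasVec fun x => applyOp Lin Lout (K x) (f x) := by
  obtain ⟨⟨S, hS⟩, hf⟩ := hf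
  have h : ∀ x, QMoney.applyOp Lin Lout (K x) (f x) = ∑ c ∈ S, ∑ b,
      Finsupp.single (setBits Lout b (setBits Lin (fun _ => false) c))
        (K x b (getBits Lin c) * f x c) := by
    intro x
    have h1 : f x = ∑ c ∈ S, Finsupp.single c (f x c) := by
      conv_lhs => rw [← Finsupp.sum_single (f x)]
      rw [Finsupp.sum_of_support_subset _ (hS x)]
      simp
    have h2 : QMoney.applyOp Lin Lout (K x) (∑ c ∈ S, Finsupp.single c (f x c)) =
        ∑ c ∈ S, QMoney.applyOp Lin Lout (K x) (Finsupp.single c (f x c)) :=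
      map_sum (opMap Lin Lout (K x)) _ _
    conv_lhs => rw [h1]
    rw [h2]
    exact Finset.sum_congr rfl fun c _ => applyOp_single _ _ _ _ _
  simp only [h]
  exact MeasVec.sum _ fun c _ => MeasVec.sum _ fun b _ => MeasVec.single _ ((hK _ _).mul (hf c))

theorem MeasVec.filter (p : Config → Prop) [DecidablePred p] {f : X → Vec} (hf : MeasVec f) :
    MeasVec fun x => (f x).filter p := by
  obtain ⟨⟨S, hS⟩, hf⟩ := hf
  refine ⟨⟨S, fun x => ?_⟩, fun c => ?_⟩
  · rw [Finsupp.support_filter]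
    exact (Finset.filter_subset _ _).trans (hS x)
  by_cases h : p c
  · simpa [h] using hf c
  · simp [h]

theorem MeasVec.actMap {n : ℕ} (L : Fin n → Loc) (U : Matrix (Fin n → Bool) (Fin n → Bool) ℂ)
    {f : X → Vec} (hf : MeasVec f) : MeasVec fun x => actMap L U (f x) := by
  by_cases h : Function.Injective L
  · have e : (fun x => QMoney.actMap L U (f x)) = fun x => QMoney.applyOp L L U (f x) :=
      funext fun x => by rw [QMoney.actMap, if_pos h]; rfl
    rw [e]
    exact hf.applyOp L L (K := fun _ => U) (fun _ _ => measurable_const)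
  · have e : (fun x => QMoney.actMap L U (f x)) = f :=
      funext fun x => by rw [QMoney.actMap, if_neg h]; rfl
    rwa [e]

theorem MeasVec.normSq {f : X → Vec} (hf : MeasVec f) : Measurable fun x => normSq (f x) := by
  obtain ⟨⟨S, hS⟩, hf⟩ := hf
  simp only [fun x => normSq_eq_sum (hS x)]
  exact Finset.measurable_fun_sum _ fun c _ => (hf c).norm.pow_const 2

/-- A family of states with a constant classical part. -/
def MeasState (f : X → State) : Prop :=
  ∃ (s : State) (v : X → Vec), MeasVec v ∧ ∀ x, f x = { s with vec := v x }

/-- Preservation of measurability. -/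
def MeasExec (F : X → State → Multiset State) : Prop :=
  ∀ f, MeasState f → ∃ M : Multiset (X → State), (∀ g ∈ M, MeasState g) ∧
    ∀ x, F x (f x) = M.map fun g => g x

theorem MeasExec.id : MeasExec fun (_ : X) s => {s} := fun f hf =>
  ⟨{f}, by simpa using hf, fun x => by simp⟩

theorem MeasExec.comp {F G : X → State → Multiset State} (hF : MeasExec F) (hG : MeasExec G) :
    MeasExec fun x s => (F x s).bind (G x) := by
  classical
  intro f hf
  obtain ⟨M, h1, h2⟩ := hF f hf
  have h3 : ∀ g : X → State, ∃ M' : Multiset (X → State), MeasState g →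
      (∀ g' ∈ M', MeasState g') ∧ ∀ x, G x (g x) = M'.map fun g => g x := by
    intro g
    by_cases hg : MeasState g
    · obtain ⟨M', h⟩ := hG g hg
      exact ⟨M', fun _ => h⟩
    · exact ⟨0, fun h => absurd h hg⟩
  choose N hN using h3
  refine ⟨M.bind N, fun g' hg' => ?_, fun x => ?_⟩
  · obtain ⟨g, hg, hg'⟩ := Multiset.mem_bind.1 hg'
    exact (hN g (h1 g hg)).1 g' hg'
  · show (F x (f x)).bind (G x) = _
    rw [h2, Multiset.bind_map, Multiset.map_bind]
    exact Multiset.bind_congr fun g hg => (hN g (h1 g hg)).2 x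

theorem MeasExec.iterate {F : X → State → Multiset State} (hF : MeasExec F) (n : ℕ) :
    MeasExec fun x s => (fun M : Multiset State => M.bind (F x))^[n] {s} := by
  induction n with
  | zero => exact MeasExec.id
  | succ n ih =>
    simp only [Function.iterate_succ_apply']
    exact ih.comp hF

theorem MeasExec.congr {F : X → State → Multiset State} (h : ∀ s : State, ∃ G, MeasExec G ∧
    ∀ x v, F x { s with vec := v } = G x { s with vec := v }) : MeasExec F := by
  intro f hf
  obtain ⟨s, v, hv, hf'⟩ := hf
  obtain ⟨G, hG, e⟩ := h s
  obtain ⟨M, h1, h2⟩ := hG f ⟨s, v, hv, hf'⟩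
  refine ⟨M, h1, fun x => ?_⟩
  rw [← h2, hf', e]

theorem MeasExec.step {F : X → State → Multiset State} (h : ∀ s : State, ∃ (β : Type)
    (_ : Fintype β) (c : β → State) (w : β → X → Vec → Vec),
    (∀ o v, MeasVec v → MeasVec fun x => w o x (v x)) ∧
    ∀ x v, F x { s with vec := v } = Finset.univ.val.map fun o => { c o with vec := w o x v }) :
    MeasExec F := by
  rintro f ⟨s, v, hv, hf⟩
  obtain ⟨β, _, c, w, hw, hF⟩ := h s
  refine ⟨Finset.univ.val.map fun o x => { c o with vec := w o x (v x) }, fun g hg => ?_, fun x => ?_⟩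
  · obtain ⟨o, _, rfl⟩ := Multiset.mem_map.1 hg
    exact ⟨c o, _, hw o v hv, fun _ => rfl⟩
  · rw [hf, hF, Multiset.map_map]
    rfl

/-- Instructions that do not depend on the key and have a single outcome. -/
theorem MeasExec.det {F : X → State → Multiset State} (c : State → State) (w : State → Vec → Vec)
    (hw : ∀ s (v : X → Vec), MeasVec v → MeasVec fun x => w s (v x))
    (hF : ∀ x s v, F x { s with vec := v } = {{ c s with vec := w s v }}) : MeasExec F :=
  MeasExec.step fun s => ⟨Unit, inferInstance, fun _ => c s, fun _ _ => w s, fun _ v hv => hw s v hv,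
    fun x v => by rw [hF]; rfl⟩

variable {ℓ : ℕ} {V : X → Matrix (Fin ℓ → Bool) (Fin ℓ → Bool) ℂ} {φ : X → (Fin ℓ → Bool) → ℂ}

theorem measurable_copies (hφ : ∀ b, Measurable fun x => φ x b) {R : Type} [Fintype R]
    (b : R × Fin ℓ → Bool) : Measurable fun x => copies (φ x) b :=
  Finset.measurable_fun_prod _ fun _ _ => hφ _

theorem measurable_measureEach (hV : ∀ a b, Measurable fun x => V x a b) {R : Type} [Fintype R]
    (o : R → Bool) (a b : R × Fin ℓ → Bool) : Measurable fun x => measureEach (V x) o a b := by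
  refine Finset.measurable_fun_prod _ fun ρ _ => ?_
  by_cases h : o ρ = true
  · simpa [h] using hV _ _
  · simp only [h, Matrix.sub_apply]
    exact measurable_const.sub (hV _ _)

theorem MeasVec.prep {n : ℕ} (hφ : ∀ b, Measurable fun x => φ x b) (Lb Lf : Slots 1 n ℓ → Loc)
    {f : X → Vec} (hf : MeasVec f) : MeasVec fun x => prep Lb Lf (copies (φ x)) (f x) := by
  have h := hf.applyOp Lb Lf (K := fun _ => (1 : Matrix (Slots 1 n ℓ → Bool) (Slots 1 n ℓ → Bool) ℂ))
    (fun _ _ => measurable_const)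
  exact h.applyOp (Fin.elim0 : Fin 0 → Loc) Lb (K := fun x => colMatrix (copies (φ x)))
    fun b _ => (measurable_copies hφ b : _)

/-- The key enters only the amplitudes. Branches are indexed by outcomes from finite sets, their
classical parts are independent of the key, and amplitudes arise from those of coin and verification
by finitely many sums and products; branches of probability zero are kept, so the list of branches
does not vary with the key. -/
theorem measExec_exec (hV : ∀ a b, Measurable fun x => V x a b)
    (hφ : ∀ b, Measurable fun x => φ x b) (P : Prog) :
    MeasExec fun x => exec (privOracles (V x) (φ x)) P := by
  have tick : MeasExec fun (_ : X) s => {s.tick 1} :=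
    MeasExec.det (fun s => s.tick 1) (fun _ v => v) (fun _ _ h => h) fun _ _ _ => rfl
  have assign : ∀ (x : ℕ) (f : (ℕ → ℕ) → ℕ), MeasExec fun (_ : X) s =>
      {(s.assign x (f s.store)).tick 1} := fun x f =>
    MeasExec.det (fun s => (s.assign x (f s.store)).tick 1) (fun _ v => v) (fun _ _ h => h)
      fun _ _ _ => rfl
  have act : ∀ {n : ℕ} (L : State → Fin n → Loc) (U : (ℕ → ℕ) → Matrix (Fin n → Bool) (Fin n → Bool) ℂ),
      (∀ s v, L { s with vec := v } = L s) →
      MeasExec fun (_ : X) s => {(s.act (L s) (U s.store)).tick 1} := by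
    intro n L U hL
    refine MeasExec.det (fun s => s.tick 1) (fun s v => actMap (L s) (U s.store) v)
      (fun _ _ h => h.actMap _ _) fun _ s v => ?_
    rw [State.act_eq, hL]
    rfl
  induction P with
  | skip => simpa only [exec] using tick
  | const x c => simpa only [exec] using assign x fun _ => c
  | add x y z => simpa only [exec] using assign x fun σ => σ y + σ z
  | sub x y z => simpa only [exec] using assign x fun σ => σ y - σ z
  | compute x f => simpa only [exec] using assign x f
  | gate g q => simpa only [exec] using act (fun s => ![s.loc q]) (fun _ => g.matrix) fun _ _ => rfl
  | cnot q₁ q₂ =>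
    simpa only [exec] using act (fun s => ![s.loc q₁, s.loc q₂]) (fun _ => cnotMatrix) fun _ _ => rfl
  | toffoli q₁ q₂ q₃ =>
    simpa only [exec] using act (fun s => ![s.loc q₁, s.loc q₂, s.loc q₃]) (fun _ => toffoliMatrix)
      fun _ _ => rfl
  | rot q y z =>
    simpa only [exec] using act (fun s => ![s.loc q]) (fun σ => rotMatrix (σ y) (σ z)) fun _ _ => rfl
  | unitary k L U =>
    simpa only [exec] using act (fun _ i => Sum.inl (L i))
      (fun σ => (U σ : Matrix (Fin k → Bool) (Fin k → Bool) ℂ)) fun _ _ => rfl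
  | measure x q =>
    refine MeasExec.step fun s => ⟨Bool, inferInstance, fun b => (s.assign x b.toNat).tick 1,
      fun b _ v => v.filter fun c => decide (s.loc q ∈ c) = b, fun b v hv => hv.filter _,
      fun _ v => by rw [exec]; rfl⟩
  | mint q =>
    refine MeasExec.step fun s => ⟨Unit, inferInstance, fun _ => { s with
        time := s.time + (1 * ℓ + 1), queries := s.queries + 1, calls := s.calls + 1,
        minted := s.minted + 1 },
      fun _ x v => prep (s.block q 1 1 ℓ) (s.fresh 1 1 ℓ) (copies (φ x)) v,
      fun _ v hv => hv.prep hφ _ _, fun x v => ?_⟩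
    rw [exec, univ_val_map_eq_sum, Fintype.sum_unique]
    rfl
  | verify x q =>
    refine MeasExec.step fun s => ⟨Unit, inferInstance, fun _ => s.doVerify x q
        (⟨0, 1, 1⟩ : KrausOp 1 1 ℓ), fun _ _ v => applyOp (s.block q 1 1 ℓ) (s.fresh 1 1 ℓ)
        (1 : Matrix (Slots 1 1 ℓ → Bool) (Slots 1 1 ℓ → Bool) ℂ) v,
      fun _ v hv => hv.applyOp _ _ (K := fun _ => 1) (fun _ _ => measurable_const), fun _ v => ?_⟩
    rw [exec, univ_val_map_eq_sum, Fintype.sum_unique]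
    rfl
  | submit x q y =>
    refine MeasExec.step fun s => ⟨Fin (s.store y) × Fin 1 → Bool, inferInstance,
      fun a => s.doSubmit x q (s.store y) (⟨numTrue a, s.store y, 0⟩ : KrausOp (s.store y) 1 ℓ),
      fun a z v => applyOp (s.block q (s.store y) 1 ℓ) (s.fresh (s.store y) 1 ℓ)
        (measureEach (V z) a) v,
      fun a v hv => hv.applyOp _ _ fun _ _ => measurable_measureEach hV _ _ _, fun z v => ?_⟩
    rw [exec]
    simp only [privOracles, Multiset.map_map]
    rfl
  | seq P Q ihP ihQ => simpa only [exec] using ihP.comp ihQ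
  | ite x P Q ihP ihQ =>
    refine MeasExec.congr fun s => ?_
    by_cases h : s.store x = 0
    · exact ⟨_, tick.comp ihP, fun z v => by rw [exec, if_pos h, Multiset.singleton_bind]⟩
    · exact ⟨_, tick.comp ihQ, fun z v => by rw [exec, if_neg h, Multiset.singleton_bind]⟩
  | loop x P ih =>
    exact MeasExec.congr fun s => ⟨_, tick.comp (ih.iterate (s.store x)), fun z v => by
      rw [exec, Multiset.singleton_bind]⟩

theorem measurable_expectation (hV : ∀ a b, Measurable fun x => V x a b)
    (hφ : ∀ b, Measurable fun x => φ x b) (P : Prog) (σ : ℕ → ℕ) (u : State → ℝ)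
    (hu : ∀ s v, u { s with vec := v } = u s) :
    Measurable fun x => ((exec (privOracles (V x) (φ x)) P (State.start σ)).map
      fun s => s.prob * u s).sum := by
  obtain ⟨M, h1, h2⟩ := measExec_exec hV hφ P (fun _ => State.start σ)
    ⟨State.start σ, fun _ => Finsupp.single ∅ 1, MeasVec.single _ measurable_const, fun _ => rfl⟩
  simp only [h2, Multiset.map_map]
  clear h2
  induction M using Multiset.induction with
  | empty => simp
  | cons g M ih =>
    simp only [Multiset.map_cons, Multiset.sum_cons]
    refine Measurable.add ?_ (ih fun g hg => h1 g (Multiset.mem_cons_of_mem hg))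
    obtain ⟨s, v, hv, hg⟩ := h1 g (Multiset.mem_cons_self _ _)
    simp only [Function.comp_apply, hg, hu]
    exact hv.normSq.mul_const _

end Measurability

/-! ### Computing κ inside the reduction -/

section Renaming

/-! ### Classical computations on renamed variables -/

/-- From the store `σ`, the program only changes the store to `σ'`, in exactly `τ` steps. -/
def Computes (P : Prog) (σ σ' : ℕ → ℕ) (τ : ℕ) : Prop :=
  ∀ (r ℓ : ℕ) (O : Oracles r ℓ) (s : State), s.store = σ →
    exec O P s = {{ s with store := σ', time := s.time + τ }}

namespace Computes

variable {P P' : Prog} {σ σ' σ'' : ℕ → ℕ} {τ τ' : ℕ}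

theorem seq (h : Computes P σ σ' τ) (h' : Computes P' σ' σ'' τ') :
    Computes (.seq P P') σ σ'' (τ + τ') := fun _ _ O s hs => by
  rw [exec, h _ _ O s hs, Multiset.singleton_bind, h' _ _ O _ rfl, add_assoc]

theorem skip (σ : ℕ → ℕ) : Computes .skip σ σ 1 := fun _ _ O s hs => by subst hs; rfl

theorem const (x c : ℕ) (σ : ℕ → ℕ) : Computes (.const x c) σ (Function.update σ x c) 1 :=
  fun _ _ O s hs => by subst hs; rfl

theorem add (x y z : ℕ) (σ : ℕ → ℕ) :
    Computes (.add x y z) σ (Function.update σ x (σ y + σ z)) 1 := fun _ _ O s hs => by subst hs; rfl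

theorem sub (x y z : ℕ) (σ : ℕ → ℕ) :
    Computes (.sub x y z) σ (Function.update σ x (σ y - σ z)) 1 := fun _ _ O s hs => by subst hs; rfl

theorem ite_zero {x : ℕ} (hx : σ x = 0) (h : Computes P σ σ' τ) :
    Computes (.ite x P P') σ σ' (1 + τ) := fun _ _ O s hs => by
  rw [exec, if_pos (by rw [hs, hx]), h _ _ O (s.tick 1) hs, ← add_assoc]
  rfl

theorem ite_ne {x : ℕ} (hx : σ x ≠ 0) (h : Computes P' σ σ' τ) :
    Computes (.ite x P P') σ σ' (1 + τ) := fun _ _ O s hs => by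
  rw [exec, if_neg (by rwa [hs]), h _ _ O (s.tick 1) hs, ← add_assoc]
  rfl

theorem loop {c : (ℕ → ℕ) → ℕ → ℕ} {e : (ℕ → ℕ) → ℕ} (h : ∀ σ, Computes P σ (c σ) (e σ)) (x : ℕ)
    (σ : ℕ → ℕ) : Computes (.loop x P) σ (c^[σ x] σ)
      (1 + ∑ i ∈ Finset.range (σ x), e (c^[i] σ)) := fun _ _ O s hs => by
  rw [exec, hs]
  generalize σ x = n
  induction n with
  | zero => subst hs; rfl
  | succ n ih =>
    rw [Function.iterate_succ_apply', ih, Multiset.singleton_bind, h _ _ _ O _ rfl,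
      Function.iterate_succ_apply', Finset.sum_range_succ]
    simp only [add_assoc]

end Computes

/-- A classical program, run on a private set of variables. -/
def rename : Prog → Prog
  | .const x c => .const (vP x) c
  | .add x y z => .add (vP x) (vP y) (vP z)
  | .sub x y z => .sub (vP x) (vP y) (vP z)
  | .seq P Q => .seq (rename P) (rename Q)
  | .ite x P Q => .ite (vP x) (rename P) (rename Q)
  | .loop x P => .loop (vP x) (rename P)
  | _ => .skip

theorem rename_elementary (P : Prog) : (rename P).Elementary := by
  induction P with
  | seq P Q hP hQ => exact ⟨hP, hQ⟩
  | ite x P Q hP hQ => exact ⟨hP, hQ⟩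
  | loop x P hP => exact hP
  | _ => trivial

/-- Replace the values of the private variables. -/
def withPriv (ρ σ : ℕ → ℕ) : ℕ → ℕ := Function.extend vP ρ σ

theorem withPriv_vP (ρ σ : ℕ → ℕ) (x : ℕ) : withPriv ρ σ (vP x) = ρ x := vP_injective.extend_apply _ _ _

theorem withPriv_of_ne (ρ σ : ℕ → ℕ) {y : ℕ} (h : ∀ x, vP x ≠ y) : withPriv ρ σ y = σ y :=
  Function.extend_apply' _ _ _ fun ⟨x, hx⟩ => h x hx

theorem withPriv_comp (ρ σ : ℕ → ℕ) : withPriv ρ σ ∘ vP = ρ := funext (withPriv_vP ρ σ)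

theorem withPriv_withPriv (ρ ρ' σ : ℕ → ℕ) : withPriv ρ (withPriv ρ' σ) = withPriv ρ σ := by
  ext y
  by_cases h : ∃ x, vP x = y
  · obtain ⟨x, rfl⟩ := h
    rw [withPriv_vP, withPriv_vP]
  · push Not at h
    rw [withPriv_of_ne _ _ h, withPriv_of_ne _ _ h, withPriv_of_ne _ _ h]

theorem withPriv_self (σ : ℕ → ℕ) : withPriv (σ ∘ vP) σ = σ := by
  ext y
  by_cases h : ∃ x, vP x = y
  · obtain ⟨x, rfl⟩ := h
    rw [withPriv_vP]; rfl
  · push Not at h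
    rw [withPriv_of_ne _ _ h]

theorem withPriv_update (σ : ℕ → ℕ) (x c : ℕ) :
    withPriv (Function.update (σ ∘ vP) x c) σ = Function.update σ (vP x) c := by
  ext y
  by_cases h : ∃ x, vP x = y
  · obtain ⟨z, rfl⟩ := h
    rw [withPriv_vP]
    by_cases hz : z = x
    · subst hz; simp
    · rw [Function.update_of_ne hz, Function.update_of_ne (vP_injective.ne hz)]; rfl
  · push Not at h
    rw [withPriv_of_ne _ _ h, Function.update_of_ne (h x).symm]

/-- Classical programs are deterministic, so they have a result `c` and a running time `e` that
depend on the variables only. The renamed program computes the same on its private variables, in the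
same time, and leaves all other variables untouched. -/
theorem exists_computes {P : Prog} (hP : P.Classical) : ∃ (c : (ℕ → ℕ) → ℕ → ℕ)
    (e : (ℕ → ℕ) → ℕ), (∀ σ, Computes P σ (c σ) (e σ)) ∧
      ∀ σ, Computes (rename P) σ (withPriv (c (σ ∘ vP)) σ) (e (σ ∘ vP)) := by
  induction P with
  | skip => exact ⟨fun σ => σ, fun _ => 1, Computes.skip, fun σ => by
      rw [withPriv_self]; exact Computes.skip σ⟩
  | const x a => exact ⟨_, _, Computes.const x a, fun σ => by
      rw [withPriv_update]; exact Computes.const _ _ _⟩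
  | add x y z => exact ⟨_, _, Computes.add x y z, fun σ => by
      rw [withPriv_update]; exact Computes.add _ _ _ _⟩
  | sub x y z => exact ⟨_, _, Computes.sub x y z, fun σ => by
      rw [withPriv_update]; exact Computes.sub _ _ _ _⟩
  | seq P Q ihP ihQ =>
    obtain ⟨c, e, h, h'⟩ := ihP hP.1
    obtain ⟨d, f, k, k'⟩ := ihQ hP.2
    refine ⟨fun σ => d (c σ), fun σ => e σ + f (c σ), fun σ => (h σ).seq (k _), fun σ => ?_⟩
    have := (h' σ).seq (k' _)
    rwa [withPriv_comp, withPriv_withPriv] at this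
  | ite x P Q ihP ihQ =>
    obtain ⟨c, e, h, h'⟩ := ihP hP.1
    obtain ⟨d, f, k, k'⟩ := ihQ hP.2
    refine ⟨fun σ => if σ x = 0 then c σ else d σ, fun σ => 1 + if σ x = 0 then e σ else f σ,
      fun σ => ?_, fun σ => ?_⟩
    · by_cases hx : σ x = 0
      · simpa only [if_pos hx] using (h σ).ite_zero hx
      · simpa only [if_neg hx] using (k σ).ite_ne hx
    · by_cases hx : σ (vP x) = 0
      · simpa only [rename, Function.comp_apply, if_pos hx] using (h' σ).ite_zero hx
      · simpa only [rename, Function.comp_apply, if_neg hx] using (k' σ).ite_ne hx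
  | loop x P ih =>
    obtain ⟨c, e, h, h'⟩ := ih hP
    refine ⟨_, _, Computes.loop h x, fun σ => ?_⟩
    have key : ∀ i, (fun σ => withPriv (c (σ ∘ vP)) σ)^[i] σ = withPriv (c^[i] (σ ∘ vP)) σ := by
      intro i
      induction i with
      | zero => exact (withPriv_self σ).symm
      | succ i ih =>
        rw [Function.iterate_succ_apply', ih, Function.iterate_succ_apply', withPriv_comp,
          withPriv_withPriv]
    have := Computes.loop h' (vP x) σ
    simp only [key, withPriv_comp] at this
    exact this
  | _ => exact hP.elim

/-! ### The preparation of the simulation -/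

/-- The program `I` computes `r` and prepares the inputs of the simulated program. -/
def Initializes (I : Prog) (r ℓ n T : ℕ) : Prop :=
  ∀ σ : ℕ → ℕ, σ 0 = n → σ 1 = 1 → σ 2 = ℓ → (∀ x, 3 ≤ x → σ x = 0) →
    ∃ σ' τ, Computes I σ σ' τ ∧ τ ≤ T ∧ σ' 1 = 1 ∧ σ' 2 = ℓ ∧ σ' 3 = r ∧ σ' 4 = 0 ∧
      σ' (vA 0) = n ∧ σ' (vA 1) = r ∧ σ' (vA 2) = ℓ ∧ ∀ x, 3 ≤ x → σ' (vA x) = 0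

/-- Adding variable 4, the constant zero, is copying: the security parameter, the number of
registers and the number of qubits go to the simulated inputs. -/
def inputP : Prog := .seq (.add (vA 0) 0 4) (.seq (.add (vA 1) 3 4) (.add (vA 2) 2 4))

theorem computes_inputP {σ : ℕ → ℕ} {r ℓ n : ℕ} (h0 : σ 0 = n) (h1 : σ 1 = 1) (h2 : σ 2 = ℓ)
    (h3 : σ 3 = r) (h4 : σ 4 = 0) (hA : ∀ x, σ (vA x) = 0) :
    ∃ σ', Computes inputP σ σ' 3 ∧ σ' 1 = 1 ∧ σ' 2 = ℓ ∧ σ' 3 = r ∧ σ' 4 = 0 ∧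
      σ' (vA 0) = n ∧ σ' (vA 1) = r ∧ σ' (vA 2) = ℓ ∧ ∀ x, 3 ≤ x → σ' (vA x) = 0 := by
  refine ⟨_, (Computes.add _ _ _ _).seq ((Computes.add _ _ _ _).seq (Computes.add _ _ _ _)),
    ?_, ?_, ?_, ?_, ?_, ?_, ?_, fun x hx => ?_⟩
  · simp [vA, h1]
  · simp [vA, h2]
  · simp [vA, h3]
  · simp [vA, h4]
  · simp [vA, h0, h4]
  · simp [vA, h3, h4]
  · simp [vA, h2, h4]
  · rw [Function.update_of_ne (vA_injective.ne (by omega)),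
      Function.update_of_ne (vA_injective.ne (by omega)),
      Function.update_of_ne (vA_injective.ne (by omega)), hA]

/-- The number of registers is a constant of the program. This is admissible for unbounded
adversaries, whose program may vary with the security parameter. -/
def constInit (r : ℕ) : Prog := .seq (.const 3 r) inputP

theorem initializes_constInit (r ℓ n : ℕ) : Initializes (constInit r) r ℓ n 4 := by
  intro σ h0 h1 h2 h3
  obtain ⟨σ', h, h'⟩ := computes_inputP (σ := Function.update σ 3 r) (r := r) (ℓ := ℓ) (n := n)
    (by simp [h0]) (by simp [h1]) (by simp [h2]) (by simp) (by simp [h3])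
    (fun x => by rw [Function.update_of_ne (by have := vA_ge x; omega), h3 _ (by have := vA_ge x; omega)])
  exact ⟨σ', _, (Computes.const 3 r σ).seq h, le_rfl, h'⟩

/-- The uniform variant: the program for κ runs on its private variables, all initially zero except
for the argument, and its result becomes variable 3. -/
def computedInit (P : Prog) : Prog :=
  .seq (.add (vP 0) 0 4) (.seq (rename P) (.seq (.add 3 (vP 0) 4) inputP))

theorem computedInit_elementary (P : Prog) : (computedInit P).Elementary :=
  ⟨trivial, rename_elementary P, trivial, trivial, trivial, trivial⟩

theorem initializes_computedInit {P : Prog} (hP : P.Classical) {r ℓ n T : ℕ}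
    (h : ∀ (r' ℓ' : ℕ) (O : Oracles r' ℓ'),
      ∀ s ∈ exec O P (State.start (Function.update 0 0 n)), s.store 0 = r ∧ s.time ≤ T) :
    Initializes (computedInit P) r ℓ n (T + 5) := by
  intro σ h0 h1 h2 h3
  obtain ⟨c, e, hc, hc'⟩ := exists_computes hP
  have hn4 : n + σ 4 = n := by rw [h3 4 (by norm_num)]; rfl
  -- The oracles are irrelevant to a classical program, so trivial ones suffice for reading off
  -- result and running time.
  obtain ⟨hr, ht⟩ := h 0 0 ⟨0, fun _ => 0, 0⟩ _ (by
    rw [hc (Function.update 0 0 n) _ _ _ _ rfl]; exact Multiset.mem_singleton_self _)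
  have ht : e (Function.update 0 0 n) ≤ T := by simpa [State.start] using ht
  simp only at hr
  set σ₁ := Function.update σ (vP 0) (σ 0 + σ 4) with hσ₁
  have hpriv : σ₁ ∘ vP = Function.update (0 : ℕ → ℕ) 0 n := by
    ext x
    by_cases hx : x = 0
    · subst hx; simp [hσ₁, h0, hn4]
    · rw [Function.update_of_ne hx, Function.comp_apply, hσ₁,
        Function.update_of_ne (vP_injective.ne hx), h3 _ (by have := vP_ge x; omega)]
      rfl
  have hk := hc' σ₁
  rw [hpriv] at hk
  set σ₂ := withPriv (c (Function.update 0 0 n)) σ₁ with hσ₂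
  have hlow : ∀ y < 20, σ₂ y = σ y := fun y hy => by
    rw [hσ₂, withPriv_of_ne _ _ fun x => by have := vP_ge x; omega, hσ₁,
      Function.update_of_ne (by have := vP_ge 0; omega)]
  have hA : ∀ x, σ₂ (vA x) = 0 := fun x => by
    rw [hσ₂, withPriv_of_ne _ _ fun y => (vA_ne_vP x y).symm, hσ₁,
      Function.update_of_ne (vA_ne_vP x 0), h3 _ (by have := vA_ge x; omega)]
  have h4 : σ₂ 4 = 0 := by rw [hlow 4 (by norm_num), h3 4 (by norm_num)]
  have hP0 : σ₂ (vP 0) = r := by rw [hσ₂, withPriv_vP, hr]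
  obtain ⟨σ', h5, h6⟩ := computes_inputP (σ := Function.update σ₂ 3 (σ₂ (vP 0) + σ₂ 4)) (r := r)
    (ℓ := ℓ) (n := n) (by simp [hlow, h0]) (by simp [hlow, h1]) (by simp [hlow, h2])
    (by simp [hP0, h4]) (by simp [h4])
    (fun x => by rw [Function.update_of_ne (by have := vA_ge x; omega), hA])
  exact ⟨σ', _, (Computes.add _ _ _ σ).seq (hk.seq ((Computes.add _ _ _ _).seq h5)), by omega, h6⟩

end Renaming

/-! ### The coupling of both games and the comparison of utilities, for a fixed key -/

section Reduction

/-! ### The reduction for a fixed key -/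

/-- The adversary against the private scheme: prepare the inputs, then simulate `A`. -/
def reduction (I A : Prog) : Prog := .seq I (.ite 3 .skip (compile A))

theorem reduction_elementary {I A : Prog} (hI : I.Elementary) (hA : A.Elementary) :
    (reduction I A).Elementary := ⟨hI, trivial, compile_elementary hA⟩

theorem State.prob_nonneg (s : State) : 0 ≤ s.prob := normSq_nonneg _

theorem State.prob_start (σ : ℕ → ℕ) : (State.start σ).prob = 1 := by
  simp [State.prob, State.start, normSq]

theorem gram_single (a b : Finset (ℕ × ℕ)) (p : Prop) [Decidable p] (h : p ↔ ∅ = a ∧ ∅ = b) :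
    gram (Finsupp.single ∅ 1) a b = if p then 1 else 0 := by
  classical
  rw [gram, sesq_single]
  simp [h, show (∅ : Config).toLeft = ∅ from rfl]

/-- By Pythagoras the component (1 - V)φ has norm zero. Perfect completeness thus says that V fixes
the coin. -/
theorem mulVec_eq_self_of_norm {ι : Type} [Fintype ι] [DecidableEq ι] {V : Matrix ι ι ℂ}
    (hV : IsStarProjection V) {φ : ι → ℂ} (h : nsq (V.mulVec φ) = nsq φ) : V.mulVec φ = φ := by
  have h1 : V.conjTranspose = V := hV.isSelfAdjoint
  have h2 : V * V = V := hV.isIdempotentElem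
  have h3 : (1 - V).conjTranspose = 1 - V := by
    rw [Matrix.conjTranspose_sub, Matrix.conjTranspose_one, h1]
  have h4 : (1 - V) * (1 - V) = 1 - V := by
    rw [Matrix.mul_sub, Matrix.sub_mul, Matrix.sub_mul, h2]; simp
  have e1 := nsq_mulVec_proj h1 h2 φ
  have e2 := nsq_mulVec_proj h3 h4 φ
  have e3 : (nsq ((1 - V).mulVec φ) : ℂ) = 0 := by
    rw [e2, Matrix.sub_mulVec, Matrix.one_mulVec, dotProduct_sub, ← e1, ← nsq_eq_dot, h, sub_self]
  have e4 : nsq ((1 - V).mulVec φ) = 0 := by exact_mod_cast e3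
  rw [nsq, Finset.sum_eq_zero_iff_of_nonneg fun _ _ => by positivity] at e4
  ext b
  have e5 := e4 b (Finset.mem_univ b)
  rw [sq_eq_zero_iff, norm_eq_zero, Matrix.sub_mulVec, Matrix.one_mulVec, Pi.sub_apply,
    sub_eq_zero] at e5
  exact e5.symm

variable {r ℓ n T : ℕ} {V : Matrix (Fin ℓ → Bool) (Fin ℓ → Bool) ℂ} {φ : (Fin ℓ → Bool) → ℂ}
  {I A : Prog} {σA σP : ℕ → ℕ}

/-- The inputs of an adversary. -/
structure IsInput (n r ℓ : ℕ) (σ : ℕ → ℕ) : Prop where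
  param : σ 0 = n
  regs : σ 1 = r
  qubits : σ 2 = ℓ
  rest : ∀ x, 3 ≤ x → σ x = 0

theorem exec_reduction (hI : Initializes I r ℓ n T) (hA : IsInput n r ℓ σA) (hP : IsInput n 1 ℓ σP)
    (hr : 0 < r) : ∃ t, Rep r ℓ (T + 1) (State.start σA) {t} ∧ potential r (State.start σA) t = 0 ∧
      t.prob = 1 ∧
      exec (privOracles V φ) (reduction I A) (State.start σP) =
        exec (privOracles V φ) (compile A) t := by
  obtain ⟨σ', τ, hc, hτ, h1, h2, h3, h4, hA0, hA1, hA2, hA3⟩ :=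
    hI σP hP.param hP.regs hP.qubits hP.rest
  have hsupp : Supp (fun c => c = ∅) (Finsupp.single ∅ 1 : Vec) :=
    Supp.single (p := fun c => c = ∅) rfl 1
  refine ⟨({ State.start σP with store := σ', time := 0 + τ } : State).tick 1, ⟨⟨?_, le_rfl, le_rfl⟩,
    ?_, ?_⟩, ?_, State.prob_start σP, ?_⟩
  · intro c hc
    rw [hsupp c hc]
    intro e he
    simp at he
  · intro t ht
    rw [Multiset.mem_singleton] at ht
    subst ht
    refine ⟨fun x => ?_, h1, h2, h3, h4, ?_, ?_, ?_, ?_, ?_⟩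
    · show σ' (vA x) = σA x
      match x with
      | 0 => rw [hA0, hA.param]
      | 1 => rw [hA1, hA.regs]
      | 2 => rw [hA2, hA.qubits]
      | x + 3 => rw [hA3 _ (by omega), hA.rest _ (by omega)]
    · intro c hc
      rw [hsupp c hc]
      intro b _ x
      simp
    · intro c hc
      rw [hsupp c hc]
      intro e he
      simp at he
    · simp only [State.tick]
      omega
    · simp [State.tick, State.start]
    · simp [State.tick, State.start, State.flexible]
  · rw [Multiset.map_singleton, Multiset.sum_singleton]
    ext a b
    simp only [State.tick, State.start, simGram]
    rw [gram_single a b (∅ = a ∧ ∅ = b) Iff.rfl,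
      gram_single (a.map shiftLoc) (b.map shiftLoc) (∅ = a ∧ ∅ = b)]
    rw [eq_comm (a := ∅) (b := a.map _), eq_comm (a := ∅) (b := b.map _), Finset.map_eq_empty,
      Finset.map_eq_empty, eq_comm (a := a), eq_comm (a := b)]
  · simp [potential, State.tick, State.start, State.flexible, State.allOrNothing, State.total]
  · rw [reduction, exec, hc _ _ _ _ rfl, Multiset.singleton_bind, exec, if_neg]
    · rfl
    · show σ' 3 ≠ 0
      omega

/-- The simulation needs at least one register for each coin, but bounds on time and queries must
hold for every security parameter. If κ vanishes, the reduction stops after the preparation. -/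
theorem exec_reduction_zero (hI : Initializes I 0 ℓ n T) (hP : IsInput n 1 ℓ σP) :
    ∀ t ∈ exec (privOracles V φ) (reduction I A) (State.start σP),
      t.time ≤ T + 2 ∧ t.queries = 0 := by
  obtain ⟨σ', τ, hc, hτ, h1, h2, h3, h4, -⟩ := hI σP hP.param hP.regs hP.qubits hP.rest
  intro t ht
  rw [reduction, exec, hc _ _ _ _ rfl, Multiset.singleton_bind, exec, if_pos h3, exec,
    Multiset.mem_singleton] at ht
  subst ht
  exact ⟨by show 0 + τ + 1 + 1 ≤ T + 2; omega, rfl⟩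

theorem exists_coupling (hV : IsStarProjection V) (hφ : V.mulVec φ = φ) (hφ1 : nsq φ = 1)
    (hr : 0 < r) (hI : Initializes I r ℓ n T) (hA : IsInput n r ℓ σA) (hP : IsInput n 1 ℓ σP) :
    ∃ Λ : Multiset (State × Multiset State),
      Λ.map Prod.fst = exec (pubOracles r V φ) A (State.start σA) ∧
      Λ.bind Prod.snd = exec (privOracles V φ) (reduction I A) (State.start σP) ∧
      (∀ p ∈ Λ, Rep r ℓ (T + 1) p.1 p.2) ∧
      (Λ.map fun p => (p.2.map State.prob).sum).sum = 1 ∧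
      0 ≤ (Λ.map fun p => (p.2.map (potential r p.1)).sum).sum := by
  obtain ⟨t, h1, h2, h3, h4⟩ := exec_reduction (V := V) (φ := φ) (A := A) hI hA hP hr
  obtain ⟨Λ, a, b, c, d, e⟩ := sim_compile hV hφ hφ1 hr A _ _ h1
  refine ⟨Λ, a, ?_, c, ?_, ?_⟩
  · rw [b, h4, Multiset.singleton_bind]
  · rw [d, Multiset.map_singleton, Multiset.sum_singleton, h3]
  · rwa [Multiset.map_singleton, Multiset.sum_singleton, h2] at e

/-- Bounds on the adversary are only assumed for branches of nonzero probability. The probabilities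
of the representing branches add up to that of the represented one, so a possible branch never
represents an impossible one. -/
theorem Rep.vec_ne_zero {s : State} {N : Multiset State} (h : Rep r ℓ T s N) {t : State} (ht : t ∈ N)
    (hv : t.vec ≠ 0) : s.vec ≠ 0 := by
  intro hs
  have h1 := h.prob
  have h2 : s.prob = 0 := by rw [State.prob, hs, normSq_zero]
  have h3 : t.prob ≤ (N.map State.prob).sum :=
    Multiset.single_le_sum (fun x hx => by
      obtain ⟨u, _, rfl⟩ := Multiset.mem_map.1 hx
      exact u.prob_nonneg) _ (Multiset.mem_map_of_mem _ ht)
  have h4 : 0 < t.prob := normSq_pos hv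
  linarith

theorem exists_simulated (hV : IsStarProjection V) (hφ : V.mulVec φ = φ) (hφ1 : nsq φ = 1)
    (hr : 0 < r) (hI : Initializes I r ℓ n T) (hA : IsInput n r ℓ σA) (hP : IsInput n 1 ℓ σP)
    {t : State} (ht : t ∈ exec (privOracles V φ) (reduction I A) (State.start σP))
    (hv : t.vec ≠ 0) : ∃ s ∈ exec (pubOracles r V φ) A (State.start σA), s.vec ≠ 0 ∧
      SimRel r ℓ (T + 1) s t := by
  obtain ⟨Λ, a, b, c, -⟩ := exists_coupling (A := A) hV hφ hφ1 hr hI hA hP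
  rw [← b] at ht
  obtain ⟨p, hp, hpt⟩ := Multiset.mem_bind.1 ht
  exact ⟨p.1, a ▸ Multiset.mem_map_of_mem _ hp, (c p hp).vec_ne_zero hpt hv, (c p hp).rel t hpt⟩

theorem reduction_time (hV : IsStarProjection V) (hφ : V.mulVec φ = φ) (hφ1 : nsq φ = 1)
    (hI : Initializes I r ℓ n T) (hA : IsInput n r ℓ σA) (hP : IsInput n 1 ℓ σP) {τ : ℕ}
    (h : ∀ s ∈ exec (pubOracles r V φ) A (State.start σA), s.vec ≠ 0 → s.time ≤ τ) :
    ∀ t ∈ exec (privOracles V φ) (reduction I A) (State.start σP), t.vec ≠ 0 →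
      t.time ≤ T + 2 + τ * stepBound r τ := by
  intro t ht hv
  rcases Nat.eq_zero_or_pos r with rfl | hr
  · exact (exec_reduction_zero hI hP t ht).1.trans (Nat.le_add_right _ _)
  · obtain ⟨s, hs, hsv, hst⟩ := exists_simulated hV hφ hφ1 hr hI hA hP ht hv
    have h1 := h s hs hsv
    have h2 := hst.time
    have h3 := Nat.mul_le_mul h1 (stepBound_mono r h1)
    omega

theorem reduction_queries (hV : IsStarProjection V) (hφ : V.mulVec φ = φ) (hφ1 : nsq φ = 1)
    (hI : Initializes I r ℓ n T) (hA : IsInput n r ℓ σA) (hP : IsInput n 1 ℓ σP) {q : ℕ}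
    (h : ∀ s ∈ exec (pubOracles r V φ) A (State.start σA), s.vec ≠ 0 → s.queries ≤ q) :
    ∀ t ∈ exec (privOracles V φ) (reduction I A) (State.start σP), t.vec ≠ 0 →
      t.queries ≤ 3 * (r + 1) * q := by
  intro t ht hv
  rcases Nat.eq_zero_or_pos r with rfl | hr
  · exact (exec_reduction_zero hI hP t ht).2.trans_le (Nat.zero_le _)
  · obtain ⟨s, hs, hsv, hst⟩ := exists_simulated hV hφ hφ1 hr hI hA hP ht hv
    exact hst.queries.trans (Nat.mul_le_mul_left _ (h s hs hsv))

/-- Every query costs at least one step. This is part of the invariant `Regular`, which the coupling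
provides for all branches of the simulated run. -/
theorem queries_le_of_time (hV : IsStarProjection V) (hφ : V.mulVec φ = φ) (hφ1 : nsq φ = 1)
    (hr : 0 < r) (hI : Initializes I r ℓ n T) (hA : IsInput n r ℓ σA) (hP : IsInput n 1 ℓ σP) {τ : ℕ}
    (h : ∀ s ∈ exec (pubOracles r V φ) A (State.start σA), s.vec ≠ 0 → s.time ≤ τ) :
    ∀ s ∈ exec (pubOracles r V φ) A (State.start σA), s.vec ≠ 0 → s.queries ≤ τ := by
  obtain ⟨Λ, a, b, c, -⟩ := exists_coupling (A := A) hV hφ hφ1 hr hI hA hP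
  intro s hs hv
  have hs' := hs
  rw [← a] at hs'
  obtain ⟨p, hp, rfl⟩ := Multiset.mem_map.1 hs'
  exact (c p hp).regular.queries.trans (h _ hs hv)

theorem sum_prob_reduction (hV : IsStarProjection V) (hφ : V.mulVec φ = φ) (hφ1 : nsq φ = 1)
    (hr : 0 < r) (hI : Initializes I r ℓ n T) (hA : IsInput n r ℓ σA) (hP : IsInput n 1 ℓ σP) :
    ((exec (privOracles V φ) (reduction I A) (State.start σP)).map State.prob).sum = 1 := by
  obtain ⟨Λ, a, b, c, d, -⟩ := exists_coupling (A := A) hV hφ hφ1 hr hI hA hP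
  rw [← b, Multiset.map_bind, Multiset.sum_bind, d]

-- The expected potential starts at zero and does not decrease, which gives r·E[U_aon] ≤ E[U_flex] +
-- r·(1/2)^r·q. A positive flexible utility is bounded by the number of queries of the reduction,
-- hence its expectation by that bound times the probability of a positive value.
open Classical in
theorem allOrNothing_le_reduction (hV : IsStarProjection V) (hφ : V.mulVec φ = φ)
    (hφ1 : nsq φ = 1) (hr : 0 < r) (hI : Initializes I r ℓ n T) (hA : IsInput n r ℓ σA)
    (hP : IsInput n 1 ℓ σP) {q : ℕ}
    (h : ∀ s ∈ exec (pubOracles r V φ) A (State.start σA), s.vec ≠ 0 → s.queries ≤ q) :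
    ((exec (pubOracles r V φ) A (State.start σA)).map fun s => s.prob * s.allOrNothing).sum ≤
      6 * q * ((exec (privOracles V φ) (reduction I A) (State.start σP)).map fun t =>
        t.prob * if 0 < t.flexible then 1 else 0).sum + (1 / 2) ^ r * q := by
  obtain ⟨Λ, a, b, c, d, e⟩ := exists_coupling (A := A) hV hφ hφ1 hr hI hA hP
  have hr' : (1 : ℝ) ≤ r := by exact_mod_cast hr
  -- The estimate for the representatives of a single branch; their total probability is that of the
  -- branch, on which the utility of the adversary is constant.
  have key : ∀ p ∈ Λ, (p.2.map (potential r p.1)).sum ≤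
      3 * (r + 1) * q * (p.2.map fun t => t.prob * if 0 < t.flexible then (1 : ℝ) else 0).sum +
      (r * (1 / 2) ^ r * q * (p.2.map State.prob).sum - r * (p.1.prob * p.1.allOrNothing)) := by
    intro p hp
    have hR := c p hp
    rw [← hR.prob]
    have hle : ∀ t ∈ p.2, potential r p.1 t ≤
        3 * (r + 1) * q * (t.prob * if 0 < t.flexible then (1 : ℝ) else 0) +
          (r * (1 / 2) ^ r * q - r * p.1.allOrNothing) * t.prob := by
      intro t ht
      by_cases hv : t.vec = 0
      · have : t.prob = 0 := by rw [State.prob, hv, normSq_zero]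
        simp [potential, this]
      · have hq := h p.1 (a ▸ Multiset.mem_map_of_mem _ hp) (hR.vec_ne_zero ht hv)
        have h1 : (p.1.total : ℝ) ≤ q := by exact_mod_cast hR.regular.total.trans hq
        -- The flexible utility is at most the number of queries of the reduction, and 3(r + 1) such
        -- queries are made at most for each query of the adversary; a utility that is not positive
        -- is bounded by zero.
        have h2 : t.flexible ≤ 3 * (r + 1) * q * if 0 < t.flexible then (1 : ℝ) else 0 := by
          split_ifs with hf
          · have h3 : (t.queries : ℝ) ≤ 3 * (r + 1) * q := by
              exact_mod_cast (hR.rel t ht).queries.trans (Nat.mul_le_mul_left _ hq)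
            rw [mul_one]
            exact (hR.rel t ht).flexible.trans h3
          · rw [mul_zero]; exact not_lt.1 hf
        have h3 : (r : ℝ) * (1 / 2) ^ r * p.1.total ≤ r * (1 / 2) ^ r * q := by gcongr
        have h4 := mul_le_mul_of_nonneg_left (add_le_add h2 h3) t.prob_nonneg
        rw [potential]
        nlinarith [h4]
    refine (Multiset.sum_map_le_sum_map _ _ hle).trans_eq ?_
    rw [Multiset.sum_map_add, Multiset.sum_map_mul_left, Multiset.sum_map_mul_left]
    ring
  have h1 := e.trans (Multiset.sum_map_le_sum_map _ _ key)
  rw [Multiset.sum_map_add, Multiset.sum_map_sub, Multiset.sum_map_mul_left,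
    Multiset.sum_map_mul_left, Multiset.sum_map_mul_left, d] at h1
  rw [← a, ← b, Multiset.map_bind, Multiset.sum_bind, Multiset.map_map]
  simp only [Function.comp_def]
  set G := (Λ.map fun p => (p.2.map fun t => t.prob * if 0 < t.flexible then (1 : ℝ) else 0).sum).sum
  set E := (Λ.map fun p => p.1.prob * p.1.allOrNothing).sum
  have hG : 0 ≤ G := Multiset.sum_nonneg fun x hx => by
    obtain ⟨p, _, rfl⟩ := Multiset.mem_map.1 hx
    refine Multiset.sum_nonneg fun y hy => ?_
    obtain ⟨t, _, rfl⟩ := Multiset.mem_map.1 hy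
    have := t.prob_nonneg
    split_ifs <;> simp [this]
  have hq0 : (0 : ℝ) ≤ q := Nat.cast_nonneg q
  -- The constant 6 comes from 3(r + 1) ≤ 6r, valid for r ≥ 1; then `r` can be cancelled.
  have h2 : (r : ℝ) * E ≤ r * (6 * q * G + (1 / 2) ^ r * q) := by
    have : (0 : ℝ) ≤ (r - 1) * (q * G) := mul_nonneg (by linarith) (mul_nonneg hq0 hG)
    nlinarith
  exact le_of_mul_le_mul_left h2 (by linarith)

end Reduction

/-! ### Logarithmic growth: κ is polynomially bounded and 2^(-κ) is negligible -/

section Growth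

/-! ### Asymptotics of the number of registers -/

variable {κ : ℕ → ℕ} {c : ℝ}

theorem isLittleO_log_rpow (hc : 1 < c) :
    (fun n : ℕ => Real.log (n : ℝ)) =o[atTop] fun n : ℕ => Real.log (n : ℝ) ^ c := by
  have h1 : (fun _ : ℝ => (1 : ℝ)) =o[atTop] fun x : ℝ => x ^ (c - 1) :=
    isLittleO_const_left.2 (Or.inr (tendsto_norm_atTop_atTop.comp
      (tendsto_rpow_atTop (by linarith))))
  have h2 : (fun x : ℝ => x) =o[atTop] fun x : ℝ => x ^ c := by
    refine ((isBigO_refl (fun x : ℝ => x) atTop).mul_isLittleO h1).congr' ?_ ?_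
    · filter_upwards with x using mul_one x
    · filter_upwards [eventually_gt_atTop 0] with x hx
      rw [← Real.rpow_one_add' hx.le (by linarith)]
      congr 1
      ring
  exact h2.comp_tendsto (Real.tendsto_log_atTop.comp tendsto_natCast_atTop_atTop)

theorem isLittleO_log_regs (hc : 1 < c)
    (hκ : (fun n : ℕ => (κ n : ℝ)) =Θ[atTop] fun n : ℕ => Real.log (n : ℝ) ^ c) :
    (fun n : ℕ => Real.log (n : ℝ)) =o[atTop] fun n : ℕ => (κ n : ℝ) :=
  (isLittleO_log_rpow hc).trans_isBigO hκ.2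

/-- Since log n = o(κ), eventually k·log n ≤ κ·log 2, that is n^k ≤ 2^κ, for every exponent k. -/
theorem negligible_half_pow (h : (fun n : ℕ => Real.log (n : ℝ)) =o[atTop] fun n : ℕ => (κ n : ℝ)) :
    Negligible fun n => (1 / 2 : ℝ) ^ κ n := by
  rw [Negligible, superpolynomialDecay_iff_abs_isBoundedUnder _ tendsto_natCast_atTop_atTop]
  intro k
  refine ⟨1, ?_⟩
  rw [eventually_map]
  have hlog : 0 < Real.log 2 := Real.log_pos one_lt_two
  filter_upwards [h.bound (c := Real.log 2 / (k + 1)) (by positivity), eventually_ge_atTop 1]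
    with n hn h1
  have hn0 : (0 : ℝ) < n := by exact_mod_cast h1
  have h2 : 0 ≤ Real.log (n : ℝ) := Real.log_nonneg (by exact_mod_cast h1)
  rw [Real.norm_of_nonneg h2, Real.norm_of_nonneg (Nat.cast_nonneg _), div_mul_eq_mul_div,
    le_div_iff₀ (by positivity)] at hn
  have h3 : (n : ℝ) ^ k ≤ 2 ^ κ n := by
    rw [← Real.log_le_log_iff (by positivity) (by positivity), Real.log_pow, Real.log_pow]
    nlinarith
  show |(n : ℝ) ^ k * (1 / 2) ^ κ n| ≤ 1
  rw [abs_of_nonneg (by positivity), one_div, inv_pow, ← div_eq_mul_inv]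
  exact div_le_one_of_le₀ h3 (by positivity)

theorem eventually_regs_pos
    (h : (fun n : ℕ => Real.log (n : ℝ)) =o[atTop] fun n : ℕ => (κ n : ℝ)) :
    ∀ᶠ n in atTop, 0 < κ n := by
  filter_upwards [h.bound one_pos, eventually_ge_atTop 2] with n hn h2
  by_contra h0
  have h1 : 0 < Real.log (n : ℝ) := Real.log_pos (by exact_mod_cast h2)
  rw [Real.norm_of_nonneg h1.le, show κ n = 0 by omega] at hn
  simp at hn
  linarith

/-- A power of the logarithm is o(n), so κ(n) ≤ n eventually; the finitely many exceptions are
absorbed by the sum of their values. -/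
theorem exists_regs_le
    (hκ : (fun n : ℕ => (κ n : ℝ)) =Θ[atTop] fun n : ℕ => Real.log (n : ℝ) ^ c) :
    ∃ K, ∀ n, κ n ≤ n + K := by
  have h1 : (fun n : ℕ => (κ n : ℝ)) =o[atTop] fun n : ℕ => ((n : ℕ) : ℝ) ^ (1 : ℝ) :=
    hκ.1.trans_isLittleO
      ((isLittleO_log_rpow_rpow_atTop c one_pos).comp_tendsto tendsto_natCast_atTop_atTop)
  obtain ⟨N, hN⟩ := eventually_atTop.1 (h1.bound one_pos)
  refine ⟨∑ i ∈ Finset.range N, κ i, fun n => ?_⟩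
  rcases lt_or_ge n N with h | h
  · exact (Finset.single_le_sum (f := κ) (fun _ _ => Nat.zero_le _) (Finset.mem_range.2 h)).trans
      (Nat.le_add_left _ _)
  · have := hN n h
    rw [one_mul, Real.rpow_one, Real.norm_of_nonneg (Nat.cast_nonneg _),
      Real.norm_of_nonneg (Nat.cast_nonneg _)] at this
    have : κ n ≤ n := by exact_mod_cast this
    omega

theorem Negligible.natPolynomial_mul {ε : ℕ → ℝ} (h : Negligible ε) (p : Polynomial ℕ) :
    Negligible fun n => ((p.eval n : ℕ) : ℝ) * ε n := by
  refine SuperpolynomialDecay.congr (SuperpolynomialDecay.polynomial_mul h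
    (p.map (Nat.castRingHom ℝ))) fun n => ?_
  rw [Polynomial.eval_natCast_map]
  rfl

end Growth

/-! ### Averaging over the key, and the asymptotic conclusion -/

section Security

/-! ### Unforgeability of the public scheme -/

/-- Nothing is assumed about measurability of `f`, the expected utility in the public game as a
function of the key. If `f` is not integrable, its integral is zero by convention and the right side
is nonnegative. -/
theorem integral_le_mul_integral_add {X : Type} [MeasurableSpace X] {μ : Measure X}
    [IsProbabilityMeasure μ] {f g : X → ℝ} (hg : Measurable g) (h01 : ∀ᵐ x ∂μ, 0 ≤ g x ∧ g x ≤ 1)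
    {a b : ℝ} (ha : 0 ≤ a) (hb : 0 ≤ b) (h : ∀ᵐ x ∂μ, f x ≤ a * g x + b) :
    ∫ x, f x ∂μ ≤ a * ∫ x, g x ∂μ + b := by
  have hgi : Integrable g μ := by
    refine Integrable.of_bound hg.aestronglyMeasurable 1 ?_
    filter_upwards [h01] with x hx
    rw [Real.norm_of_nonneg hx.1]
    exact hx.2
  have e : ∫ x, a * g x + b ∂μ = a * ∫ x, g x ∂μ + b := by
    rw [integral_add (hgi.const_mul a) (integrable_const b), integral_const_mul]
    simp
  by_cases hf : Integrable f μ
  · rw [← e]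
    exact integral_mono_ae hf ((hgi.const_mul a).add (integrable_const b)) h
  · rw [integral_undef hf]
    have : 0 ≤ ∫ x, g x ∂μ := integral_nonneg_of_ae (h01.mono fun x hx => hx.1)
    positivity

variable (S : PrivateCoinScheme) {κ : ℕ → ℕ} {I A : ℕ → Prog} {T : ℕ → ℕ}

theorem ae_verify_coin (hcomplete : S.PerfectlyComplete) (n : ℕ) :
    ∀ᵐ sk ∂S.keyGen n, (S.verify n sk).mulVec (S.coin n sk) = S.coin n sk :=
  (hcomplete n).mono fun sk h => mulVec_eq_self_of_norm (S.verify_projection n sk)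
    (by rw [nsq, nsq, h, S.coin_normalized])

theorem isInput_private (n : ℕ) : IsInput n 1 (S.qubits n) (S.toMoneyScheme.input n) :=
  ⟨rfl, rfl, rfl, fun x hx => by obtain ⟨y, rfl⟩ := Nat.exists_eq_add_of_le' hx; rfl⟩

theorem isInput_public (κ : ℕ → ℕ) (n : ℕ) :
    IsInput n (κ n) (S.qubits n) ((PkQC S κ).input n) :=
  ⟨rfl, rfl, rfl, fun x hx => by obtain ⟨y, rfl⟩ := Nat.exists_eq_add_of_le' hx; rfl⟩

theorem ae_reduction_time (hcomplete : S.PerfectlyComplete) (n : ℕ)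
    (hI : Initializes (I n) (κ n) (S.qubits n) n (T n)) {τ : ℕ}
    (h : ∀ᵐ sk ∂(PkQC S κ).keyGen n, ∀ s ∈ (PkQC S κ).outcomes A n sk, s.vec ≠ 0 → s.time ≤ τ) :
    ∀ᵐ sk ∂S.toMoneyScheme.keyGen n,
      ∀ t ∈ S.toMoneyScheme.outcomes (fun n => reduction (I n) (A n)) n sk, t.vec ≠ 0 →
        t.time ≤ T n + 2 + τ * stepBound (κ n) τ := by
  filter_upwards [ae_verify_coin S hcomplete n, h] with sk h1 h2
  exact reduction_time (S.verify_projection n sk) h1 (S.coin_normalized n sk) hI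
    (isInput_public S κ n) (isInput_private S n) h2

theorem ae_reduction_queries (hcomplete : S.PerfectlyComplete) (n : ℕ)
    (hI : Initializes (I n) (κ n) (S.qubits n) n (T n)) {q : ℕ}
    (h : ∀ᵐ sk ∂(PkQC S κ).keyGen n, ∀ s ∈ (PkQC S κ).outcomes A n sk, s.vec ≠ 0 → s.queries ≤ q) :
    ∀ᵐ sk ∂S.toMoneyScheme.keyGen n,
      ∀ t ∈ S.toMoneyScheme.outcomes (fun n => reduction (I n) (A n)) n sk, t.vec ≠ 0 →
        t.queries ≤ 3 * (κ n + 1) * q := by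
  filter_upwards [ae_verify_coin S hcomplete n, h] with sk h1 h2
  exact reduction_queries (S.verify_projection n sk) h1 (S.coin_normalized n sk) hI
    (isInput_public S κ n) (isInput_private S n) h2

theorem ae_queries_of_time (hcomplete : S.PerfectlyComplete) (n : ℕ) (hn : 0 < κ n)
    (hI : Initializes (I n) (κ n) (S.qubits n) n (T n)) {τ : ℕ}
    (h : ∀ᵐ sk ∂(PkQC S κ).keyGen n, ∀ s ∈ (PkQC S κ).outcomes A n sk, s.vec ≠ 0 → s.time ≤ τ) :
    ∀ᵐ sk ∂(PkQC S κ).keyGen n, ∀ s ∈ (PkQC S κ).outcomes A n sk, s.vec ≠ 0 → s.queries ≤ τ := by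
  filter_upwards [ae_verify_coin S hcomplete n, h] with sk h1 h2
  exact queries_le_of_time (S.verify_projection n sk) h1 (S.coin_normalized n sk) hn hI
    (isInput_public S κ n) (isInput_private S n) h2

open Classical in
theorem expect_allOrNothing_le (hcomplete : S.PerfectlyComplete) (n : ℕ) (hn : 0 < κ n)
    (hI : Initializes (I n) (κ n) (S.qubits n) n (T n)) {q : ℕ}
    (h : ∀ᵐ sk ∂(PkQC S κ).keyGen n, ∀ s ∈ (PkQC S κ).outcomes A n sk, s.vec ≠ 0 → s.queries ≤ q) :
    (PkQC S κ).expect A n State.allOrNothing ≤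
      6 * q * S.toMoneyScheme.expect (fun n => reduction (I n) (A n)) n
        (fun s => if 0 < s.flexible then 1 else 0) + (1 / 2) ^ κ n * q := by
  have : IsProbabilityMeasure (S.keyGen n) := S.isProbabilityMeasure_keyGen n
  refine integral_le_mul_integral_add (μ := S.keyGen n) ?_ ?_ (by positivity) (by positivity) ?_
  · exact measurable_expectation (S.measurable_verify n) (S.measurable_coin n)
      (reduction (I n) (A n)) (S.toMoneyScheme.input n)
      (fun s => if 0 < s.flexible then 1 else 0) fun _ _ => rfl
  · filter_upwards [ae_verify_coin S hcomplete n] with sk h1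
    constructor
    · refine Multiset.sum_nonneg fun y hy => ?_
      obtain ⟨t, _, rfl⟩ := Multiset.mem_map.1 hy
      have := t.prob_nonneg
      split_ifs <;> simp [this]
    · refine (Multiset.sum_map_le_sum_map _ State.prob fun t _ => ?_).trans_eq
        (sum_prob_reduction (A := A n) (S.verify_projection n sk) h1 (S.coin_normalized n sk) hn
          hI (isInput_public S κ n) (isInput_private S n))
      have := t.prob_nonneg
      split_ifs <;> simp [this]
  · filter_upwards [ae_verify_coin S hcomplete n, h] with sk h1 h2
    exact allOrNothing_le_reduction (S.verify_projection n sk) h1 (S.coin_normalized n sk) hn hI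
      (isInput_public S κ n) (isInput_private S n) h2

-- The common end of both parts: the advantage of the reduction and 2^(-κ) are negligible, and they
-- remain so after multiplication by the polynomial bound on the queries.
open Classical in
theorem exists_negligible (hcomplete : S.PerfectlyComplete)
    (hκ : (fun n : ℕ => Real.log (n : ℝ)) =o[atTop] fun n : ℕ => (κ n : ℝ))
    (hI : ∀ n, Initializes (I n) (κ n) (S.qubits n) n (T n)) (q : Polynomial ℕ)
    (h : ∀ n, 0 < κ n → ∀ᵐ sk ∂(PkQC S κ).keyGen n, ∀ s ∈ (PkQC S κ).outcomes A n sk,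
      s.vec ≠ 0 → s.queries ≤ q.eval n)
    {ε : ℕ → ℝ} (hε : Negligible ε)
    (hB : ∀ n, S.toMoneyScheme.expect (fun n => reduction (I n) (A n)) n
      (fun s => if 0 < s.flexible then 1 else 0) ≤ ε n) :
    ∃ ε', Negligible ε' ∧ ∀ n, (PkQC S κ).expect A n State.allOrNothing ≤ ε' n := by
  -- For the finitely many parameters with κ(n) = 0 there is no estimate, and the expectation itself
  -- is taken as the value; this does not affect negligibility.
  refine ⟨fun n => if 0 < κ n then 6 * (((q.eval n : ℕ) : ℝ) * ε n) + ((q.eval n : ℕ) : ℝ) * (1 / 2) ^ κ n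
    else (PkQC S κ).expect A n State.allOrNothing, ?_, fun n => ?_⟩
  · refine SuperpolynomialDecay.congr' (((hε.natPolynomial_mul q).const_mul 6).add
      ((negligible_half_pow hκ).natPolynomial_mul q)) ?_
    filter_upwards [eventually_regs_pos hκ] with n hn
    rw [if_pos hn]
    rfl
  · show _ ≤ if 0 < κ n then _ else _
    split_ifs with hn
    · refine (expect_allOrNothing_le S hcomplete n hn (hI n) (h n hn)).trans ?_
      have := mul_le_mul_of_nonneg_left (hB n) (show (0 : ℝ) ≤ 6 * (q.eval n : ℕ) by positivity)
      linarith
    · exact le_rfl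

theorem rationallyUnforgeable_of_unforgeable (hcomplete : S.PerfectlyComplete) {K : ℕ}
    (hK : ∀ n, κ n ≤ n + K)
    (hκ : (fun n : ℕ => Real.log (n : ℝ)) =o[atTop] fun n : ℕ => (κ n : ℝ))
    (hcomp : PolyTimeComputable κ) (hS : S.toMoneyScheme.MultiverifierNonadaptiveUnforgeable) :
    (PkQC S κ).MultiverifierNonadaptiveRationallyUnforgeable := by
  obtain ⟨P, hP, p, hp⟩ := hcomp
  rintro A ⟨⟨P', hP', hA⟩, p', hp'⟩
  have hI : ∀ n, Initializes (computedInit P) (κ n) (S.qubits n) n (p.eval n + 5) := fun n =>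
    initializes_computedInit hP fun r ℓ O => hp r ℓ O n
  obtain ⟨ε, hε, hB⟩ := hS (fun n => reduction (computedInit P) (A n))
    ⟨⟨reduction (computedInit P) P', reduction_elementary (computedInit_elementary P) hP',
      fun n => by simp only [hA]⟩,
    -- The time of the preparation, plus the time of the adversary multiplied by `stepBound`, in
    -- which the number of registers is replaced by its linear bound n + K.
    p + 5 + 2 + p' * (100 * ((Polynomial.X + (K : Polynomial ℕ) + 1) * (p' + 1)) ^ 5), fun n => by
      filter_upwards [ae_reduction_time S hcomplete n (I := fun _ => computedInit P)
        (T := fun n => p.eval n + 5) (hI n) (hp' n)] with sk h s hs hv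
      refine (h s hs hv).trans ?_
      simp only [Polynomial.eval_add, Polynomial.eval_mul, Polynomial.eval_pow, Polynomial.eval_X,
        Polynomial.eval_one, Polynomial.eval_natCast, Nat.cast_id, Polynomial.eval_ofNat, stepBound]
      have := hK n
      gcongr⟩
  exact exists_negligible S hcomplete hκ hI p' (fun n hn =>
    ae_queries_of_time S hcomplete n hn (I := fun _ => computedInit P)
      (T := fun n => p.eval n + 5) (hI n) (hp' n)) hε hB

theorem unconditionally_rationallyUnforgeable_of_unforgeable (hcomplete : S.PerfectlyComplete)
    {K : ℕ} (hK : ∀ n, κ n ≤ n + K)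
    (hκ : (fun n : ℕ => Real.log (n : ℝ)) =o[atTop] fun n : ℕ => (κ n : ℝ))
    (hS : S.toMoneyScheme.UnconditionallyMultiverifierNonadaptiveUnforgeable) :
    (PkQC S κ).UnconditionallyMultiverifierNonadaptiveRationallyUnforgeable := by
  rintro A ⟨p, hp⟩
  have hI : ∀ n, Initializes (constInit (κ n)) (κ n) (S.qubits n) n 4 := fun n =>
    initializes_constInit _ _ _
  obtain ⟨ε, hε, hB⟩ := hS (fun n => reduction (constInit (κ n)) (A n))
    ⟨3 * (Polynomial.X + (K : Polynomial ℕ) + 1) * p, fun n => by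
      filter_upwards [ae_reduction_queries S hcomplete n (I := fun n => constInit (κ n))
        (T := fun _ => 4) (hI n) (hp n)] with sk h s hs hv
      refine (h s hs hv).trans ?_
      simp only [Polynomial.eval_add, Polynomial.eval_mul, Polynomial.eval_X,
        Polynomial.eval_one, Polynomial.eval_natCast, Nat.cast_id, Polynomial.eval_ofNat]
      gcongr
      exact hK n⟩
  exact exists_negligible S hcomplete hκ (T := fun _ => 4) hI p (fun n _ => hp n) hε hB

end Security

end QMoney

end

theorem mainTheorem9 (S : QMoney.PrivateCoinScheme)
    (hcomplete : S.PerfectlyComplete) (hrank : S.RankOneVerification)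
    (κ : ℕ → ℕ) (c : ℝ) (hc : 1 < c)
    (hκ : (fun n : ℕ => (κ n : ℝ)) =Θ[Filter.atTop] fun n : ℕ => Real.log (n : ℝ) ^ c) :
    (QMoney.PolyTimeComputable κ →
      S.toMoneyScheme.MultiverifierNonadaptiveUnforgeable →
      (QMoney.PkQC S κ).MultiverifierNonadaptiveRationallyUnforgeable) ∧
    (S.toMoneyScheme.UnconditionallyMultiverifierNonadaptiveUnforgeable →
      (QMoney.PkQC S κ).UnconditionallyMultiverifierNonadaptiveRationallyUnforgeable) := by
  -- The asymptotics of κ enter only through log n = o(κ(n)), which makes 2^(-κ) negligible, and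
  -- through a linear bound, which keeps the reduction polynomial.
  have h := QMoney.isLittleO_log_regs hc hκ
  obtain ⟨K, hK⟩ := QMoney.exists_regs_le hκ
  exact ⟨QMoney.rationallyUnforgeable_of_unforgeable S hcomplete hK h,
    QMoney.unconditionally_rationallyUnforgeable_of_unforgeable S hcomplete hK h⟩
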